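/- Let $M$ be a smooth manifold (Hausdorff, second countable, without boundary, of finite dimension $2n$), let $H$ be a closed real three-form on $M$, and let $\mathcal J$ be an $H$-twisted generalized complex structure on $M$: a smooth bundle map of $TM\oplus T^*M$, orthogonal for $\langle X+\alpha,Y+\beta\rangle=\tfrac12(\beta(X)+\alpha(Y))$, with $\mathcal J^2=-1$, such that the sections of its $\sqrt{-1}$-eigenbundle $L\subset T_{\mathbb C}M\oplus T^*_{\mathbb C}M$ are closed under the $H$-twisted Courant bracket $$[X+\xi,Y+\eta]=[X,Y]+L_X\eta-L_Y\xi-\tfrac12 d\big(\eta(X)-\xi(Y)\big)+\iota_Y\iota_XH .$$ Let $TM\oplus T^*M$ act on the space $\Omega(M)$ of smooth complex differential forms by $(X+\xi)\cdot\rho=\iota_X\rho+\xi\wedge\rho$, extended complex linearly to $T_{\mathbb C}M\oplus T^*_{\mathbb C}M$. Regard $\mathcal J\in\mathfrak{so}(TM\oplus T^*M)$ as a section of the Clifford bundle, acting on forms so that $[\mathcal J\cdot,\,v\cdot\,]=(\mathcal Jv)\cdot$, and let $U^k$ be its $-k\sqrt{-1}$-eigenbundle in $\wedge T^*_{\mathbb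 C}M$, so that $\Omega(M)=\bigoplus_{k=-n}^n\Gamma(U^k)$. Put $d_H=d-H\wedge$, and let $\partial:\Gamma(U^k)\to\Gamma(U^{k-1})$ and $\bar\partial:\Gamma(U^k)\to\Gamma(U^{k+1})$ be the components of $d_H$, so that $d_H=\partial+\bar\partial$. Assume that $(M,\mathcal J)$ satisfies the $\bar\partial\partial$-lemma, that is, on $\Omega(M)$, $$\operatorname{im}\bar\partial\cap\ker\partial=\ker\bar\partial\cap\operatorname{im}\partial=\operatorname{im}\bar\partial\partial .$$ Let $G$ be a compact connected Lie group with Lie algebra $\mathfrak g$ that acts smoothly on $M$, preserving $H$ and $\mathcal J$; for $\xi\in\mathfrak g$ let $\xi_M$ be the induced vector field. Assume that the action is Hamiltonian, with twisted generalized moment map $f$ and moment one-form $\eta$: $f:M\to\mathfrak g^*$ is smooth and $G$-equivariant, $\eta\in\Omega^1(M,\mathfrak g^*)$, and for all $\xi\in\mathfrak g$ the section $\xi_M-\sqrt{-1}\,(df^\xi+\sqrt{-1}\,\eta^\xi)$ lies in $L$ and $\iota_{\xi_M}H=d\eta^\xi$. Let $U_G=(S\mathfrak g^*\otimes\Omega(M))^G$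 be the space of $G$-equivariant polynomial maps $\mathfrak g\to\Omega(M)$ (the total space of the generalized equivariant Dolbeault complex), let $\partial$ and $\bar\partial$ act on it as $1\otimes\partial$ and $1\otimes\bar\partial$, and put $$\bar\partial_G=\bar\partial+\mathscr A,\qquad (\mathscr A\alpha)(\xi)=\big(-\xi_M+\sqrt{-1}\,(df^\xi+\sqrt{-1}\,\eta^\xi)\big)\cdot\alpha(\xi).$$ Then, on $U_G$, $$\operatorname{im}\bar\partial_G\cap\ker\partial=\ker\bar\partial_G\cap\operatorname{im}\partial=\operatorname{im}\bar\partial_G\partial .$$ -/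

import Mathlib

open scoped Manifold ContDiff

noncomputable section

namespace GenCx

/-! ### Linear algebra of `V ⊕ V*` and of its spin representation on `⋀ V* ⊗ ℂ` -/

section LinearAlgebra

variable (E : Type*) [NormedAddCommGroup E] [NormedSpace ℝ E]

/-- The generalized tangent space `V ⊕ V*`. -/
abbrev Gen := E × (E →L[ℝ] ℝ)

/-- The complexification of `V ⊕ V*`; `⟨u, v⟩` stands for `u + √-1 v`. -/
@[ext]
structure CGen where
  /-- real part -/
  re : Gen E
  /-- imaginary part -/
  im : Gen E

/-- The alternating `k`-forms on `V` with values in `F`. -/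
abbrev Alt (F : Type*) [NormedAddCommGroup F] [NormedSpace ℝ F] (k : ℕ) := E [⋀^Fin k]→L[ℝ] F

/-- `⋀ V* ⊗ ℂ`, as families of complex valued alternating forms, one in every degree
(those of degree larger than `dim V` vanish). -/
abbrev Spinor := ∀ k : ℕ, Alt E ℂ k

variable {E}

/-- The natural pairing `⟨X + α, Y + β⟩ = (β(X) + α(Y)) / 2`. -/
def pairing (u v : Gen E) : ℝ := (v.2 u.1 + u.2 v.1) / 2

/-- The map `X + ξ ↦ A X + ξ ∘ B` on `V ⊕ V*`. When `B = A⁻¹` it is the map induced by the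
isomorphism `A`. -/
def genMap (A B : E →L[ℝ] E) : Gen E →L[ℝ] Gen E :=
  A.prodMap (ContinuousLinearMap.precomp ℝ B)

/-- A one-form, as an alternating form of degree one. -/
def oneForm (ξ : E →L[ℝ] ℝ) : Alt E ℝ 1 :=
  ContinuousAlternatingMap.ofSubsingleton ℝ E ℝ (0 : Fin 1) ξ

/-- An alternating form of degree one, as a covector. -/
def covector (ξ : Alt E ℝ 1) : E →L[ℝ] ℝ :=
  (ContinuousAlternatingMap.ofSubsingleton ℝ E ℝ (0 : Fin 1)).symm ξ

/-- Interior product `ι_X ρ`. -/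
def interior (X : E) : Spinor E →ₗ[ℂ] Spinor E where
  toFun ρ k := (ρ (k + 1)).curryLeft X
  map_add' _ _ := rfl
  map_smul' _ _ := rfl

/-- Exterior product `ξ ∧ ρ` with a covector:
`(ξ ∧ ρ)(v₀, …, v_k) = ∑ i, (-1)^i ξ(v_i) ρ(v₀, …, v̂_i, …, v_k)`. -/
def wedge (ξ : E →L[ℝ] ℝ) : Spinor E →ₗ[ℂ] Spinor E where
  toFun ρ k := match k with
    | 0 => 0
    | k + 1 => ContinuousAlternatingMap.alternatizeUncurryFin (ξ.smulRight (ρ k))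
  map_add' ρ σ := by
    funext k
    cases k with
    | zero => simp
    | succ k =>
      ext v
      simp [ContinuousAlternatingMap.alternatizeUncurryFin_apply, Finset.sum_add_distrib]
  map_smul' c ρ := by
    funext k
    cases k with
    | zero => simp
    | succ k =>
      ext v
      simp only [ContinuousAlternatingMap.alternatizeUncurryFin_apply, Pi.smul_apply,
        ContinuousLinearMap.smulRight_apply, ContinuousAlternatingMap.smul_apply,
        RingHom.id_apply, Finset.smul_sum]
      refine Finset.sum_congr rfl fun i _ => ?_
      rw [smul_comm (ξ (v i)) c, smul_comm _ c]

/-- Clifford (spin) action of `X + ξ`: `(X + ξ) · ρ = ι_X ρ + ξ ∧ ρ`. -/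
def cliff (u : Gen E) : Spinor E →ₗ[ℂ] Spinor E := interior u.1 + wedge u.2

/-- The complex linear extension of the Clifford action. -/
def cliffC (w : CGen E) : Spinor E →ₗ[ℂ] Spinor E := cliff w.re + Complex.I • cliff w.im

/-- The `√-1` eigenspace `L` of the complex linear extension of `J`:
`J (u + √-1 v) = √-1 (u + √-1 v)`. -/
def IsInL (J : Gen E →L[ℝ] Gen E) (w : CGen E) : Prop := J w.re = -w.im ∧ J w.im = w.re

variable [FiniteDimensional ℝ E]

/-- A basis `e_i` of `V`. -/
def vec (E : Type*) [NormedAddCommGroup E] [NormedSpace ℝ E] [FiniteDimensional ℝ E]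
    (i : Fin (Module.finrank ℝ E)) : E := Module.finBasis ℝ E i

/-- The dual basis `e^i` of `V*`. -/
def covec (E : Type*) [NormedAddCommGroup E] [NormedSpace ℝ E] [FiniteDimensional ℝ E]
    (i : Fin (Module.finrank ℝ E)) : E →L[ℝ] ℝ :=
  LinearMap.toContinuousLinearMap ((Module.finBasis ℝ E).coord i)

/-- Exterior product `H ∧ ρ` with a three-form
`H = (1/6) ∑ H(e_i, e_j, e_k) e^i ∧ e^j ∧ e^k`. -/
def wedge3 (H : Alt E ℝ 3) : Spinor E →ₗ[ℂ] Spinor E :=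
  (1 / 6 : ℂ) • ∑ i, ∑ j, ∑ k, ((H ![vec E i, vec E j, vec E k] : ℝ) : ℂ) •
    (wedge (covec E i) ∘ₗ wedge (covec E j) ∘ₗ wedge (covec E k))

/-- The Clifford action on spinors of a skew endomorphism `J ∈ so(V ⊕ V*) ⊂ CL(V ⊕ V*)`.
For bases `v_a`, `v^a` of `V ⊕ V*` that are dual with respect to the pairing, the element of the
Clifford algebra that corresponds to `J` (the `S` of `⋀²` with `[S, w] = J w` for all `w`) is
`(1/4) ∑ J(v_a) v^a`; the basis `e_i, e^i` has the dual basis `2 e^i, 2 e_i`. -/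
def spin (J : Gen E →L[ℝ] Gen E) : Module.End ℂ (Spinor E) :=
  (1 / 2 : ℂ) • ∑ i, (cliff (J (vec E i, 0)) ∘ₗ cliff (0, covec E i) +
    cliff (J (0, covec E i)) ∘ₗ cliff (vec E i, 0))

/-- `U^k`, the `-k√-1` eigenspace of the Clifford action of `J`. -/
def U (J : Gen E →L[ℝ] Gen E) (k : ℤ) : Submodule ℂ (Spinor E) :=
  Module.End.eigenspace (spin J) (-(k : ℂ) * Complex.I)

/-- Half the dimension: the spinors are the direct sum of `U^{-n}, …, U^n` when `dim V = 2n`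
(a space that carries a generalized complex structure has even dimension). -/
def halfDim (E : Type*) [NormedAddCommGroup E] [NormedSpace ℝ E] : ℤ :=
  ((Module.finrank ℝ E / 2 : ℕ) : ℤ)

/-- The projection of `⋀ V* ⊗ ℂ = U^{-n} ⊕ ⋯ ⊕ U^n` onto `U^k`, written as the spectral projection
of the diagonalizable endomorphism `spin J`: the polynomial in `spin J` that is `1` at the eigenvalue
`-k√-1` and `0` at the other ones. See `proj_of_mem_U` and `sum_proj`. -/
def proj (J : Gen E →L[ℝ] Gen E) (k : ℤ) : Module.End ℂ (Spinor E) :=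
  Polynomial.aeval (spin J) (Lagrange.basis (Finset.Icc (-halfDim E) (halfDim E))
    (fun l : ℤ => -(l : ℂ) * Complex.I) k)

theorem eigenvalue_injective : Function.Injective (fun l : ℤ => -(l : ℂ) * Complex.I) := by
  intro a b h
  have := mul_right_cancel₀ Complex.I_ne_zero h
  exact_mod_cast neg_injective this

/-- `proj J k` is the identity on `U^k` and vanishes on every other `U^l`. -/
theorem proj_of_mem_U (J : Gen E →L[ℝ] Gen E) (k l : ℤ)
    (hl : l ∈ Finset.Icc (-halfDim E) (halfDim E)) (ρ : Spinor E) (hρ : ρ ∈ U J l) :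
    proj J k ρ = if k = l then ρ else 0 := by
  have h : ∀ p : Polynomial ℂ, Polynomial.aeval (spin J) p ρ =
      p.eval (-(l : ℂ) * Complex.I) • ρ := by
    intro p
    have h1 : spin J ρ = (-(l : ℂ) * Complex.I) • ρ := Module.End.mem_eigenspace_iff.1 hρ
    induction p using Polynomial.induction_on' with
    | add p q hp hq => rw [map_add, LinearMap.add_apply, hp, hq, Polynomial.eval_add, add_smul]
    | monomial m a =>
      have h2 : ∀ m : ℕ, (spin J ^ m) ρ = (-(l : ℂ) * Complex.I) ^ m • ρ := by
        intro m
        induction m with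
        | zero => simp
        | succ m ih => rw [pow_succ', Module.End.mul_apply, ih, map_smul, h1, smul_smul, pow_succ]
      rw [Polynomial.aeval_monomial, Module.End.mul_apply, h2, Polynomial.eval_monomial,
        Module.algebraMap_end_apply, smul_smul]
  rw [proj, h]
  split_ifs with hk
  · subst hk
    have := Lagrange.eval_basis_self (F := ℂ) (v := fun l : ℤ => -(l : ℂ) * Complex.I)
      (eigenvalue_injective.injOn) hl
    beta_reduce at this
    rw [this, one_smul]
  · have := Lagrange.eval_basis_of_ne (F := ℂ) (v := fun l : ℤ => -(l : ℂ) * Complex.I) hk hl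
    beta_reduce at this
    rw [this, zero_smul]

/-- The projections add up to the identity. -/
theorem sum_proj (J : Gen E →L[ℝ] Gen E) :
    ∑ k ∈ Finset.Icc (-halfDim E) (halfDim E), proj J k = 1 := by
  have := Lagrange.sum_basis (F := ℂ) (s := Finset.Icc (-halfDim E) (halfDim E))
    (v := fun l : ℤ => -(l : ℂ) * Complex.I) eigenvalue_injective.injOn
    ⟨0, by simp only [Finset.mem_Icc, halfDim]; omega⟩
  simp only [proj]
  rw [← map_sum, this, map_one]

end LinearAlgebra

/-! ### Fields and forms on a manifold modelled on `E`

The tangent space of `M` at `x` is, by definition, the model space `E`, identified through the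
preferred chart at `x`. -/

section Manifold

variable {E : Type*} [NormedAddCommGroup E] [NormedSpace ℝ E]
  {M : Type*} [TopologicalSpace M] [ChartedSpace E M]
  {F : Type*} [NormedAddCommGroup F] [NormedSpace ℝ F]

/-- The tangent map of `f` at `x`. -/
def tmap {E' : Type*} [NormedAddCommGroup E'] [NormedSpace ℝ E']
    {N : Type*} [TopologicalSpace N] [ChartedSpace E' N] (f : M → N) (x : M) : E →L[ℝ] E' :=
  mfderiv 𝓘(ℝ, E) 𝓘(ℝ, E') f x

/-- The differential of a real function. -/
def dFun (g : M → ℝ) (x : M) : E →L[ℝ] ℝ := tmap g x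

/-- The expression of a `k`-form in the chart at `x₀`: its pullback by the inverse of the chart. -/
def chartRep {k : ℕ} (θ : M → Alt E F k) (x₀ : M) (y : E) : Alt E F k :=
  (θ ((extChartAt 𝓘(ℝ, E) x₀).symm y)).compContinuousLinearMap
    (tmap (E' := E) (extChartAt 𝓘(ℝ, E) x₀).symm y)

/-- Smoothness of a `k`-form. -/
def IsSmooth {k : ℕ} (θ : M → Alt E F k) : Prop :=
  ∀ x₀ : M, ContDiffOn ℝ ∞ (chartRep θ x₀) (extChartAt 𝓘(ℝ, E) x₀).target

/-- The exterior derivative of a `k`-form, computed at `x` in the chart at `x`. -/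
def extD {k : ℕ} (θ : M → Alt E F k) (x : M) : Alt E F (k + 1) :=
  (extDeriv (chartRep θ x) (extChartAt 𝓘(ℝ, E) x x)).compContinuousLinearMap
    (tmap (E' := E) (extChartAt 𝓘(ℝ, E) x) x)

/-- Smoothness of a section of `TM ⊕ T*M`. -/
def IsSmoothGen [IsManifold 𝓘(ℝ, E) ∞ M] (u : M → Gen E) : Prop :=
  ContMDiff 𝓘(ℝ, E) (𝓘(ℝ, E).prod 𝓘(ℝ, E)) ∞
    (fun x => (⟨x, (u x).1⟩ : TangentBundle 𝓘(ℝ, E) M)) ∧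
  IsSmooth (fun x => oneForm (u x).2)

/-- Smoothness of a section of `T_ℂ M ⊕ T*_ℂ M`. -/
def IsSmoothCGen [IsManifold 𝓘(ℝ, E) ∞ M] (w : M → CGen E) : Prop :=
  IsSmoothGen (fun x => (w x).re) ∧ IsSmoothGen (fun x => (w x).im)

/-- Smoothness of a bundle endomorphism of `TM ⊕ T*M`: smoothness of its expression in charts. -/
def IsSmoothEnd (J : M → Gen E →L[ℝ] Gen E) : Prop :=
  ∀ x₀ : M, ContDiffOn ℝ ∞
    (fun y : E =>
      let x : M := (extChartAt 𝓘(ℝ, E) x₀).symm y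
      let φ : E →L[ℝ] E := tmap (E' := E) (extChartAt 𝓘(ℝ, E) x₀) x
      let ψ : E →L[ℝ] E := tmap (E' := E) (extChartAt 𝓘(ℝ, E) x₀).symm y
      (genMap φ ψ) ∘L (J x) ∘L (genMap ψ φ))
    (extChartAt 𝓘(ℝ, E) x₀).target

/-- Lie bracket of vector fields. -/
def lieBr (X Y : M → E) (x : M) : E :=
  VectorField.mlieBracket (M := M) 𝓘(ℝ, E) X Y x

/-- Lie derivative `L_X η = d(ι_X η) + ι_X dη` of a one-form. -/
def lieDer (X : M → E) (η : M → E →L[ℝ] ℝ) (x : M) : E →L[ℝ] ℝ :=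
  dFun (fun z => η z (X z)) x + covector ((extD (fun z => oneForm (η z)) x).curryLeft (X x))

/-- The `H`-twisted Courant bracket of sections of `TM ⊕ T*M`:
`[X+ξ, Y+η] = [X,Y] + L_X η - L_Y ξ - (1/2) d(η(X) - ξ(Y)) + ι_Y ι_X H`. -/
def courant (H : M → Alt E ℝ 3) (u v : M → Gen E) (x : M) : Gen E :=
  (lieBr (fun z => (u z).1) (fun z => (v z).1) x,
    lieDer (fun z => (u z).1) (fun z => (v z).2) x
      - lieDer (fun z => (v z).1) (fun z => (u z).2) x
      - (1 / 2 : ℝ) • dFun (fun z => (v z).2 (u z).1 - (u z).2 (v z).1) x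
      + covector ((((H x).curryLeft (u x).1).curryLeft (v x).1)))

/-- The complex bilinear extension of the `H`-twisted Courant bracket. -/
def courantC (H : M → Alt E ℝ 3) (w w' : M → CGen E) (x : M) : CGen E where
  re := courant H (fun z => (w z).re) (fun z => (w' z).re) x
    - courant H (fun z => (w z).im) (fun z => (w' z).im) x
  im := courant H (fun z => (w z).re) (fun z => (w' z).im) x
    + courant H (fun z => (w z).im) (fun z => (w' z).re) x

/-- `H` is a smooth closed three-form. -/
def IsClosedThreeForm (H : M → Alt E ℝ 3) : Prop :=
  IsSmooth H ∧ ∀ x, extD H x = 0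

/-- `J` is an `H`-twisted generalized complex structure on `M`. -/
structure IsGenComplex [IsManifold 𝓘(ℝ, E) ∞ M] (H : M → Alt E ℝ 3) (J : M → Gen E →L[ℝ] Gen E) : Prop where
  smooth : IsSmoothEnd J
  orthogonal : ∀ x u v, pairing (J x u) (J x v) = pairing u v
  sq_eq : ∀ x u, J x (J x u) = -u
  integrable : ∀ w w' : M → CGen E, IsSmoothCGen w → IsSmoothCGen w' →
    (∀ x, IsInL (J x) (w x)) → (∀ x, IsInL (J x) (w' x)) →
    ∀ x, IsInL (J x) (courantC H w w' x)

variable (E M) in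
/-- Complex differential forms of mixed degree, without any regularity; see `Omega`. -/
abbrev Form := M → Spinor E

variable (E M) in
/-- `Ω(M)`: the smooth complex differential forms of mixed degree. -/
def Omega : Set (Form E M) := {θ | ∀ k, IsSmooth (fun x => θ x k)}

/-- The exterior derivative of a form of mixed degree. -/
def d (θ : Form E M) : Form E M := fun x k => match k with
  | 0 => 0
  | k + 1 => extD (fun z => θ z k) x

variable [FiniteDimensional ℝ E]

/-- The twisted exterior derivative `d_H = d - H ∧`. -/
def dH (H : M → Alt E ℝ 3) (θ : Form E M) : Form E M :=
  fun x => d θ x - wedge3 (H x) (θ x)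

/-- The component in `Γ(U^k)` of a form. -/
def component (J : M → Gen E →L[ℝ] Gen E) (k : ℤ) (θ : Form E M) : Form E M :=
  fun x => proj (J x) k (θ x)

/-- `∂`: on `Γ(U^k)`, the operator `d_H` followed by the projection to `Γ(U^{k-1})`. -/
def del (H : M → Alt E ℝ 3) (J : M → Gen E →L[ℝ] Gen E) (θ : Form E M) : Form E M :=
  ∑ k ∈ Finset.Icc (-halfDim E) (halfDim E), component J (k - 1) (dH H (component J k θ))

/-- `∂̄`: on `Γ(U^k)`, the operator `d_H` followed by the projection to `Γ(U^{k+1})`. -/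
def delbar (H : M → Alt E ℝ 3) (J : M → Gen E →L[ℝ] Gen E) (θ : Form E M) : Form E M :=
  ∑ k ∈ Finset.Icc (-halfDim E) (halfDim E), component J (k + 1) (dH H (component J k θ))

end Manifold

/-- For operators `p`, `q` on the space `K`:
`im p ∩ ker q = ker p ∩ im q = im (p q)`. -/
def DDLemma {A : Type*} [Zero A] (K : Set A) (p q : A → A) : Prop :=
  (p '' K) ∩ {a ∈ K | q a = 0} = {a ∈ K | p a = 0} ∩ (q '' K) ∧
  {a ∈ K | p a = 0} ∩ (q '' K) = (fun a => p (q a)) '' K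

/-! ### Hamiltonian actions and the equivariant complex -/

section Action

variable {E : Type*} [NormedAddCommGroup E] [NormedSpace ℝ E]
  {M : Type*} [TopologicalSpace M] [ChartedSpace E M]
  {EG : Type*} [NormedAddCommGroup EG] [NormedSpace ℝ EG]
  {G : Type*} [TopologicalSpace G] [ChartedSpace EG G] [Group G] [MulAction G M]

variable (EG G) in
/-- The Lie algebra of `G`. -/
abbrev Lie𝔤 := GroupLieAlgebra 𝓘(ℝ, EG) G

/-- The adjoint action of `G` on its Lie algebra. -/
def Ad (g : G) (ξ : Lie𝔤 EG G) : Lie𝔤 EG G :=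
  tmap (E := EG) (E' := EG) (fun h : G => g * h * g⁻¹) 1 ξ

/-- The vector field `ξ_M` on `M` induced by `ξ`. -/
def fundField (ξ : Lie𝔤 EG G) (x : M) : E :=
  tmap (E := EG) (E' := E) (fun g : G => g • x) 1 ξ

/-- The tangent map of the action of `g` at `x`. -/
def actMap (E : Type*) [NormedAddCommGroup E] [NormedSpace ℝ E] {M : Type*} [TopologicalSpace M]
    [ChartedSpace E M] {G : Type*} [Group G] [MulAction G M] (g : G) (x : M) : E →L[ℝ] E :=
  tmap (E := E) (E' := E) (fun z : M => g • z) x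

/-- Pullback `g^* θ` of a form of mixed degree. -/
def pullback (g : G) (θ : Form E M) : Form E M :=
  fun x k => (θ (g • x) k).compContinuousLinearMap (actMap E g x)

variable (G) in
/-- The action of `G` preserves the three-form `H`. -/
def PreservesH (H : M → Alt E ℝ 3) : Prop :=
  ∀ (g : G) (x : M), (H (g • x)).compContinuousLinearMap (actMap E g x) = H x

variable (G) in
/-- The action of `G` preserves the bundle map `J` of `TM ⊕ T*M`. -/
def PreservesJ (J : M → Gen E →L[ℝ] Gen E) : Prop :=
  ∀ (g : G) (x : M),
    (genMap (actMap E g x) (actMap E g⁻¹ (g • x))) ∘L (J x) =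
      (J (g • x)) ∘L (genMap (actMap E g x) (actMap E g⁻¹ (g • x)))

/-- `f` is a twisted generalized moment map, with moment one-form `η`, for the action of `G`. -/
structure IsMomentMap (H : M → Alt E ℝ 3) (J : M → Gen E →L[ℝ] Gen E)
    (f : M → Module.Dual ℝ (Lie𝔤 EG G)) (η : M → Lie𝔤 EG G →ₗ[ℝ] (E →L[ℝ] ℝ)) : Prop where
  smooth : ∀ ξ, ContMDiff 𝓘(ℝ, E) 𝓘(ℝ, ℝ) ∞ (fun x => f x ξ)
  smooth_oneForm : ∀ ξ, IsSmooth (fun x => oneForm (η x ξ))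
  /-- `ξ_M - √-1 (df^ξ + √-1 η^ξ)` lies in `L`. -/
  mem_L : ∀ ξ x, IsInL (J x) ⟨(fundField ξ x, η x ξ), (0, -dFun (fun z => f z ξ) x)⟩
  equivariant : ∀ (g : G) (x : M) ξ, f (g • x) (Ad g ξ) = f x ξ
  /-- `ι_{ξ_M} H = d η^ξ`. -/
  interior_eq : ∀ ξ x, (H x).curryLeft (fundField ξ x) = extD (fun z => oneForm (η z ξ)) x

/-- `S𝔤* ⊗ Ω(M)`, as the space of polynomial maps from `𝔤` to `Ω(M)`. -/
def polyForms (E M EG G : Type*) [NormedAddCommGroup E] [NormedSpace ℝ E] [TopologicalSpace M]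
    [ChartedSpace E M] [NormedAddCommGroup EG] [NormedSpace ℝ EG] [TopologicalSpace G]
    [ChartedSpace EG G] [Group G] : Submodule ℂ (Lie𝔤 EG G → Form E M) :=
  Submodule.span ℂ {α | ∃ (m : ℕ) (l : Fin m → Module.Dual ℝ (Lie𝔤 EG G)), ∃ θ ∈ Omega E M,
    α = fun ξ => ((∏ i, l i ξ : ℝ) : ℂ) • θ}

/-- `U_G = (S𝔤* ⊗ Ω(M))^G`: the polynomial maps `α : 𝔤 → Ω(M)` that are equivariant,
`g^* (α (Ad_g ξ)) = α ξ`. -/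
def UG (E M EG G : Type*) [NormedAddCommGroup E] [NormedSpace ℝ E] [TopologicalSpace M]
    [ChartedSpace E M] [NormedAddCommGroup EG] [NormedSpace ℝ EG] [TopologicalSpace G]
    [ChartedSpace EG G] [Group G] [MulAction G M] : Set (Lie𝔤 EG G → Form E M) :=
  {α | α ∈ polyForms E M EG G ∧ ∀ (g : G) ξ, pullback g (α (Ad g ξ)) = α ξ}

/-- `𝒜(ξ) = -ξ_M + √-1 (df^ξ + √-1 η^ξ)`. -/
def calA (f : M → Module.Dual ℝ (Lie𝔤 EG G)) (η : M → Lie𝔤 EG G →ₗ[ℝ] (E →L[ℝ] ℝ))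
    (ξ : Lie𝔤 EG G) (x : M) : CGen E :=
  ⟨(-fundField ξ x, -η x ξ), (0, dFun (fun z => f z ξ) x)⟩

variable [FiniteDimensional ℝ E]

/-- The operator `1 ⊗ ∂` on polynomial maps from `𝔤` to forms. -/
def delEq (H : M → Alt E ℝ 3) (J : M → Gen E →L[ℝ] Gen E)
    (α : Lie𝔤 EG G → Form E M) : Lie𝔤 EG G → Form E M :=
  fun ξ => del H J (α ξ)

/-- `∂̄_G = 1 ⊗ ∂̄ + 𝒜`, where `(𝒜 α)(ξ) = 𝒜(ξ) · α(ξ)`. -/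
def delbarG (H : M → Alt E ℝ 3) (J : M → Gen E →L[ℝ] Gen E)
    (f : M → Module.Dual ℝ (Lie𝔤 EG G)) (η : M → Lie𝔤 EG G →ₗ[ℝ] (E →L[ℝ] ℝ))
    (α : Lie𝔤 EG G → Form E M) : Lie𝔤 EG G → Form E M :=
  fun ξ => delbar H J (α ξ) + fun x => cliffC (calA f η ξ x) (α ξ x)

end Action

end GenCx

end

open scoped Manifold ContDiff

set_option linter.unusedSectionVars false

noncomputable section

namespace GenCx

/-! ### The Clifford algebra of `V ⊕ V*` acting on spinors -/

section Clifford

variable {E : Type*} [NormedAddCommGroup E] [NormedSpace ℝ E]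

/-! Write `P = ∂`, `Q = ∂̄`, `A = 𝒜`, and let `F` be multiplication by the moment map, all acting on
`U_G`. The theorem follows formally from four facts. (1) `P² = Q² = PQ + QP = 0`, where `P` has
degree `-1` and `Q` degree `1` for the finite grading by the `U^k`. (2) `A` has degree `-1` and `A =
2√-1 [P, F]`. (3) `P` anticommutes with `Q + A`, and `(Q + A)² = 0`. (4) The `∂̄∂`-lemma for `Q` and
`P` holds on `U_G` itself.

Let `(Q + A) α = 0` and `α = P β`. Since `A` lowers degrees, the component of `α` of top degree is
`Q`-closed; it is also `P`-exact, hence of the form `Q P γ`. Subtracting `(Q + A) P γ` lowers the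
top degree, and the grading is finite (`exists_of_mem_range_of_mem_ker`). Let now `P α = 0` and `α =
(Q + A) β`. The first half allows one to make `β` closed for `P`; then `A β = 2√-1 P F β` and, by
(4), `Q β` are both `P`-exact, so `α` is `P`-exact and the first half applies to it
(`exists_of_mem_ker_of_mem_range`).

For (1), the spin action `S` of `𝒥` must be diagonalizable with eigenvalues `-k√-1`, `|k| ≤ n`
(`aeval_nodal_spin`), and `d_H` must have components of degree `±1` only. In a chart, `[S, [S, d_H]]
+ d_H` is an operator `T` of order zero because `𝒥² = -1` (`spin_spin_dHl`), and its double
commutators with `V ⊕ V*` give the Nijenhuis tensor (`dcomm_torsionOp`). When that tensor vanishes,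
`[S, [S, T]] = -T` (`spin_comm_spin_comm`), so the component of `d_H` from `U^l` to `U^k` is killed
by `(1 - (k - l)²)²` (`proj_dHl_proj`). The relations (1) are the components of `d_H² = 0`.

For (2), put `u = ξ_M + η^ξ`. The commutator of `d_H` with `f^ξ` is `df^ξ ∧`, while `√-1 df^ξ - u`
and `√-1 df^ξ + u` have degrees `-1` and `1` because `𝒥 u = df^ξ`; the identity compares parts of
degree `-1` (`IsHamiltonian.two_I_smul_commutator`). For (3), `A² = 0` and `PA + AP = 0` follow
algebraically from (2). Moreover `QA + AQ` is minus the anticommutator of `d_H` with `u`, which by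
Cartan's formula and `ι_{ξ_M} H = dη^ξ` is the Lie derivative along `ξ_M`. It kills `α(ξ)` for
equivariant `α`, because `Ad_g ξ` is stationary along a curve through the identity with velocity `ξ`
(`hasDerivAt_Ad`, `lieD_eq_zero`).

For (4), the hypothesis provides primitives for each `ξ` separately. They are chosen at finitely
many interpolation nodes in `𝔤`, and averaging over `G` turns them into an equivariant polynomial
map (`exists_lift`). -/

instance : AddCommMonoid (Spinor E) := inferInstance

instance : Module ℂ (Spinor E) := inferInstance

instance : AddCommGroup (Spinor E) := inferInstance

/-- The ring structure on the endomorphisms of the spinors, over the additive structure that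
instance search finds for them. -/
instance spinorEndRing : Ring (Module.End ℂ (Spinor E)) :=
  { (inferInstance : Semiring (Module.End ℂ (Spinor E))),
    (inferInstance : AddCommGroup (Module.End ℂ (Spinor E))) with
    intCast := Int.castDef
    intCast_ofNat := fun _ => rfl
    intCast_negSucc := fun _ => rfl }

instance spinorEndNeg : Neg (Module.End ℂ (Spinor E)) := spinorEndRing.toNeg

instance spinorEndSub : Sub (Module.End ℂ (Spinor E)) := spinorEndRing.toSub

instance spinorEndAddCommGroup : AddCommGroup (Module.End ℂ (Spinor E)) :=
  spinorEndRing.toAddCommGroup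

instance : Semigroup (Module.End ℂ (Spinor E)) := inferInstance

instance : Semiring (Module.End ℂ (Spinor E)) := inferInstance

instance : NonUnitalNonAssocSemiring (Module.End ℂ (Spinor E)) := inferInstance

instance : Module ℂ (Module.End ℂ (Spinor E)) := inferInstance

instance : SMul ℂ (Module.End ℂ (Spinor E)) := inferInstance

instance : DistribSMul ℂ (Module.End ℂ (Spinor E)) := inferInstance

instance : Algebra ℂ (Module.End ℂ (Spinor E)) := inferInstance

instance : IsScalarTower ℂ (Module.End ℂ (Spinor E)) (Module.End ℂ (Spinor E)) := inferInstance

instance : SMulCommClass ℂ (Module.End ℂ (Spinor E)) (Module.End ℂ (Spinor E)) := inferInstance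

@[simp]
theorem spinorEnd_neg_apply (D : Module.End ℂ (Spinor E)) (ρ : Spinor E) : (-D) ρ = -D ρ := rfl

@[simp]
theorem spinorEnd_sub_apply (D D' : Module.End ℂ (Spinor E)) (ρ : Spinor E) :
    (D - D') ρ = D ρ - D' ρ := rfl

/-- Contractions with all vectors determine a form of positive degree. The inductions on the degree
of a form below rest on this. -/
theorem alt_succ_ext {F : Type*} [NormedAddCommGroup F] [NormedSpace ℝ F] {k : ℕ}
    {θ τ : Alt E F (k + 1)} (h : ∀ X, θ.curryLeft X = τ.curryLeft X) : θ = τ := by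
  ext v
  have := congrArg (fun σ => σ (Fin.tail v)) (h (v 0))
  simpa only [ContinuousAlternatingMap.curryLeft_apply_apply, Matrix.vecCons,
    Fin.cons_self_tail] using this

@[simp]
theorem interior_apply (X : E) (ρ : Spinor E) (k : ℕ) :
    interior X ρ k = (ρ (k + 1)).curryLeft X := rfl

@[simp]
theorem wedge_zero_degree (ξ : E →L[ℝ] ℝ) (ρ : Spinor E) : wedge ξ ρ 0 = 0 := rfl

theorem wedge_succ (ξ : E →L[ℝ] ℝ) (ρ : Spinor E) (k : ℕ) :
    wedge ξ ρ (k + 1) = ContinuousAlternatingMap.alternatizeUncurryFin (ξ.smulRight (ρ k)) := rfl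

/-- Two operators that agree in degree zero and whose difference commutes with interior
products agree. -/
theorem eq_zero_of_interior_comm {D : Module.End ℂ (Spinor E)} (h0 : ∀ ρ, D ρ 0 = 0)
    (h : ∀ X ρ, interior X (D ρ) = D (interior X ρ)) : D = 0 := by
  have key : ∀ k ρ, D ρ k = 0 := by
    intro k
    induction k with
    | zero => exact h0
    | succ k ih =>
      intro ρ
      apply alt_succ_ext
      intro X
      have := congrFun (h X ρ) k
      rw [interior_apply] at this
      rw [this, ih]
      simp
  ext1 ρ
  funext k
  exact key k ρ

theorem interior_add (X Y : E) : interior (X + Y) = interior X + interior Y := by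
  ext1 ρ
  funext k
  simp

theorem interior_smul (c : ℝ) (X : E) : interior (c • X) = (c : ℂ) • interior X := by
  ext1 ρ
  funext k
  ext v
  simp

theorem wedge_add (ξ ζ : E →L[ℝ] ℝ) : wedge (ξ + ζ) = wedge ξ + wedge ζ := by
  ext1 ρ
  funext k
  ext v
  cases k <;> simp [wedge_succ, ContinuousAlternatingMap.alternatizeUncurryFin_apply, add_smul,
    Finset.sum_add_distrib]

theorem wedge_smul (c : ℝ) (ξ : E →L[ℝ] ℝ) : wedge (c • ξ) = (c : ℂ) • wedge ξ := by
  ext1 ρ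
  funext k
  ext v
  cases k
  · simp
  · simp only [wedge_succ, ContinuousAlternatingMap.alternatizeUncurryFin_apply,
      LinearMap.smul_apply, Pi.smul_apply, ContinuousAlternatingMap.smul_apply, Finset.smul_sum,
      ContinuousLinearMap.smulRight_apply, smul_apply]
    refine Finset.sum_congr rfl fun i _ => ?_
    simp
    ring

theorem interior_mul_self (X : E) : interior X * interior X = 0 := by
  ext1 ρ
  funext k
  exact (ρ (k + 2)).curryLeft_same X

theorem interior_mul_interior (X Y : E) :
    interior X * interior Y + interior Y * interior X = 0 := by
  have h := interior_mul_self (X + Y)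
  rw [interior_add, add_mul, mul_add, mul_add, interior_mul_self, interior_mul_self] at h
  simpa using h

/-- The term `i = 0` of the alternating sum for `ξ ∧ ρ` contributes `ξ(X) ρ`; the remaining terms
are those of `ξ ∧ ι_X ρ` with the opposite sign. -/
theorem interior_mul_wedge (X : E) (ξ : E →L[ℝ] ℝ) :
    interior X * wedge ξ + wedge ξ * interior X = ((ξ X : ℝ) : ℂ) • 1 := by
  ext1 ρ
  funext k
  ext v
  cases k with
  | zero =>
    simp [wedge_succ, ContinuousAlternatingMap.curryLeft_apply_apply,
      ContinuousAlternatingMap.alternatizeUncurryFin_apply]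
  | succ k =>
    simp only [LinearMap.add_apply, Module.End.mul_apply, Pi.add_apply, interior_apply, wedge_succ,
      ContinuousAlternatingMap.add_apply, ContinuousAlternatingMap.curryLeft_apply_apply,
      ContinuousAlternatingMap.alternatizeUncurryFin_apply, LinearMap.smul_apply,
      Module.End.one_apply, Pi.smul_apply, ContinuousAlternatingMap.smul_apply,
      ContinuousLinearMap.smulRight_apply]
    rw [Fin.sum_univ_succ, add_assoc, ← Finset.sum_add_distrib, Finset.sum_eq_zero]
    · simp [Matrix.vecCons]
    · intro i _
      have : Fin.removeNth i.succ (Matrix.vecCons X v) = Matrix.vecCons X (Fin.removeNth i v) := by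
        funext j
        refine Fin.cases ?_ (fun j => ?_) j <;> simp [Fin.removeNth]
      rw [this]
      simp [pow_succ]

/-- No shuffle sum is needed: by the preceding relation the anticommutator commutes with all
contractions, and it vanishes in degree zero. -/
theorem wedge_mul_wedge (ξ ζ : E →L[ℝ] ℝ) : wedge ξ * wedge ζ + wedge ζ * wedge ξ = 0 := by
  apply eq_zero_of_interior_comm
  · intro ρ
    simp
  · intro X ρ
    have h1 := eq_sub_of_add_eq (interior_mul_wedge X ξ)
    have h2 := eq_sub_of_add_eq (interior_mul_wedge X ζ)
    have : interior X * (wedge ξ * wedge ζ + wedge ζ * wedge ξ) =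
        (wedge ξ * wedge ζ + wedge ζ * wedge ξ) * interior X := by
      rw [mul_add, ← mul_assoc, ← mul_assoc, h1, h2, sub_mul, sub_mul, mul_assoc, mul_assoc, h1, h2]
      simp only [mul_sub, smul_mul_assoc, mul_smul_comm, one_mul, mul_one, add_mul, mul_assoc]
      abel
    exact congrArg (fun D : Module.End ℂ (Spinor E) => D ρ) this

theorem cliff_add (u v : Gen E) : cliff (u + v) = cliff u + cliff v := by
  simp only [cliff, Prod.fst_add, Prod.snd_add, interior_add, wedge_add]
  abel

theorem cliff_smul (c : ℝ) (u : Gen E) : cliff (c • u) = (c : ℂ) • cliff u := by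
  simp only [cliff, Prod.smul_fst, Prod.smul_snd, interior_smul, wedge_smul, smul_add]

variable (E) in
/-- The Clifford action as a real linear map. -/
def cliffL : Gen E →ₗ[ℝ] Module.End ℂ (Spinor E) where
  toFun := cliff
  map_add' := cliff_add
  map_smul' c u := by
    rw [cliff_smul]
    ext1 ρ
    funext k
    ext v
    simp

@[simp]
theorem cliffL_apply (u : Gen E) : cliffL E u = cliff u := rfl

theorem cliff_zero : cliff (0 : Gen E) = 0 := (cliffL E).map_zero

theorem cliff_neg (u : Gen E) : cliff (-u) = -cliff u := (cliffL E).map_neg u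

theorem cliff_sub (u v : Gen E) : cliff (u - v) = cliff u - cliff v := (cliffL E).map_sub u v

theorem cliff_sum {ι : Type*} (s : Finset ι) (u : ι → Gen E) :
    cliff (∑ i ∈ s, u i) = ∑ i ∈ s, cliff (u i) := map_sum (cliffL E) u s

theorem cliff_mul_cliff (u v : Gen E) :
    cliff u * cliff v + cliff v * cliff u = ((2 * pairing u v : ℝ) : ℂ) • 1 := by
  have h1 := interior_mul_interior u.1 v.1
  have h2 := wedge_mul_wedge u.2 v.2
  have h3 := interior_mul_wedge u.1 v.2
  have h4 := interior_mul_wedge v.1 u.2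
  have : ((2 * pairing u v : ℝ) : ℂ) • (1 : Module.End ℂ (Spinor E)) =
      ((v.2 u.1 : ℝ) : ℂ) • 1 + ((u.2 v.1 : ℝ) : ℂ) • 1 := by
    rw [← add_smul]
    congr 1
    simp only [pairing]
    push_cast
    ring
  rw [this, ← h3, ← h4]
  have h5 : cliff u * cliff v + cliff v * cliff u =
    (interior u.1 * interior v.1 + interior v.1 * interior u.1) +
    (wedge u.2 * wedge v.2 + wedge v.2 * wedge u.2) +
    (interior u.1 * wedge v.2 + wedge v.2 * interior u.1 +
      (interior v.1 * wedge u.2 + wedge u.2 * interior v.1)) := by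
    simp only [cliff]
    noncomm_ring
  rw [h5, h1, h2]
  abel

theorem pairing_comm (u v : Gen E) : pairing u v = pairing v u := by
  simp only [pairing]
  ring

theorem pairing_add_left (u v w : Gen E) : pairing (u + v) w = pairing u w + pairing v w := by
  simp [pairing]
  ring

theorem pairing_smul_left (c : ℝ) (u w : Gen E) : pairing (c • u) w = c * pairing u w := by
  simp [pairing]
  ring

theorem pairing_add_right (u v w : Gen E) : pairing u (v + w) = pairing u v + pairing u w := by
  simp [pairing]
  ring

theorem pairing_smul_right (c : ℝ) (u w : Gen E) : pairing u (c • w) = c * pairing u w := by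
  simp [pairing]
  ring

variable (E) in
/-- The natural pairing as a bilinear map. -/
def pairingL : Gen E →ₗ[ℝ] Gen E →ₗ[ℝ] ℝ :=
  LinearMap.mk₂ ℝ pairing pairing_add_left pairing_smul_left pairing_add_right pairing_smul_right

@[simp]
theorem pairingL_apply (u v : Gen E) : pairingL E u v = pairing u v := rfl

/-- The parity operator. -/
def parity : Module.End ℂ (Spinor E) where
  toFun ρ k := (-1 : ℂ) ^ k • ρ k
  map_add' _ _ := by funext k; simp
  map_smul' c ρ := by funext k; simp [smul_comm c]

@[simp]
theorem parity_apply (ρ : Spinor E) (k : ℕ) : parity ρ k = (-1 : ℂ) ^ k • ρ k := rfl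

theorem parity_mul_cliff (u : Gen E) : parity * cliff u = -(cliff u * parity) := by
  ext1 ρ
  funext k
  ext v
  cases k with
  | zero => simp [cliff, ContinuousAlternatingMap.curryLeft_apply_apply]
  | succ k =>
    simp [cliff, wedge_succ, ContinuousAlternatingMap.curryLeft_apply_apply,
      ContinuousAlternatingMap.alternatizeUncurryFin_apply, Finset.mul_sum, pow_succ]
    rw [add_comm]
    congr 2
    exact Finset.sum_congr rfl fun i _ => by ring

variable [FiniteDimensional ℝ E]

theorem sum_coord_smul_vec (X : E) : ∑ i, covec E i X • vec E i = X :=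
  (Module.finBasis ℝ E).sum_repr X

theorem sum_apply_vec_smul_covec (ξ : E →L[ℝ] ℝ) : ∑ i, ξ (vec E i) • covec E i = ξ := by
  ext X
  conv_rhs => rw [← sum_coord_smul_vec X]
  simp [mul_comm]

theorem covec_vec (i j : Fin (Module.finrank ℝ E)) :
    covec E i (vec E j) = if i = j then 1 else 0 := by
  simp only [covec, vec, LinearMap.coe_toContinuousLinearMap', Module.Basis.coord_apply,
    Module.Basis.repr_self, Finsupp.single_apply, eq_comm]

/-- `Spinor E` is a product over all degrees; this vanishing makes every spinor a finite sum of
homogeneous ones. -/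
theorem alt_eq_zero_of_finrank_lt {F : Type*} [NormedAddCommGroup F] [NormedSpace ℝ F] {k : ℕ}
    (hk : Module.finrank ℝ E < k) (θ : Alt E F k) : θ = 0 := by
  ext v
  apply θ.toAlternatingMap.map_linearDependent
  intro h
  have := h.fintype_card_le_finrank
  simp at this
  omega

/-- The degree operator `∑ e^a ∧ ι_{e_a}`. -/
theorem sum_wedge_interior (ρ : Spinor E) (k : ℕ) :
    (∑ a, wedge (covec E a) (interior (vec E a) ρ)) k = (k : ℂ) • ρ k := by
  induction k generalizing ρ with
  | zero => simp
  | succ k ih =>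
    apply alt_succ_ext
    intro X
    have h1 : interior X (∑ a, wedge (covec E a) (interior (vec E a) ρ)) =
        interior X ρ + ∑ a, wedge (covec E a) (interior (vec E a) (interior X ρ)) := by
      rw [map_sum]
      conv_rhs => lhs; rw [← sum_coord_smul_vec X]
      have h2 : interior (∑ i, covec E i X • vec E i) ρ =
          ∑ i, ((covec E i X : ℝ) : ℂ) • interior (vec E i) ρ := by
        funext k
        ext v
        simp
      rw [h2, ← Finset.sum_add_distrib]
      refine Finset.sum_congr rfl fun a _ => ?_
      have h3 := congrArg (fun D : Module.End ℂ (Spinor E) => D (interior (vec E a) ρ))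
        (interior_mul_wedge X (covec E a))
      have h4 := congrArg (fun D : Module.End ℂ (Spinor E) => D ρ)
        (interior_mul_interior X (vec E a))
      simp only [LinearMap.add_apply, Module.End.mul_apply, LinearMap.smul_apply,
        Module.End.one_apply, LinearMap.zero_apply] at h3 h4
      rw [← h3, eq_neg_of_add_eq_zero_left h4, map_neg]
      abel
    have h5 := congrFun h1 k
    rw [interior_apply] at h5
    rw [h5, Pi.add_apply, ih]
    ext v
    simp [ContinuousAlternatingMap.curryLeft_apply_apply]
    ring

/-- An odd operator that anticommutes with the Clifford action vanishes. -/
theorem eq_zero_of_odd_of_anticomm {R : Module.End ℂ (Spinor E)}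
    (hodd : parity * R = -(R * parity)) (h : ∀ u, cliff u * R = -(R * cliff u)) : R = 0 := by
  have hw : ∀ ξ ρ, R (wedge ξ ρ) = -wedge ξ (R ρ) := by
    intro ξ ρ
    have := congrArg (fun D : Module.End ℂ (Spinor E) => D ρ) (h (0, ξ))
    have h0 : interior (0 : E) = 0 := by simpa using interior_smul 0 (0 : E)
    simp only [cliff, h0, zero_add, Module.End.mul_apply, spinorEnd_neg_apply] at this
    rw [this, neg_neg]
  have hi : ∀ X ρ, interior X (R ρ) = -R (interior X ρ) := by
    intro X ρ
    have := congrArg (fun D : Module.End ℂ (Spinor E) => D ρ) (h (X, 0))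
    have h0 : wedge (0 : E →L[ℝ] ℝ) = 0 := by simpa using wedge_smul 0 (0 : E →L[ℝ] ℝ)
    simpa only [cliff, h0, add_zero, Module.End.mul_apply, spinorEnd_neg_apply] using this
  -- Induction on the degree: through the degree operator, a form of positive degree is a sum of
  -- exterior products `e^a ∧ σ`, and `R` anticommutes with `e^a ∧`.
  have hsingle : ∀ (k : ℕ) (θ : Alt E ℂ k), R (Pi.single k θ) = 0 := by
    intro k
    induction k with
    | zero =>
      intro θ
      have hz : ∀ X, interior X (Pi.single 0 θ : Spinor E) = 0 := by
        intro X
        funext k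
        rw [interior_apply, Pi.single_eq_of_ne (by simp)]
        simp
      funext k
      cases k with
      | zero =>
        -- Contractions say nothing about the component of degree zero; there oddness shows that it
        -- equals its negative.
        have h1 : parity (Pi.single 0 θ : Spinor E) = Pi.single 0 θ := by
          funext k
          cases k with
          | zero => simp
          | succ k => rw [parity_apply, Pi.single_eq_of_ne (by simp), smul_zero]
        have h2 := congrArg (fun D : Module.End ℂ (Spinor E) => D (Pi.single 0 θ) 0) hodd
        simp only [Module.End.mul_apply, spinorEnd_neg_apply, h1, parity_apply, pow_zero,
          one_smul, Pi.neg_apply] at h2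
        ext v
        exact self_eq_neg.1 (congrArg (fun σ => σ v) h2)
      | succ k =>
        apply alt_succ_ext
        intro X
        have := congrFun (hi X (Pi.single 0 θ)) k
        rw [hz, map_zero, interior_apply] at this
        rw [this]
        simp
    | succ k ih =>
      intro θ
      have h1 : ((k + 1 : ℕ) : ℂ) • (Pi.single (k + 1) θ : Spinor E) =
          ∑ a, wedge (covec E a) (interior (vec E a) (Pi.single (k + 1) θ)) := by
        funext j
        rw [sum_wedge_interior, Pi.smul_apply]
        by_cases hj : j = k + 1
        · subst hj; rfl
        · rw [Pi.single_eq_of_ne hj, smul_zero, smul_zero]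
      have h2 : ∀ X, interior X (Pi.single (k + 1) θ : Spinor E) =
          Pi.single k (θ.curryLeft X) := by
        intro X
        funext j
        rw [interior_apply]
        by_cases hj : j = k
        · subst hj; simp
        · rw [Pi.single_eq_of_ne hj, Pi.single_eq_of_ne (by omega)]
          simp
      have h3 : ((k + 1 : ℕ) : ℂ) • R (Pi.single (k + 1) θ : Spinor E) = 0 := by
        rw [← map_smul, h1, map_sum]
        refine Finset.sum_eq_zero fun a _ => ?_
        rw [hw, h2, ih, map_zero, neg_zero]
      exact (smul_eq_zero.1 h3).resolve_left (by exact_mod_cast Nat.succ_ne_zero k)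
  ext1 ρ
  have : ρ = ∑ k ∈ Finset.range (Module.finrank ℝ E + 1), Pi.single k (ρ k) := by
    funext j
    rw [Finset.sum_apply]
    by_cases hj : j < Module.finrank ℝ E + 1
    · rw [Finset.sum_eq_single_of_mem j (Finset.mem_range.2 hj)]
      · simp
      · intro i _ hi
        exact Pi.single_eq_of_ne hi.symm _
    · rw [alt_eq_zero_of_finrank_lt (by omega) (ρ j), Finset.sum_eq_zero]
      intro i hi
      rw [Pi.single_eq_of_ne]
      rintro rfl
      exact hj (Finset.mem_range.1 hi)
  rw [this, map_sum]
  simp only [hsingle, Finset.sum_const_zero, LinearMap.zero_apply]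

end Clifford

/-! ### The spin action of skew endomorphisms -/

section Spin

variable {E : Type*} [NormedAddCommGroup E] [NormedSpace ℝ E]

/-- Skew endomorphisms of `V ⊕ V*`. -/
def IsSkew (J : Gen E →L[ℝ] Gen E) : Prop := ∀ u v, pairing (J u) v = -pairing u (J v)

theorem isSkew_of_orthogonal {J : Gen E →L[ℝ] Gen E}
    (h : ∀ u v, pairing (J u) (J v) = pairing u v) (h2 : ∀ u, J (J u) = -u) : IsSkew J := by
  intro u v
  rw [← h u (J v), h2]
  simp [pairing]
  ring

theorem pairing_mk_zero (X : E) (u : Gen E) : pairing (X, 0) u = u.2 X / 2 := by simp [pairing]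

theorem pairing_zero_mk (ξ : E →L[ℝ] ℝ) (u : Gen E) : pairing (0, ξ) u = ξ u.1 / 2 := by
  simp [pairing]

theorem cliff_mul_cliff_comm (a b w : Gen E) :
    cliff a * cliff b * cliff w - cliff w * (cliff a * cliff b) =
      ((2 * pairing b w : ℝ) : ℂ) • cliff a - ((2 * pairing a w : ℝ) : ℂ) • cliff b := by
  have h1 := cliff_mul_cliff b w
  have h2 := cliff_mul_cliff a w
  have : cliff a * cliff b * cliff w - cliff w * (cliff a * cliff b) =
      cliff a * (cliff b * cliff w + cliff w * cliff b) -
        (cliff a * cliff w + cliff w * cliff a) * cliff b := by noncomm_ring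
  rw [this, h1, h2]
  simp

variable [FiniteDimensional ℝ E]

/-- The basis `e_i, e^i` has the dual basis `2 e^i, 2 e_i`, because of the factor `1/2` in the
pairing. -/
theorem sum_gen (w : Gen E) :
    ∑ i, ((2 * pairing (0, covec E i) w) • ((vec E i, 0) : Gen E) +
      (2 * pairing (vec E i, 0) w) • ((0, covec E i) : Gen E)) = w := by
  have h : ∀ i, (2 * pairing (0, covec E i) w) • ((vec E i, 0) : Gen E) +
      (2 * pairing (vec E i, 0) w) • ((0, covec E i) : Gen E) =
      (covec E i w.1 • vec E i, w.2 (vec E i) • covec E i) := by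
    intro i
    rw [pairing_mk_zero, pairing_zero_mk, mul_div_cancel₀ _ two_ne_zero,
      mul_div_cancel₀ _ two_ne_zero]
    simp
  simp only [h]
  rw [← Prod.mk.eta (p := ∑ i, (covec E i w.1 • vec E i, w.2 (vec E i) • covec E i)), Prod.fst_sum,
    Prod.snd_sum, sum_coord_smul_vec, sum_apply_vec_smul_covec]

theorem spin_eq (J : Gen E →L[ℝ] Gen E) :
    spin J = (1 / 2 : ℂ) • ∑ i, (cliff (J (vec E i, 0)) * cliff (0, covec E i) +
      cliff (J (0, covec E i)) * cliff (vec E i, 0)) := rfl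

/-- Commuting `J(v_a) v^a` past `w` gives one term for each factor. Expanding `w` in the basis turns
the first into `J w`; by skewness the second is the expansion of `J w` itself. The prefactor `1/2`
compensates for the two copies. -/
theorem spin_mul_cliff {J : Gen E →L[ℝ] Gen E} (hJ : IsSkew J) (w : Gen E) :
    spin J * cliff w - cliff w * spin J = cliff (J w) := by
  have h1 : ∀ i, (cliff (J (vec E i, 0)) * cliff (0, covec E i) +
      cliff (J (0, covec E i)) * cliff (vec E i, 0)) * cliff w -
      cliff w * (cliff (J (vec E i, 0)) * cliff (0, covec E i) +
      cliff (J (0, covec E i)) * cliff (vec E i, 0)) =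
      cliff (J ((2 * pairing (0, covec E i) w) • ((vec E i, 0) : Gen E) +
      (2 * pairing (vec E i, 0) w) • ((0, covec E i) : Gen E))) +
      cliff ((2 * pairing (0, covec E i) (J w)) • ((vec E i, 0) : Gen E) +
      (2 * pairing (vec E i, 0) (J w)) • ((0, covec E i) : Gen E)) := by
    intro i
    rw [add_mul, mul_add, add_sub_add_comm, cliff_mul_cliff_comm, cliff_mul_cliff_comm, hJ, hJ]
    simp only [map_add, map_smul, cliff_add, cliff_smul]
    simp only [mul_neg, Complex.ofReal_neg, neg_smul]
    abel
  rw [spin_eq, smul_mul_assoc, mul_smul_comm, ← smul_sub, Finset.sum_mul, Finset.mul_sum,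
    ← Finset.sum_sub_distrib]
  simp only [h1]
  rw [Finset.sum_add_distrib, ← cliff_sum, ← cliff_sum, ← map_sum, sum_gen, sum_gen, ← two_smul ℂ,
    smul_smul]
  norm_num

theorem spin_mul_parity (J : Gen E →L[ℝ] Gen E) : parity * spin J = spin J * parity := by
  have h : ∀ a b : Gen E, parity * (cliff a * cliff b) = cliff a * cliff b * parity := by
    intro a b
    rw [← mul_assoc, parity_mul_cliff, neg_mul, mul_assoc, parity_mul_cliff, mul_neg, neg_neg,
      mul_assoc]
  rw [spin_eq, mul_smul_comm, smul_mul_assoc, Finset.mul_sum, Finset.sum_mul]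
  congr 1
  refine Finset.sum_congr rfl fun i _ => ?_
  rw [mul_add, h, h, add_mul]

/-- An operator that commutes with the Clifford action commutes with `spin J`. -/
theorem spin_comm_of_comm {A : Module.End ℂ (Spinor E)} (h : ∀ u, cliff u * A = A * cliff u)
    (J : Gen E →L[ℝ] Gen E) : spin J * A = A * spin J := by
  have h : ∀ a b : Gen E, cliff a * cliff b * A = A * (cliff a * cliff b) := by
    intro a b
    rw [mul_assoc, h, ← mul_assoc, h, mul_assoc]
  rw [spin_eq, mul_smul_comm, smul_mul_assoc, Finset.mul_sum, Finset.sum_mul]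
  congr 1
  refine Finset.sum_congr rfl fun i _ => ?_
  rw [mul_add, ← h, ← h, add_mul]

/-- The commutator with `spin J` squares to `-1` on odd operators `T` for which all the double
commutators `[{T, u}, v]` vanish. -/
theorem spin_comm_spin_comm {J : Gen E →L[ℝ] Gen E} (hJ : IsSkew J) (hJ2 : ∀ u, J (J u) = -u)
    {T : Module.End ℂ (Spinor E)} (hodd : parity * T = -(T * parity))
    (h : ∀ u v, (T * cliff u + cliff u * T) * cliff v = cliff v * (T * cliff u + cliff u * T)) :
    spin J * (spin J * T - T * spin J) - (spin J * T - T * spin J) * spin J = -T := by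
  have hS := spin_mul_parity J
  have hs : ∀ u, spin J * cliff u = cliff (J u) + cliff u * spin J := fun u =>
    eq_add_of_sub_eq (spin_mul_cliff hJ u)
  have hA : ∀ u, spin J * (T * cliff u + cliff u * T) = (T * cliff u + cliff u * T) * spin J :=
    fun u => spin_comm_of_comm (fun v => (h u v).symm) J
  generalize spin J = S at hS hs hA ⊢
  -- Passing from `Q` to `[S, Q]` replaces the anticommutator `{Q, u}` by `-{Q, J u}`. Two passages
  -- give `{T, J² u} = -{T, u}`, so `[S, [S, T]] + T` anticommutes with every `u`; being odd, it
  -- vanishes.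
  have key : ∀ (Q : Module.End ℂ (Spinor E)) u,
      S * (Q * cliff u + cliff u * Q) = (Q * cliff u + cliff u * Q) * S →
      (S * Q - Q * S) * cliff u + cliff u * (S * Q - Q * S) =
        -(Q * cliff (J u) + cliff (J u) * Q) := by
    intro Q u hQ
    have e1 : (S * Q - Q * S) * cliff u + cliff u * (S * Q - Q * S) =
        S * (Q * cliff u + cliff u * Q) - (Q * cliff u + cliff u * Q) * S -
        (Q * (S * cliff u - cliff u * S) + (S * cliff u - cliff u * S) * Q) := by noncomm_ring
    rw [e1, hQ, hs u]
    noncomm_ring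
  have h1 := fun u => key T u (hA u)
  have h2 := fun u => key (S * T - T * S) u (by rw [h1, mul_neg, neg_mul, hA])
  rw [← sub_eq_zero, sub_neg_eq_add]
  apply eq_zero_of_odd_of_anticomm
  · have e : parity * S = S * parity := hS
    have f : parity * T = -(T * parity) := hodd
    have g1 : parity * (S * (S * T)) = -(S * (S * T) * parity) := by
      rw [← mul_assoc, e, mul_assoc, ← mul_assoc parity, e, mul_assoc, f]; noncomm_ring
    have g2 : parity * (S * (T * S)) = -(S * (T * S) * parity) := by
      rw [← mul_assoc, e, mul_assoc, ← mul_assoc parity, f, neg_mul, mul_assoc T, e]; noncomm_ring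
    have g3 : parity * (T * (S * S)) = -(T * (S * S) * parity) := by
      rw [← mul_assoc, f, neg_mul, mul_assoc, ← mul_assoc parity, e, mul_assoc S, e]; noncomm_ring
    have e2 : S * (S * T - T * S) - (S * T - T * S) * S + T =
      S * (S * T) - S * (T * S) - S * (T * S) + T * (S * S) + T := by noncomm_ring
    rw [e2]
    simp only [mul_add, mul_sub, g1, g2, g3, f]
    noncomm_ring
  · intro u
    have h3 := h2 u
    have h4 := h1 (J u)
    rw [hJ2, cliff_neg] at h4
    rw [h4] at h3
    rw [mul_add, add_mul, eq_sub_of_add_eq' h3]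
    noncomm_ring

end Spin

/-! ### Naturality under linear isomorphisms -/

section Naturality

variable {E : Type*} [NormedAddCommGroup E] [NormedSpace ℝ E]

/-- Pullback of spinors by a linear map. -/
def pb (A : E →L[ℝ] E) : Module.End ℂ (Spinor E) where
  toFun ρ k := (ρ k).compContinuousLinearMap A
  map_add' _ _ := rfl
  map_smul' _ _ := rfl

@[simp]
theorem pb_apply (A : E →L[ℝ] E) (ρ : Spinor E) (k : ℕ) :
    pb A ρ k = (ρ k).compContinuousLinearMap A := rfl

theorem pb_pb (A B : E →L[ℝ] E) (ρ : Spinor E) : pb A (pb B ρ) = pb (B ∘L A) ρ := by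
  funext k
  ext v
  simp [Function.comp_def]

theorem interior_pb (A : E →L[ℝ] E) (X : E) (ρ : Spinor E) :
    interior X (pb A ρ) = pb A (interior (A X) ρ) := by
  funext k
  exact ContinuousAlternatingMap.curryLeft_compContinuousLinearMap _ _ _

theorem wedge_pb (A : E →L[ℝ] E) (ξ : E →L[ℝ] ℝ) (ρ : Spinor E) :
    wedge (ξ ∘L A) (pb A ρ) = pb A (wedge ξ ρ) := by
  funext k
  ext v
  cases k with
  | zero => simp
  | succ k =>
    simp [wedge_succ, ContinuousAlternatingMap.alternatizeUncurryFin_apply, Function.comp_def]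
    rfl

theorem cliff_pb {A B : E →L[ℝ] E} (hAB : B ∘L A = ContinuousLinearMap.id ℝ E) (u : Gen E)
    (ρ : Spinor E) : cliff u (pb A ρ) = pb A (cliff (genMap A B u) ρ) := by
  have h : u.2 = (u.2 ∘L B) ∘L A := by
    rw [ContinuousLinearMap.comp_assoc, hAB, ContinuousLinearMap.comp_id]
  simp only [cliff, LinearMap.add_apply, map_add, genMap]
  rw [interior_pb]
  conv_lhs => rw [h, wedge_pb]
  rfl

theorem genMap_comp (A B A' B' : E →L[ℝ] E) : genMap A B ∘L genMap A' B' =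
    genMap (A ∘L A') (B' ∘L B) := by
  ext <;> simp [genMap, ContinuousLinearMap.precomp]
  rfl

theorem genMap_id :
    genMap (ContinuousLinearMap.id ℝ E) (ContinuousLinearMap.id ℝ E) =
      ContinuousLinearMap.id ℝ (Gen E) := by
  ext <;> simp [genMap, ContinuousLinearMap.precomp]

theorem genMap_apply (A B : E →L[ℝ] E) (u : Gen E) : genMap A B u = (A u.1, u.2 ∘L B) := rfl

theorem pairing_genMap {A B : E →L[ℝ] E} (hAB : B ∘L A = ContinuousLinearMap.id ℝ E) (u v : Gen E) :
    pairing (genMap A B u) (genMap A B v) = pairing u v := by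
  have h : ∀ X, B (A X) = X := fun X => congrArg (fun D : E →L[ℝ] E => D X) hAB
  simp [pairing, genMap_apply, h]

variable [FiniteDimensional ℝ E]

/-- The contraction of a bilinear map on `V × V*` does not depend on the choice of the basis. -/
theorem sum_contract {W : Type*} [AddCommGroup W] [Module ℝ W] {A B : E →L[ℝ] E}
    (hAB : A ∘L B = ContinuousLinearMap.id ℝ E) (b : E →ₗ[ℝ] (E →L[ℝ] ℝ) →ₗ[ℝ] W) :
    ∑ i, b (A (vec E i)) (covec E i ∘L B) = ∑ i, b (vec E i) (covec E i) := by
  have h1 : ∀ i, b (A (vec E i)) (covec E i ∘L B) =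
      ∑ j, b (vec E j) ((covec E j ∘L A) (vec E i) • (covec E i ∘L B)) := by
    intro i
    conv_lhs => rw [← sum_coord_smul_vec (A (vec E i))]
    simp
  simp only [h1]
  rw [Finset.sum_comm]
  refine Finset.sum_congr rfl fun j _ => ?_
  rw [← map_sum]
  congr 1
  have h2 := congrArg (fun ξ : E →L[ℝ] ℝ => ξ ∘L B) (sum_apply_vec_smul_covec (covec E j ∘L A))
  simp only [ContinuousLinearMap.comp_assoc, hAB, ContinuousLinearMap.comp_id] at h2
  conv_rhs => rw [← h2]
  ext X
  simp only [sum_apply, smul_apply, ContinuousLinearMap.comp_apply]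

/-- The definition of `spin` uses a fixed basis, which `A` does not preserve. The sum is however the
contraction of a bilinear map on `V × V*`, so it may be evaluated in the transported basis instead.
-/
theorem spin_pb {A B : E →L[ℝ] E} (hAB : A ∘L B = ContinuousLinearMap.id ℝ E)
    (hBA : B ∘L A = ContinuousLinearMap.id ℝ E) (J : Gen E →L[ℝ] Gen E) :
    spin (genMap B A ∘L J ∘L genMap A B) * pb A = pb A * spin J := by
  have hg : ∀ u, genMap A B (genMap B A u) = u := by
    intro u
    have := congrArg (fun D => D u) (genMap_comp A B B A)
    rw [hAB, genMap_id] at this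
    exact this
  have h : ∀ u v : Gen E, cliff u * cliff v * pb A =
      pb A * (cliff (genMap A B u) * cliff (genMap A B v)) := by
    intro u v
    ext1 ρ
    simp only [Module.End.mul_apply]
    rw [cliff_pb hBA, cliff_pb hBA]
  rw [spin_eq, spin_eq, smul_mul_assoc, mul_smul_comm, Finset.sum_mul, Finset.mul_sum]
  congr 1
  let b : E →ₗ[ℝ] (E →L[ℝ] ℝ) →ₗ[ℝ] Module.End ℂ (Spinor E) :=
    LinearMap.mk₂ ℝ (fun X ξ => cliffL E (J (X, 0)) * cliffL E (0, ξ) +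
      cliffL E (J (0, ξ)) * cliffL E (X, 0))
      (fun X Y ξ => by
        rw [← zero_add (0 : E →L[ℝ] ℝ), ← Prod.mk_add_mk, add_zero, map_add, map_add, map_add]
        noncomm_ring)
      (fun c X ξ => by
        rw [← smul_zero (A := E →L[ℝ] ℝ) c, ← Prod.smul_mk, map_smul, map_smul, map_smul, smul_zero, smul_mul_assoc, mul_smul_comm, smul_add])
      (fun X ξ ζ => by
        rw [← zero_add (0 : E), ← Prod.mk_add_mk, add_zero, map_add, map_add, map_add]
        noncomm_ring)
      (fun c X ξ => by
        rw [← smul_zero (A := E) c, ← Prod.smul_mk, map_smul, map_smul, map_smul, smul_zero, smul_mul_assoc, mul_smul_comm, smul_add])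
  have hb := sum_contract hAB b
  simp only [b, LinearMap.mk₂_apply, cliffL_apply] at hb
  rw [← Finset.mul_sum, ← hb, Finset.mul_sum]
  refine Finset.sum_congr rfl fun i _ => ?_
  rw [add_mul, h, h, mul_add]
  simp only [ContinuousLinearMap.comp_apply, hg]
  simp only [genMap_apply, map_zero, ContinuousLinearMap.zero_comp]

/-- The projections onto the `U^k` are polynomials in `spin J` whose coefficients depend only on the
dimension and on `k`, so they inherit every intertwining relation of `spin J`. -/
theorem aeval_intertwine {V : Type*} [AddCommGroup V] [Module ℂ V] {S S' P : Module.End ℂ V}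
    (h : S * P = P * S') (p : Polynomial ℂ) :
    Polynomial.aeval S p * P = P * Polynomial.aeval S' p := by
  have hm : ∀ m : ℕ, S ^ m * P = P * S' ^ m := by
    intro m
    induction m with
    | zero => simp
    | succ m ih => rw [pow_succ, mul_assoc, h, ← mul_assoc, ih, mul_assoc, pow_succ]
  induction p using Polynomial.induction_on' with
  | add p q hp hq => rw [map_add, map_add, add_mul, mul_add, hp, hq]
  | monomial m a =>
    rw [Polynomial.aeval_monomial, Polynomial.aeval_monomial, mul_assoc, hm, ← mul_assoc,
      Algebra.commutes, mul_assoc]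

theorem proj_pb {A B : E →L[ℝ] E} (hAB : A ∘L B = ContinuousLinearMap.id ℝ E)
    (hBA : B ∘L A = ContinuousLinearMap.id ℝ E) (J : Gen E →L[ℝ] Gen E) (k : ℤ) :
    proj (genMap B A ∘L J ∘L genMap A B) k * pb A = pb A * proj J k :=
  aeval_intertwine (spin_pb hAB hBA J) _

end Naturality

/-! ### Exterior products with two-forms and three-forms -/

section ThreeForms

variable {E : Type*} [NormedAddCommGroup E] [NormedSpace ℝ E] [FiniteDimensional ℝ E]

theorem interior_mul_wedge' (X : E) (ξ : E →L[ℝ] ℝ) :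
    interior X * wedge ξ = ((ξ X : ℝ) : ℂ) • 1 - wedge ξ * interior X :=
  eq_sub_of_add_eq (interior_mul_wedge X ξ)

/-- Exterior product with a two-form `β = (1/2) ∑ β(e_i, e_j) e^i ∧ e^j`. -/
def wedge2 (β : Alt E ℝ 2) : Module.End ℂ (Spinor E) :=
  (1 / 2 : ℂ) • ∑ i, ∑ j, ((β ![vec E i, vec E j] : ℝ) : ℂ) •
    (wedge (covec E i) * wedge (covec E j))

theorem wedge3_eq (H : Alt E ℝ 3) : wedge3 H = (1 / 6 : ℂ) • ∑ i, ∑ j, ∑ k,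
    ((H ![vec E i, vec E j, vec E k] : ℝ) : ℂ) •
    (wedge (covec E i) * (wedge (covec E j) * wedge (covec E k))) := rfl

variable (E) in
/-- `wedge` as a real linear map. -/
def wedgeL : (E →L[ℝ] ℝ) →ₗ[ℝ] Module.End ℂ (Spinor E) where
  toFun := wedge
  map_add' := wedge_add
  map_smul' c u := by
    rw [wedge_smul]
    ext1 ρ
    funext k
    ext v
    simp

@[simp]
theorem wedgeL_apply (u : E →L[ℝ] ℝ) : wedgeL E u = wedge u := rfl

theorem ofReal_smul_spinorEnd (c : ℝ) (D : Module.End ℂ (Spinor E)) : (c : ℂ) • D = c • D := by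
  ext1 ρ
  funext k
  ext v
  simp

/-- `∑ φ(e_i) e^i`, for a linear form `φ`. -/
theorem sum_smul_wedge_covec (φ : E →L[ℝ] ℝ) :
    ∑ i, ((φ (vec E i) : ℝ) : ℂ) • wedge (covec E i) = wedge φ := by
  conv_rhs => rw [← sum_apply_vec_smul_covec φ]
  have := map_sum (wedgeL E) (fun i => φ (vec E i) • covec E i) Finset.univ
  simp only [wedgeL_apply] at this
  rw [this]
  simp [wedge_smul]

theorem alt_two_swap (β : Alt E ℝ 2) (X Y : E) : β ![X, Y] = -β ![Y, X] := by
  have := β.toAlternatingMap.map_swap ![X, Y] (i := 0) (j := 1) (by simp)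
  have h2 : ![X, Y] ∘ ⇑(Equiv.swap (0 : Fin 2) 1) = ![Y, X] := by
    funext i
    fin_cases i <;> simp
  rw [h2] at this
  simp only [ContinuousAlternatingMap.coe_toAlternatingMap] at this
  linarith

/-- `β(X, ·)`, as a covector. -/
theorem covector_apply (ξ : Alt E ℝ 1) (Y : E) : covector ξ Y = ξ ![Y] := by
  simp [covector, ContinuousAlternatingMap.ofSubsingleton]
  congr 1
  funext i
  fin_cases i
  rfl

/-- The contraction can hit either slot of `β`; the two contributions agree by antisymmetry and
absorb the factor `1/2`. -/
theorem wedge2_mul_interior (β : Alt E ℝ 2) (Y : E) :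
    wedge2 β * interior Y - interior Y * wedge2 β = -wedge (covector (β.curryLeft Y)) := by
  have h1 : ∀ ξ ζ : E →L[ℝ] ℝ, wedge ξ * wedge ζ * interior Y - interior Y * (wedge ξ * wedge ζ) =
      ((ζ Y : ℝ) : ℂ) • wedge ξ - ((ξ Y : ℝ) : ℂ) • wedge ζ := by
    intro ξ ζ
    rw [← mul_assoc, interior_mul_wedge', sub_mul, mul_assoc (wedge ξ) (interior Y),
      interior_mul_wedge', smul_mul_assoc, mul_sub, mul_smul_comm, mul_one, one_mul]
    noncomm_ring
  rw [wedge2, smul_mul_assoc, mul_smul_comm, ← smul_sub, Finset.sum_mul, Finset.mul_sum,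
    ← Finset.sum_sub_distrib]
  have h2 : ∀ i, (∑ j, ((β ![vec E i, vec E j] : ℝ) : ℂ) •
      (wedge (covec E i) * wedge (covec E j))) * interior Y -
      interior Y * ∑ j, ((β ![vec E i, vec E j] : ℝ) : ℂ) • (wedge (covec E i) * wedge (covec E j))
      = ∑ j, (((β ![vec E i, vec E j] * covec E j Y : ℝ) : ℂ) • wedge (covec E i) -
        ((β ![vec E i, vec E j] * covec E i Y : ℝ) : ℂ) • wedge (covec E j)) := by
    intro i
    rw [Finset.sum_mul, Finset.mul_sum, ← Finset.sum_sub_distrib]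
    refine Finset.sum_congr rfl fun j _ => ?_
    rw [smul_mul_assoc, mul_smul_comm, ← smul_sub, h1, smul_sub, smul_smul, smul_smul]
    push_cast
    rfl
  simp only [h2, Finset.sum_sub_distrib]
  rw [Finset.sum_comm (f := fun i j => ((β ![vec E i, vec E j] * covec E i Y : ℝ) : ℂ) •
    wedge (covec E j))]
  have hcov : ∀ (X : E), β ![Y, X] = covector (β.curryLeft Y) X := by
    intro X
    rw [covector_apply]
    rfl
  have h3 : ∀ i, ∑ j, β ![vec E i, vec E j] * covec E j Y =
      -covector (β.curryLeft Y) (vec E i) := by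
    intro i
    have : β ![vec E i, Y] = covector (β.curryLeft (vec E i)) Y := by
      rw [covector_apply]
      rfl
    rw [← hcov, alt_two_swap, neg_neg, this]
    conv_rhs => rw [← sum_coord_smul_vec Y]
    simp only [map_sum, map_smul, smul_eq_mul, covector_apply]
    exact Finset.sum_congr rfl fun j _ => mul_comm _ _
  have h4 : ∀ i, ∑ j, β ![vec E j, vec E i] * covec E j Y =
      covector (β.curryLeft Y) (vec E i) := by
    intro i
    rw [← neg_neg (covector _ _), ← h3, ← Finset.sum_neg_distrib]
    exact Finset.sum_congr rfl fun j _ => by rw [alt_two_swap]; ring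
  simp only [← Finset.sum_smul, ← Complex.ofReal_sum, h3, h4]
  rw [sum_smul_wedge_covec]
  simp only [Complex.ofReal_neg, neg_smul, Finset.sum_neg_distrib]
  rw [sum_smul_wedge_covec, sub_eq_add_neg, ← two_smul ℂ, smul_smul]
  norm_num

theorem interior_wedge_wedge_wedge (X : E) (ξ ζ χ : E →L[ℝ] ℝ) :
    interior X * (wedge ξ * (wedge ζ * wedge χ)) + wedge ξ * (wedge ζ * wedge χ) * interior X =
      ((ξ X : ℝ) : ℂ) • (wedge ζ * wedge χ) - ((ζ X : ℝ) : ℂ) • (wedge ξ * wedge χ) +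
      ((χ X : ℝ) : ℂ) • (wedge ξ * wedge ζ) := by
  have e : interior X * (wedge ξ * (wedge ζ * wedge χ)) +
      wedge ξ * (wedge ζ * wedge χ) * interior X =
      (interior X * wedge ξ + wedge ξ * interior X) * (wedge ζ * wedge χ)
      - wedge ξ * ((interior X * wedge ζ + wedge ζ * interior X) * wedge χ) +
      wedge ξ * (wedge ζ * (interior X * wedge χ + wedge χ * interior X)) := by
    noncomm_ring
  rw [e, interior_mul_wedge, interior_mul_wedge, interior_mul_wedge]
  simp

theorem alt_three_swap12 (H : Alt E ℝ 3) (X Y Z : E) : H ![X, Y, Z] = -H ![Y, X, Z] := by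
  have := H.toAlternatingMap.map_swap ![X, Y, Z] (i := 0) (j := 1) (by simp)
  have h2 : ![X, Y, Z] ∘ ⇑(Equiv.swap (0 : Fin 3) 1) = ![Y, X, Z] := by
    funext i
    fin_cases i <;> simp [Equiv.swap_apply_def]
  rw [h2] at this
  simp only [ContinuousAlternatingMap.coe_toAlternatingMap] at this
  linarith

theorem alt_three_swap23 (H : Alt E ℝ 3) (X Y Z : E) : H ![X, Y, Z] = -H ![X, Z, Y] :=
  alt_two_swap (H.curryLeft X) Y Z

/-- The contraction can hit any of three slots. Antisymmetry of `H` makes the three contributions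
equal, and `3 · 1/6` is the `1/2` in `wedge2`. -/
theorem interior_mul_wedge3 (H : Alt E ℝ 3) (X : E) :
    interior X * wedge3 H + wedge3 H * interior X = wedge2 (H.curryLeft X) := by
  have hc : ∀ Y Z, ∑ i, H ![vec E i, Y, Z] * covec E i X = H ![X, Y, Z] := by
    intro Y Z
    have h : ∀ W, H ![W, Y, Z] = H.curryLeft W ![Y, Z] := fun W => rfl
    simp only [h]
    conv_rhs => rw [← sum_coord_smul_vec X]
    rw [map_sum, ContinuousAlternatingMap.sum_apply]
    exact Finset.sum_congr rfl fun i _ => by rw [map_smul]; exact mul_comm _ _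
  rw [wedge3_eq, smul_mul_assoc, mul_smul_comm, ← smul_add]
  simp only [Finset.sum_mul, Finset.mul_sum, ← Finset.sum_add_distrib, smul_mul_assoc,
    mul_smul_comm]
  simp only [← smul_add, interior_wedge_wedge_wedge]
  have h1 : ∑ i, ∑ j, ∑ k, ((H ![vec E i, vec E j, vec E k] : ℝ) : ℂ) • ((covec E i X : ℝ) : ℂ) •
      (wedge (covec E j) * wedge (covec E k)) = ∑ j, ∑ k, ((H ![X, vec E j, vec E k] : ℝ) : ℂ) •
      (wedge (covec E j) * wedge (covec E k)) := by
    rw [Finset.sum_comm]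
    refine Finset.sum_congr rfl fun j _ => ?_
    rw [Finset.sum_comm]
    refine Finset.sum_congr rfl fun k _ => ?_
    rw [← hc, Complex.ofReal_sum, Finset.sum_smul]
    refine Finset.sum_congr rfl fun i _ => ?_
    rw [smul_smul, Complex.ofReal_mul]
  have h2 : ∑ i, ∑ j, ∑ k, ((H ![vec E i, vec E j, vec E k] : ℝ) : ℂ) • ((covec E j X : ℝ) : ℂ) •
      (wedge (covec E i) * wedge (covec E k)) = -∑ j, ∑ k, ((H ![X, vec E j, vec E k] : ℝ) : ℂ) •
      (wedge (covec E j) * wedge (covec E k)) := by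
    rw [← h1, ← Finset.sum_neg_distrib, Finset.sum_comm]
    refine Finset.sum_congr rfl fun i _ => ?_
    rw [← Finset.sum_neg_distrib]
    refine Finset.sum_congr rfl fun j _ => ?_
    rw [← Finset.sum_neg_distrib]
    refine Finset.sum_congr rfl fun k _ => ?_
    rw [alt_three_swap12, Complex.ofReal_neg, neg_smul]
  have h3 : ∑ i, ∑ j, ∑ k, ((H ![vec E i, vec E j, vec E k] : ℝ) : ℂ) • ((covec E k X : ℝ) : ℂ) •
      (wedge (covec E i) * wedge (covec E j)) = ∑ j, ∑ k, ((H ![X, vec E j, vec E k] : ℝ) : ℂ) •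
      (wedge (covec E j) * wedge (covec E k)) := by
    rw [← neg_neg (∑ j, ∑ k, ((H ![X, vec E j, vec E k] : ℝ) : ℂ) •
      (wedge (covec E j) * wedge (covec E k))), ← h2, ← Finset.sum_neg_distrib]
    refine Finset.sum_congr rfl fun i _ => ?_
    rw [Finset.sum_comm, ← Finset.sum_neg_distrib]
    refine Finset.sum_congr rfl fun j _ => ?_
    rw [← Finset.sum_neg_distrib]
    refine Finset.sum_congr rfl fun k _ => ?_
    rw [alt_three_swap23, Complex.ofReal_neg, neg_smul]
  simp only [smul_add, smul_sub, Finset.sum_add_distrib, Finset.sum_sub_distrib, h1, h2, h3]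
  rw [wedge2]
  have h4 : ∀ Y Z, (H.curryLeft X) ![Y, Z] = H ![X, Y, Z] := fun _ _ => rfl
  simp only [h4]
  module

theorem wedge_mul_wedge3 (H : Alt E ℝ 3) (ξ : E →L[ℝ] ℝ) :
    wedge ξ * wedge3 H + wedge3 H * wedge ξ = 0 := by
  have h : ∀ a b : E →L[ℝ] ℝ, wedge a * wedge b = -(wedge b * wedge a) := fun a b =>
    eq_neg_of_add_eq_zero_left (wedge_mul_wedge a b)
  have h3 : ∀ a b c : E →L[ℝ] ℝ, wedge ξ * (wedge a * (wedge b * wedge c)) =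
      -(wedge a * (wedge b * wedge c) * wedge ξ) := by
    intro a b c
    rw [← mul_assoc, h ξ a, neg_mul, mul_assoc, ← mul_assoc (wedge ξ), h ξ b, neg_mul, mul_assoc,
      h ξ c]
    noncomm_ring
  rw [wedge3_eq, smul_mul_assoc, mul_smul_comm, ← smul_add]
  simp only [Finset.sum_mul, Finset.mul_sum, ← Finset.sum_add_distrib, smul_mul_assoc,
    mul_smul_comm, h3]
  simp

theorem wedge_mul_wedge2 (β : Alt E ℝ 2) (ξ : E →L[ℝ] ℝ) :
    wedge ξ * wedge2 β = wedge2 β * wedge ξ := by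
  have h : ∀ a b : E →L[ℝ] ℝ, wedge a * wedge b = -(wedge b * wedge a) := fun a b =>
    eq_neg_of_add_eq_zero_left (wedge_mul_wedge a b)
  have h3 : ∀ a b : E →L[ℝ] ℝ, wedge ξ * (wedge a * wedge b) = wedge a * wedge b * wedge ξ := by
    intro a b
    rw [← mul_assoc, h ξ a, neg_mul, mul_assoc, h ξ b]
    noncomm_ring
  rw [wedge2, smul_mul_assoc, mul_smul_comm]
  simp only [Finset.sum_mul, Finset.mul_sum, smul_mul_assoc, mul_smul_comm, h3]

/-- The double commutator of `H ∧` with two elements of `V ⊕ V*`. -/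
theorem wedge3_comm_comm (H : Alt E ℝ 3) (u v : Gen E) :
    (wedge3 H * cliff u + cliff u * wedge3 H) * cliff v -
      cliff v * (wedge3 H * cliff u + cliff u * wedge3 H) =
      -wedge (covector ((H.curryLeft u.1).curryLeft v.1)) := by
  have h1 : wedge3 H * cliff u + cliff u * wedge3 H = wedge2 (H.curryLeft u.1) := by
    rw [← interior_mul_wedge3, cliff, mul_add, add_mul]
    have := wedge_mul_wedge3 H u.2
    rw [← add_zero (interior u.1 * wedge3 H + wedge3 H * interior u.1), ← this]
    abel
  rw [h1, ← wedge2_mul_interior, cliff, mul_add, add_mul, wedge_mul_wedge2]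
  abel

theorem wedge3_pb {A B : E →L[ℝ] E} (hAB : A ∘L B = ContinuousLinearMap.id ℝ E)
    (hBA : B ∘L A = ContinuousLinearMap.id ℝ E) (H : Alt E ℝ 3) :
    wedge3 (H.compContinuousLinearMap A) * pb A = pb A * wedge3 H := by
  have hw : ∀ a : E →L[ℝ] ℝ, wedge a * pb A = pb A * wedge (a ∘L B) := by
    intro a
    ext1 ρ
    rw [Module.End.mul_apply, Module.End.mul_apply, ← wedge_pb, ContinuousLinearMap.comp_assoc, hBA,
      ContinuousLinearMap.comp_id]
  have hφ : ∀ φ : E →L[ℝ] ℝ, ∑ i, ((φ (A (vec E i)) : ℝ) : ℂ) • wedge (covec E i ∘L B) =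
      ∑ i, ((φ (vec E i) : ℝ) : ℂ) • wedge (covec E i) := by
    intro φ
    have h1 := congrArg (fun ξ : E →L[ℝ] ℝ => ξ ∘L B) (sum_apply_vec_smul_covec (φ ∘L A))
    simp only [ContinuousLinearMap.comp_assoc, hAB, ContinuousLinearMap.comp_id] at h1
    rw [sum_smul_wedge_covec]
    have h2 : (∑ i, (φ ∘L A) (vec E i) • covec E i) ∘L B =
        ∑ i, (φ (A (vec E i))) • (covec E i ∘L B) := by
      ext X
      simp
    have := map_sum (wedgeL E) (fun i => φ (A (vec E i)) • (covec E i ∘L B)) Finset.univ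
    simp only [wedgeL_apply] at this
    rw [h2] at h1
    conv_rhs => rw [← h1, this]
    simp only [wedge_smul]
  have hmid : ∀ (φ : E →L[ℝ] ℝ) (P Q : Module.End ℂ (Spinor E)),
      ∑ i, ((φ (A (vec E i)) : ℝ) : ℂ) • (P * (wedge (covec E i ∘L B) * Q)) =
      ∑ i, ((φ (vec E i) : ℝ) : ℂ) • (P * (wedge (covec E i) * Q)) := by
    intro φ P Q
    have := congrArg (fun D => P * (D * Q)) (hφ φ)
    simpa only [Finset.mul_sum, Finset.sum_mul, smul_mul_assoc, mul_smul_comm] using this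
  have h3 : ∀ X Y Z, H ![X, Y, Z] = covector ((H.curryLeft X).curryLeft Y) Z := by
    intro X Y Z
    rw [covector_apply]
    rfl
  have h2 : ∀ X Y Z, H ![X, Y, Z] = (-covector ((H.curryLeft X).curryLeft Z)) Y := by
    intro X Y Z
    rw [alt_three_swap23, h3]
    rfl
  have h1 : ∀ X Y Z, H ![X, Y, Z] = covector ((H.curryLeft Y).curryLeft Z) X := by
    intro X Y Z
    rw [alt_three_swap12, alt_three_swap23, neg_neg, h3]
  rw [wedge3_eq, wedge3_eq, smul_mul_assoc, mul_smul_comm]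
  congr 1
  simp only [Finset.sum_mul, Finset.mul_sum, smul_mul_assoc, mul_smul_comm]
  have hA : ∀ i j k, (H.compContinuousLinearMap A) ![vec E i, vec E j, vec E k] =
      H ![A (vec E i), A (vec E j), A (vec E k)] := by
    intro i j k
    rw [ContinuousAlternatingMap.compContinuousLinearMap_apply]
    congr 1
    funext l
    fin_cases l <;> rfl
  have hP : ∀ i j k, wedge (covec E i) * (wedge (covec E j) * wedge (covec E k)) * pb A =
      pb A * (wedge (covec E i ∘L B) * (wedge (covec E j ∘L B) * (wedge (covec E k ∘L B) * 1))) := by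
    intro i j k
    rw [mul_assoc, mul_assoc, hw, ← mul_assoc (wedge (covec E j)), hw, ← mul_assoc,
      ← mul_assoc (wedge (covec E i)), hw, mul_one]
    noncomm_ring
  simp only [hA, hP]
  -- The basis is changed one slot at a time, from the last to the first; the other two slots stay
  -- frozen in the factors `P` and `Q` of `hmid`.
  calc _ = ∑ i, ∑ j, ∑ k, ((H ![A (vec E i), A (vec E j), vec E k] : ℝ) : ℂ) •
        (pb A * (wedge (covec E i ∘L B) * (wedge (covec E j ∘L B) * (wedge (covec E k) * 1)))) := by
        refine Finset.sum_congr rfl fun i _ => Finset.sum_congr rfl fun j _ => ?_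
        simp only [h3]
        simpa only [mul_assoc] using hmid (covector ((H.curryLeft (A (vec E i))).curryLeft
          (A (vec E j)))) (pb A * wedge (covec E i ∘L B) * wedge (covec E j ∘L B)) 1
    _ = ∑ i, ∑ k, ∑ j, ((H ![A (vec E i), vec E j, vec E k] : ℝ) : ℂ) •
        (pb A * (wedge (covec E i ∘L B) * (wedge (covec E j) * (wedge (covec E k) * 1)))) := by
        refine Finset.sum_congr rfl fun i _ => ?_
        rw [Finset.sum_comm]
        refine Finset.sum_congr rfl fun k _ => ?_
        simp only [h2]
        simpa only [mul_assoc] using hmid (-covector ((H.curryLeft (A (vec E i))).curryLeft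
          (vec E k))) (pb A * wedge (covec E i ∘L B)) (wedge (covec E k) * 1)
    _ = ∑ k, ∑ j, ∑ i, ((H ![vec E i, vec E j, vec E k] : ℝ) : ℂ) •
        (pb A * (wedge (covec E i) * (wedge (covec E j) * (wedge (covec E k) * 1)))) := by
        rw [Finset.sum_comm]
        refine Finset.sum_congr rfl fun k _ => ?_
        rw [Finset.sum_comm]
        refine Finset.sum_congr rfl fun j _ => ?_
        simp only [h1]
        exact hmid _ _ _
    _ = _ := by
        simp only [mul_one]
        rw [Finset.sum_comm]
        conv_lhs =>
          enter [2, j]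
          rw [Finset.sum_comm]
        rw [Finset.sum_comm]

theorem parity_mul_wedge3 (H : Alt E ℝ 3) : parity * wedge3 H = -(wedge3 H * parity) := by
  have h : ∀ a : E →L[ℝ] ℝ, parity * wedge a = -(wedge a * parity) := by
    intro a
    have := parity_mul_cliff (0, a)
    have h0 : interior (0 : E) = 0 := by simpa using interior_smul 0 (0 : E)
    simpa only [cliff, h0, zero_add] using this
  rw [wedge3_eq, mul_smul_comm, smul_mul_assoc, ← smul_neg]
  congr 1
  simp only [Finset.sum_mul, Finset.mul_sum, ← Finset.sum_neg_distrib]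
  refine Finset.sum_congr rfl fun i _ => Finset.sum_congr rfl fun j _ =>
    Finset.sum_congr rfl fun k _ => ?_
  rw [mul_smul_comm, smul_mul_assoc, ← smul_neg]
  congr 1
  rw [← mul_assoc, h, neg_mul, mul_assoc, ← mul_assoc parity, h, neg_mul, mul_assoc, h]
  noncomm_ring

end ThreeForms

/-! ### Parity of the dimension -/

section Even

/-- In odd dimension the determinant of `j² = -1` would be a negative square. -/
theorem even_finrank_of_sq_eq_neg_one {V : Type*} [AddCommGroup V] [Module ℝ V]
    [FiniteDimensional ℝ V] (j : V →ₗ[ℝ] V) (h : ∀ v, j (j v) = -v) :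
    Even (Module.finrank ℝ V) := by
  by_contra hodd
  rw [Nat.not_even_iff_odd] at hodd
  have h1 : j * j = (-1 : ℝ) • (1 : Module.End ℝ V) := by
    ext v
    simp [h]
  have h2 := congrArg LinearMap.det h1
  rw [map_mul, LinearMap.det_smul, hodd.neg_one_pow, map_one] at h2
  nlinarith [mul_self_nonneg (LinearMap.det j)]

/-- A skew matrix of odd size is singular, and a kernel vector of the Gram matrix gives a nonzero
vector in the radical. -/
theorem even_finrank_of_skew_nondegenerate {V : Type*} [AddCommGroup V] [Module ℝ V]
    [FiniteDimensional ℝ V] (b : V →ₗ[ℝ] V →ₗ[ℝ] ℝ) (hb : ∀ v w, b v w = -b w v)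
    (h : ∀ v, (∀ w, b v w = 0) → v = 0) : Even (Module.finrank ℝ V) := by
  by_contra hodd
  rw [Nat.not_even_iff_odd] at hodd
  let e := Module.finBasis ℝ V
  let A : Matrix (Fin (Module.finrank ℝ V)) (Fin (Module.finrank ℝ V)) ℝ :=
    Matrix.of fun i j => b (e i) (e j)
  have hA : A.transpose = -A := by
    ext i j
    simp [A, hb (e j) (e i)]
  have h1 := congrArg Matrix.det hA
  rw [Matrix.det_transpose, Matrix.det_neg, Fintype.card_fin, hodd.neg_one_pow] at h1
  have h2 : A.det = 0 := by linarith
  obtain ⟨c, hc, hc2⟩ := Matrix.exists_vecMul_eq_zero_iff.2 h2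
  apply hc
  have h3 : ∑ i, c i • e i = 0 := by
    apply h
    intro w
    have h4 : b (∑ i, c i • e i) = 0 := by
      apply e.ext
      intro j
      have := congrFun hc2 j
      simpa [Matrix.vecMul, dotProduct, A] using this
    rw [h4]
    rfl
  funext i
  exact Fintype.linearIndependent_iff.1 e.linearIndependent c h3 i

variable {E : Type*} [NormedAddCommGroup E] [NormedSpace ℝ E] [FiniteDimensional ℝ E]

/-- The form `⟨J Y, X⟩` on `V` is skew. Its kernel `K` consists of the `Y` with `J Y` in `V`; it is
stable under `J`, hence of even dimension, and a complement of `K` carries a nondegenerate skew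
form. Evenness is needed because `halfDim` is a truncated quotient. -/
theorem even_finrank {J : Gen E →L[ℝ] Gen E} (hJ : IsSkew J) (hJ2 : ∀ u, J (J u) = -u) :
    Even (Module.finrank ℝ E) := by
  let b : E →ₗ[ℝ] E →ₗ[ℝ] ℝ := LinearMap.mk₂ ℝ (fun Y X => pairing (J (Y, 0)) (X, 0))
    (fun Y Y' X => by
      rw [← pairing_add_left, ← map_add, Prod.mk_add_mk, add_zero])
    (fun c Y X => by
      rw [smul_eq_mul, ← pairing_smul_left, ← map_smul, Prod.smul_mk, smul_zero])
    (fun Y X X' => by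
      rw [← pairing_add_right, Prod.mk_add_mk, add_zero])
    (fun c Y X => by
      rw [smul_eq_mul, ← pairing_smul_right, Prod.smul_mk, smul_zero])
  have hb : ∀ X Y, b X Y = pairing (J (X, 0)) (Y, 0) := fun _ _ => rfl
  have hskew : ∀ X Y, b X Y = -b Y X := by
    intro X Y
    rw [hb, hJ, pairing_comm, hb]
  let K : Submodule ℝ E := LinearMap.ker b
  have hK : ∀ Y, Y ∈ K ↔ (J (Y, 0)).2 = 0 := by
    intro Y
    constructor
    · intro h
      ext X
      have := congrArg (fun l : E →ₗ[ℝ] ℝ => l X) (LinearMap.mem_ker.1 h)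
      simp only [hb, LinearMap.zero_apply, pairing] at this
      simpa using this
    · intro h
      ext X
      simp [hb, pairing, h]
  have hj : ∀ Y ∈ K, J ((J (Y, 0)).1, 0) = (-Y, 0) := by
    intro Y hY
    have h1 : (((J (Y, 0)).1, 0) : Gen E) = J (Y, 0) := Prod.ext rfl ((hK Y).1 hY).symm
    rw [h1, hJ2]
    simp
  let j : K →ₗ[ℝ] K :=
    { toFun := fun Y => ⟨(J (Y.1, 0)).1, (hK _).2 (by rw [hj _ Y.2])⟩
      map_add' := fun Y Y' => by
        ext
        simp only [Submodule.coe_add]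
        rw [← Prod.fst_add, ← map_add, Prod.mk_add_mk, add_zero]
      map_smul' := fun c Y => by
        ext
        simp only [Submodule.coe_smul, RingHom.id_apply]
        rw [← Prod.smul_fst, ← map_smul, Prod.smul_mk, smul_zero] }
  have hKeven : Even (Module.finrank ℝ K) := by
    apply even_finrank_of_sq_eq_neg_one j
    intro Y
    ext
    exact congrArg Prod.fst (hj _ Y.2)
  obtain ⟨C, hC⟩ := K.exists_isCompl
  have hCeven : Even (Module.finrank ℝ C) := by
    apply even_finrank_of_skew_nondegenerate (b.domRestrict₁₂ C C)
    · intro v w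
      exact hskew _ _
    · intro v hv
      have : (v : E) ∈ K := by
        rw [LinearMap.mem_ker]
        ext X
        obtain ⟨x, hx, y, hy, rfl⟩ := Submodule.mem_sup.1
          (show X ∈ K ⊔ C by rw [hC.sup_eq_top]; trivial)
        have h1 : b v x = 0 := by
          rw [hskew, LinearMap.mem_ker.1 hx]
          simp
        have h2 : b v y = 0 := hv ⟨y, hy⟩
        rw [map_add, h1, h2]
        simp
      have := hC.disjoint.le_bot (Submodule.mem_inf.2 ⟨this, v.2⟩)
      exact Subtype.ext ((Submodule.mem_bot ℝ).1 this)
  rw [← Submodule.finrank_add_eq_of_isCompl hC]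
  exact hKeven.add hCeven

theorem two_mul_halfDim {J : Gen E →L[ℝ] Gen E} (hJ : IsSkew J) (hJ2 : ∀ u, J (J u) = -u) :
    2 * halfDim E = Module.finrank ℝ E := by
  have := Nat.two_mul_div_two_of_even (even_finrank hJ hJ2)
  simp only [halfDim]
  exact_mod_cast this

end Even

/-! ### Diagonalization of the spin action of `J` -/

section Spectral

variable {E : Type*} [NormedAddCommGroup E] [NormedSpace ℝ E]

/-- The Clifford action of `v - √-1 J v`, an element of `L`. -/
def lower (J : Gen E →L[ℝ] Gen E) (v : Gen E) : Module.End ℂ (Spinor E) :=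
  cliff v - Complex.I • cliff (J v)

theorem lower_map {J : Gen E →L[ℝ] Gen E} (hJ2 : ∀ u, J (J u) = -u) (v : Gen E) :
    lower J (J v) = Complex.I • lower J v := by
  rw [lower, lower, hJ2, cliff_neg, smul_sub, smul_smul, Complex.I_mul_I]
  module

theorem lower_add (J : Gen E →L[ℝ] Gen E) (v w : Gen E) :
    lower J (v + w) = lower J v + lower J w := by
  simp only [lower, map_add, cliff_add]
  module

theorem lower_smul (J : Gen E →L[ℝ] Gen E) (c : ℝ) (v : Gen E) :
    lower J (c • v) = (c : ℂ) • lower J v := by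
  simp only [lower, map_smul, cliff_smul]
  module

/-- `L` is isotropic, since `J` is orthogonal and `⟨v, J v⟩ = 0`. -/
theorem lower_mul_self {J : Gen E →L[ℝ] Gen E} (hJ : IsSkew J) (hJ2 : ∀ u, J (J u) = -u)
    (v : Gen E) : lower J v * lower J v = 0 := by
  have h1 : ∀ u : Gen E, cliff u * cliff u = ((pairing u u : ℝ) : ℂ) • 1 := by
    intro u
    have := cliff_mul_cliff u u
    rw [← two_smul ℂ, Complex.ofReal_mul, mul_smul] at this
    exact smul_right_injective _ (two_ne_zero (α := ℂ)) (by simpa using this)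
  have h2 : pairing (J v) (J v) = pairing v v := by
    rw [hJ, hJ2]
    simp [pairing]
  have h3 : pairing v (J v) = 0 := by
    have := hJ v v
    rw [pairing_comm] at this
    linarith
  have h4 := cliff_mul_cliff v (J v)
  rw [h3] at h4
  have e : lower J v * lower J v = cliff v * cliff v + (Complex.I * Complex.I) •
      (cliff (J v) * cliff (J v)) -
      Complex.I • (cliff v * cliff (J v) + cliff (J v) * cliff v) := by
    simp only [lower, sub_mul, mul_sub, smul_mul_assoc, mul_smul_comm]
    module
  rw [e, h4, h1, h1, h2, Complex.I_mul_I]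
  simp

/-- The Clifford action of `L`, as a space of operators. -/
def lowerSubmodule {J : Gen E →L[ℝ] Gen E} (hJ2 : ∀ u, J (J u) = -u) :
    Submodule ℂ (Module.End ℂ (Spinor E)) where
  carrier := Set.range (lower J)
  add_mem' := by
    rintro _ _ ⟨v, rfl⟩ ⟨w, rfl⟩
    exact ⟨v + w, lower_add J v w⟩
  zero_mem' := ⟨0, by simpa using lower_smul J 0 0⟩
  smul_mem' := by
    rintro c _ ⟨v, rfl⟩
    refine ⟨c.re • v + c.im • J v, ?_⟩
    rw [lower_add, lower_smul, lower_smul, lower_map hJ2, smul_smul, ← add_smul, Complex.re_add_im]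

variable [FiniteDimensional ℝ E]

/-- Elements of `L` are eigenvectors of the commutator with `spin J`, for the eigenvalue `√-1`. As
`U^k` belongs to `-k√-1`, they lower `k` by one. -/
theorem spin_mul_lower {J : Gen E →L[ℝ] Gen E} (hJ : IsSkew J) (hJ2 : ∀ u, J (J u) = -u)
    (v : Gen E) : spin J * lower J v = lower J v * spin J + Complex.I • lower J v := by
  have h1 := eq_add_of_sub_eq (spin_mul_cliff hJ v)
  have h2 := eq_add_of_sub_eq (spin_mul_cliff hJ (J v))
  rw [hJ2, cliff_neg] at h2
  simp only [lower, mul_sub, sub_mul, mul_smul_comm, smul_mul_assoc, h1, h2, smul_sub, smul_smul,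
    Complex.I_mul_I]
  module

theorem spin_mul_prod_lower {J : Gen E →L[ℝ] Gen E} (hJ : IsSkew J) (hJ2 : ∀ u, J (J u) = -u)
    (l : List (Gen E)) : spin J * (l.map (lower J)).prod =
      (l.map (lower J)).prod * spin J + ((l.length : ℂ) * Complex.I) • (l.map (lower J)).prod := by
  induction l with
  | nil => simp
  | cons v l ih =>
    rw [List.map_cons, List.prod_cons, ← mul_assoc, spin_mul_lower hJ hJ2, add_mul, mul_assoc, ih,
      List.length_cons]
    push_cast
    simp only [mul_add, mul_smul_comm, smul_mul_assoc, add_smul, add_mul, mul_assoc, one_mul]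
    abel

/-- The space is a real linear image of `V ⊕ V*`, of real dimension `2 dim V`, and complex
dimensions are half the real ones. -/
theorem finrank_lowerSubmodule_le {J : Gen E →L[ℝ] Gen E} (hJ2 : ∀ u, J (J u) = -u) :
    Module.Finite ℂ (lowerSubmodule hJ2) ∧
      Module.finrank ℂ (lowerSubmodule hJ2) ≤ Module.finrank ℝ E := by
  let φ : Gen E →ₗ[ℝ] lowerSubmodule hJ2 :=
    { toFun := fun v => ⟨lower J v, v, rfl⟩
      map_add' := fun v w => Subtype.ext (lower_add J v w)
      map_smul' := fun c v => Subtype.ext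
        ((lower_smul J c v).trans (ofReal_smul_spinorEnd c (lower J v))) }
  have hφ : Function.Surjective φ := by
    rintro ⟨_, v, rfl⟩
    exact ⟨v, rfl⟩
  have hfin : Module.Finite ℝ (lowerSubmodule hJ2) := Module.Finite.of_surjective φ hφ
  have h1 := LinearMap.finrank_le_finrank_of_surjective hφ
  have h2 : Module.finrank ℝ (Gen E) = 2 * Module.finrank ℝ E := by
    have h3 : Module.finrank ℝ (E →L[ℝ] ℝ) = Module.finrank ℝ E := by
      rw [← (LinearMap.toContinuousLinearMap (𝕜 := ℝ) (E := E) (F' := ℝ)).finrank_eq]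
      exact Subspace.dual_finrank_eq
    rw [Module.finrank_prod, h3, two_mul]
  have hfinC : Module.Finite ℂ (lowerSubmodule hJ2) := Module.Finite.of_restrictScalars_finite ℝ ℂ _
  refine ⟨hfinC, ?_⟩
  have h4 := finrank_real_of_complex (lowerSubmodule hJ2)
  omega

/-- By isotropy, products of elements of `L` factor through its exterior algebra, which vanishes
above the dimension of `L`. -/
theorem prod_lower_eq_zero {J : Gen E →L[ℝ] Gen E} (hJ : IsSkew J) (hJ2 : ∀ u, J (J u) = -u)
    (l : List (Gen E)) (hl : Module.finrank ℝ E < l.length) : (l.map (lower J)).prod = 0 := by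
  obtain ⟨hfin, hle⟩ := finrank_lowerSubmodule_le hJ2
  let φ := ExteriorAlgebra.lift ℂ (A := Module.End ℂ (Spinor E))
    ⟨(lowerSubmodule hJ2).subtype, by rintro ⟨_, v, rfl⟩; exact lower_mul_self hJ hJ2 v⟩
  let x : Fin l.length → lowerSubmodule hJ2 := fun i => ⟨lower J (l.get i), l.get i, rfl⟩
  have h0 : ExteriorAlgebra.ιMulti ℂ l.length x = 0 := by
    apply AlternatingMap.map_linearDependent
    intro h
    have := h.fintype_card_le_finrank
    simp at this
    omega
  have h1 := congrArg φ h0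
  rw [ExteriorAlgebra.ιMulti_apply, map_list_prod, map_zero, List.map_ofFn] at h1
  rw [← h1]
  congr 1
  have : (φ ∘ fun i => ExteriorAlgebra.ι ℂ (x i)) = fun i => lower J (l.get i) := by
    funext i
    exact ExteriorAlgebra.lift_ι_apply ℂ _ _ _
  rw [this]
  conv_lhs => rw [← List.ofFn_get l]
  rw [List.map_ofFn]
  rfl

/-- On such a spinor `J v` acts as `-√-1 v`. After reordering by the Clifford relation the terms `⟨J
e_i, e^i⟩` cancel by skewness, and each `i` leaves one `√-1`. -/
theorem spin_apply_of_lower {J : Gen E →L[ℝ] Gen E} (hJ : IsSkew J) {ρ : Spinor E}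
    (h : ∀ v, lower J v ρ = 0) :
    spin J ρ = (((Module.finrank ℝ E : ℂ) / 2) * Complex.I) • ρ := by
  have hc : ∀ v, cliff (J v) ρ = -(Complex.I • cliff v ρ) := by
    intro v
    have h1 := h v
    simp only [lower, spinorEnd_sub_apply, LinearMap.smul_apply] at h1
    rw [sub_eq_zero.1 h1, smul_smul, Complex.I_mul_I, neg_one_smul, neg_neg]
  have ha : ∀ u v : Gen E, cliff u (cliff v ρ) =
      ((2 * pairing u v : ℝ) : ℂ) • ρ - cliff v (cliff u ρ) := by
    intro u v
    have := congrArg (fun D : Module.End ℂ (Spinor E) => D ρ) (cliff_mul_cliff u v)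
    exact eq_sub_of_add_eq this
  have h1 : ∀ i, cliff (J (vec E i, 0)) (cliff (0, covec E i) ρ) +
      cliff (J (0, covec E i)) (cliff (vec E i, 0) ρ) = Complex.I • ρ := by
    intro i
    have h2 := ha (J (vec E i, 0)) (0, covec E i)
    have h3 := ha (J (0, covec E i)) (vec E i, 0)
    have h4 := ha (vec E i, 0) (0, covec E i)
    have h5 : 2 * pairing ((vec E i, 0) : Gen E) (0, covec E i) = 1 := by
      rw [pairing_mk_zero, covec_vec, if_pos rfl]
      norm_num
    have h6 : pairing (J (0, covec E i)) (vec E i, 0) =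
        -pairing (J (vec E i, 0)) (0, covec E i) := by
      rw [hJ, pairing_comm]
    rw [h5, Complex.ofReal_one, one_smul] at h4
    rw [h2, h3, hc, hc, h6, map_neg, map_neg, map_smul, map_smul, h4]
    push_cast
    module
  have h2 : spin J ρ = (1 / 2 : ℂ) • ∑ i, (cliff (J (vec E i, 0)) (cliff (0, covec E i) ρ) +
      cliff (J (0, covec E i)) (cliff (vec E i, 0) ρ)) := by
    rw [spin_eq, LinearMap.smul_apply, LinearMap.sum_apply]
    rfl
  rw [h2]
  simp only [h1, Finset.sum_const, Finset.card_univ, Fintype.card_fin]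
  rw [← Nat.cast_smul_eq_nsmul ℂ, smul_smul, smul_smul]
  congr 1
  ring

/-- The polynomial with the eigenvalues of `spin J` on the spinors that are killed by any `m`
elements of `L`. -/
def lowerPoly (E : Type*) [NormedAddCommGroup E] [NormedSpace ℝ E] (m : ℕ) : Polynomial ℂ :=
  ∏ j ∈ Finset.range m, (Polynomial.X -
    Polynomial.C (((Module.finrank ℝ E : ℂ) / 2 - j) * Complex.I))

/-- Suppose that any `m + 1` elements of `L` kill `ρ`. A product of `m` of them sends `ρ` to a
spinor killed by `L`, on which `spin J` is a known scalar. Commuting `spin J` back through the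
product shows that `spin J`, minus the root for `j = m`, sends `ρ` to a spinor killed by any `m`
elements. -/
theorem aeval_lowerPoly_apply {J : Gen E →L[ℝ] Gen E} (hJ : IsSkew J) (hJ2 : ∀ u, J (J u) = -u)
    (m : ℕ) (ρ : Spinor E)
    (h : ∀ l : List (Gen E), l.length = m → (l.map (lower J)).prod ρ = 0) :
    Polynomial.aeval (spin J) (lowerPoly E m) ρ = 0 := by
  induction m generalizing ρ with
  | zero => simpa [lowerPoly] using h [] rfl
  | succ m ih =>
    rw [lowerPoly, Finset.prod_range_succ, map_mul, Module.End.mul_apply]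
    apply ih
    intro l hl
    have h1 : spin J ((l.map (lower J)).prod ρ) =
        (((Module.finrank ℝ E : ℂ) / 2) * Complex.I) • (l.map (lower J)).prod ρ := by
      apply spin_apply_of_lower hJ
      intro v
      exact h (v :: l) (by simp [hl])
    have h2 := congrArg (fun D : Module.End ℂ (Spinor E) => D ρ) (spin_mul_prod_lower hJ hJ2 l)
    simp only [Module.End.mul_apply, LinearMap.add_apply, LinearMap.smul_apply, h1, hl] at h2
    simp only [map_sub, Polynomial.aeval_X, Polynomial.aeval_C, LinearMap.sub_apply,
      Module.algebraMap_end_apply, map_smul]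
    rw [eq_sub_of_add_eq h2.symm]
    module

/-- Any `dim V + 1` elements of `L` kill every spinor, so `spin J` is annihilated by a polynomial
with simple roots. These are the `-k√-1` with `|k| ≤ n`, where `k = j - n`. -/
theorem aeval_nodal_spin {J : Gen E →L[ℝ] Gen E} (hJ : IsSkew J) (hJ2 : ∀ u, J (J u) = -u) :
    Polynomial.aeval (spin J) (Lagrange.nodal (Finset.Icc (-halfDim E) (halfDim E))
      (fun l : ℤ => -(l : ℂ) * Complex.I)) = 0 := by
  have hn := two_mul_halfDim hJ hJ2
  have h1 : Lagrange.nodal (Finset.Icc (-halfDim E) (halfDim E))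
      (fun l : ℤ => -(l : ℂ) * Complex.I) = lowerPoly E (Module.finrank ℝ E + 1) := by
    rw [Lagrange.nodal, lowerPoly]
    symm
    have hn' : (Module.finrank ℝ E : ℂ) / 2 = (halfDim E : ℂ) := by
      have : (2 : ℂ) * (halfDim E : ℂ) = (Module.finrank ℝ E : ℂ) := by exact_mod_cast hn
      rw [← this]
      ring
    refine Finset.prod_bij (fun j _ => (j : ℤ) - halfDim E) ?_ ?_ ?_ ?_
    · intro j hj
      rw [Finset.mem_range] at hj
      rw [Finset.mem_Icc]
      omega
    · intro a _ b _ h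
      simpa using h
    · intro b hb
      rw [Finset.mem_Icc] at hb
      refine ⟨(b + halfDim E).toNat, ?_, ?_⟩
      · rw [Finset.mem_range]
        omega
      · omega
    · intro j _
      rw [hn']
      congr 2
      push_cast
      ring
  rw [h1]
  ext1 ρ
  apply aeval_lowerPoly_apply hJ hJ2
  intro l hl
  rw [prod_lower_eq_zero hJ hJ2 l (by omega)]
  rfl

/-- For `k` in the range, the root factor for `k` times the Lagrange polynomial is a multiple of the
annihilating nodal polynomial. For other `k` nothing is erased from the product, and the Lagrange
polynomial is already such a multiple. -/
theorem spin_mul_proj {J : Gen E →L[ℝ] Gen E} (hJ : IsSkew J) (hJ2 : ∀ u, J (J u) = -u) (k : ℤ)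
    (ρ : Spinor E) : spin J (proj J k ρ) = (-(k : ℂ) * Complex.I) • proj J k ρ := by
  have h1 : (Polynomial.X - Polynomial.C (-(k : ℂ) * Complex.I)) *
      Lagrange.basis (Finset.Icc (-halfDim E) (halfDim E)) (fun l : ℤ => -(l : ℂ) * Complex.I) k ∈
      Ideal.span {Lagrange.nodal (Finset.Icc (-halfDim E) (halfDim E))
        (fun l : ℤ => -(l : ℂ) * Complex.I)} := by
    have h2 : Lagrange.basis (Finset.Icc (-halfDim E) (halfDim E))
        (fun l : ℤ => -(l : ℂ) * Complex.I) k =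
        (∏ j ∈ (Finset.Icc (-halfDim E) (halfDim E)).erase k,
          Polynomial.C ((-(k : ℂ) * Complex.I - -(j : ℂ) * Complex.I)⁻¹)) *
        Lagrange.nodal ((Finset.Icc (-halfDim E) (halfDim E)).erase k)
          (fun l : ℤ => -(l : ℂ) * Complex.I) := by
      rw [Lagrange.basis, Lagrange.nodal, ← Finset.prod_mul_distrib]
      rfl
    rw [h2, Ideal.mem_span_singleton, mul_left_comm]
    apply Dvd.dvd.mul_left
    by_cases hk : k ∈ Finset.Icc (-halfDim E) (halfDim E)
    · rw [Lagrange.nodal_eq_mul_nodal_erase hk]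
    · rw [Finset.erase_eq_of_notMem hk]
      exact Dvd.intro_left _ rfl
  obtain ⟨q, hq⟩ := Ideal.mem_span_singleton.1 h1
  have h3 := congrArg (fun p => Polynomial.aeval (spin J) p ρ) hq
  simp only [map_mul, aeval_nodal_spin hJ hJ2, zero_mul, LinearMap.zero_apply, map_sub,
    Polynomial.aeval_X, Polynomial.aeval_C, Module.End.mul_apply, LinearMap.sub_apply,
    Module.algebraMap_end_apply] at h3
  rw [smul_smul] at h3
  exact sub_eq_zero.1 h3

theorem spin_proj_comm (J : Gen E →L[ℝ] Gen E) (k : ℤ) (ρ : Spinor E) :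
    proj J k (spin J ρ) = spin J (proj J k ρ) :=
  congrArg (fun D : Module.End ℂ (Spinor E) => D ρ)
    (aeval_intertwine (S := spin J) (S' := spin J) (P := spin J) rfl _)

/-- The definitions of `∂` and `∂̄` use projections one step outside the range of degrees; those
terms must not contribute. -/
theorem proj_eq_zero {J : Gen E →L[ℝ] Gen E} (hJ : IsSkew J) (hJ2 : ∀ u, J (J u) = -u) {k : ℤ}
    (hk : k ∉ Finset.Icc (-halfDim E) (halfDim E)) : proj J k = 0 := by
  ext1 ρ
  have h1 : ρ = ∑ l ∈ Finset.Icc (-halfDim E) (halfDim E), proj J l ρ := by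
    rw [← LinearMap.sum_apply, sum_proj]
    rfl
  rw [h1, map_sum]
  refine Finset.sum_eq_zero fun l hl => ?_
  rw [proj_of_mem_U J k l hl _ (Module.End.mem_eigenspace_iff.2 (spin_mul_proj hJ hJ2 l ρ)),
    if_neg (by rintro rfl; exact hk hl)]

/-- `proj J k` is the identity on `U^k` and vanishes on every other `U^l`, for all `k` and `l`. -/
theorem proj_apply_of_eigen {J : Gen E →L[ℝ] Gen E} (hJ : IsSkew J) (hJ2 : ∀ u, J (J u) = -u)
    (k l : ℤ) {ρ : Spinor E} (hρ : spin J ρ = (-(l : ℂ) * Complex.I) • ρ) :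
    proj J k ρ = if k = l then ρ else 0 := by
  by_cases hl : l ∈ Finset.Icc (-halfDim E) (halfDim E)
  · exact proj_of_mem_U J k l hl ρ (Module.End.mem_eigenspace_iff.2 hρ)
  · have h0 : ρ = 0 := by
      have h1 : ρ = ∑ l ∈ Finset.Icc (-halfDim E) (halfDim E), proj J l ρ := by
        rw [← LinearMap.sum_apply, sum_proj]
        rfl
      rw [h1]
      refine Finset.sum_eq_zero fun m hm => ?_
      have h2 := spin_mul_proj hJ hJ2 m ρ
      rw [← spin_proj_comm, hρ, map_smul] at h2
      have h3 := sub_eq_zero.2 h2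
      rw [← sub_smul] at h3
      refine (smul_eq_zero.1 h3).resolve_left fun h4 => hl ?_
      rwa [eigenvalue_injective (sub_eq_zero.1 h4)]
    rw [h0, map_zero, ite_self]

theorem proj_proj {J : Gen E →L[ℝ] Gen E} (hJ : IsSkew J) (hJ2 : ∀ u, J (J u) = -u)
    (k l : ℤ) (ρ : Spinor E) : proj J k (proj J l ρ) = if k = l then proj J l ρ else 0 :=
  proj_apply_of_eigen hJ hJ2 k l (spin_mul_proj hJ hJ2 l ρ)

/-- An operator of degree `j` for the grading by the `U^k` is compatible with the projections. -/
theorem proj_mul_of_degree {J : Gen E →L[ℝ] Gen E} (hJ : IsSkew J) (hJ2 : ∀ u, J (J u) = -u)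
    {D : Module.End ℂ (Spinor E)} {j : ℤ} (hD : spin J * D = D * spin J + (-(j : ℂ) * Complex.I) • D)
    (k : ℤ) (ρ : Spinor E) : proj J (k + j) (D ρ) = D (proj J k ρ) := by
  have h1 : ∀ l, proj J (k + j) (D (proj J l ρ)) = if k = l then D (proj J l ρ) else 0 := by
    intro l
    have h2 : spin J (D (proj J l ρ)) = (-((l + j : ℤ) : ℂ) * Complex.I) • D (proj J l ρ) := by
      have := congrArg (fun D : Module.End ℂ (Spinor E) => D (proj J l ρ)) hD
      simp only [Module.End.mul_apply, LinearMap.add_apply, LinearMap.smul_apply,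
        spin_mul_proj hJ hJ2, map_smul] at this
      rw [this, ← add_smul]
      congr 1
      push_cast
      ring
    rw [proj_apply_of_eigen hJ hJ2 _ _ h2]
    simp only [add_left_inj]
  have h3 : ρ = ∑ l ∈ Finset.Icc (-halfDim E) (halfDim E), proj J l ρ := by
    rw [← LinearMap.sum_apply, sum_proj]
    rfl
  conv_lhs => rw [h3, map_sum, map_sum]
  simp only [h1]
  by_cases hk : k ∈ Finset.Icc (-halfDim E) (halfDim E)
  · rw [Finset.sum_ite_eq, if_pos hk]
  · rw [Finset.sum_ite_eq, if_neg hk, proj_eq_zero hJ hJ2 hk]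
    simp

end Spectral

/-! ### Calculus of spinor fields on the model space -/

section LocalCalculus

variable {E : Type*} [NormedAddCommGroup E] [NormedSpace ℝ E]

/-- Smoothness at `y` of a spinor field on `E`. -/
def SmoothAt (ρ : E → Spinor E) (y : E) : Prop := ∀ k, ContDiffAt ℝ ∞ (fun z => ρ z k) y

/-- Directional derivative of a spinor field on `E`. -/
def pd (ρ : E → Spinor E) (y v : E) : Spinor E := fun k => fderiv ℝ (fun z => ρ z k) y v

theorem SmoothAt.differentiableAt {ρ : E → Spinor E} {y : E} (h : SmoothAt ρ y) (k : ℕ) :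
    DifferentiableAt ℝ (fun z => ρ z k) y := (h k).differentiableAt (by simp)

theorem SmoothAt.congr {ρ σ : E → Spinor E} {y : E} (h : SmoothAt ρ y) (hσ : σ =ᶠ[nhds y] ρ) :
    SmoothAt σ y := fun k => (h k).congr_of_eventuallyEq (hσ.mono fun z hz => by
      simp only [hz])

theorem pd_congr {ρ σ : E → Spinor E} {y : E} (hσ : σ =ᶠ[nhds y] ρ) (v : E) :
    pd σ y v = pd ρ y v := by
  funext k
  have : (fun z => σ z k) =ᶠ[nhds y] fun z => ρ z k := hσ.mono fun z hz => by simp only [hz]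
  simp only [pd, this.fderiv_eq]

theorem SmoothAt.add {ρ σ : E → Spinor E} {y : E} (h : SmoothAt ρ y) (hσ : SmoothAt σ y) :
    SmoothAt (fun z => ρ z + σ z) y := fun k => (h k).add (hσ k)

theorem SmoothAt.sub {ρ σ : E → Spinor E} {y : E} (h : SmoothAt ρ y) (hσ : SmoothAt σ y) :
    SmoothAt (fun z => ρ z - σ z) y := fun k => (h k).sub (hσ k)

theorem SmoothAt.const_smul {ρ : E → Spinor E} {y : E} (h : SmoothAt ρ y) (c : ℂ) :
    SmoothAt (fun z => c • ρ z) y := fun k => by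
  have : ContDiffAt ℝ ∞ (fun z => c • ρ z k) y := (h k).const_smul c
  exact this

theorem SmoothAt.smul {ρ : E → Spinor E} {y : E} (h : SmoothAt ρ y) {c : E → ℂ}
    (hc : ContDiffAt ℝ ∞ c y) : SmoothAt (fun z => c z • ρ z) y := fun k => by
  have : ContDiffAt ℝ ∞ (fun z => c z • ρ z k) y := hc.smul (h k)
  exact this

theorem SmoothAt.sum {ι : Type*} {s : Finset ι} {ρ : ι → E → Spinor E} {y : E}
    (h : ∀ i ∈ s, SmoothAt (ρ i) y) : SmoothAt (fun z => ∑ i ∈ s, ρ i z) y := fun k => by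
  have : ContDiffAt ℝ ∞ (fun z => ∑ i ∈ s, ρ i z k) y := ContDiffAt.sum fun i hi => h i hi k
  simpa only [Finset.sum_apply] using this

theorem smoothAt_zero (y : E) : SmoothAt (fun _ => (0 : Spinor E)) y := fun _ => contDiffAt_const

theorem pd_add {ρ σ : E → Spinor E} {y : E} (h : SmoothAt ρ y) (hσ : SmoothAt σ y) (v : E) :
    pd (fun z => ρ z + σ z) y v = pd ρ y v + pd σ y v := by
  funext k
  have := fderiv_fun_add (h.differentiableAt k) (hσ.differentiableAt k)
  exact congrArg (fun D => D v) this

theorem pd_const_smul {ρ : E → Spinor E} {y : E} (h : SmoothAt ρ y) (c : ℂ) (v : E) :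
    pd (fun z => c • ρ z) y v = c • pd ρ y v := by
  funext k
  have := fderiv_fun_const_smul (h.differentiableAt k) c
  exact congrArg (fun D => D v) this

theorem pd_sum {ι : Type*} {s : Finset ι} {ρ : ι → E → Spinor E} {y : E}
    (h : ∀ i ∈ s, SmoothAt (ρ i) y) (v : E) :
    pd (fun z => ∑ i ∈ s, ρ i z) y v = ∑ i ∈ s, pd (ρ i) y v := by
  funext k
  have := fderiv_fun_sum (u := s) fun i hi => (h i hi).differentiableAt k
  have := congrArg (fun D => D v) this
  simpa only [pd, Finset.sum_apply, sum_apply] using this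

theorem pd_smul {ρ : E → Spinor E} {y : E} (h : SmoothAt ρ y) {c : E → ℂ}
    (hc : DifferentiableAt ℝ c y) (v : E) :
    pd (fun z => c z • ρ z) y v = fderiv ℝ c y v • ρ y + c y • pd ρ y v := by
  funext k
  have := congrArg (fun D => D v) (fderiv_fun_smul hc (h.differentiableAt k))
  simp only [pd, Pi.add_apply, Pi.smul_apply]
  rw [add_comm]
  exact this

variable (E) in
/-- `curryLeft` as a continuous linear map. -/
def curryLeftC (k : ℕ) : Alt E ℂ (k + 1) →L[ℝ] E →L[ℝ] Alt E ℂ k :=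
  (ContinuousAlternatingMap.curryLeftLI (𝕜 := ℝ) (E := E) (F := ℂ) (n := k)).toContinuousLinearMap

variable (E) in
/-- `ξ ↦ θ ↦ ξ ∧ θ` as a continuous bilinear map. -/
def wedgeC (k : ℕ) : (E →L[ℝ] ℝ) →L[ℝ] Alt E ℂ k →L[ℝ] Alt E ℂ (k + 1) :=
  (ContinuousLinearMap.compL ℝ (Alt E ℂ k) (E →L[ℝ] Alt E ℂ k) (Alt E ℂ (k + 1))
    (ContinuousAlternatingMap.alternatizeUncurryFinCLM ℝ E ℂ)) ∘L
    (ContinuousLinearMap.smulRightL ℝ E (Alt E ℂ k))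

theorem smoothAt_interior {ρ : E → Spinor E} {X : E → E} {y : E} (h : SmoothAt ρ y)
    (hX : ContDiffAt ℝ ∞ X y) : SmoothAt (fun z => interior (X z) (ρ z)) y := fun k => by
  have h1 : ContDiffAt ℝ ∞ (fun z => curryLeftC E k (ρ z (k + 1))) y :=
    have hc : ContDiff ℝ ∞ (fun θ : Alt E ℂ (k + 1) => curryLeftC E k θ) :=
      ContinuousLinearMap.contDiff (E := Alt E ℂ (k + 1)) (F := E →L[ℝ] Alt E ℂ k) _
    hc.contDiffAt.comp y (h (k + 1))
  exact h1.clm_apply hX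

theorem pd_interior {ρ : E → Spinor E} {X : E → E} {y : E} (h : SmoothAt ρ y)
    (hX : DifferentiableAt ℝ X y) (v : E) :
    pd (fun z => interior (X z) (ρ z)) y v =
      interior (fderiv ℝ X y v) (ρ y) + interior (X y) (pd ρ y v) := by
  funext k
  have h1 : HasFDerivAt (fun z => curryLeftC E k (ρ z (k + 1)))
      (curryLeftC E k ∘L (fderiv ℝ (fun z => ρ z (k + 1)) y)) y :=
    have hc : HasFDerivAt (fun θ : Alt E ℂ (k + 1) => curryLeftC E k θ) (curryLeftC E k)
      (ρ y (k + 1)) := (curryLeftC E k).hasFDerivAt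
    HasFDerivAt.comp (F := Alt E ℂ (k + 1)) (G := E →L[ℝ] Alt E ℂ k) y hc
      (h.differentiableAt (k + 1)).hasFDerivAt
  have h2 := congrArg (fun D => D v) (h1.clm_apply hX.hasFDerivAt).fderiv
  exact h2

theorem smoothAt_wedge {ρ : E → Spinor E} {ξ : E → E →L[ℝ] ℝ} {y : E} (h : SmoothAt ρ y)
    (hξ : ContDiffAt ℝ ∞ ξ y) : SmoothAt (fun z => wedge (ξ z) (ρ z)) y := fun k => by
  cases k with
  | zero => exact contDiffAt_const
  | succ k =>
    have h1 : ContDiffAt ℝ ∞ (fun z => wedgeC E k (ξ z)) y :=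
      have hc : ContDiff ℝ ∞ (fun ξ : E →L[ℝ] ℝ => wedgeC E k ξ) :=
        ContinuousLinearMap.contDiff (F := Alt E ℂ k →L[ℝ] Alt E ℂ (k + 1)) _
      hc.contDiffAt.comp y hξ
    exact h1.clm_apply (h k)

theorem pd_wedge {ρ : E → Spinor E} {ξ : E → E →L[ℝ] ℝ} {y : E} (h : SmoothAt ρ y)
    (hξ : DifferentiableAt ℝ ξ y) (v : E) :
    pd (fun z => wedge (ξ z) (ρ z)) y v =
      wedge (fderiv ℝ ξ y v) (ρ y) + wedge (ξ y) (pd ρ y v) := by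
  funext k
  cases k with
  | zero => simp [pd]
  | succ k =>
    have h1 : HasFDerivAt (fun z => wedgeC E k (ξ z)) (wedgeC E k ∘L (fderiv ℝ ξ y)) y :=
      have hc : HasFDerivAt (fun ξ : E →L[ℝ] ℝ => wedgeC E k ξ) (wedgeC E k) (ξ y) :=
        (wedgeC E k).hasFDerivAt
      HasFDerivAt.comp (F := E →L[ℝ] ℝ) (G := Alt E ℂ k →L[ℝ] Alt E ℂ (k + 1)) y hc
        hξ.hasFDerivAt
    have h2 := congrArg (fun D => D v) (h1.clm_apply (h.differentiableAt k).hasFDerivAt).fderiv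
    refine Eq.trans h2 ?_
    simp only [ContinuousLinearMap.comp_apply, add_apply, ContinuousLinearMap.flip_apply]
    exact add_comm _ _

theorem smoothAt_cliff {ρ : E → Spinor E} {u : E → Gen E} {y : E} (h : SmoothAt ρ y)
    (hu : ContDiffAt ℝ ∞ u y) : SmoothAt (fun z => cliff (u z) (ρ z)) y :=
  (smoothAt_interior h (contDiffAt_fst.comp y hu)).add
    (smoothAt_wedge h (contDiffAt_snd.comp y hu))

theorem pd_cliff {ρ : E → Spinor E} {u : E → Gen E} {y : E} (h : SmoothAt ρ y)
    (hu : ContDiffAt ℝ ∞ u y) (v : E) :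
    pd (fun z => cliff (u z) (ρ z)) y v =
      cliff (fderiv ℝ u y v) (ρ y) + cliff (u y) (pd ρ y v) := by
  have h1 : ContDiffAt ℝ ∞ (fun z => (u z).1) y := contDiffAt_fst.comp y hu
  have h2 : ContDiffAt ℝ ∞ (fun z => (u z).2) y := contDiffAt_snd.comp y hu
  have hd := hu.differentiableAt (n := ∞) (by simp)
  have e1 : fderiv ℝ (fun z => (u z).1) y v = (fderiv ℝ u y v).1 := by
    rw [fderiv.fst hd]
    rfl
  have e2 : fderiv ℝ (fun z => (u z).2) y v = (fderiv ℝ u y v).2 := by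
    rw [fderiv.snd hd]
    rfl
  have h3 := pd_add (smoothAt_interior h h1) (smoothAt_wedge h h2) v
  rw [pd_interior h (h1.differentiableAt (by simp)), pd_wedge h (h2.differentiableAt (by simp)),
    e1, e2] at h3
  refine Eq.trans h3 ?_
  simp only [cliff, LinearMap.add_apply]
  abel

variable [FiniteDimensional ℝ E]

theorem spin_apply (J : Gen E →L[ℝ] Gen E) (ρ : Spinor E) :
    spin J ρ = (1 / 2 : ℂ) • ∑ i, (cliff (J (vec E i, 0)) (cliff (0, covec E i) ρ) +
      cliff (J (0, covec E i)) (cliff (vec E i, 0) ρ)) := by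
  rw [spin_eq, LinearMap.smul_apply, LinearMap.sum_apply]
  rfl

theorem smoothAt_spin {ρ : E → Spinor E} {J : E → Gen E →L[ℝ] Gen E} {y : E} (h : SmoothAt ρ y)
    (hJ : ContDiffAt ℝ ∞ J y) : SmoothAt (fun z => spin (J z) (ρ z)) y := by
  simp only [spin_apply]
  refine SmoothAt.const_smul (SmoothAt.sum fun i _ => ?_) _
  exact (smoothAt_cliff (smoothAt_cliff h contDiffAt_const) (hJ.clm_apply contDiffAt_const)).add
    (smoothAt_cliff (smoothAt_cliff h contDiffAt_const) (hJ.clm_apply contDiffAt_const))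

theorem pd_cliff_const {ρ : E → Spinor E} {y : E} (h : SmoothAt ρ y) (u : Gen E) (v : E) :
    pd (fun z => cliff u (ρ z)) y v = cliff u (pd ρ y v) := by
  rw [pd_cliff h contDiffAt_const]
  simp [cliff_zero]

theorem pd_spin {ρ : E → Spinor E} {J : E → Gen E →L[ℝ] Gen E} {y : E} (h : SmoothAt ρ y)
    (hJ : ContDiffAt ℝ ∞ J y) (v : E) :
    pd (fun z => spin (J z) (ρ z)) y v =
      spin (fderiv ℝ J y v) (ρ y) + spin (J y) (pd ρ y v) := by
  have hs : ∀ u w : Gen E, SmoothAt (fun z => cliff (J z u) (cliff w (ρ z))) y := fun u w =>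
    smoothAt_cliff (smoothAt_cliff h contDiffAt_const) (hJ.clm_apply contDiffAt_const)
  have hd : ∀ u w : Gen E, pd (fun z => cliff (J z u) (cliff w (ρ z))) y v =
      cliff (fderiv ℝ J y v u) (cliff w (ρ y)) + cliff (J y u) (cliff w (pd ρ y v)) := by
    intro u w
    rw [pd_cliff (smoothAt_cliff h contDiffAt_const) (hJ.clm_apply contDiffAt_const),
      pd_cliff_const h, fderiv_clm_apply (hJ.differentiableAt (by simp))
        (differentiableAt_const u)]
    simp
  simp only [spin_apply]
  rw [pd_const_smul (SmoothAt.sum fun i _ => (hs _ _).add (hs _ _)),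
    pd_sum (fun i _ => (hs _ _).add (hs _ _)), ← smul_add, ← Finset.sum_add_distrib]
  congr 1
  refine Finset.sum_congr rfl fun i _ => ?_
  rw [pd_add (hs _ _) (hs _ _), hd, hd]
  abel

theorem smoothAt_aeval_spin {ρ : E → Spinor E} {J : E → Gen E →L[ℝ] Gen E} {y : E}
    (h : SmoothAt ρ y) (hJ : ContDiffAt ℝ ∞ J y) (p : Polynomial ℂ) :
    SmoothAt (fun z => Polynomial.aeval (spin (J z)) p (ρ z)) y := by
  induction p using Polynomial.induction_on' with
  | add p q hp hq =>
    simp only [map_add, LinearMap.add_apply]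
    exact hp.add hq
  | monomial m a =>
    simp only [Polynomial.aeval_monomial, Module.End.mul_apply, Module.algebraMap_end_apply]
    refine SmoothAt.const_smul ?_ a
    induction m with
    | zero => simpa using h
    | succ m ih =>
      simp only [pow_succ', Module.End.mul_apply]
      exact smoothAt_spin ih hJ

theorem smoothAt_proj {ρ : E → Spinor E} {J : E → Gen E →L[ℝ] Gen E} {y : E}
    (h : SmoothAt ρ y) (hJ : ContDiffAt ℝ ∞ J y) (k : ℤ) :
    SmoothAt (fun z => proj (J z) k (ρ z)) y := smoothAt_aeval_spin h hJ _

theorem wedge3_apply (H : Alt E ℝ 3) (ρ : Spinor E) : wedge3 H ρ = (1 / 6 : ℂ) •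
    ∑ i, ∑ j, ∑ k, ((H ![vec E i, vec E j, vec E k] : ℝ) : ℂ) •
      wedge (covec E i) (wedge (covec E j) (wedge (covec E k) ρ)) := by
  simp only [wedge3, LinearMap.smul_apply, LinearMap.sum_apply, LinearMap.comp_apply]

theorem smoothAt_wedge3 {ρ : E → Spinor E} {H : E → Alt E ℝ 3} {y : E} (h : SmoothAt ρ y)
    (hH : ContDiffAt ℝ ∞ H y) : SmoothAt (fun z => wedge3 (H z) (ρ z)) y := by
  simp only [wedge3_apply]
  refine SmoothAt.const_smul (SmoothAt.sum fun i _ => SmoothAt.sum fun j _ => SmoothAt.sum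
    fun k _ => SmoothAt.smul (smoothAt_wedge (smoothAt_wedge (smoothAt_wedge h contDiffAt_const)
      contDiffAt_const) contDiffAt_const) ?_) _
  have h1 : ContDiffAt ℝ ∞ (fun z => H z ![vec E i, vec E j, vec E k]) y :=
    (ContinuousAlternatingMap.apply ℝ E ℝ ![vec E i, vec E j, vec E k]).contDiff.contDiffAt.comp y hH
  exact Complex.ofRealCLM.contDiff.contDiffAt.comp y h1

theorem pd_wedge3 {ρ : E → Spinor E} {H : E → Alt E ℝ 3} {y : E} (h : SmoothAt ρ y)
    (hH : ContDiffAt ℝ ∞ H y) (v : E) :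
    pd (fun z => wedge3 (H z) (ρ z)) y v =
      wedge3 (fderiv ℝ H y v) (ρ y) + wedge3 (H y) (pd ρ y v) := by
  have hw : ∀ i j k, SmoothAt (fun z =>
      wedge (covec E i) (wedge (covec E j) (wedge (covec E k) (ρ z)))) y := fun i j k =>
    smoothAt_wedge (smoothAt_wedge (smoothAt_wedge h contDiffAt_const) contDiffAt_const)
      contDiffAt_const
  have hpw : ∀ i j k, pd (fun z =>
      wedge (covec E i) (wedge (covec E j) (wedge (covec E k) (ρ z)))) y v =
      wedge (covec E i) (wedge (covec E j) (wedge (covec E k) (pd ρ y v))) := by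
    intro i j k
    have h0 : wedge (0 : E →L[ℝ] ℝ) = 0 := by simpa using wedge_smul 0 (0 : E →L[ℝ] ℝ)
    rw [pd_wedge (smoothAt_wedge (smoothAt_wedge h contDiffAt_const) contDiffAt_const)
      (differentiableAt_const _), pd_wedge (smoothAt_wedge h contDiffAt_const)
      (differentiableAt_const _), pd_wedge h (differentiableAt_const _)]
    simp [h0]
  have hc : ∀ m : Fin 3 → E, ContDiffAt ℝ ∞ (fun z => ((H z m : ℝ) : ℂ)) y := fun m =>
    Complex.ofRealCLM.contDiff.contDiffAt.comp y
      ((ContinuousAlternatingMap.apply ℝ E ℝ m).contDiff.contDiffAt.comp y hH)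
  have hdc : ∀ m : Fin 3 → E, fderiv ℝ (fun z => ((H z m : ℝ) : ℂ)) y v =
      ((fderiv ℝ H y v m : ℝ) : ℂ) := by
    intro m
    have h1 : HasFDerivAt (fun z => ((H z m : ℝ) : ℂ)) (Complex.ofRealCLM ∘L
      ((ContinuousAlternatingMap.apply ℝ E ℝ m) ∘L (fderiv ℝ H y))) y :=
      Complex.ofRealCLM.hasFDerivAt.comp y ((ContinuousAlternatingMap.apply ℝ E ℝ m).hasFDerivAt.comp
        y (hH.differentiableAt (by simp)).hasFDerivAt)
    rw [h1.fderiv]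
    rfl
  simp only [wedge3_apply]
  rw [pd_const_smul (SmoothAt.sum fun i _ => SmoothAt.sum fun j _ => SmoothAt.sum
    fun k _ => SmoothAt.smul (hw i j k) (hc _)), ← smul_add,
    pd_sum (fun i _ => SmoothAt.sum fun j _ => SmoothAt.sum
      fun k _ => SmoothAt.smul (hw i j k) (hc _)), ← Finset.sum_add_distrib]
  congr 1
  refine Finset.sum_congr rfl fun i _ => ?_
  rw [pd_sum (fun j _ => SmoothAt.sum fun k _ => SmoothAt.smul (hw i j k) (hc _)),
    ← Finset.sum_add_distrib]
  refine Finset.sum_congr rfl fun j _ => ?_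
  rw [pd_sum (fun k _ => SmoothAt.smul (hw i j k) (hc _)), ← Finset.sum_add_distrib]
  refine Finset.sum_congr rfl fun k _ => ?_
  rw [pd_smul (hw i j k) ((hc _).differentiableAt (by simp)), hpw, hdc]

/-- The exterior derivative of a spinor field on `E`. -/
def dl (ρ : E → Spinor E) (y : E) : Spinor E :=
  ∑ a, wedge (covec E a) (pd ρ y (vec E a))

theorem dl_zero_degree (ρ : E → Spinor E) (y : E) : dl ρ y 0 = 0 := by
  simp [dl]

/-- Writing the derivative as `∑ e^a ⊗ ∂_a` turns `d` into `∑ e^a ∧ ∂_a`, so that commutators with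
Clifford elements can be computed algebraically. -/
theorem dl_succ (ρ : E → Spinor E) (y : E) (k : ℕ) :
    dl ρ y (k + 1) = extDeriv (fun z => ρ z k) y := by
  have h : fderiv ℝ (fun z => ρ z k) y =
      ∑ a, (covec E a).smulRight (fderiv ℝ (fun z => ρ z k) y (vec E a)) := by
    ext1 X
    conv_lhs => rw [← sum_coord_smul_vec X]
    simp
  rw [extDeriv, h]
  have := map_sum (ContinuousAlternatingMap.alternatizeUncurryFinCLM ℝ E ℂ)
    (fun a => (covec E a).smulRight (fderiv ℝ (fun z => ρ z k) y (vec E a))) Finset.univ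
  simp only [ContinuousAlternatingMap.alternatizeUncurryFinCLM_apply] at this
  rw [this, dl, Finset.sum_apply]
  rfl

theorem dl_congr {ρ σ : E → Spinor E} {y : E} (h : σ =ᶠ[nhds y] ρ) : dl σ y = dl ρ y := by
  simp only [dl, pd_congr h]

theorem dl_add {ρ σ : E → Spinor E} {y : E} (h : SmoothAt ρ y) (hσ : SmoothAt σ y) :
    dl (fun z => ρ z + σ z) y = dl ρ y + dl σ y := by
  simp only [dl, pd_add h hσ, map_add, Finset.sum_add_distrib]

theorem dl_const_smul {ρ : E → Spinor E} {y : E} (h : SmoothAt ρ y) (c : ℂ) :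
    dl (fun z => c • ρ z) y = c • dl ρ y := by
  simp only [dl, pd_const_smul h, map_smul, Finset.smul_sum]

theorem smoothAt_pd {ρ : E → Spinor E} {y : E} (h : SmoothAt ρ y) (v : E) :
    SmoothAt (fun z => pd ρ z v) y := fun k =>
  ((h k).fderiv_right (m := ∞) (by simp)).clm_apply contDiffAt_const

theorem smoothAt_dl {ρ : E → Spinor E} {y : E} (h : SmoothAt ρ y) : SmoothAt (dl ρ) y :=
  SmoothAt.sum fun _ _ => smoothAt_wedge (smoothAt_pd h _) contDiffAt_const

theorem dl_dl {ρ : E → Spinor E} {y : E} (h : SmoothAt ρ y) : dl (dl ρ) y = 0 := by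
  funext k
  cases k with
  | zero => exact dl_zero_degree _ _
  | succ k =>
    rw [dl_succ]
    cases k with
    | zero =>
      simp only [dl_zero_degree]
      rw [extDeriv, show (fun z : E => (0 : Alt E ℂ 0)) = Function.const E 0 from rfl,
        fderiv_const]
      exact (ContinuousAlternatingMap.alternatizeUncurryFinCLM ℝ E ℂ).map_zero
    | succ k =>
      simp only [dl_succ]
      exact extDeriv_extDeriv_apply (h k) (by
        rw [minSmoothness_of_isRCLikeNormedField]
        exact WithTop.coe_le_coe.2 le_top)

end LocalCalculus

/-! ### Integrability and the degrees of `d_H`, locally -/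

section FlatIntegrability

variable {E : Type*} [NormedAddCommGroup E] [NormedSpace ℝ E]

/-- The double commutator `[{D, u}, v]` of an operator with two elements of `V ⊕ V*`. -/
def dcomm (D : Module.End ℂ (Spinor E)) (u v : Gen E) : Module.End ℂ (Spinor E) :=
  (D * cliff u + cliff u * D) * cliff v - cliff v * (D * cliff u + cliff u * D)

theorem dcomm_add (D D' : Module.End ℂ (Spinor E)) (u v : Gen E) :
    dcomm (D + D') u v = dcomm D u v + dcomm D' u v := by
  simp only [dcomm]
  noncomm_ring

theorem dcomm_neg (D : Module.End ℂ (Spinor E)) (u v : Gen E) :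
    dcomm (-D) u v = -dcomm D u v := by
  simp only [dcomm]
  noncomm_ring

theorem dcomm_sub (D D' : Module.End ℂ (Spinor E)) (u v : Gen E) :
    dcomm (D - D') u v = dcomm D u v - dcomm D' u v := by
  simp only [dcomm]
  noncomm_ring

theorem dcomm_sum {ι : Type*} (s : Finset ι) (D : ι → Module.End ℂ (Spinor E)) (u v : Gen E) :
    dcomm (∑ i ∈ s, D i) u v = ∑ i ∈ s, dcomm (D i) u v := by
  simp only [dcomm, Finset.sum_mul, Finset.mul_sum, ← Finset.sum_add_distrib,
    ← Finset.sum_sub_distrib]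

theorem dcomm_cliff_mul {s : Module.End ℂ (Spinor E)} {k : Gen E →L[ℝ] Gen E}
    (hs : ∀ w, s * cliff w - cliff w * s = cliff (k w)) (e u v : Gen E) :
    dcomm (cliff e * s) u v =
      cliff ((2 * pairing e u) • k v + (2 * pairing (k u) v) • e - (2 * pairing e v) • k u) := by
  have h1 : cliff e * s * cliff u + cliff u * (cliff e * s) =
      ((2 * pairing e u : ℝ) : ℂ) • s + cliff e * cliff (k u) := by
    have h := cliff_mul_cliff e u
    have e1 : cliff e * s * cliff u + cliff u * (cliff e * s) =
        cliff e * (s * cliff u - cliff u * s) + (cliff e * cliff u + cliff u * cliff e) * s := by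
      noncomm_ring
    rw [e1, h, hs, smul_mul_assoc, one_mul]
    abel
  have h2 := cliff_mul_cliff_comm e (k u) v
  rw [dcomm, h1, cliff_sub, cliff_add, cliff_smul, cliff_smul, cliff_smul, add_mul, mul_add,
    smul_mul_assoc, mul_smul_comm, add_sub_add_comm, ← smul_sub, hs, h2]
  abel

variable [FiniteDimensional ℝ E]

/-- The commutator with `spin J` is a derivation that acts on `V ⊕ V*` by `J`. -/
theorem dcomm_commutator {J : Gen E →L[ℝ] Gen E} (hJ : IsSkew J) (D : Module.End ℂ (Spinor E))
    (u v : Gen E) : dcomm (spin J * D - D * spin J) u v =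
      spin J * dcomm D u v - dcomm D u v * spin J - dcomm D (J u) v - dcomm D u (J v) := by
  simp only [dcomm, ← spin_mul_cliff hJ]
  noncomm_ring

/-- The one-form `w ↦ ⟨A w, v⟩`. -/
def pairD (A : E →L[ℝ] Gen E) (v : Gen E) : E →L[ℝ] ℝ :=
  ((pairingL E).flip v ∘ₗ (A : E →ₗ[ℝ] Gen E)).toContinuousLinearMap

@[simp]
theorem pairD_apply (A : E →L[ℝ] Gen E) (v : Gen E) (w : E) : pairD A v w = pairing (A w) v := rfl

@[simp]
theorem pairD_zero (v : Gen E) : pairD (0 : E →L[ℝ] Gen E) v = 0 := by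
  ext w
  simp [pairing]

/-- The covector `h(u, v, ·)`. -/
def contr (h : Alt E ℝ 3) (u v : Gen E) : Gen E := (0, covector ((h.curryLeft u.1).curryLeft v.1))

/-- The Courant bracket at the origin of sections of `V ⊕ V*` with values `u`, `v` and derivatives
`Du`, `Dv`. -/
def jetCourant (h : Alt E ℝ 3) (u : Gen E) (Du : E →L[ℝ] Gen E) (v : Gen E)
    (Dv : E →L[ℝ] Gen E) : Gen E :=
  Dv u.1 - Du v.1 + (0, pairD Du v - pairD Dv u) + contr h u v

theorem dcomm_wedge3 (H : Alt E ℝ 3) (u v : Gen E) :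
    dcomm (wedge3 H) u v = cliff (-contr H u v) := by
  rw [dcomm, wedge3_comm_comm, cliff_neg, contr, cliff]
  congr 1
  have : interior (0 : E) = 0 := by simpa using interior_smul (E := E) 0 0
  rw [this, zero_add]

/-- The obstruction to the integrability of an almost generalized complex structure with value `J`
and derivative `K`, on a pair of constant sections. -/
def jetNijenhuis (h : Alt E ℝ 3) (J : Gen E →L[ℝ] Gen E) (K : E →L[ℝ] Gen E →L[ℝ] Gen E)
    (u v : Gen E) : Gen E :=
  jetCourant h (J u) (K.flip u) (J v) (K.flip v) - jetCourant h u 0 v 0 -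
    J (jetCourant h (J u) (K.flip u) v 0 + jetCourant h u 0 (J v) (K.flip v))

/-- The part of order zero of `[S, [S, d_H]] + d_H`, for the spin action `S` of an almost
generalized complex structure with value `J` and derivative `K`. -/
def torsionOp (h : Alt E ℝ 3) (J : Gen E →L[ℝ] Gen E) (K : E →L[ℝ] Gen E →L[ℝ] Gen E) :
    Module.End ℂ (Spinor E) :=
  -∑ a, (cliff (0, covec E a) * (spin J * spin (K (vec E a)) - spin (K (vec E a)) * spin J) +
    (2 : ℂ) • (cliff (J (0, covec E a)) * spin (K (vec E a)))) -
    (spin J * (spin J * wedge3 h - wedge3 h * spin J) -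
      (spin J * wedge3 h - wedge3 h * spin J) * spin J + wedge3 h)

/-- Every summand contains one Clifford vector or `H ∧`, which are odd, and otherwise only even spin
actions. Oddness is a hypothesis of `spin_comm_spin_comm`. -/
theorem torsionOp_odd (h : Alt E ℝ 3) (J : Gen E →L[ℝ] Gen E) (K : E →L[ℝ] Gen E →L[ℝ] Gen E) :
    parity * torsionOp h J K = -(torsionOp h J K * parity) := by
  have hodd : ∀ {S A : Module.End ℂ (Spinor E)}, parity * S = S * parity →
      parity * A = -(A * parity) → parity * (S * A) = -(S * A * parity) ∧
        parity * (A * S) = -(A * S * parity) := by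
    intro S A hS hA
    constructor
    · rw [← mul_assoc, hS, mul_assoc, hA, mul_neg, mul_assoc]
    · rw [← mul_assoc, hA, neg_mul, mul_assoc, hS, mul_assoc]
  have hS := spin_mul_parity J
  have hw := parity_mul_wedge3 h
  have h1 : ∀ a, parity * (cliff (0, covec E a) * (spin J * spin (K (vec E a)) -
      spin (K (vec E a)) * spin J) + (2 : ℂ) • (cliff (J (0, covec E a)) * spin (K (vec E a)))) =
      -((cliff (0, covec E a) * (spin J * spin (K (vec E a)) - spin (K (vec E a)) * spin J) +
        (2 : ℂ) • (cliff (J (0, covec E a)) * spin (K (vec E a)))) * parity) := by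
    intro a
    have hK := spin_mul_parity (K (vec E a))
    have h2 : parity * (spin J * spin (K (vec E a)) - spin (K (vec E a)) * spin J) =
        (spin J * spin (K (vec E a)) - spin (K (vec E a)) * spin J) * parity := by
      rw [mul_sub, ← mul_assoc, hS, mul_assoc, hK, ← mul_assoc parity, hK, mul_assoc _ parity, hS]
      noncomm_ring
    rw [mul_add, (hodd h2 (parity_mul_cliff _)).2, mul_smul_comm,
      (hodd hK (parity_mul_cliff _)).2, add_mul, smul_mul_assoc, smul_neg, neg_add]
  have h3 := (hodd hS (hodd hS hw).1).1
  have h4 := (hodd hS (hodd hS hw).1).2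
  have h5 := (hodd hS (hodd hS hw).2).1
  have h6 := (hodd hS (hodd hS hw).2).2
  have h7 : parity * (spin J * (spin J * wedge3 h - wedge3 h * spin J) -
      (spin J * wedge3 h - wedge3 h * spin J) * spin J + wedge3 h) =
      -((spin J * (spin J * wedge3 h - wedge3 h * spin J) -
      (spin J * wedge3 h - wedge3 h * spin J) * spin J + wedge3 h) * parity) := by
    simp only [mul_add, mul_sub, sub_mul, add_mul, h3, h4, h5, h6, hw]
    abel
  have h8 : ∀ {A B : Module.End ℂ (Spinor E)}, parity * A = -(A * parity) →
      parity * B = -(B * parity) → parity * (-A - B) = -((-A - B) * parity) := by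
    intro A B hA hB
    rw [mul_sub, mul_neg, hA, hB]
    noncomm_ring
  refine h8 ?_ h7
  rw [Finset.mul_sum, Finset.sum_mul, Finset.sum_congr rfl fun a _ => h1 a,
    Finset.sum_neg_distrib]

theorem sum_two_mul_pairing_covec {F : Type*} [NormedAddCommGroup F] [NormedSpace ℝ F]
    (A : E →L[ℝ] F) (u : Gen E) :
    ∑ a, (2 * pairing (0, covec E a) u) • A (vec E a) = A u.1 := by
  conv_rhs => rw [← sum_coord_smul_vec u.1]
  rw [map_sum]
  refine Finset.sum_congr rfl fun a _ => ?_
  rw [pairing_zero_mk, map_smul]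
  congr 1
  ring

theorem dcomm_commutator_of_eq {J : Gen E →L[ℝ] Gen E} (hJ : IsSkew J)
    {D : Module.End ℂ (Spinor E)} {B : Gen E → Gen E → Gen E}
    (hB : ∀ u v, dcomm D u v = cliff (B u v)) (u v : Gen E) :
    dcomm (spin J * D - D * spin J) u v = cliff (J (B u v) - B (J u) v - B u (J v)) := by
  rw [dcomm_commutator hJ, hB, hB, hB, spin_mul_cliff hJ, cliff_sub, cliff_sub]

theorem contr_neg_left (h : Alt E ℝ 3) (u v : Gen E) : contr h (-u) v = -contr h u v := by
  ext w <;> simp [contr, covector_apply, ContinuousAlternatingMap.curryLeft_apply_apply]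

theorem contr_neg_right (h : Alt E ℝ 3) (u v : Gen E) : contr h u (-v) = -contr h u v := by
  ext w <;> simp [contr, covector_apply, ContinuousAlternatingMap.curryLeft_apply_apply]

theorem sum_smul_zero_covec (φ : E →L[ℝ] ℝ) :
    ∑ a, φ (vec E a) • ((0, covec E a) : Gen E) = (0, φ) := by
  conv_rhs => rw [← sum_apply_vec_smul_covec φ]
  rw [Prod.ext_iff]
  simp [Prod.fst_sum, Prod.snd_sum]

theorem dcomm_smul (c : ℝ) (D : Module.End ℂ (Spinor E)) (u v : Gen E) :
    dcomm ((c : ℂ) • D) u v = (c : ℂ) • dcomm D u v := by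
  simp only [dcomm, smul_mul_assoc, mul_smul_comm, ← smul_add, ← smul_sub]

/-- The Courant bracket is the derived bracket of `d_H`, so double commutators of the order-zero
part of `[S, [S, d_H]] + d_H` produce the Nijenhuis tensor. If that tensor vanishes, `torsionOp`
satisfies the condition on double commutators in `spin_comm_spin_comm`. -/
theorem dcomm_torsionOp (h : Alt E ℝ 3) {J : Gen E →L[ℝ] Gen E}
    {K : E →L[ℝ] Gen E →L[ℝ] Gen E} (hJ : IsSkew J) (hJ2 : ∀ u, J (J u) = -u)
    (hK : ∀ w, IsSkew (K w)) (hJK : ∀ w u, K w (J u) = -J (K w u)) (u v : Gen E) :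
    dcomm (torsionOp h J K) u v = cliff ((2 : ℝ) • jetNijenhuis h J K u v) := by
  have hc : ∀ a w, (spin J * spin (K a) - spin (K a) * spin J) * cliff w -
      cliff w * (spin J * spin (K a) - spin (K a) * spin J) =
        cliff (((2 : ℝ) • (J ∘L K a)) w) := by
    intro a w
    have h1 : (spin J * spin (K a) - spin (K a) * spin J) * cliff w -
        cliff w * (spin J * spin (K a) - spin (K a) * spin J) =
        (spin J * (spin (K a) * cliff w - cliff w * spin (K a)) -
          (spin (K a) * cliff w - cliff w * spin (K a)) * spin J) -
        (spin (K a) * (spin J * cliff w - cliff w * spin J) -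
          (spin J * cliff w - cliff w * spin J) * spin (K a)) := by noncomm_ring
    rw [h1, spin_mul_cliff (hK a), spin_mul_cliff hJ, spin_mul_cliff hJ, spin_mul_cliff (hK a),
      hJK, cliff_neg, sub_neg_eq_add, smul_apply, two_smul, cliff_add]
    rfl
  have hw := dcomm_commutator_of_eq hJ (dcomm_commutator_of_eq hJ (dcomm_wedge3 h)) u v
  have h2 : ∀ D : Module.End ℂ (Spinor E), dcomm ((2 : ℂ) • D) u v = (2 : ℂ) • dcomm D u v :=
    fun D => by simpa using dcomm_smul 2 D u v
  have h2' : ∀ x : Gen E, (2 : ℂ) • cliff x = cliff ((2 : ℝ) • x) := fun x => by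
    simp [cliff_smul]
  rw [torsionOp, dcomm_sub, dcomm_neg, dcomm_sum, dcomm_add, hw, dcomm_wedge3]
  simp only [dcomm_add, h2, dcomm_cliff_mul (hc _), dcomm_cliff_mul (spin_mul_cliff (hK _)), h2',
    ← cliff_add, ← cliff_sum, ← cliff_neg, ← cliff_sub]
  congr 1
  set φ := pairD (K.flip u) v with hφ
  set ψ := pairD ((J : Gen E →L[ℝ] Gen E) ∘L K.flip u) v with hψ
  have p1 : ∀ A : E →L[ℝ] Gen E, ∀ x : Gen E,
      ∑ a, (2 * pairing (0, covec E a) x) • A (vec E a) = A x.1 := sum_two_mul_pairing_covec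
  have e1 : ∑ a, (2 * pairing (0, covec E a) u) • ((2 : ℝ) • (J ∘L K (vec E a))) v =
      (2 : ℝ) • J (K u.1 v) := by
    simpa using p1 ((2 : ℝ) • (J ∘L K.flip v)) u
  have e2 : ∑ a, (2 * pairing (0, covec E a) v) • ((2 : ℝ) • (J ∘L K (vec E a))) u =
      (2 : ℝ) • J (K v.1 u) := by
    simpa using p1 ((2 : ℝ) • (J ∘L K.flip u)) v
  have e3 : ∑ a, (2 * pairing (((2 : ℝ) • (J ∘L K (vec E a))) u) v) • ((0, covec E a) : Gen E) =
      (4 : ℝ) • (0, ψ) := by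
    rw [← sum_smul_zero_covec, Finset.smul_sum]
    refine Finset.sum_congr rfl fun a _ => ?_
    rw [smul_smul, smul_apply, pairing_smul_left]
    congr 1
    simp only [hψ, pairD_apply, ContinuousLinearMap.comp_apply, ContinuousLinearMap.flip_apply]
    ring
  have e4 : ∀ x y : Gen E, ∑ a, (2 * pairing (J (0, covec E a)) x) • K (vec E a) y =
      -K (J x).1 y := by
    intro x y
    have := p1 (K.flip y) (J x)
    rw [ContinuousLinearMap.flip_apply] at this
    rw [← this, ← Finset.sum_neg_distrib]
    refine Finset.sum_congr rfl fun a _ => ?_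
    rw [hJ, ContinuousLinearMap.flip_apply]
    module
  have e5 : ∑ a, (2 * pairing (K (vec E a) u) v) • J (0, covec E a) = (2 : ℝ) • J (0, φ) := by
    rw [← sum_smul_zero_covec, map_sum, Finset.smul_sum]
    refine Finset.sum_congr rfl fun a _ => ?_
    rw [map_smul, smul_smul]
    rfl
  -- Skewness of `J` and `K`, together with `K J = -J K`, reduces all one-forms in the brackets to
  -- `φ` and `ψ`.
  have f1 : pairD (K.flip u) (J v) = -ψ := by
    ext w
    have := hJ (K w u) v
    simp only [hψ, pairD_apply, ContinuousLinearMap.flip_apply, neg_apply,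
      ContinuousLinearMap.comp_apply, this, neg_neg]
  have f2 : pairD (K.flip v) (J u) = ψ := by
    ext w
    have h3 := hK w v (J u)
    simp only [hψ, pairD_apply, ContinuousLinearMap.flip_apply, ContinuousLinearMap.comp_apply,
      h3, hJK]
    simp [pairing]
    ring
  have f3 : pairD (K.flip v) u = -φ := by
    ext w
    have h3 := hK w v u
    simp only [hφ, pairD_apply, ContinuousLinearMap.flip_apply, neg_apply, h3, pairing_comm]
  simp only [Finset.sum_add_distrib, Finset.sum_sub_distrib, ← Finset.smul_sum, smul_add, smul_sub]
  rw [e1, e2, e3, e4, e4, e5]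
  simp only [jetNijenhuis, jetCourant, f1, f2, f3, ← hφ, pairD_zero, map_add, map_sub, map_neg, hJ2,
    contr_neg_left, contr_neg_right, ContinuousLinearMap.flip_apply, zero_apply]
  have g1 : ((0, -ψ - ψ) : Gen E) = (-2 : ℝ) • (0, ψ) := by
    ext w <;> simp
    ring
  have g2 : ((0, φ - 0) : Gen E) = (0, φ) := by simp
  have g3 : ((0, 0 - -φ) : Gen E) = (0, φ) := by simp
  have g4 : ((0, 0 - 0) : Gen E) = 0 := by simp
  rw [g1, g2, g3, g4]
  module

/-- The twisted exterior derivative of a spinor field on `E`. -/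
def dHl (H : E → Alt E ℝ 3) (ρ : E → Spinor E) (y : E) : Spinor E :=
  dl ρ y - wedge3 (H y) (ρ y)

theorem dHl_congr {H : E → Alt E ℝ 3} {ρ σ : E → Spinor E} {y : E} (h : σ =ᶠ[nhds y] ρ) :
    dHl H σ y = dHl H ρ y := by
  simp only [dHl, dl_congr h, h.eq_of_nhds]

theorem dHl_const_smul {H : E → Alt E ℝ 3} {ρ : E → Spinor E} {y : E} (h : SmoothAt ρ y) (c : ℂ) :
    dHl H (fun z => c • ρ z) y = c • dHl H ρ y := by
  simp only [dHl, dl_const_smul h, map_smul, smul_sub]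

theorem dHl_spin {H : E → Alt E ℝ 3} {J : E → Gen E →L[ℝ] Gen E} {ρ : E → Spinor E} {y : E}
    (hρ : SmoothAt ρ y) (hJ : ContDiffAt ℝ ∞ J y) :
    dHl H (fun z => spin (J z) (ρ z)) y =
      ∑ a, (cliff (0, covec E a) (spin (fderiv ℝ J y (vec E a)) (ρ y)) +
        cliff (0, covec E a) (spin (J y) (pd ρ y (vec E a)))) -
      wedge3 (H y) (spin (J y) (ρ y)) := by
  have : interior (0 : E) = 0 := by simpa using interior_smul (E := E) 0 0
  simp only [dHl, dl, pd_spin hρ hJ, map_add, cliff, this, zero_add]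

/-- The commutators of `d_H` with the spin action of an almost generalized complex structure. -/
theorem spin_spin_dHl {H : E → Alt E ℝ 3} {J : E → Gen E →L[ℝ] Gen E} {ρ : E → Spinor E} {y : E}
    (hρ : SmoothAt ρ y) (hJ : ContDiffAt ℝ ∞ J y) (hJs : IsSkew (J y))
    (hJ2 : ∀ u, J y (J y u) = -u) :
    spin (J y) (spin (J y) (dHl H ρ y)) - (2 : ℂ) • spin (J y) (dHl H (fun z => spin (J z) (ρ z)) y) +
      dHl H (fun z => spin (J z) (spin (J z) (ρ z))) y + dHl H ρ y =
      torsionOp (H y) (J y) (fderiv ℝ J y) (ρ y) := by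
  have h0 : interior (0 : E) = 0 := by simpa using interior_smul (E := E) 0 0
  have hS : SmoothAt (fun z => spin (J z) (ρ z)) y := smoothAt_spin hρ hJ
  rw [dHl_spin hS hJ, dHl_spin hρ hJ]
  simp only [pd_spin hρ hJ]
  have e : dHl H ρ y = ∑ a, cliff (0, covec E a) (pd ρ y (vec E a)) - wedge3 (H y) (ρ y) := by
    simp only [dHl, dl, cliff, h0, zero_add]
  have hc : ∀ (w : Gen E) σ, cliff (J y w) σ = spin (J y) (cliff w σ) - cliff w (spin (J y) σ) :=
    fun w σ => by
      rw [← spin_mul_cliff hJs]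
      rfl
  have hc2 : ∀ (w : Gen E) σ, cliff w σ = -(spin (J y) (cliff (J y w) σ) -
      cliff (J y w) (spin (J y) σ)) := fun w σ => by
    rw [← hc, hJ2, cliff_neg, spinorEnd_neg_apply, neg_neg]
  -- The terms with derivatives of `ρ` cancel: the commutator with `S` acts on `e^a` by `J`, and `J²
  -- = -1`. Only an operator of order zero is left.
  have hpd : ∀ a, cliff (0, covec E a) (pd ρ y (vec E a)) =
      -(spin (J y) (spin (J y) (cliff (0, covec E a) (pd ρ y (vec E a)))) -
        (2 : ℂ) • spin (J y) (cliff (0, covec E a) (spin (J y) (pd ρ y (vec E a)))) +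
        cliff (0, covec E a) (spin (J y) (spin (J y) (pd ρ y (vec E a))))) := by
    intro a
    conv_lhs => rw [hc2, hc, hc, map_sub]
    module
  have hsum : ∑ a, cliff (0, covec E a) (pd ρ y (vec E a)) =
      -(spin (J y) (spin (J y) (∑ a, cliff (0, covec E a) (pd ρ y (vec E a)))) -
        (2 : ℂ) • spin (J y) (∑ a, cliff (0, covec E a) (spin (J y) (pd ρ y (vec E a)))) +
        ∑ a, cliff (0, covec E a) (spin (J y) (spin (J y) (pd ρ y (vec E a))))) := by
    simp only [map_sum, Finset.smul_sum, ← Finset.sum_sub_distrib, ← Finset.sum_add_distrib,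
      ← Finset.sum_neg_distrib]
    exact Finset.sum_congr rfl fun a _ => hpd a
  have ht : torsionOp (H y) (J y) (fderiv ℝ J y) (ρ y) =
      -(2 : ℂ) • ∑ a, spin (J y) (cliff (0, covec E a) (spin (fderiv ℝ J y (vec E a)) (ρ y))) +
      ∑ a, cliff (0, covec E a) (spin (fderiv ℝ J y (vec E a)) (spin (J y) (ρ y))) +
      ∑ a, cliff (0, covec E a) (spin (J y) (spin (fderiv ℝ J y (vec E a)) (ρ y))) -
      (spin (J y) (spin (J y) (wedge3 (H y) (ρ y))) -
        (2 : ℂ) • spin (J y) (wedge3 (H y) (spin (J y) (ρ y))) +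
        wedge3 (H y) (spin (J y) (spin (J y) (ρ y))) + wedge3 (H y) (ρ y)) := by
    simp only [torsionOp, spinorEnd_sub_apply, spinorEnd_neg_apply, LinearMap.add_apply,
      LinearMap.sum_apply, LinearMap.smul_apply, Module.End.mul_apply, hc, map_sub,
      Finset.sum_add_distrib, Finset.sum_sub_distrib, smul_sub, ← Finset.smul_sum]
    module
  rw [ht, e]
  simp only [map_sub, map_add, Finset.sum_add_distrib, smul_sub, smul_add, ← map_sum]
  simp only [map_sum] at hsum ⊢
  rw [← sub_eq_zero] at hsum ⊢
  refine Eq.trans ?_ hsum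
  module

/-- When the Nijenhuis tensor vanishes at `y`, `d_H` has components of degree `±1` only. -/
theorem proj_dHl_proj {H : E → Alt E ℝ 3} {J : E → Gen E →L[ℝ] Gen E} {ρ : E → Spinor E} {y : E}
    (hρ : SmoothAt ρ y) (hJ : ContDiffAt ℝ ∞ J y) (hJs : ∀ᶠ z in nhds y, IsSkew (J z))
    (hJ2 : ∀ᶠ z in nhds y, ∀ u, J z (J z u) = -u)
    (hN : ∀ u v, jetNijenhuis (H y) (J y) (fderiv ℝ J y) u v = 0) {k l : ℤ}
    (hkl : k ≠ l + 1) (hkl' : k ≠ l - 1) :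
    proj (J y) k (dHl H (fun z => proj (J z) l (ρ z)) y) = 0 := by
  have hd := hJ.differentiableAt (n := ∞) (by simp)
  have hdu : ∀ u w, fderiv ℝ (fun z => J z u) y w = fderiv ℝ J y w u := fun u w => by
    rw [fderiv_clm_apply hd (differentiableAt_const u)]
    simp
  -- The constraints on the derivative of `J` come from differentiating those on `J`, which hold in
  -- a neighbourhood of `y`.
  have hK : ∀ w, IsSkew (fderiv ℝ J y w) := by
    intro w u v
    have h1 : (fun z => pairing (J z u) v) =ᶠ[nhds y] fun z => -pairing u (J z v) :=
      hJs.mono fun z hz => hz u v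
    have h2 : ∀ u v, HasFDerivAt (fun z => pairing (J z u) v)
        (pairD ((fderiv ℝ J y).flip u) v) y := by
      intro u v
      let L : Gen E →L[ℝ] ℝ := LinearMap.toContinuousLinearMap ((pairingL E).flip v)
      have h := (L.hasFDerivAt (x := J y u)).comp y
        (hd.hasFDerivAt.clm_apply (hasFDerivAt_const u y))
      refine (show HasFDerivAt (fun z => pairing (J z u) v) _ y from h).congr_fderiv ?_
      ext w
      simp [L]
    have h3 : (fun z => pairing (J z u) v) =ᶠ[nhds y] fun z => -pairing (J z v) u :=
      h1.trans (Filter.Eventually.of_forall fun z => by simp only [pairing_comm])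
    have h4 := congrArg (fun D => D w) ((h2 u v).unique ((h2 v u).neg.congr_of_eventuallyEq h3))
    simpa [pairing_comm] using h4
  have hJK : ∀ w u, fderiv ℝ J y w (J y u) = -J y (fderiv ℝ J y w u) := by
    intro w u
    have h1 : (fun z => J z (J z u)) =ᶠ[nhds y] fun _ => -u := hJ2.mono fun z hz => hz u
    have h2 : HasFDerivAt (fun z => J z (J z u)) (0 : E →L[ℝ] Gen E) y :=
      (hasFDerivAt_const (-u) y).congr_of_eventuallyEq h1
    have h3 := hd.hasFDerivAt.clm_apply (hd.hasFDerivAt.clm_apply (hasFDerivAt_const u y))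
    have h4 := congrArg (fun D => D w) (h3.unique h2)
    simp at h4
    exact eq_neg_of_add_eq_zero_right h4
  have hJs0 := hJs.self_of_nhds
  have hJ20 := hJ2.self_of_nhds
  set T := torsionOp (H y) (J y) (fderiv ℝ J y) with hT
  have hT2 : spin (J y) * (spin (J y) * T - T * spin (J y)) -
      (spin (J y) * T - T * spin (J y)) * spin (J y) = -T := by
    refine spin_comm_spin_comm hJs0 hJ20 (torsionOp_odd _ _ _) fun u v => sub_eq_zero.1 ?_
    have := dcomm_torsionOp (H y) hJs0 hJ20 hK hJK u v
    rw [hN, smul_zero, cliff_zero] at this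
    exact this
  -- On the section of `U^l` the operator `S` is the scalar `c` near `y`, so also inside `d_H`;
  -- after projection to `U^k` it is `-k√-1`. Thus the squared commutator with `S`, plus one,
  -- becomes multiplication by `1 - (k - l)²`.
  set c : ℂ := -(l : ℂ) * Complex.I with hc
  have hσ : SmoothAt (fun z => proj (J z) l (ρ z)) y := smoothAt_proj hρ hJ l
  have hev : (fun z => spin (J z) (proj (J z) l (ρ z))) =ᶠ[nhds y]
      fun z => c • proj (J z) l (ρ z) := by
    filter_upwards [hJs, hJ2] with z h1 h2 using spin_mul_proj h1 h2 l _
  have hev2 : (fun z => spin (J z) (spin (J z) (proj (J z) l (ρ z)))) =ᶠ[nhds y]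
      fun z => (c * c) • proj (J z) l (ρ z) := by
    filter_upwards [hJs, hJ2] with z h1 h2
    rw [spin_mul_proj h1 h2, map_smul, spin_mul_proj h1 h2, smul_smul]
  have h1 := spin_spin_dHl (H := H) hσ hJ hJs0 hJ20
  rw [dHl_congr hev, dHl_congr hev2, dHl_const_smul hσ, dHl_const_smul hσ, ← hT] at h1
  have hσy : spin (J y) (proj (J y) l (ρ y)) = c • proj (J y) l (ρ y) := hev.self_of_nhds
  have h2 := congrArg (fun D : Module.End ℂ (Spinor E) => D (proj (J y) l (ρ y))) hT2
  simp only [spinorEnd_sub_apply, spinorEnd_neg_apply, Module.End.mul_apply, hσy, map_smul,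
    map_sub] at h2
  set τ := dHl H (fun z => proj (J z) l (ρ z)) y with hτ
  have hp := spin_mul_proj hJs0 hJ20 k
  have h1' := congrArg (proj (J y) k) h1
  have h2' := congrArg (proj (J y) k) h2
  simp only [map_add, map_sub, map_smul, map_neg, spin_proj_comm, hp] at h1' h2'
  have hI := Complex.I_mul_I
  have hs : 1 - ((k : ℂ) - l) ^ 2 = -(k : ℂ) * Complex.I * (-(k : ℂ) * Complex.I) -
      2 * (c * (-(k : ℂ) * Complex.I)) + c * c + 1 := by
    rw [hc]
    linear_combination (-((k : ℂ) - l) ^ 2) * hI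
  -- The first equation expresses the component of `d_H` by that of `T`, and the second annihilates
  -- the latter. The factor is nonzero unless `k - l = ±1`.
  have e1 : (1 - ((k : ℂ) - l) ^ 2) • proj (J y) k τ =
      proj (J y) k (T (proj (J y) l (ρ y))) := by
    rw [← h1', hs]
    module
  have e2 : (1 - ((k : ℂ) - l) ^ 2) • proj (J y) k (T (proj (J y) l (ρ y))) = 0 := by
    rw [hs]
    rw [← sub_eq_zero] at h2'
    refine Eq.trans ?_ h2'
    module
  have hne : (1 - ((k : ℂ) - l) ^ 2) ≠ 0 := by
    intro h
    have h3 : ((k - l) ^ 2 : ℤ) = 1 := by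
      have : ((k : ℂ) - l) ^ 2 = 1 := (sub_eq_zero.1 h).symm
      exact_mod_cast this
    rcases sq_eq_one_iff.1 h3 with h | h <;> omega
  rw [← e1, smul_smul] at e2
  exact (smul_eq_zero.1 e2).resolve_left (mul_ne_zero hne hne)

end FlatIntegrability

/-! ### `d_H² = 0` and Cartan's formula, locally -/

section LocalCartan

variable {E : Type*} [NormedAddCommGroup E] [NormedSpace ℝ E] [FiniteDimensional ℝ E]

/-- Antisymmetrization of `K`, for the identity `∑ K(e_a; e_i, e_j, e_k) e^a e^i e^j e^k = 0`. -/
theorem sum_wedge_wedge3 (K : E →L[ℝ] Alt E ℝ 3)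
    (hK : ContinuousAlternatingMap.alternatizeUncurryFin K = 0) :
    ∑ a, wedge (covec E a) * wedge3 (K (vec E a)) = 0 := by
  have h1 : ∀ w x y z : E, K w ![x, y, z] - K x ![w, y, z] + K y ![w, x, z] - K z ![w, x, y] = 0 := by
    intro w x y z
    have h := congrArg (fun θ : Alt E ℝ 4 => θ ![w, x, y, z]) hK
    simp only [ContinuousAlternatingMap.alternatizeUncurryFin_apply] at h
    replace h := (Fin.sum_univ_four _).symm.trans h
    have r0 : Fin.removeNth 0 ![w, x, y, z] = ![x, y, z] := by
      funext i; fin_cases i <;> rfl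
    have r1 : Fin.removeNth 1 ![w, x, y, z] = ![w, y, z] := by
      funext i; fin_cases i <;> rfl
    have r2 : Fin.removeNth 2 ![w, x, y, z] = ![w, x, z] := by
      funext i; fin_cases i <;> rfl
    have r3 : Fin.removeNth 3 ![w, x, y, z] = ![w, x, y] := by
      funext i; fin_cases i <;> rfl
    rw [r0, r1, r2, r3] at h
    simp at h
    linarith
  set e : Fin (Module.finrank ℝ E) → Module.End ℂ (Spinor E) := fun a => wedge (covec E a) with he
  set F : Fin (Module.finrank ℝ E) → Fin (Module.finrank ℝ E) → Fin (Module.finrank ℝ E) →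
    Fin (Module.finrank ℝ E) → ℂ :=
    fun a i j k => ((K (vec E a) ![vec E i, vec E j, vec E k] : ℝ) : ℂ) with hF
  have hF0 : ∀ a i j k, F a i j k = F i a j k - F j a i k + F k a i j := by
    intro a i j k
    have := h1 (vec E a) (vec E i) (vec E j) (vec E k)
    simp only [hF]
    exact_mod_cast (by linarith : K (vec E a) ![vec E i, vec E j, vec E k] =
      K (vec E i) ![vec E a, vec E j, vec E k] - K (vec E j) ![vec E a, vec E i, vec E k] +
      K (vec E k) ![vec E a, vec E i, vec E j])
  have hee : ∀ a b, e a * e b = -(e b * e a) := fun a b =>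
    eq_neg_of_add_eq_zero_left (wedge_mul_wedge (covec E a) (covec E b))
  set W := ∑ a, ∑ i, ∑ j, ∑ k, F a i j k • (e a * (e i * (e j * e k))) with hW
  -- Each sum becomes `±W` once the covectors are reordered by a cyclic permutation, with its sign.
  -- The closedness relation `hF0` then reads `W = -3 W`.
  have g1 : ∑ a, ∑ i, ∑ j, ∑ k, F i a j k • (e a * (e i * (e j * e k))) = -W := by
    rw [Finset.sum_comm, hW]
    simp only [← Finset.sum_neg_distrib]
    refine Finset.sum_congr rfl fun a _ => Finset.sum_congr rfl fun i _ =>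
      Finset.sum_congr rfl fun j _ => Finset.sum_congr rfl fun k _ => ?_
    rw [← mul_assoc (e i), hee i a, neg_mul, smul_neg, mul_assoc]
  have g2 : ∑ a, ∑ i, ∑ j, ∑ k, F j a i k • (e a * (e i * (e j * e k))) = W := by
    have : ∑ a, ∑ i, ∑ j, ∑ k, F j a i k • (e a * (e i * (e j * e k))) =
        ∑ j, ∑ a, ∑ i, ∑ k, F j a i k • (e a * (e i * (e j * e k))) := by
      rw [Finset.sum_comm]
      conv_rhs => rw [Finset.sum_comm]
      conv_lhs => rw [Finset.sum_comm]
      exact Finset.sum_congr rfl fun a _ => Finset.sum_comm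
    rw [this, hW]
    refine Finset.sum_congr rfl fun a _ => Finset.sum_congr rfl fun i _ =>
      Finset.sum_congr rfl fun j _ => Finset.sum_congr rfl fun k _ => ?_
    rw [← mul_assoc (e j) (e a), hee j a, neg_mul, mul_neg, ← mul_assoc, ← mul_assoc (e i), 
      hee i a]
    noncomm_ring
  have g3 : ∑ a, ∑ i, ∑ j, ∑ k, F k a i j • (e a * (e i * (e j * e k))) = -W := by
    have : ∑ a, ∑ i, ∑ j, ∑ k, F k a i j • (e a * (e i * (e j * e k))) =
        ∑ k, ∑ a, ∑ i, ∑ j, F k a i j • (e a * (e i * (e j * e k))) := by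
      conv_rhs => rw [Finset.sum_comm]
      refine Finset.sum_congr rfl fun a _ => ?_
      conv_rhs => rw [Finset.sum_comm]
      exact Finset.sum_congr rfl fun i _ => Finset.sum_comm
    rw [this, hW]
    simp only [← Finset.sum_neg_distrib]
    refine Finset.sum_congr rfl fun a _ => Finset.sum_congr rfl fun i _ =>
      Finset.sum_congr rfl fun j _ => Finset.sum_congr rfl fun k _ => ?_
    rw [hee k a, mul_neg, mul_neg, ← mul_assoc (e j), hee j a, neg_mul, mul_neg, neg_neg,
      ← mul_assoc (e i), ← mul_assoc (e i), hee i a, ← smul_neg]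
    noncomm_ring
  have h4 : W = -W - W + -W := by
    conv_lhs => rw [hW]
    conv_lhs =>
      enter [2, a, 2, i, 2, j, 2, k]
      rw [hF0, add_smul, sub_smul]
    simp only [Finset.sum_add_distrib, Finset.sum_sub_distrib, g1, g2, g3]
  have h5 : W = 0 := by
    have : (4 : ℂ) • W = 0 := by
      have h6 : (4 : ℂ) • W = W - (-W - W + -W) := by module
      rw [h6, ← h4, sub_self]
    exact (smul_eq_zero.1 this).resolve_left (by norm_num)
  have h7 : ∑ a, wedge (covec E a) * wedge3 (K (vec E a)) = (1 / 6 : ℂ) • W := by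
    simp only [wedge3_eq, mul_smul_comm, Finset.mul_sum, hW, Finset.smul_sum]
    rfl
  rw [h7, h5, smul_zero]

/-- Exterior product with a three-form is odd, so it anticommutes with itself. -/
theorem wedge3_mul_wedge3 (H : Alt E ℝ 3) : wedge3 H * wedge3 H = 0 := by
  have h : ∀ ξ : E →L[ℝ] ℝ, wedge ξ * wedge3 H = -(wedge3 H * wedge ξ) := fun ξ => by
    rw [eq_neg_iff_add_eq_zero]
    exact wedge_mul_wedge3 H ξ
  have h3 : ∀ i j k, wedge (covec E i) * (wedge (covec E j) * wedge (covec E k)) * wedge3 H =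
      -(wedge3 H * (wedge (covec E i) * (wedge (covec E j) * wedge (covec E k)))) := by
    intro i j k
    rw [mul_assoc, mul_assoc, h, mul_neg, mul_neg, ← mul_assoc (wedge (covec E j)), h, neg_mul,
      mul_neg, neg_neg, ← mul_assoc (wedge (covec E i)), ← mul_assoc (wedge (covec E i)), h]
    noncomm_ring
  have h4 : wedge3 H * wedge3 H = -(wedge3 H * wedge3 H) := by
    conv_lhs => lhs; rw [wedge3_eq]
    simp only [smul_mul_assoc, Finset.sum_mul, h3]
    conv_rhs => rhs; rhs; rw [wedge3_eq]
    simp only [mul_smul_comm, Finset.mul_sum, smul_neg, Finset.sum_neg_distrib]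
  have h5 : (2 : ℂ) • (wedge3 H * wedge3 H) = 0 := by
    rw [two_smul]
    nth_rewrite 1 [h4]
    simp
  exact (smul_eq_zero.1 h5).resolve_left (by norm_num)

theorem smoothAt_dHl {H : E → Alt E ℝ 3} {ρ : E → Spinor E} {y : E} (h : SmoothAt ρ y)
    (hH : ContDiffAt ℝ ∞ H y) : SmoothAt (dHl H ρ) y :=
  (smoothAt_dl h).sub (smoothAt_wedge3 h hH)

theorem dHl_add {H : E → Alt E ℝ 3} {ρ σ : E → Spinor E} {y : E} (h : SmoothAt ρ y)
    (hσ : SmoothAt σ y) : dHl H (fun z => ρ z + σ z) y = dHl H ρ y + dHl H σ y := by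
  simp only [dHl, dl_add h hσ, map_add]
  abel

theorem dl_sub {ρ σ : E → Spinor E} {y : E} (h : SmoothAt ρ y) (hσ : SmoothAt σ y) :
    dl (fun z => ρ z - σ z) y = dl ρ y - dl σ y := by
  have h1 := dl_add (h.sub hσ) hσ
  simp only [sub_add_cancel] at h1
  exact eq_sub_of_add_eq h1.symm

/-- The cross terms `d(H ∧ ρ) + H ∧ dρ` reduce to `dH ∧ ρ`, which vanishes for closed `H`. -/
theorem dHl_dHl {H : E → Alt E ℝ 3} {ρ : E → Spinor E} {y : E} (h : SmoothAt ρ y)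
    (hH : ContDiffAt ℝ ∞ H y) (hdH : extDeriv H y = 0) : dHl H (dHl H ρ) y = 0 := by
  have h1 : dl (dHl H ρ) y = -dl (fun z => wedge3 (H z) (ρ z)) y := by
    have := dl_sub (smoothAt_dl h) (smoothAt_wedge3 h hH)
    rw [dl_dl h, zero_sub] at this
    exact this
  have h2 : ∀ ξ : E →L[ℝ] ℝ, ∀ σ, wedge ξ (wedge3 (H y) σ) = -wedge3 (H y) (wedge ξ σ) := by
    intro ξ σ
    rw [eq_neg_iff_add_eq_zero]
    exact congrArg (fun D : Module.End ℂ (Spinor E) => D σ) (wedge_mul_wedge3 (H y) ξ)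
  have h3 := congrArg (fun D : Module.End ℂ (Spinor E) => D (ρ y))
    (sum_wedge_wedge3 (fderiv ℝ H y) hdH)
  have h4 := congrArg (fun D : Module.End ℂ (Spinor E) => D (ρ y)) (wedge3_mul_wedge3 (H y))
  simp only [LinearMap.sum_apply, Module.End.mul_apply, LinearMap.zero_apply] at h3 h4
  have h5 : dl (fun z => wedge3 (H z) (ρ z)) y = -wedge3 (H y) (dl ρ y) := by
    simp only [dl, pd_wedge3 h hH, map_add, Finset.sum_add_distrib, h3, h2, map_sum,
      Finset.sum_neg_distrib, zero_add]
  rw [dHl, h1, h5, dHl, map_sub, h4]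
  abel

/-- The Lie derivative of a spinor field along a vector field `X`. -/
def lieD (X : E → E) (ρ : E → Spinor E) (y : E) : Spinor E :=
  pd ρ y (X y) + ∑ a, wedge (covec E a) (interior (fderiv ℝ X y (vec E a)) (ρ y))

theorem pd_eq_sum (ρ : E → Spinor E) (y X : E) :
    pd ρ y X = ∑ a, ((covec E a X : ℝ) : ℂ) • pd ρ y (vec E a) := by
  funext k
  conv_lhs => rw [pd, ← sum_coord_smul_vec X, map_sum]
  rw [Finset.sum_apply]
  refine Finset.sum_congr rfl fun a _ => ?_
  rw [map_smul, Pi.smul_apply, Complex.coe_smul]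
  rfl

variable (E) in
/-- `oneForm` as a continuous linear map. -/
def oneFormC : (E →L[ℝ] ℝ) →L[ℝ] Alt E ℝ 1 :=
  (ContinuousAlternatingMap.ofSubsingletonLIE (𝕜 := ℝ) (E := E) (F := ℝ)
    (0 : Fin 1)).toContinuousLinearEquiv

theorem extDeriv_oneForm {ζ : E → E →L[ℝ] ℝ} {y : E} (hζ : DifferentiableAt ℝ ζ y) (X Y : E) :
    extDeriv (fun z => oneForm (ζ z)) y ![X, Y] = fderiv ℝ ζ y X Y - fderiv ℝ ζ y Y X := by
  have h1 : HasFDerivAt (fun z => oneForm (ζ z)) (oneFormC E ∘L fderiv ℝ ζ y) y :=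
    (oneFormC E).hasFDerivAt.comp y hζ.hasFDerivAt
  rw [extDeriv, h1.fderiv, ContinuousAlternatingMap.alternatizeUncurryFin_apply]
  refine (Fin.sum_univ_two _).trans ?_
  have r0 : Fin.removeNth 0 ![X, Y] = ![Y] := by
    funext i; fin_cases i; rfl
  have r1 : Fin.removeNth 1 ![X, Y] = ![X] := by
    funext i; fin_cases i; rfl
  rw [r0, r1]
  have hL : ∀ (ξ : E →L[ℝ] ℝ) Z, oneFormC E ξ ![Z] = ξ Z := fun ξ Z => rfl
  simp [hL]
  ring

theorem sum_wedge_wedge_fderiv {ζ : E → E →L[ℝ] ℝ} {y : E} (hζ : DifferentiableAt ℝ ζ y) :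
    ∑ a, wedge (covec E a) * wedge (fderiv ℝ ζ y (vec E a)) =
      wedge2 (extDeriv (fun z => oneForm (ζ z)) y) := by
  have hd := extDeriv_oneForm hζ
  have hs : ∀ a, wedge (fderiv ℝ ζ y (vec E a)) =
      ∑ j, ((fderiv ℝ ζ y (vec E a) (vec E j) : ℝ) : ℂ) • wedge (covec E j) := fun a =>
    (sum_smul_wedge_covec _).symm
  set c : Fin (Module.finrank ℝ E) → Fin (Module.finrank ℝ E) → ℂ :=
    fun a j => ((fderiv ℝ ζ y (vec E a) (vec E j) : ℝ) : ℂ) with hc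
  have h1 : ∑ a, wedge (covec E a) * wedge (fderiv ℝ ζ y (vec E a)) =
      ∑ a, ∑ j, c a j • (wedge (covec E a) * wedge (covec E j)) := by
    simp only [hs, Finset.mul_sum, mul_smul_comm, hc]
  have h2 : ∑ a, ∑ j, c j a • (wedge (covec E a) * wedge (covec E j)) =
      -∑ a, ∑ j, c a j • (wedge (covec E a) * wedge (covec E j)) := by
    rw [Finset.sum_comm]
    simp only [← Finset.sum_neg_distrib]
    refine Finset.sum_congr rfl fun a _ => Finset.sum_congr rfl fun j _ => ?_
    rw [eq_neg_of_add_eq_zero_left (wedge_mul_wedge (covec E j) (covec E a)), smul_neg]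
  rw [wedge2, h1]
  simp only [hd, Complex.ofReal_sub, sub_smul, Finset.sum_sub_distrib]
  change _ = (1 / 2 : ℂ) • (∑ a, ∑ j, c a j • (wedge (covec E a) * wedge (covec E j)) -
    ∑ a, ∑ j, c j a • (wedge (covec E a) * wedge (covec E j)))
  rw [h2]
  module

/-- Cartan's formula for the twisted exterior derivative. -/
theorem dHl_cliff_add {H : E → Alt E ℝ 3} {ρ : E → Spinor E} {u : E → Gen E} {y : E}
    (h : SmoothAt ρ y) (hu : ContDiffAt ℝ ∞ u y)
    (hd : (H y).curryLeft (u y).1 = extDeriv (fun z => oneForm (u z).2) y) :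
    dHl H (fun z => cliff (u z) (ρ z)) y + cliff (u y) (dHl H ρ y) =
      lieD (fun z => (u z).1) ρ y := by
  have hud := hu.differentiableAt (n := ∞) (by simp)
  have e1 : ∀ v, fderiv ℝ (fun z => (u z).1) y v = (fderiv ℝ u y v).1 := fun v => by
    rw [fderiv.fst hud]
    rfl
  have e2 : ∀ v, fderiv ℝ (fun z => (u z).2) y v = (fderiv ℝ u y v).2 := fun v => by
    rw [fderiv.snd hud]
    rfl
  have h1 := congrArg (fun D : Module.End ℂ (Spinor E) => D (ρ y))
    (sum_wedge_wedge_fderiv (ζ := fun z => (u z).2) hud.snd)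
  have h2 : wedge3 (H y) (cliff (u y) (ρ y)) + cliff (u y) (wedge3 (H y) (ρ y)) =
      wedge2 ((H y).curryLeft (u y).1) (ρ y) := by
    have e : wedge3 (H y) * cliff (u y) + cliff (u y) * wedge3 (H y) =
        wedge2 ((H y).curryLeft (u y).1) := by
      rw [← interior_mul_wedge3, cliff, mul_add, add_mul]
      have := wedge_mul_wedge3 (H y) (u y).2
      rw [← add_zero (interior (u y).1 * wedge3 (H y) + wedge3 (H y) * interior (u y).1), ← this]
      abel
    exact congrArg (fun D : Module.End ℂ (Spinor E) => D (ρ y)) e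
  have h3 : ∀ a σ, wedge (covec E a) (cliff (u y) σ) =
      ((covec E a (u y).1 : ℝ) : ℂ) • σ - cliff (u y) (wedge (covec E a) σ) := by
    intro a σ
    have h0 : interior (0 : E) = 0 := by simpa using interior_smul (E := E) 0 0
    have := congrArg (fun D : Module.End ℂ (Spinor E) => D σ) (cliff_mul_cliff (0, covec E a) (u y))
    have e : (2 * pairing ((0, covec E a) : Gen E) (u y)) = covec E a (u y).1 := by
      rw [pairing_zero_mk]
      ring
    rw [e] at this
    exact eq_sub_of_add_eq (by simpa [cliff, h0] using this)
  simp only [LinearMap.sum_apply, Module.End.mul_apply, e2] at h1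
  rw [← hd, ← h2] at h1
  -- Moving `e^a` past `u` produces the directional derivative along the vector part. The
  -- derivatives of the covector part `η` add up to `dη ∧ ρ`; by hypothesis this is the
  -- anticommutator of `H ∧` with `u`, so the twist cancels.
  have h4 : dl (fun z => cliff (u z) (ρ z)) y =
      ∑ a, wedge (covec E a) (interior (fderiv ℝ u y (vec E a)).1 (ρ y)) +
      (wedge3 (H y) (cliff (u y) (ρ y)) + cliff (u y) (wedge3 (H y) (ρ y))) +
      (pd ρ y (u y).1 - cliff (u y) (dl ρ y)) := by
    rw [pd_eq_sum, ← h1, dl, dl, map_sum, ← Finset.sum_sub_distrib, ← Finset.sum_add_distrib,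
      ← Finset.sum_add_distrib]
    refine Finset.sum_congr rfl fun a _ => ?_
    rw [pd_cliff h hu, map_add, h3 a (pd ρ y (vec E a)), cliff, LinearMap.add_apply, map_add]
  rw [dHl, h4, dHl, lieD, map_sub]
  simp only [e1]
  abel

/-- The Lie derivative is the derivative of the pullback along a flow. -/
theorem hasDerivAt_comp_pullback {X : E → E} {ρ : E → Spinor E} {y : E} (h : SmoothAt ρ y)
    {c : ℝ → E} {A : ℝ → E →L[ℝ] E} (hc : HasDerivAt c (X y) 0) (hc0 : c 0 = y)
    (hA : HasDerivAt A (fderiv ℝ X y) 0) (hA0 : A 0 = ContinuousLinearMap.id ℝ E) (k : ℕ) :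
    HasDerivAt (fun t => (ρ (c t) k).compContinuousLinearMap (A t)) (lieD X ρ y k) 0 := by
  have h1 : HasFDerivAt (fun t => ρ (c t) k) _ (0 : ℝ) :=
    HasFDerivAt.comp (g := fun z => ρ z k) (0 : ℝ)
      (by rw [hc0]; exact (h.differentiableAt k).hasFDerivAt) hc.hasFDerivAt
  have h2 := (h1.continuousAlternatingMapCompContinuousLinearMap hA.hasFDerivAt).hasDerivAt
  refine h2.congr_deriv ?_
  rw [hA0, hc0]
  -- At the identity, the derivative of `A ↦ A^* ρ` in the direction `DX` is `∑ e^a ∧ ι_{DX(e_a)}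
  -- ρ`.
  have h3 : ∀ k, (ρ y k).fderivCompContinuousLinearMap (ContinuousLinearMap.id ℝ E)
      (fderiv ℝ X y) =
      (∑ a, wedge (covec E a) (interior (fderiv ℝ X y (vec E a)) (ρ y))) k := by
    intro k
    cases k with
    | zero =>
      simp [ContinuousAlternatingMap.fderivCompContinuousLinearMap_of_isEmpty]
    | succ k =>
      have e : (ρ y (k + 1)).curryLeft ∘L fderiv ℝ X y =
          ∑ a, (covec E a).smulRight ((ρ y (k + 1)).curryLeft (fderiv ℝ X y (vec E a))) := by
        ext1 Z
        conv_lhs => rw [← sum_coord_smul_vec Z]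
        simp
      rw [ContinuousAlternatingMap.fderivCompContinuousLinearMap_eq_alternatizeUncurryFin,
        Finset.sum_apply]
      have e2 := map_sum (ContinuousAlternatingMap.alternatizeUncurryFinCLM ℝ E ℂ)
        (fun a => (covec E a).smulRight ((ρ y (k + 1)).curryLeft (fderiv ℝ X y (vec E a))))
        Finset.univ
      rw [← e] at e2
      refine Eq.trans ?_ e2
      simp only [ContinuousLinearMap.comp_apply]
      congr 1
  have h4 := h3 k
  simp only [lieD, Pi.add_apply, ← h4]
  ext v
  simp [pd]

end LocalCartan

/-! ### Differential forms in charts -/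

section Charts

variable {E : Type*} [NormedAddCommGroup E] [NormedSpace ℝ E]
  {M : Type*} [TopologicalSpace M] [ChartedSpace E M]
  {E' : Type*} [NormedAddCommGroup E'] [NormedSpace ℝ E']
  {N : Type*} [TopologicalSpace N] [ChartedSpace E' N]
  {E'' : Type*} [NormedAddCommGroup E''] [NormedSpace ℝ E'']
  {P : Type*} [TopologicalSpace P] [ChartedSpace E'' P]
  {F : Type*} [NormedAddCommGroup F] [NormedSpace ℝ F]

variable (E) in
/-- The preferred chart at `x`, as a map to `E`. -/
abbrev ch (x : M) : PartialEquiv M E := extChartAt 𝓘(ℝ, E) x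

variable (E) in
/-- The tangent map of the chart at `x₀`. -/
abbrev fwd (x₀ : M) (x : M) : E →L[ℝ] E := tmap (E' := E) (ch E x₀) x

variable (E) in
/-- The tangent map of the inverse of the chart at `x₀`. -/
abbrev bwd (x₀ : M) (y : E) : E →L[ℝ] E := tmap (E' := E) (ch E x₀).symm y

theorem tmap_comp {g : N → P} {f : M → N} {x : M}
    (hg : MDifferentiableAt 𝓘(ℝ, E') 𝓘(ℝ, E'') g (f x))
    (hf : MDifferentiableAt 𝓘(ℝ, E) 𝓘(ℝ, E') f x) :
    tmap (E := E) (E' := E'') (fun z => g (f z)) x =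
      (tmap (E := E') (E' := E'') g (f x)) ∘L (tmap (E := E) (E' := E') f x) :=
  mfderiv_comp x hg hf

theorem tmap_id (x : M) : tmap (E := E) (E' := E) (fun z : M => z) x = ContinuousLinearMap.id ℝ E :=
  mfderiv_id

theorem tmap_eq_fderiv (f : E → E') (y : E) : tmap (E := E) (E' := E') f y = fderiv ℝ f y :=
  mfderiv_eq_fderiv

theorem tmap_congr {f g : M → N} {x : M} (h : f =ᶠ[nhds x] g) :
    tmap (E := E) (E' := E') f x = tmap (E := E) (E' := E') g x := h.mfderiv_eq

theorem ch_target_mem {x₀ : M} {y : E} (hy : y ∈ (ch E x₀).target) :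
    (ch E x₀).target ∈ nhds y := (isOpen_extChartAt_target x₀).mem_nhds hy

theorem mem_ch_source (x : M) : x ∈ (ch E x).source := mem_extChartAt_source x

theorem mem_ch_target (x : M) : ch E x x ∈ (ch E x).target := mem_extChartAt_target x

theorem ch_symm_self (x : M) : (ch E x).symm (ch E x x) = x := extChartAt_to_inv x

variable [IsManifold 𝓘(ℝ, E) ∞ M] [IsManifold 𝓘(ℝ, E') ∞ N]

theorem contMDiffAt_ch {x₀ x : M} (hx : x ∈ (ch E x₀).source) :
    ContMDiffAt 𝓘(ℝ, E) 𝓘(ℝ, E) ∞ (ch E x₀) x :=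
  contMDiffAt_extChartAt' (by rwa [extChartAt_source] at hx)

theorem contMDiffAt_ch_symm {x₀ : M} {y : E} (hy : y ∈ (ch E x₀).target) :
    ContMDiffAt 𝓘(ℝ, E) 𝓘(ℝ, E) ∞ (ch E x₀).symm y :=
  ((contMDiffOn_extChartAt_symm x₀) y hy).contMDiffAt (ch_target_mem hy)

theorem fwd_comp_bwd {x₀ : M} {y : E} (hy : y ∈ (ch E x₀).target) :
    fwd E x₀ ((ch E x₀).symm y) ∘L bwd E x₀ y = ContinuousLinearMap.id ℝ E := by
  rw [← tmap_comp ((contMDiffAt_ch ((ch E x₀).map_target hy)).mdifferentiableAt (by simp))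
    ((contMDiffAt_ch_symm hy).mdifferentiableAt (by simp)), ← tmap_id (M := E)]
  exact tmap_congr (Filter.eventually_of_mem (ch_target_mem hy) fun z hz => (ch E x₀).right_inv hz)

theorem bwd_comp_fwd {x₀ : M} {y : E} (hy : y ∈ (ch E x₀).target) :
    bwd E x₀ y ∘L fwd E x₀ ((ch E x₀).symm y) = ContinuousLinearMap.id ℝ E := by
  have hx := (ch E x₀).map_target hy
  have h1 := (contMDiffAt_ch_symm hy).mdifferentiableAt (by simp)
  rw [← (ch E x₀).right_inv hy] at h1
  have h2 := tmap_comp h1 ((contMDiffAt_ch hx).mdifferentiableAt (by simp))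
  rw [(ch E x₀).right_inv hy] at h2
  rw [← h2, ← tmap_id ((ch E x₀).symm y)]
  exact tmap_congr (Filter.eventually_of_mem ((isOpen_extChartAt_source x₀).mem_nhds hx)
    fun z hz => (ch E x₀).left_inv hz)

theorem fwd_comp_bwd' {x₀ x : M} (hx : x ∈ (ch E x₀).source) :
    fwd E x₀ x ∘L bwd E x₀ (ch E x₀ x) = ContinuousLinearMap.id ℝ E := by
  have := fwd_comp_bwd ((ch E x₀).map_source hx)
  rwa [(ch E x₀).left_inv hx] at this

theorem bwd_comp_fwd' {x₀ x : M} (hx : x ∈ (ch E x₀).source) :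
    bwd E x₀ (ch E x₀ x) ∘L fwd E x₀ x = ContinuousLinearMap.id ℝ E := by
  have := bwd_comp_fwd ((ch E x₀).map_source hx)
  rwa [(ch E x₀).left_inv hx] at this

/-- The tangent space at `x` is identified with `E` by the preferred chart at `x`, whose derivative
at its centre is therefore the identity. Pointwise identities on `M` are accordingly checked at `x`
in the chart at `x`. -/
theorem fwd_self (x : M) : fwd E x x = ContinuousLinearMap.id ℝ E := mfderiv_extChartAt_self

theorem bwd_self (x : M) : bwd E x (ch E x x) = ContinuousLinearMap.id ℝ E := by
  have := fwd_comp_bwd' (mem_ch_source (E := E) x)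
  rwa [fwd_self, ContinuousLinearMap.id_comp] at this

/-- The expression in charts of a map. -/
def inCh (f : M → N) (x₀ : M) (x₁ : N) (y : E) : E' := ch E' x₁ (f ((ch E x₀).symm y))

theorem contDiffAt_inCh {f : M → N} {x₀ : M} {x₁ : N} {y : E} (hy : y ∈ (ch E x₀).target)
    (hf : ContMDiffAt 𝓘(ℝ, E) 𝓘(ℝ, E') ∞ f ((ch E x₀).symm y))
    (hs : f ((ch E x₀).symm y) ∈ (ch E' x₁).source) :
    ContDiffAt ℝ ∞ (inCh (E := E) (E' := E') f x₀ x₁) y := by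
  rw [← contMDiffAt_iff_contDiffAt]
  exact (contMDiffAt_ch hs).comp y (hf.comp y (contMDiffAt_ch_symm hy))

theorem fderiv_inCh {f : M → N} {x₀ : M} {x₁ : N} {y : E} (hy : y ∈ (ch E x₀).target)
    (hf : MDifferentiableAt 𝓘(ℝ, E) 𝓘(ℝ, E') f ((ch E x₀).symm y))
    (hs : f ((ch E x₀).symm y) ∈ (ch E' x₁).source) :
    fderiv ℝ (inCh (E := E) (E' := E') f x₀ x₁) y =
      fwd E' x₁ (f ((ch E x₀).symm y)) ∘L tmap (E := E) (E' := E') f ((ch E x₀).symm y) ∘L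
        bwd E x₀ y := by
  have h1 := (contMDiffAt_ch_symm hy).mdifferentiableAt (n := ∞) (by simp)
  rw [← tmap_comp hf h1, ← tmap_comp (f := fun z => f ((ch E x₀).symm z))
    ((contMDiffAt_ch hs).mdifferentiableAt (by simp)) (hf.comp y h1), ← tmap_eq_fderiv]
  rfl

/-- Pullback of a `k`-form by a map. -/
def pullForm {k : ℕ} (f : M → N) (θ : N → Alt E' F k) (x : M) : Alt E F k :=
  (θ (f x)).compContinuousLinearMap (tmap (E := E) (E' := E') f x)

theorem chartRep_pullForm {k : ℕ} {f : M → N} (θ : N → Alt E' F k) {x₀ : M} {x₁ : N} {y : E}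
    (hy : y ∈ (ch E x₀).target)
    (hf : MDifferentiableAt 𝓘(ℝ, E) 𝓘(ℝ, E') f ((ch E x₀).symm y))
    (hs : f ((ch E x₀).symm y) ∈ (ch E' x₁).source) :
    chartRep (pullForm (E := E) f θ) x₀ y =
      (chartRep θ x₁ (inCh f x₀ x₁ y)).compContinuousLinearMap (fderiv ℝ (inCh f x₀ x₁) y) := by
  rw [fderiv_inCh hy hf hs]
  have h1 : (ch E' x₁).symm (inCh f x₀ x₁ y) = f ((ch E x₀).symm y) := (ch E' x₁).left_inv hs
  have h2 := bwd_comp_fwd' hs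
  ext v
  simp only [chartRep, pullForm, ContinuousAlternatingMap.compContinuousLinearMap_apply]
  rw [h1]
  congr 1
  funext i
  exact (congrArg (fun A : E' →L[ℝ] E' => A (tmap (E := E) (E' := E') f ((ch E x₀).symm y)
    (bwd E x₀ y (v i)))) h2).symm

theorem eventually_inCh {f : M → N} {x₀ : M} {x₁ : N} {y : E} (hy : y ∈ (ch E x₀).target)
    (hf : ContinuousAt f ((ch E x₀).symm y))
    (hs : f ((ch E x₀).symm y) ∈ (ch E' x₁).source) :
    ∀ᶠ z in nhds y, z ∈ (ch E x₀).target ∧ f ((ch E x₀).symm z) ∈ (ch E' x₁).source := by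
  refine (Filter.eventually_of_mem (ch_target_mem hy) fun z hz => hz).and ?_
  have h1 : ContinuousAt (fun z => f ((ch E x₀).symm z)) y :=
    ContinuousAt.comp (f := (ch E x₀).symm) (g := f) hf (contMDiffAt_ch_symm hy).continuousAt
  exact h1.eventually_mem ((isOpen_extChartAt_source x₁).mem_nhds hs)

/-- The exterior derivative in charts commutes with the pullback by smooth maps. -/
theorem extDeriv_chartRep_pullForm {k : ℕ} {f : M → N} {θ : N → Alt E' F k} {x₀ : M} {x₁ : N}
    {y : E} (hy : y ∈ (ch E x₀).target) (hf : ContMDiff 𝓘(ℝ, E) 𝓘(ℝ, E') ∞ f)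
    (hs : f ((ch E x₀).symm y) ∈ (ch E' x₁).source) (hθ : IsSmooth θ) :
    extDeriv (chartRep (pullForm (E := E) f θ) x₀) y =
      (extDeriv (chartRep θ x₁) (inCh f x₀ x₁ y)).compContinuousLinearMap
        (fderiv ℝ (inCh f x₀ x₁) y) := by
  have h1 : chartRep (pullForm (E := E) f θ) x₀ =ᶠ[nhds y] fun z =>
      (chartRep θ x₁ (inCh f x₀ x₁ z)).compContinuousLinearMap (fderiv ℝ (inCh f x₀ x₁) z) := by
    filter_upwards [eventually_inCh hy hf.continuous.continuousAt hs] with z hz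
    exact chartRep_pullForm θ hz.1 (hf.mdifferentiable (by simp) _) hz.2
  have h2 : inCh f x₀ x₁ y ∈ (ch E' x₁).target := (ch E' x₁).map_source hs
  rw [h1.extDeriv_eq]
  refine extDeriv_pullback ?_ (contDiffAt_inCh hy hf.contMDiffAt hs) (by
    rw [minSmoothness_of_isRCLikeNormedField]
    exact WithTop.coe_le_coe.2 le_top)
  exact ((hθ x₁).contDiffAt (ch_target_mem h2)).differentiableAt (by simp)

theorem pullForm_id {k : ℕ} (θ : M → Alt E F k) : pullForm (E := E) (fun z => z) θ = θ := by
  funext x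
  rw [pullForm, tmap_id]
  ext v
  rfl

theorem chartRep_self {k : ℕ} (θ : M → Alt E F k) (x : M) : chartRep θ x (ch E x x) = θ x := by
  have h := bwd_self (E := E) x
  change (θ ((ch E x).symm (ch E x x))).compContinuousLinearMap (bwd E x (ch E x x)) = θ x
  rw [h, ch_symm_self]
  rfl

theorem extD_eq {k : ℕ} (θ : M → Alt E F k) (x : M) :
    extD θ x = extDeriv (chartRep θ x) (ch E x x) := by
  have h := fwd_self (E := E) x
  change (extDeriv (chartRep θ x) (ch E x x)).compContinuousLinearMap (fwd E x x) = _
  rw [h]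
  rfl

/-- The exterior derivative in charts. -/
theorem chartRep_extD {k : ℕ} {θ : M → Alt E F k} (hθ : IsSmooth θ) {x₀ : M} {y : E}
    (hy : y ∈ (ch E x₀).target) :
    chartRep (extD θ) x₀ y = extDeriv (chartRep θ x₀) y := by
  set x := (ch E x₀).symm y with hx
  -- The identity of `M`, read from the chart at `x₀` to the chart at `x`, is the transition map;
  -- naturality under pullback becomes independence of the chart.
  have h1 := extDeriv_chartRep_pullForm (F := F) (x₁ := x) hy contMDiff_id
    (mem_ch_source (E := E) x) hθ
  have h2 : chartRep (pullForm (E := E) id θ) x₀ = chartRep θ x₀ := by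
    rw [show (id : M → M) = fun z => z from rfl, pullForm_id]
  rw [h2, fderiv_inCh hy (mdifferentiable_id _) (mem_ch_source (E := E) x)] at h1
  rw [h1]
  have h3 : inCh (E := E) (E' := E) id x₀ x y = ch E x x := rfl
  rw [h3, ← extD_eq, chartRep, ← hx]
  have h4 : tmap (E := E) (E' := E) (id : M → M) x = ContinuousLinearMap.id ℝ E := tmap_id x
  have h5 : fwd E x (id x) = ContinuousLinearMap.id ℝ E := fwd_self x
  rw [h4, h5]
  rfl

theorem eq_of_chartRep_eq {k : ℕ} {θ τ : M → Alt E F k}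
    (h : ∀ x₀ : M, chartRep θ x₀ (ch E x₀ x₀) = chartRep τ x₀ (ch E x₀ x₀)) : θ = τ := by
  funext x
  rw [← chartRep_self θ x, h, chartRep_self]

theorem extD_pullForm {k : ℕ} {f : M → N} {θ : N → Alt E' F k}
    (hf : ContMDiff 𝓘(ℝ, E) 𝓘(ℝ, E') ∞ f) (hθ : IsSmooth θ) :
    extD (pullForm (E := E) f θ) = pullForm f (extD θ) := by
  apply eq_of_chartRep_eq
  intro x₀
  have hy := mem_ch_target (E := E) x₀
  have hs := mem_ch_source (E := E') (f ((ch E x₀).symm (ch E x₀ x₀)))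
  rw [chartRep_self, extD_eq, extDeriv_chartRep_pullForm hy hf hs hθ,
    chartRep_pullForm _ hy (hf.mdifferentiable (by simp) _) hs, chartRep_extD hθ]
  exact (ch E' _).map_source hs

end Charts

/-! ### Smooth dependence of pullbacks of alternating forms -/

section SmoothPullback

variable {E : Type*} [NormedAddCommGroup E] [NormedSpace ℝ E]
  {E' : Type*} [NormedAddCommGroup E'] [NormedSpace ℝ E']
  {F : Type*} [NormedAddCommGroup F] [NormedSpace ℝ F]
  {X : Type*} [NormedAddCommGroup X] [NormedSpace ℝ X]

variable (E F) in
/-- Alternatization of continuous multilinear maps, divided by `k!`, as a continuous linear map. -/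
def alternatizeC (k : ℕ) :
    ContinuousMultilinearMap ℝ (fun _ : Fin k => E) F →L[ℝ] Alt E F k :=
  LinearMap.mkContinuous
    { toFun := fun f => ((k.factorial : ℝ)⁻¹) • ContinuousMultilinearMap.alternatization f
      map_add' := fun f g => by rw [map_add, smul_add]
      map_smul' := fun c f => by
        ext v
        simp only [ContinuousAlternatingMap.smul_apply,
          ContinuousMultilinearMap.alternatization_apply_apply, smul_apply,
          RingHom.id_apply, Finset.smul_sum]
        refine Finset.sum_congr rfl fun σ _ => ?_
        rw [smul_comm (Equiv.Perm.sign σ) c, smul_comm _ c] } 1 fun f => by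
    rw [one_mul]
    refine ContinuousAlternatingMap.opNorm_le_bound _ (norm_nonneg f) fun v => ?_
    simp only [LinearMap.coe_mk, AddHom.coe_mk, ContinuousAlternatingMap.smul_apply,
      ContinuousMultilinearMap.alternatization_apply_apply, norm_smul, norm_inv, norm_natCast]
    have h1 : ∀ σ : Equiv.Perm (Fin k), ‖Equiv.Perm.sign σ • f (v ∘ σ)‖ ≤ ‖f‖ * ∏ i, ‖v i‖ := by
      intro σ
      have h2 : ‖Equiv.Perm.sign σ • f (v ∘ σ)‖ = ‖f (v ∘ σ)‖ := by
        rcases Int.units_eq_one_or (Equiv.Perm.sign σ) with h | h <;> rw [h] <;> simp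
      rw [h2]
      refine (f.le_opNorm _).trans_eq ?_
      rw [← Equiv.prod_comp σ fun i => ‖v i‖]
      rfl
    have h3 := (norm_sum_le Finset.univ fun σ : Equiv.Perm (Fin k) =>
      Equiv.Perm.sign σ • f (v ∘ σ)).trans (Finset.sum_le_sum fun σ _ => h1 σ)
    rw [Finset.sum_const, Finset.card_univ, Fintype.card_perm, Fintype.card_fin, nsmul_eq_mul] at h3
    rw [inv_mul_le_iff₀ (by positivity)]
    exact h3

/-- Normalized alternatization is a retraction onto the alternating maps; it transfers smoothness of
composition from multilinear to alternating maps. -/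
theorem alternatizeC_coe {k : ℕ} (θ : Alt E F k) :
    alternatizeC E F k θ.toContinuousMultilinearMap = θ := by
  ext v
  change ((k.factorial : ℝ)⁻¹ • ContinuousMultilinearMap.alternatization
    θ.toContinuousMultilinearMap) v = _
  simp only [ContinuousAlternatingMap.smul_apply,
    ContinuousMultilinearMap.alternatization_apply_apply]
  have h : ∀ σ : Equiv.Perm (Fin k), Equiv.Perm.sign σ •
      θ.toContinuousMultilinearMap (v ∘ σ) = θ v := by
    intro σ
    have := θ.toAlternatingMap.map_perm v σ
    change Equiv.Perm.sign σ • θ.toAlternatingMap (v ∘ σ) = _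
    rw [this, smul_smul, Int.units_mul_self, one_smul]
    rfl
  rw [Finset.sum_congr rfl fun σ _ => h σ, Finset.sum_const, Finset.card_univ, Fintype.card_perm,
    Fintype.card_fin, ← Nat.cast_smul_eq_nsmul ℝ, smul_smul, inv_mul_cancel₀ (by positivity),
    one_smul]

/-- Pullbacks of alternating forms depend smoothly on the form and on the linear map. -/
theorem ContDiffAt.compAlt {n : WithTop ℕ∞} {k : ℕ} {θ : X → Alt E' F k} {A : X → E →L[ℝ] E'} {x : X}
    (hθ : ContDiffAt ℝ n θ x) (hA : ContDiffAt ℝ n A x) :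
    ContDiffAt ℝ n (fun z => (θ z).compContinuousLinearMap (A z)) x := by
  have h1 : ContDiffAt ℝ n (fun z => (θ z).toContinuousMultilinearMap) x :=
    ContDiffAt.comp x (ContinuousLinearMap.contDiff (𝕜 := ℝ)
      (ContinuousAlternatingMap.toContinuousMultilinearMapCLM (𝕜 := ℝ) (ι := Fin k) (E := E')
        (F := F) ℝ)).contDiffAt hθ
  have h2 : ContDiffAt ℝ n (fun z =>
      ContinuousMultilinearMap.compContinuousLinearMapContinuousMultilinear ℝ
        (fun _ : Fin k => E) (fun _ : Fin k => E') F (fun _ => A z)) x :=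
    (ContinuousMultilinearMap.contDiff _).contDiffAt.comp x (contDiffAt_pi.2 fun _ => hA)
  have h3 := (alternatizeC E F k).contDiff.contDiffAt.comp x (h2.clm_apply h1)
  refine h3.congr_of_eventuallyEq (Filter.Eventually.of_forall fun z => ?_)
  exact (alternatizeC_coe _).symm

end SmoothPullback

/-! ### Forms, sections and endomorphisms in the chart at a point -/

section Center

variable {E : Type*} [NormedAddCommGroup E] [NormedSpace ℝ E]
  {M : Type*} [TopologicalSpace M] [ChartedSpace E M] [IsManifold 𝓘(ℝ, E) ∞ M]
  {E' : Type*} [NormedAddCommGroup E'] [NormedSpace ℝ E']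
  {N : Type*} [TopologicalSpace N] [ChartedSpace E' N] [IsManifold 𝓘(ℝ, E') ∞ N]
  {F : Type*} [NormedAddCommGroup F] [NormedSpace ℝ F]

theorem contDiffAt_chartRep_pullForm {k : ℕ} {f : M → N} {θ : N → Alt E' F k} {x₀ : M} {x₁ : N}
    {y : E} (hy : y ∈ (ch E x₀).target) (hf : ContMDiff 𝓘(ℝ, E) 𝓘(ℝ, E') ∞ f)
    (hs : f ((ch E x₀).symm y) ∈ (ch E' x₁).source)
    (hθ : ContDiffAt ℝ ∞ (chartRep θ x₁) (ch E' x₁ (f ((ch E x₀).symm y)))) :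
    ContDiffAt ℝ ∞ (chartRep (pullForm (E := E) f θ) x₀) y := by
  have h1 : chartRep (pullForm (E := E) f θ) x₀ =ᶠ[nhds y] fun z =>
      (chartRep θ x₁ (inCh f x₀ x₁ z)).compContinuousLinearMap (fderiv ℝ (inCh f x₀ x₁) z) := by
    filter_upwards [eventually_inCh hy hf.continuous.continuousAt hs] with z hz
    exact chartRep_pullForm θ hz.1 (hf.mdifferentiable (by simp) _) hz.2
  refine ContDiffAt.congr_of_eventuallyEq ?_ h1
  have h2 := contDiffAt_inCh hy hf.contMDiffAt hs
  exact ContDiffAt.compAlt (ContDiffAt.comp (g := chartRep θ x₁) y hθ h2) (h2.fderiv_right (by simp))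

/-- Smoothness of a form can be checked at `x` in the chart at `x`. -/
theorem isSmooth_iff_center {k : ℕ} {θ : M → Alt E F k} :
    IsSmooth θ ↔ ∀ x, ContDiffAt ℝ ∞ (chartRep θ x) (ch E x x) := by
  constructor
  · intro h x
    exact (h x).contDiffAt (ch_target_mem (mem_ch_target x))
  · intro h x₀ y hy
    have h1 := contDiffAt_chartRep_pullForm (f := id) (x₁ := (ch E x₀).symm y) hy contMDiff_id
      (mem_ch_source (E := E) _) (h _)
    have h2 : pullForm (E := E) (id : M → M) θ = θ := pullForm_id θ
    rw [h2] at h1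
    exact h1.contDiffWithinAt

theorem isSmooth_pullForm {k : ℕ} {f : M → N} {θ : N → Alt E' F k}
    (hf : ContMDiff 𝓘(ℝ, E) 𝓘(ℝ, E') ∞ f) (hθ : IsSmooth θ) :
    IsSmooth (pullForm (E := E) f θ) := fun _ _ hy =>
  (contDiffAt_chartRep_pullForm hy hf (mem_ch_source (E := E') _)
    ((hθ _).contDiffAt (ch_target_mem ((ch E' _).map_source (mem_ch_source (E := E') _))))).contDiffWithinAt

/-- The expression in the chart at `x₀` of a form of mixed degree. -/
def rep (θ : Form E M) (x₀ : M) (y : E) : Spinor E := pb (bwd E x₀ y) (θ ((ch E x₀).symm y))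

theorem rep_self (θ : Form E M) (x : M) : rep θ x (ch E x x) = θ x :=
  funext fun k => chartRep_self (fun x => θ x k) x

theorem mem_Omega_iff {θ : Form E M} : θ ∈ Omega E M ↔ ∀ x, SmoothAt (rep θ x) (ch E x x) :=
  ⟨fun h x k => isSmooth_iff_center.1 (h k) x, fun h k => isSmooth_iff_center.2 fun x => h x k⟩

/-- The expression in the chart at `x₀` of a section of `TM ⊕ T*M`. -/
def genRep (u : M → Gen E) (x₀ : M) (y : E) : Gen E :=
  genMap (fwd E x₀ ((ch E x₀).symm y)) (bwd E x₀ y) (u ((ch E x₀).symm y))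

/-- The expression in the chart at `x₀` of a bundle endomorphism of `TM ⊕ T*M`. -/
def repJ (J : M → Gen E →L[ℝ] Gen E) (x₀ : M) (y : E) : Gen E →L[ℝ] Gen E :=
  genMap (fwd E x₀ ((ch E x₀).symm y)) (bwd E x₀ y) ∘L J ((ch E x₀).symm y) ∘L
    genMap (bwd E x₀ y) (fwd E x₀ ((ch E x₀).symm y))

theorem genRep_self (u : M → Gen E) (x : M) : genRep u x (ch E x x) = u x := by
  rw [genRep, ch_symm_self, bwd_self, fwd_self]
  rfl

theorem repJ_self (J : M → Gen E →L[ℝ] Gen E) (x : M) : repJ J x (ch E x x) = J x := by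
  rw [repJ, ch_symm_self, bwd_self, fwd_self]
  rfl

theorem contDiffAt_repJ {J : M → Gen E →L[ℝ] Gen E} (hJ : IsSmoothEnd J) {x₀ : M} {y : E}
    (hy : y ∈ (ch E x₀).target) : ContDiffAt ℝ ∞ (repJ J x₀) y :=
  (hJ x₀).contDiffAt (ch_target_mem hy)

theorem genMap_genMap {A B : E →L[ℝ] E} (hAB : A ∘L B = ContinuousLinearMap.id ℝ E) (u : Gen E) :
    genMap A B (genMap B A u) = u := by
  have := congrArg (fun D => D u) (genMap_comp A B B A)
  rwa [hAB, genMap_id] at this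

theorem genRep_end (J : M → Gen E →L[ℝ] Gen E) (u : M → Gen E) {x₀ : M} {y : E}
    (hy : y ∈ (ch E x₀).target) :
    genRep (fun x => J x (u x)) x₀ y = repJ J x₀ y (genRep u x₀ y) := by
  simp only [genRep, repJ, ContinuousLinearMap.comp_apply, genMap_genMap (bwd_comp_fwd hy)]

theorem repJ_sq {J : M → Gen E →L[ℝ] Gen E} (hJ : ∀ x u, J x (J x u) = -u) {x₀ : M} {y : E}
    (hy : y ∈ (ch E x₀).target) (u : Gen E) : repJ J x₀ y (repJ J x₀ y u) = -u := by
  simp only [repJ, ContinuousLinearMap.comp_apply, genMap_genMap (bwd_comp_fwd hy), hJ, map_neg,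
    genMap_genMap (fwd_comp_bwd hy)]

theorem repJ_skew {J : M → Gen E →L[ℝ] Gen E} (hJ : ∀ x, IsSkew (J x)) {x₀ : M} {y : E}
    (hy : y ∈ (ch E x₀).target) : IsSkew (repJ J x₀ y) := by
  intro u v
  obtain ⟨u', rfl⟩ : ∃ u', genMap (fwd E x₀ ((ch E x₀).symm y)) (bwd E x₀ y) u' = u :=
    ⟨_, genMap_genMap (fwd_comp_bwd hy) u⟩
  obtain ⟨v', rfl⟩ : ∃ v', genMap (fwd E x₀ ((ch E x₀).symm y)) (bwd E x₀ y) v' = v :=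
    ⟨_, genMap_genMap (fwd_comp_bwd hy) v⟩
  simp only [repJ, ContinuousLinearMap.comp_apply, genMap_genMap (bwd_comp_fwd hy)]
  rw [pairing_genMap (bwd_comp_fwd hy), pairing_genMap (bwd_comp_fwd hy), hJ]

variable [FiniteDimensional ℝ E]

theorem rep_cliff (u : M → Gen E) (θ : Form E M) {x₀ : M} {y : E} (hy : y ∈ (ch E x₀).target) :
    rep (fun x => cliff (u x) (θ x)) x₀ y = cliff (genRep u x₀ y) (rep θ x₀ y) := by
  rw [rep, rep, genRep, cliff_pb (fwd_comp_bwd hy), genMap_genMap (bwd_comp_fwd hy)]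

theorem rep_component (J : M → Gen E →L[ℝ] Gen E) (k : ℤ) (θ : Form E M) {x₀ : M} {y : E}
    (hy : y ∈ (ch E x₀).target) :
    rep (component J k θ) x₀ y = proj (repJ J x₀ y) k (rep θ x₀ y) :=
  (congrArg (fun D : Module.End ℂ (Spinor E) => D (θ ((ch E x₀).symm y)))
    (proj_pb (bwd_comp_fwd hy) (fwd_comp_bwd hy) (J ((ch E x₀).symm y)) k)).symm

theorem rep_wedge3 (H : M → Alt E ℝ 3) (θ : Form E M) {x₀ : M} {y : E} (hy : y ∈ (ch E x₀).target) :
    rep (fun x => wedge3 (H x) (θ x)) x₀ y = wedge3 (chartRep H x₀ y) (rep θ x₀ y) :=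
  (congrArg (fun D : Module.End ℂ (Spinor E) => D (θ ((ch E x₀).symm y)))
    (wedge3_pb (bwd_comp_fwd hy) (fwd_comp_bwd hy) (H ((ch E x₀).symm y)))).symm

theorem rep_d {θ : Form E M} (h : θ ∈ Omega E M) {x₀ : M} {y : E} (hy : y ∈ (ch E x₀).target) :
    rep (d θ) x₀ y = dl (rep θ x₀) y := by
  funext k
  cases k with
  | zero =>
    rw [dl_zero_degree]
    rfl
  | succ k =>
    rw [dl_succ]
    exact chartRep_extD (h k) hy

theorem rep_dH (H : M → Alt E ℝ 3) {θ : Form E M} (h : θ ∈ Omega E M) {x₀ : M} {y : E}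
    (hy : y ∈ (ch E x₀).target) :
    rep (dH H θ) x₀ y = dHl (chartRep H x₀) (rep θ x₀) y := by
  have : rep (dH H θ) x₀ y = rep (d θ) x₀ y - rep (fun x => wedge3 (H x) (θ x)) x₀ y := by
    simp only [rep, dH, map_sub]
  rw [this, rep_d h hy, rep_wedge3 H θ hy, dHl]

end Center

/-! ### From the Courant bracket to the Nijenhuis tensor -/

section Integrability

variable {E : Type*} [NormedAddCommGroup E] [NormedSpace ℝ E]
  {M : Type*} [TopologicalSpace M] [ChartedSpace E M] [IsManifold 𝓘(ℝ, E) ∞ M]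

/-- The differential of a function, in the chart at `x`. -/
theorem dFun_eq {g : M → ℝ} {x : M}
    (hg : DifferentiableAt ℝ (fun y => g ((ch E x).symm y)) (ch E x x)) :
    dFun g x = fderiv ℝ (fun y => g ((ch E x).symm y)) (ch E x x) := by
  have h1 : g =ᶠ[nhds x] fun z => (fun y => g ((ch E x).symm y)) (ch E x z) :=
    Filter.eventually_of_mem ((isOpen_extChartAt_source x).mem_nhds (mem_ch_source (E := E) x))
      fun z hz => by simp only [(ch E x).left_inv hz]
  rw [dFun, tmap_congr h1, tmap_comp (E' := E) hg.mdifferentiableAt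
    ((contMDiffAt_ch (mem_ch_source x)).mdifferentiableAt (by simp)), tmap_eq_fderiv]
  have := fwd_self (E := E) x
  rw [show tmap (E := E) (E' := E) (ch E x) x = ContinuousLinearMap.id ℝ E from this,
    ContinuousLinearMap.comp_id]

theorem chartRep_oneForm (ζ : M → E →L[ℝ] ℝ) (x₀ : M) (y : E) :
    chartRep (fun z => oneForm (ζ z)) x₀ y =
      oneForm (ζ ((ch E x₀).symm y) ∘L bwd E x₀ y) := by
  ext v
  rfl

/-- The bracket on `M` pulls both fields back along the inverse chart at `x`, whose derivative has
inverse `fwd`. The outer derivative is taken at the centre, where it is the identity. -/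
theorem lieBr_eq [CompleteSpace E] (X Y : M → E) (x : M) :
    lieBr X Y x = VectorField.lieBracket ℝ
      (fun y => fwd E x ((ch E x).symm y) (X ((ch E x).symm y)))
      (fun y => fwd E x ((ch E x).symm y) (Y ((ch E x).symm y))) (ch E x x) := by
  have hp : ∀ Z : M → E, VectorField.mpullbackWithin 𝓘(ℝ, E) 𝓘(ℝ, E) (ch E x).symm Z
      (Set.range 𝓘(ℝ, E)) =ᶠ[nhds (ch E x x)]
      fun y => fwd E x ((ch E x).symm y) (Z ((ch E x).symm y)) := by
    intro Z
    filter_upwards [ch_target_mem (mem_ch_target (E := E) x)] with y hy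
    have h1 : mfderiv[Set.range 𝓘(ℝ, E)] (ch E x).symm y = bwd E x y := by
      rw [modelWithCornersSelf_coe, Set.range_id, mfderivWithin_univ]
      rfl
    have h2 : ContinuousLinearMap.inverse (bwd E x y) = fwd E x ((ch E x).symm y) :=
      ContinuousLinearMap.inverse_eq (bwd_comp_fwd hy) (fwd_comp_bwd hy)
    have h7 : ContinuousLinearMap.inverse
        (show E →L[ℝ] E from mfderiv[Set.range 𝓘(ℝ, E)] (ch E x).symm y) =
        fwd E x ((ch E x).symm y) := by
      rw [← h2]
      exact congrArg (fun A : E →L[ℝ] E => A.inverse) h1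
    exact congrArg (fun A : E →L[ℝ] E => A (Z ((ch E x).symm y))) h7
  have h3 : lieBr X Y x = VectorField.lieBracket ℝ
      (VectorField.mpullbackWithin 𝓘(ℝ, E) 𝓘(ℝ, E) (ch E x).symm X (Set.range 𝓘(ℝ, E)))
      (VectorField.mpullbackWithin 𝓘(ℝ, E) 𝓘(ℝ, E) (ch E x).symm Y (Set.range 𝓘(ℝ, E)))
      (ch E x x) := by
    have h5 : ContinuousLinearMap.inverse (ContinuousLinearMap.id ℝ E) =
      ContinuousLinearMap.id ℝ E := ContinuousLinearMap.inverse_id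
    have h6 : Set.range 𝓘(ℝ, E) = Set.univ := by
      rw [modelWithCornersSelf_coe, Set.range_id]
    have h8 : ContinuousLinearMap.inverse (fwd E x x) = ContinuousLinearMap.id ℝ E := by
      rw [fwd_self, h5]
    refine (congrFun (VectorField.mlieBracketWithin_univ (I := 𝓘(ℝ, E)) (V := X)
      (W := Y)).symm x).trans ((VectorField.mlieBracketWithin_apply (I := 𝓘(ℝ, E)) (V := X)
      (W := Y)).trans ?_)
    refine (congrArg (fun A : E →L[ℝ] E => A _) h8).trans ?_
    have h9 : ∀ (A B : E → E) (s : Set E) (p : E), s = Set.univ →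
        VectorField.lieBracketWithin ℝ A B s p = VectorField.lieBracket ℝ A B p := by
      rintro A B s p rfl
      rw [VectorField.lieBracketWithin_univ]
    rw [Set.preimage_univ, Set.univ_inter]
    exact h9 _ _ _ _ h6
  rw [h3]
  exact (hp X).lieBracket_vectorField_eq (hp Y)

variable [FiniteDimensional ℝ E]

/-- The Courant bracket, in the chart at `x`. -/
theorem courant_eq (H : M → Alt E ℝ 3) {u v : M → Gen E} {x : M}
    (hu : DifferentiableAt ℝ (genRep u x) (ch E x x))
    (hv : DifferentiableAt ℝ (genRep v x) (ch E x x)) :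
    courant H u v x = jetCourant (H x) (u x) (fderiv ℝ (genRep u x) (ch E x x)) (v x)
      (fderiv ℝ (genRep v x) (ch E x x)) := by
  have : CompleteSpace E := FiniteDimensional.complete ℝ E
  set y := ch E x x with hy
  have hp : ∀ {u v : M → Gen E}, DifferentiableAt ℝ (genRep u x) y →
      DifferentiableAt ℝ (genRep v x) y → ∀ w : E,
      HasFDerivAt (fun z => (u ((ch E x).symm z)).2 (v ((ch E x).symm z)).1)
        (((genRep u x y).2 ∘L (ContinuousLinearMap.fst ℝ E (E →L[ℝ] ℝ) ∘L
          fderiv ℝ (genRep v x) y)) + ((ContinuousLinearMap.snd ℝ E (E →L[ℝ] ℝ) ∘L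
          fderiv ℝ (genRep u x) y)).flip (genRep v x y).1) y := by
    intro u v hu hv w
    have h1 := hu.hasFDerivAt.snd.clm_apply hv.hasFDerivAt.fst
    refine h1.congr_of_eventuallyEq ?_
    filter_upwards [ch_target_mem (mem_ch_target (E := E) x)] with z hz
    have := congrArg (fun A : E →L[ℝ] E => A (v ((ch E x).symm z)).1) (bwd_comp_fwd hz)
    simp only [genRep, genMap_apply, ContinuousLinearMap.comp_apply] at this ⊢
    rw [this]
    rfl
  have hder : ∀ {u v : M → Gen E}, DifferentiableAt ℝ (genRep u x) y →
      DifferentiableAt ℝ (genRep v x) y → ∀ w : E,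
      lieDer (fun z => (u z).1) (fun z => (v z).2) x w =
        (v x).2 (fderiv ℝ (genRep u x) y w).1 + (fderiv ℝ (genRep v x) y (u x).1).2 w := by
    intro u v hu hv w
    have h1 := hp hv hu w
    rw [lieDer, dFun_eq h1.differentiableAt, h1.fderiv, extD_eq, add_apply, covector_apply,
      ContinuousAlternatingMap.curryLeft_apply_apply]
    have h2 : chartRep (fun z => oneForm (v z).2) x = fun z => oneForm (genRep v x z).2 :=
      funext fun z => chartRep_oneForm _ x z
    have h3 := extDeriv_oneForm hv.snd (u x).1 w
    rw [h2, show Matrix.vecCons (u x).1 ![w] = ![(u x).1, w] from rfl, h3, fderiv.snd hv, hy]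
    simp only [genRep_self, add_apply, ContinuousLinearMap.comp_apply,
      ContinuousLinearMap.flip_apply, ContinuousLinearMap.coe_fst', ContinuousLinearMap.coe_snd']
    ring
  have hpair : ∀ w, dFun (fun z => (v z).2 (u z).1 - (u z).2 (v z).1) x w =
      (v x).2 (fderiv ℝ (genRep u x) y w).1 + (fderiv ℝ (genRep v x) y w).2 (u x).1 -
      ((u x).2 (fderiv ℝ (genRep v x) y w).1 + (fderiv ℝ (genRep u x) y w).2 (v x).1) := by
    intro w
    have h1 := (hp hv hu w).fun_sub (hp hu hv w)
    rw [dFun_eq h1.differentiableAt, h1.fderiv, hy]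
    simp only [genRep_self, add_apply, sub_apply, ContinuousLinearMap.comp_apply,
      ContinuousLinearMap.flip_apply, ContinuousLinearMap.coe_fst', ContinuousLinearMap.coe_snd']
  have hbr : lieBr (fun z => (u z).1) (fun z => (v z).1) x =
      (fderiv ℝ (genRep v x) y (u x).1).1 - (fderiv ℝ (genRep u x) y (v x).1).1 := by
    rw [lieBr_eq]
    change VectorField.lieBracket ℝ (fun z => (genRep u x z).1) (fun z => (genRep v x z).1) y = _
    rw [VectorField.lieBracket, fderiv.fst hu, fderiv.fst hv, hy, genRep_self, genRep_self]
    rfl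
  refine Prod.ext ?_ ?_
  · rw [courant, hbr]
    simp [jetCourant, contr]
  · ext w
    simp only [courant, jetCourant, contr, add_apply, sub_apply, smul_apply, hpair,
      hder hu hv, hder hv hu, Prod.snd_add, Prod.snd_sub, pairD_apply, pairing, smul_eq_mul]
    ring

/-- The trivialization of the tangent bundle at `x` is the derivative of the chart at `x`, which is
also what `genRep` applies to the vector part. -/
theorem isSmoothGen_of_center {u : M → Gen E} (h : ∀ x, ContDiffAt ℝ ∞ (genRep u x) (ch E x x)) :
    IsSmoothGen u := by
  constructor
  · intro x
    refine (Bundle.contMDiffAt_section (F := E) (E := TangentSpace 𝓘(ℝ, E)) (IB := 𝓘(ℝ, E))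
      (s := fun z => ((u z).1 : TangentSpace 𝓘(ℝ, E) z)) x).2 ?_
    have h1 : ContMDiffAt 𝓘(ℝ, E) 𝓘(ℝ, E) ∞ (fun z => (genRep u x (ch E x z)).1) x :=
      (contDiffAt_fst.comp _ (h x)).contMDiffAt.comp x (contMDiffAt_ch (mem_ch_source x))
    refine h1.congr_of_eventuallyEq ?_
    filter_upwards [(isOpen_extChartAt_source (I := 𝓘(ℝ, E)) x).mem_nhds
      (mem_ch_source (E := E) x)] with z hz
    have hz' : z ∈ (chartAt E x).source := by rwa [extChartAt_source] at hz
    have h2 := TangentBundle.continuousLinearMapAt_trivializationAt (I := 𝓘(ℝ, E)) hz'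
    have h3 : (genRep u x (ch E x z)).1 = fwd E x z (u z).1 := by
      rw [genRep, (ch E x).left_inv hz]
      rfl
    rw [h3]
    refine Eq.trans ?_ (congrArg (fun A : E →L[ℝ] E => A (u z).1) h2)
    exact (congrFun (Bundle.Trivialization.coe_linearMapAt_of_mem (R := ℝ)
      (trivializationAt E (TangentSpace 𝓘(ℝ, E)) x) (by simpa using hz')) _).symm
  · rw [isSmooth_iff_center]
    intro x
    have h1 : chartRep (fun z => oneForm (u z).2) x = fun z => oneFormC E (genRep u x z).2 :=
      funext fun z => chartRep_oneForm _ x z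
    rw [h1]
    exact (oneFormC E).contDiff.contDiffAt.comp _ (contDiffAt_snd.comp _ (h x))

variable [T2Space M]

/-- A global section that is constant in the chart at `x` near `x`. -/
theorem exists_section (x : M) (u₀ : Gen E) : ∃ u : M → Gen E,
    (∀ z, ContDiffAt ℝ ∞ (genRep u z) (ch E z z)) ∧
      genRep u x =ᶠ[nhds (ch E x x)] fun _ => u₀ := by
  -- Integrability is a condition on global sections, so a bump function is used to extend the
  -- locally constant section by zero.
  let χ : SmoothBumpFunction 𝓘(ℝ, E) x := Classical.arbitrary _
  refine ⟨fun z => χ z • genMap (bwd E x (ch E x z)) (fwd E x z) u₀, fun z => ?_, ?_⟩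
  · by_cases hz : z ∈ (ch E x).source
    · have hy := mem_ch_target (E := E) z
      have hs : id ((ch E z).symm (ch E z z)) ∈ (ch E x).source := by rwa [id, ch_symm_self]
      have hev := eventually_inCh (f := (id : M → M)) hy continuousAt_id hs
      -- Read in the chart at `z`, the section is moved by the derivatives of the transition maps:
      -- in one direction for vectors, in the other for covectors.
      have hτ : ContDiffAt ℝ ∞ (inCh (E := E) (E' := E) id z x) (ch E z z) :=
        contDiffAt_inCh hy contMDiffAt_id hs
      have hx : ch E x z ∈ (ch E x).target := (ch E x).map_source hz
      have hs' : id ((ch E x).symm (ch E x z)) ∈ (ch E z).source := by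
        rw [id, (ch E x).left_inv hz]
        exact mem_ch_source z
      have hσ : ContDiffAt ℝ ∞ (inCh (E := E) (E' := E) id x z) (ch E x z) :=
        contDiffAt_inCh hx contMDiffAt_id hs'
      have hτz : inCh (E := E) (E' := E) id z x (ch E z z) = ch E x z := by
        rw [inCh, ch_symm_self]
        rfl
      have hA : ContDiffAt ℝ ∞ (fun y => fderiv ℝ (inCh (E := E) (E' := E) id x z)
          (inCh (E := E) (E' := E) id z x y)) (ch E z z) := by
        refine ContDiffAt.comp (g := fderiv ℝ (inCh (E := E) (E' := E) id x z)) _ ?_ hτ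
        rw [hτz]
        exact hσ.fderiv_right (by simp)
      have hB : ContDiffAt ℝ ∞ (fderiv ℝ (inCh (E := E) (E' := E) id z x)) (ch E z z) :=
        hτ.fderiv_right (by simp)
      have hχ : ContDiffAt ℝ ∞ (fun y => χ ((ch E z).symm y)) (ch E z z) := by
        rw [← contMDiffAt_iff_contDiffAt]
        exact χ.contMDiff.contMDiffAt.comp _ (contMDiffAt_ch_symm hy)
      have hmain : ContDiffAt ℝ ∞ (fun y => χ ((ch E z).symm y) •
          ((fderiv ℝ (inCh (E := E) (E' := E) id x z) (inCh (E := E) (E' := E) id z x y) u₀.1,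
            u₀.2 ∘L fderiv ℝ (inCh (E := E) (E' := E) id z x) y) : Gen E)) (ch E z z) :=
        hχ.smul ((hA.clm_apply contDiffAt_const).prodMk (contDiffAt_const.clm_comp hB))
      refine hmain.congr_of_eventuallyEq ?_
      filter_upwards [hev] with y hy
      have hz1 : inCh (E := E) (E' := E) id z x y ∈ (ch E x).target := (ch E x).map_source hy.2
      have e1 : (ch E x).symm (inCh (E := E) (E' := E) id z x y) = (ch E z).symm y :=
        (ch E x).left_inv hy.2
      have e3 := fderiv_inCh (f := (id : M → M)) (x₁ := z) hz1 (mdifferentiable_id _)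
        (by rw [e1]; exact (ch E z).map_target hy.1)
      rw [fderiv_inCh hy.1 (mdifferentiable_id _) hy.2, e3, e1]
      have e2 : tmap (E := E) (E' := E) (id : M → M) ((ch E z).symm y) =
        ContinuousLinearMap.id ℝ E := tmap_id _
      rw [e2, genRep, map_smul, genMap_apply, genMap_apply]
      rfl
    · have hz' : z ∉ tsupport χ := fun h => hz (χ.tsupport_subset_extChartAt_source h)
      have h1 : ∀ᶠ y in nhds (ch E z z), (ch E z).symm y ∉ tsupport χ := by
        have h2 : ContinuousAt (ch E z).symm (ch E z z) :=
          (contMDiffAt_ch_symm (mem_ch_target (E := E) z)).continuousAt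
        refine h2.eventually_mem ((isClosed_tsupport _).isOpen_compl.mem_nhds ?_)
        rwa [ch_symm_self]
      refine (contDiffAt_const (c := (0 : Gen E))).congr_of_eventuallyEq ?_
      filter_upwards [h1] with y hy
      rw [genRep, image_eq_zero_of_notMem_tsupport hy, zero_smul, map_zero]
  · have h2 : ContinuousAt (ch E x).symm (ch E x x) :=
      (contMDiffAt_ch_symm (mem_ch_target (E := E) x)).continuousAt
    have h3 : ∀ᶠ z in nhds ((ch E x).symm (ch E x x)), χ z = 1 := by
      rw [ch_symm_self]
      exact χ.eventuallyEq_one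
    filter_upwards [h2.eventually h3, ch_target_mem (mem_ch_target (E := E) x)] with y hy hy'
    rw [genRep, hy, one_smul, (ch E x).right_inv hy', genMap_genMap (fwd_comp_bwd hy')]

theorem jetCourant_neg_right (h : Alt E ℝ 3) (u : Gen E) (Du : E →L[ℝ] Gen E) (v : Gen E)
    (Dv : E →L[ℝ] Gen E) : jetCourant h u Du (-v) (-Dv) = -jetCourant h u Du v Dv := by
  refine Prod.ext ?_ ?_
  · simp [jetCourant, contr]
    abel
  · ext w
    simp [jetCourant, contr, covector_apply, ContinuousAlternatingMap.curryLeft_apply_apply, pairing]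
    ring

theorem jetCourant_neg_left (h : Alt E ℝ 3) (u : Gen E) (Du : E →L[ℝ] Gen E) (v : Gen E)
    (Dv : E →L[ℝ] Gen E) : jetCourant h (-u) (-Du) v Dv = -jetCourant h u Du v Dv := by
  refine Prod.ext ?_ ?_
  · simp [jetCourant, contr]
    abel
  · ext w
    simp [jetCourant, contr, covector_apply, ContinuousAlternatingMap.curryLeft_apply_apply, pairing]
    ring

/-- Integrability in terms of the Nijenhuis tensor, in the chart at `x`. -/
theorem jetNijenhuis_eq_zero {H : M → Alt E ℝ 3} {J : M → Gen E →L[ℝ] Gen E}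
    (hJ : IsGenComplex H J) (x : M) (u₀ v₀ : Gen E) :
    jetNijenhuis (H x) (J x) (fderiv ℝ (repJ J x) (ch E x x)) u₀ v₀ = 0 := by
  obtain ⟨u, hu, hux⟩ := exists_section x u₀
  obtain ⟨v, hv, hvx⟩ := exists_section x v₀
  have hJu : ∀ {u : M → Gen E}, (∀ z, ContDiffAt ℝ ∞ (genRep u z) (ch E z z)) → ∀ z,
      genRep (fun z => -J z (u z)) z =ᶠ[nhds (ch E z z)] fun y => -repJ J z y (genRep u z y) := by
    intro u hu z
    filter_upwards [ch_target_mem (mem_ch_target (E := E) z)] with y hy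
    rw [← genRep_end J u hy]
    simp only [genRep, map_neg]
  have hJs : ∀ {u : M → Gen E}, (∀ z, ContDiffAt ℝ ∞ (genRep u z) (ch E z z)) → ∀ z,
      ContDiffAt ℝ ∞ (genRep (fun z => -J z (u z)) z) (ch E z z) := by
    intro u hu z
    exact (((contDiffAt_repJ hJ.smooth (mem_ch_target z)).clm_apply (hu z)).neg).congr_of_eventuallyEq
      (hJu hu z)
  have hd : ∀ {u : M → Gen E} {u₀ : Gen E}, (∀ z, ContDiffAt ℝ ∞ (genRep u z) (ch E z z)) →
      genRep u x =ᶠ[nhds (ch E x x)] (fun _ => u₀) →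
      fderiv ℝ (genRep (fun z => -J z (u z)) x) (ch E x x) =
        -(fderiv ℝ (repJ J x) (ch E x x)).flip u₀ := by
    intro u u₀ hu hux
    have h1 : genRep (fun z => -J z (u z)) x =ᶠ[nhds (ch E x x)] fun y => -repJ J x y u₀ := by
      filter_upwards [hJu hu x, hux] with y h1 h2
      rw [h1, h2]
    have h2 := ((contDiffAt_repJ hJ.smooth (mem_ch_target (E := E) x)).differentiableAt
      (n := ∞) (by simp)).hasFDerivAt.clm_apply (hasFDerivAt_const u₀ _)
    rw [h1.fderiv_eq, fderiv_fun_neg, h2.fderiv]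
    ext1 w
    simp
  have hd0 : ∀ {u : M → Gen E} {u₀ : Gen E}, genRep u x =ᶠ[nhds (ch E x x)] (fun _ => u₀) →
      fderiv ℝ (genRep u x) (ch E x x) = 0 := fun hux => by
    rw [hux.fderiv_eq, fderiv_fun_const]
    rfl
  have hu0 : u x = u₀ := by rw [← genRep_self u x, hux.eq_of_nhds]
  have hv0 : v x = v₀ := by rw [← genRep_self v x, hvx.eq_of_nhds]
  -- For a real section `u`, `u - √-1 J u` lies in `L`. The bracket of two of these lies in `L`; its
  -- first eigenvector equation, once `J` is applied again, is the vanishing of the Nijenhuis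
  -- tensor, since `u` and `v` have zero derivative at `x` in this chart.
  have hint := hJ.integrable (fun z => ⟨u z, -J z (u z)⟩) (fun z => ⟨v z, -J z (v z)⟩)
    ⟨isSmoothGen_of_center hu, isSmoothGen_of_center (hJs hu)⟩
    ⟨isSmoothGen_of_center hv, isSmoothGen_of_center (hJs hv)⟩
    (fun z => ⟨by simp, by simp [hJ.sq_eq]⟩) (fun z => ⟨by simp, by simp [hJ.sq_eq]⟩) x
  have D : ∀ {u : M → Gen E}, (∀ z, ContDiffAt ℝ ∞ (genRep u z) (ch E z z)) →
      DifferentiableAt ℝ (genRep u x) (ch E x x) := fun hu => (hu x).differentiableAt (by simp)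
  have h1 := hint.1
  simp only [courantC] at h1
  rw [courant_eq H (D hu) (D hv), courant_eq H (D (hJs hu)) (D (hJs hv)),
    courant_eq H (D hu) (D (hJs hv)), courant_eq H (D (hJs hu)) (D hv), hd hu hux, hd hv hvx,
    hd0 hux, hd0 hvx, hu0, hv0] at h1
  simp only [jetCourant_neg_left, jetCourant_neg_right] at h1
  have h2 := congrArg (J x) h1
  rw [hJ.sq_eq] at h2
  simp only [map_neg, map_add] at h2
  rw [jetNijenhuis]
  simp only [map_add]
  have h3 := sub_eq_zero.2 h2
  rw [← h3]
  abel

end Integrability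

/-! ### Finite gradings given by projections -/

section Grading

variable {R : Type*} [Ring R] {s : Finset ℤ} {π : ℤ → R}

/-- A family of projections onto the summands of a finite `ℤ`-grading. -/
structure IsGrading (s : Finset ℤ) (π : ℤ → R) : Prop where
  mul : ∀ k l, π k * π l = if k = l then π l else 0
  zero : ∀ k ∉ s, π k = 0
  sum : ∑ k ∈ s, π k = 1

/-- `X` is homogeneous of degree `j`. -/
def HasDeg (π : ℤ → R) (j : ℤ) (X : R) : Prop := ∀ k, π (k + j) * X = X * π k

/-- The component of degree `j`. -/
def degPart (s : Finset ℤ) (π : ℤ → R) (j : ℤ) (X : R) : R := ∑ k ∈ s, π (k + j) * (X * π k)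

namespace IsGrading

theorem ext (h : IsGrading s π) {X Y : R} (hXY : ∀ k, X * π k = Y * π k) : X = Y := by
  rw [← mul_one X, ← mul_one Y, ← h.sum, Finset.mul_sum, Finset.mul_sum]
  exact Finset.sum_congr rfl fun k _ => hXY k

theorem degPart_mul (h : IsGrading s π) (j l : ℤ) (X : R) :
    degPart s π j X * π l = π (l + j) * (X * π l) := by
  rw [degPart, Finset.sum_mul]
  by_cases hl : l ∈ s
  · rw [Finset.sum_eq_single_of_mem l hl fun k _ hk => by
      rw [mul_assoc, mul_assoc, h.mul, if_neg hk, mul_zero, mul_zero]]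
    rw [mul_assoc, mul_assoc, h.mul, if_pos rfl]
  · rw [h.zero l hl, mul_zero, mul_zero]
    exact Finset.sum_eq_zero fun k _ => by simp

theorem hasDeg_degPart (h : IsGrading s π) (j : ℤ) (X : R) : HasDeg π j (degPart s π j X) := by
  intro k
  rw [h.degPart_mul, degPart, Finset.mul_sum]
  by_cases hl : k ∈ s
  · rw [Finset.sum_eq_single_of_mem k hl fun l _ hk => by
      rw [← mul_assoc, h.mul, if_neg (by omega), zero_mul]]
    rw [← mul_assoc, h.mul, if_pos rfl]
  · rw [h.zero k hl, mul_zero, mul_zero]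
    refine Finset.sum_eq_zero fun l hls => ?_
    rw [← mul_assoc, h.mul, if_neg (fun hk => hl (by rwa [add_right_cancel hk])), zero_mul]

/-- An element with components of degree `±1` only. -/
theorem degPart_add (h : IsGrading s π) {X : R}
    (hX : ∀ k l, k ≠ l + 1 → k ≠ l - 1 → π k * (X * π l) = 0) :
    degPart s π (-1) X + degPart s π 1 X = X := by
  refine h.ext fun l => ?_
  rw [add_mul, h.degPart_mul, h.degPart_mul]
  conv_rhs => rw [← one_mul (X * π l), ← h.sum, Finset.sum_mul]
  have h1 : ∀ k ∈ s, π k * (X * π l) = (if k = l + -1 then π (l + -1) * (X * π l) else 0) +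
      (if k = l + 1 then π (l + 1) * (X * π l) else 0) := by
    intro k _
    split_ifs with h1 h2 h2
    · omega
    · rw [h1, add_zero]
    · rw [h2, zero_add]
    · rw [hX k l h2 (by omega), add_zero]
  have h2 : ∀ m, (if m ∈ s then π m * (X * π l) else 0) = π m * (X * π l) := by
    intro m
    split_ifs with hm
    · rfl
    · rw [h.zero m hm, zero_mul]
  rw [Finset.sum_congr rfl h1, Finset.sum_add_distrib, Finset.sum_ite_eq', Finset.sum_ite_eq',
    h2, h2]

end IsGrading

theorem HasDeg.mul {i j : ℤ} {X Y : R} (hX : HasDeg π i X) (hY : HasDeg π j Y) :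
    HasDeg π (j + i) (X * Y) := fun k => by
  rw [← add_assoc, ← mul_assoc, hX, mul_assoc, hY, mul_assoc]

theorem HasDeg.add {i : ℤ} {X Y : R} (hX : HasDeg π i X) (hY : HasDeg π i Y) :
    HasDeg π i (X + Y) := fun k => by rw [mul_add, add_mul, hX, hY]

theorem HasDeg.neg {i : ℤ} {X : R} (hX : HasDeg π i X) : HasDeg π i (-X) := fun k => by
  rw [mul_neg, neg_mul, hX]

/-- An element of degree `i` that is cancelled by elements without component of degree `i`
vanishes. -/
theorem IsGrading.eq_zero_of_add (h : IsGrading s π) {i j : ℤ} (hij : i ≠ j) {X Y Z : R}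
    (hX : HasDeg π i X) (hY : HasDeg π j Y) (hZ : ∀ k, π (k + i) * (Z * π k) = 0)
    (hs : X + Y + Z = 0) : X = 0 := by
  refine h.ext fun k => ?_
  have h1 := congrArg (fun W => π (k + i) * (W * π k)) hs
  simp only [add_mul, mul_add, zero_mul, mul_zero, hZ, add_zero] at h1
  have h2 : π (k + i) * (Y * π k) = 0 := by
    rw [← hY, ← mul_assoc, h.mul, if_neg (by omega), zero_mul]
  rw [h2, add_zero, ← hX, ← mul_assoc, h.mul, if_pos rfl, hX] at h1
  rw [h1, zero_mul]

theorem IsGrading.mul_mul_eq_zero (h : IsGrading s π) {i j : ℤ} (hij : i ≠ j) {Z : R}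
    (hZ : HasDeg π j Z) (k : ℤ) : π (k + i) * (Z * π k) = 0 := by
  rw [← hZ, ← mul_assoc, h.mul, if_neg (by omega), zero_mul]

/-- The components of an element of square zero with components of degree `±1`. -/
theorem IsGrading.sq_eq_zero (h : IsGrading s π) {P Q : R} (hP : HasDeg π (-1) P)
    (hQ : HasDeg π 1 Q) (hs : (P + Q) * (P + Q) = 0) :
    P * P = 0 ∧ Q * Q = 0 ∧ P * Q + Q * P = 0 := by
  -- The square of `P + Q` has parts of degrees `-2`, `0` and `2`, which vanish separately.
  have hPP : HasDeg π (-2) (P * P) := hP.mul hP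
  have hQQ : HasDeg π 2 (Q * Q) := hQ.mul hQ
  have hPQ : HasDeg π 0 (P * Q + Q * P) := (hP.mul hQ).add (hQ.mul hP)
  refine ⟨h.eq_zero_of_add (by decide) hPP hPQ (h.mul_mul_eq_zero (by decide) hQQ) ?_,
    h.eq_zero_of_add (by decide) hQQ hPQ (h.mul_mul_eq_zero (by decide) hPP) ?_,
    h.eq_zero_of_add (by decide) hPQ hPP (h.mul_mul_eq_zero (by decide) hQQ) ?_⟩ <;>
  · rw [← hs]
    noncomm_ring

end Grading

theorem eventually_target {E : Type*} [NormedAddCommGroup E] [NormedSpace ℝ E]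
    {M : Type*} [TopologicalSpace M] [ChartedSpace E M] (x : M) :
    ∀ᶠ y in nhds (ch E x x), y ∈ (ch E x).target := ch_target_mem (mem_ch_target x)

/-! ### `∂`, `∂̄` and pullbacks as operators on `Ω(M)` -/

section Operators

variable {E : Type*} [NormedAddCommGroup E] [NormedSpace ℝ E] [FiniteDimensional ℝ E]
  {M : Type*} [TopologicalSpace M] [ChartedSpace E M] [IsManifold 𝓘(ℝ, E) ∞ M]

variable (E M) in
/-- `Ω(M)` as a complex vector space. -/
def OmegaS : Submodule ℂ (Form E M) where
  carrier := Omega E M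
  zero_mem' := mem_Omega_iff.2 fun x => (smoothAt_zero (E := E) _).congr
    (Filter.Eventually.of_forall fun y => map_zero (pb (bwd E x y)))
  add_mem' := fun hθ hτ => mem_Omega_iff.2 fun x =>
    ((mem_Omega_iff.1 hθ x).add (mem_Omega_iff.1 hτ x)).congr
      (Filter.Eventually.of_forall fun y => map_add (pb (bwd E x y)) _ _)
  smul_mem' := fun c _ hθ => mem_Omega_iff.2 fun x => ((mem_Omega_iff.1 hθ x).const_smul c).congr
      (Filter.Eventually.of_forall fun y => map_smul (pb (bwd E x y)) c _)

theorem rep_add (θ τ : Form E M) (x : M) : rep (θ + τ) x = fun y => rep θ x y + rep τ x y :=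
  funext fun y => map_add (pb (bwd E x y)) _ _

theorem rep_smul (c : ℂ) (θ : Form E M) (x : M) : rep (c • θ) x = fun y => c • rep θ x y :=
  funext fun y => map_smul (pb (bwd E x y)) c _

theorem dH_eq (H : M → Alt E ℝ 3) {θ : Form E M} (h : θ ∈ Omega E M) (x : M) :
    dH H θ x = dHl (chartRep H x) (rep θ x) (ch E x x) := by
  rw [← rep_dH H h (mem_ch_target x), rep_self]

theorem contDiffAt_chartRep_center {k : ℕ} {F : Type*} [NormedAddCommGroup F] [NormedSpace ℝ F]
    {H : M → Alt E F k} (hH : IsSmooth H) (x : M) :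
    ContDiffAt ℝ ∞ (chartRep H x) (ch E x x) := isSmooth_iff_center.1 hH x

theorem component_mem {J : M → Gen E →L[ℝ] Gen E} (hJ : IsSmoothEnd J) (k : ℤ) {θ : Form E M}
    (h : θ ∈ Omega E M) : component J k θ ∈ Omega E M := mem_Omega_iff.2 fun x =>
  (smoothAt_proj (mem_Omega_iff.1 h x) (contDiffAt_repJ hJ (mem_ch_target x)) k).congr
    ((eventually_target x).mono fun _ hy => rep_component J k θ hy)

theorem dH_mem {H : M → Alt E ℝ 3} (hH : IsSmooth H) {θ : Form E M}
    (h : θ ∈ Omega E M) : dH H θ ∈ Omega E M := mem_Omega_iff.2 fun x =>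
  (smoothAt_dHl (mem_Omega_iff.1 h x) (contDiffAt_chartRep_center hH x)).congr
    ((eventually_target x).mono fun _ hy => rep_dH H h hy)

theorem cliff_mem {u : M → Gen E} (hu : ∀ x, ContDiffAt ℝ ∞ (genRep u x) (ch E x x))
    {θ : Form E M} (h : θ ∈ Omega E M) : (fun x => cliff (u x) (θ x)) ∈ Omega E M :=
  mem_Omega_iff.2 fun x => (smoothAt_cliff (mem_Omega_iff.1 h x) (hu x)).congr
    ((eventually_target x).mono fun _ hy => rep_cliff u θ hy)

theorem rep_fun_smul (c : M → ℝ) (θ : Form E M) (x : M) :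
    rep (fun z => (c z : ℂ) • θ z) x =
      fun y => ((c ((ch E x).symm y) : ℝ) : ℂ) • rep θ x y :=
  funext fun y => map_smul (pb (bwd E x y)) _ _

theorem contDiffAt_comp_ch_symm {c : M → ℝ} (hc : ContMDiff 𝓘(ℝ, E) 𝓘(ℝ, ℝ) ∞ c) (x : M) :
    ContDiffAt ℝ ∞ (fun y => c ((ch E x).symm y)) (ch E x x) := by
  rw [← contMDiffAt_iff_contDiffAt]
  exact hc.contMDiffAt.comp _ (contMDiffAt_ch_symm (mem_ch_target x))

theorem fun_smul_mem {c : M → ℝ} (hc : ContMDiff 𝓘(ℝ, E) 𝓘(ℝ, ℝ) ∞ c)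
    {θ : Form E M} (h : θ ∈ Omega E M) : (fun z => (c z : ℂ) • θ z) ∈ Omega E M :=
  mem_Omega_iff.2 fun x => by
    rw [rep_fun_smul]
    exact (mem_Omega_iff.1 h x).smul
      (Complex.ofRealCLM.contDiff.contDiffAt.comp _ (contDiffAt_comp_ch_symm hc x))

/-- `d_H` on `Ω(M)`. -/
def dHE {H : M → Alt E ℝ 3} (hH : IsSmooth H) : Module.End ℂ (OmegaS E M) where
  toFun θ := ⟨dH H θ.1, dH_mem hH θ.2⟩
  map_add' θ τ := Subtype.ext <| funext fun x => by
    change dH H (θ.1 + τ.1) x = dH H θ.1 x + dH H τ.1 x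
    rw [dH_eq H (OmegaS E M |>.add_mem θ.2 τ.2), dH_eq H θ.2, dH_eq H τ.2, rep_add,
      dHl_add (mem_Omega_iff.1 θ.2 x) (mem_Omega_iff.1 τ.2 x)]
  map_smul' c θ := Subtype.ext <| funext fun x => by
    change dH H (c • θ.1) x = c • dH H θ.1 x
    rw [dH_eq H (OmegaS E M |>.smul_mem c θ.2), dH_eq H θ.2, rep_smul,
      dHl_const_smul (mem_Omega_iff.1 θ.2 x)]

theorem dHE_mul_dHE {H : M → Alt E ℝ 3} (hH : IsClosedThreeForm H) :
    dHE hH.1 * dHE hH.1 = (0 : Module.End ℂ (OmegaS E M)) := by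
  refine LinearMap.ext fun θ => Subtype.ext <| funext fun x => ?_
  change dH H (dH H θ.1) x = 0
  rw [dH_eq H (dH_mem hH.1 θ.2), dHl_congr ((eventually_target x).mono fun _ hy =>
    rep_dH H θ.2 hy)]
  refine dHl_dHl (mem_Omega_iff.1 θ.2 x) (contDiffAt_chartRep_center hH.1 x) ?_
  rw [← chartRep_extD hH.1 (mem_ch_target x), chartRep_self, hH.2]

/-- The projection of `Ω(M)` onto `Γ(U^k)`. -/
def compE {J : M → Gen E →L[ℝ] Gen E} (hJ : IsSmoothEnd J) (k : ℤ) :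
    Module.End ℂ (OmegaS E M) where
  toFun θ := ⟨component J k θ.1, component_mem hJ k θ.2⟩
  map_add' _ _ := Subtype.ext <| funext fun x => map_add (proj (J x) k) _ _
  map_smul' c _ := Subtype.ext <| funext fun x => map_smul (proj (J x) k) c _

/-- The Clifford action of a smooth section on `Ω(M)`. -/
def cliffE {u : M → Gen E} (hu : ∀ x, ContDiffAt ℝ ∞ (genRep u x) (ch E x x)) :
    Module.End ℂ (OmegaS E M) where
  toFun θ := ⟨fun x => cliff (u x) (θ.1 x), cliff_mem hu θ.2⟩
  map_add' _ _ := Subtype.ext <| funext fun x => map_add (cliff (u x)) _ _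
  map_smul' c _ := Subtype.ext <| funext fun x => map_smul (cliff (u x)) c _

/-- Multiplication by a smooth function on `Ω(M)`. -/
def mulE {c : M → ℝ} (hc : ContMDiff 𝓘(ℝ, E) 𝓘(ℝ, ℝ) ∞ c) : Module.End ℂ (OmegaS E M) where
  toFun θ := ⟨fun z => (c z : ℂ) • θ.1 z, fun_smul_mem hc θ.2⟩
  map_add' _ _ := Subtype.ext <| funext fun _ => smul_add _ _ _
  map_smul' a θ := Subtype.ext <| funext fun x => smul_comm (c x : ℂ) a (θ.1 x)

section GenComplex

variable {H : M → Alt E ℝ 3} {J : M → Gen E →L[ℝ] Gen E}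

theorem IsGenComplex.isSkew (hJ : IsGenComplex H J) (x : M) : IsSkew (J x) :=
  isSkew_of_orthogonal (hJ.orthogonal x) (hJ.sq_eq x)

variable (E) in
/-- The range of degrees of the grading. -/
abbrev degs : Finset ℤ := Finset.Icc (-halfDim E) (halfDim E)

theorem isGrading_compE (hJ : IsGenComplex H J) : IsGrading (degs E) (compE hJ.smooth) where
  mul k l := by
    refine LinearMap.ext fun θ => Subtype.ext <| funext fun x => ?_
    refine (proj_proj (hJ.isSkew x) (hJ.sq_eq x) k l (θ.1 x)).trans ?_
    split_ifs <;> rfl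
  zero k hk := by
    refine LinearMap.ext fun θ => Subtype.ext <| funext fun x => ?_
    exact congrArg (fun D : Module.End ℂ (Spinor E) => D (θ.1 x))
      (proj_eq_zero (hJ.isSkew x) (hJ.sq_eq x) hk)
  sum := by
    refine LinearMap.ext fun θ => Subtype.ext <| funext fun x => ?_
    have h1 := congrArg (fun D : Module.End ℂ (Spinor E) => D (θ.1 x)) (sum_proj (J x))
    simp only [LinearMap.sum_apply, Module.End.one_apply] at h1 ⊢
    rw [← h1, AddSubmonoidClass.coe_finsetSum, Finset.sum_apply]
    rfl

/-- The local vanishing result is applied at `x` in the chart at `x`, where `J` and `H` keep their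
values and integrability kills the Nijenhuis tensor. -/
theorem compE_dHE_compE [T2Space M] (hH : IsSmooth H) (hJ : IsGenComplex H J) {k l : ℤ}
    (hkl : k ≠ l + 1) (hkl' : k ≠ l - 1) :
    compE hJ.smooth k * (dHE hH * compE hJ.smooth l) = 0 := by
  refine LinearMap.ext fun θ => Subtype.ext <| funext fun x => ?_
  change proj (J x) k (dH H (component J l θ.1) x) = 0
  have h1 := proj_dHl_proj (H := chartRep H x) (J := repJ J x) (mem_Omega_iff.1 θ.2 x)
    (contDiffAt_repJ hJ.smooth (mem_ch_target x))
    ((eventually_target x).mono fun y hy => repJ_skew hJ.isSkew hy)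
    ((eventually_target x).mono fun y hy => repJ_sq hJ.sq_eq hy)
    (by
      rw [chartRep_self, repJ_self]
      exact jetNijenhuis_eq_zero hJ x) hkl hkl'
  rw [repJ_self] at h1
  rw [dH_eq H (component_mem hJ.smooth l θ.2), dHl_congr ((eventually_target x).mono fun y hy =>
    rep_component J l θ.1 hy), h1]

/-- `∂` on `Ω(M)`. -/
def delE (hH : IsSmooth H) (hJ : IsGenComplex H J) : Module.End ℂ (OmegaS E M) :=
  degPart (degs E) (compE hJ.smooth) (-1) (dHE hH)

/-- `∂̄` on `Ω(M)`. -/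
def delbarE (hH : IsSmooth H) (hJ : IsGenComplex H J) : Module.End ℂ (OmegaS E M) :=
  degPart (degs E) (compE hJ.smooth) 1 (dHE hH)

theorem delE_apply (hH : IsSmooth H) (hJ : IsGenComplex H J) (θ : OmegaS E M) :
    (delE hH hJ θ : Form E M) = del H J θ.1 := by
  rw [delE, degPart, LinearMap.sum_apply, AddSubmonoidClass.coe_finsetSum]
  rfl

theorem delbarE_apply (hH : IsSmooth H) (hJ : IsGenComplex H J) (θ : OmegaS E M) :
    (delbarE hH hJ θ : Form E M) = delbar H J θ.1 := by
  rw [delbarE, degPart, LinearMap.sum_apply, AddSubmonoidClass.coe_finsetSum]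
  rfl

theorem hasDeg_delE (hH : IsSmooth H) (hJ : IsGenComplex H J) :
    HasDeg (compE hJ.smooth) (-1) (delE hH hJ) := (isGrading_compE hJ).hasDeg_degPart _ _

theorem hasDeg_delbarE (hH : IsSmooth H) (hJ : IsGenComplex H J) :
    HasDeg (compE hJ.smooth) 1 (delbarE hH hJ) := (isGrading_compE hJ).hasDeg_degPart _ _

theorem delE_add_delbarE [T2Space M] (hH : IsSmooth H) (hJ : IsGenComplex H J) :
    delE hH hJ + delbarE hH hJ = dHE hH :=
  (isGrading_compE hJ).degPart_add fun _ _ h h' => compE_dHE_compE hH hJ h h'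

/-- These are the components by degree of `d_H² = 0`. -/
theorem delE_sq [T2Space M] (hH : IsClosedThreeForm H) (hJ : IsGenComplex H J) :
    delE hH.1 hJ * delE hH.1 hJ = 0 ∧ delbarE hH.1 hJ * delbarE hH.1 hJ = 0 ∧
      delE hH.1 hJ * delbarE hH.1 hJ + delbarE hH.1 hJ * delE hH.1 hJ = 0 :=
  (isGrading_compE hJ).sq_eq_zero (hasDeg_delE hH.1 hJ) (hasDeg_delbarE hH.1 hJ)
    (by rw [delE_add_delbarE, dHE_mul_dHE hH])

end GenComplex

section Pullback

variable {G : Type*} [Group G] [MulAction G M]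

theorem actMap_comp (hG : ∀ g : G, ContMDiff 𝓘(ℝ, E) 𝓘(ℝ, E) ∞ (fun z : M => g • z))
    (g h : G) (x : M) :
    actMap E g (h • x) ∘L actMap E h x = actMap E (g * h) x := by
  have := tmap_comp (((hG g) (h • x)).mdifferentiableAt (by simp))
    (((hG h) x).mdifferentiableAt (by simp))
  rw [actMap, actMap, ← this, actMap]
  simp only [mul_smul]

theorem actMap_one (x : M) : actMap E (1 : G) x = ContinuousLinearMap.id ℝ E := by
  rw [actMap]
  simp only [one_smul]
  exact tmap_id x

theorem actMap_inv_comp (hG : ∀ g : G, ContMDiff 𝓘(ℝ, E) 𝓘(ℝ, E) ∞ (fun z : M => g • z))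
    (g : G) (x : M) :
    actMap E g⁻¹ (g • x) ∘L actMap E g x = ContinuousLinearMap.id ℝ E := by
  rw [actMap_comp hG, inv_mul_cancel, actMap_one]

theorem actMap_comp_inv (hG : ∀ g : G, ContMDiff 𝓘(ℝ, E) 𝓘(ℝ, E) ∞ (fun z : M => g • z))
    (g : G) (x : M) :
    actMap E g x ∘L actMap E g⁻¹ (g • x) = ContinuousLinearMap.id ℝ E := by
  have := actMap_comp hG g g⁻¹ (g • x)
  rwa [inv_smul_smul, mul_inv_cancel, actMap_one] at this

theorem pullback_mem (hG : ∀ g : G, ContMDiff 𝓘(ℝ, E) 𝓘(ℝ, E) ∞ (fun z : M => g • z))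
    (g : G) {θ : Form E M} (h : θ ∈ Omega E M) : pullback g θ ∈ Omega E M :=
  fun k => isSmooth_pullForm (hG g) (h k)

theorem pullback_pullback (hG : ∀ g : G, ContMDiff 𝓘(ℝ, E) 𝓘(ℝ, E) ∞ (fun z : M => g • z))
    (g h : G) (θ : Form E M) :
    pullback g (pullback h θ) = pullback (h * g) θ := by
  funext x
  have h1 : pullback g (pullback h θ) x =
    pb (actMap E g x) (pb (actMap E h (g • x)) (θ (h • (g • x)))) := rfl
  have h2 : pullback (h * g) θ x = pb (actMap E (h * g) x) (θ ((h * g) • x)) := rfl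
  rw [h1, h2, pb_pb, actMap_comp hG, mul_smul]

/-- Pullback on `Ω(M)`. -/
def pullE (hG : ∀ g : G, ContMDiff 𝓘(ℝ, E) 𝓘(ℝ, E) ∞ (fun z : M => g • z))
    (g : G) : Module.End ℂ (OmegaS E M) where
  toFun θ := ⟨pullback g θ.1, pullback_mem hG g θ.2⟩
  map_add' _ _ := rfl
  map_smul' _ _ := rfl

variable {H : M → Alt E ℝ 3} {J : M → Gen E →L[ℝ] Gen E}

theorem pullE_dHE (hG : ∀ g : G, ContMDiff 𝓘(ℝ, E) 𝓘(ℝ, E) ∞ (fun z : M => g • z))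
    (hH : IsSmooth H) (hGH : PreservesH G H) (g : G) :
    pullE hG g * dHE hH = dHE hH * pullE hG g := by
  refine LinearMap.ext fun θ => Subtype.ext <| funext fun x => ?_
  change pb (actMap E g x) (d θ.1 (g • x) - wedge3 (H (g • x)) (θ.1 (g • x))) =
    d (pullback g θ.1) x - wedge3 (H x) (pb (actMap E g x) (θ.1 (g • x)))
  rw [map_sub]
  congr 1
  · funext k
    cases k with
    | zero => rfl
    | succ k =>
      exact (congrFun (extD_pullForm (hG g) (θ.2 k)) x).symm
  · rw [← hGH g x]
    exact (congrArg (fun D : Module.End ℂ (Spinor E) => D (θ.1 (g • x)))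
      (wedge3_pb (actMap_comp_inv hG g x) (actMap_inv_comp hG g x) (H (g • x)))).symm

theorem pullE_compE (hG : ∀ g : G, ContMDiff 𝓘(ℝ, E) 𝓘(ℝ, E) ∞ (fun z : M => g • z))
    (hJ : IsSmoothEnd J) (hGJ : PreservesJ G J) (g : G) (k : ℤ) :
    pullE hG g * compE hJ k = compE hJ k * pullE hG g := by
  refine LinearMap.ext fun θ => Subtype.ext <| funext fun x => ?_
  have h1 : genMap (actMap E g⁻¹ (g • x)) (actMap E g x) ∘L J (g • x) ∘L
      genMap (actMap E g x) (actMap E g⁻¹ (g • x)) = J x := by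
    rw [← hGJ g x]
    refine ContinuousLinearMap.ext fun u => ?_
    exact genMap_genMap (actMap_inv_comp hG g x) (J x u)
  have h2 := proj_pb (actMap_comp_inv hG g x) (actMap_inv_comp hG g x) (J (g • x)) k
  rw [h1] at h2
  exact (congrArg (fun D : Module.End ℂ (Spinor E) => D (θ.1 (g • x))) h2).symm

theorem pullE_degPart (hG : ∀ g : G, ContMDiff 𝓘(ℝ, E) 𝓘(ℝ, E) ∞ (fun z : M => g • z))
    (hH : IsSmooth H) (hJ : IsSmoothEnd J) (hGH : PreservesH G H)
    (hGJ : PreservesJ G J) (g : G) (j : ℤ) :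
    pullE hG g * degPart (degs E) (compE hJ) j (dHE hH) =
      degPart (degs E) (compE hJ) j (dHE hH) * pullE hG g := by
  rw [degPart, Finset.mul_sum, Finset.sum_mul]
  refine Finset.sum_congr rfl fun k _ => ?_
  rw [← mul_assoc, pullE_compE hG hJ hGJ, mul_assoc, ← mul_assoc (pullE hG g), pullE_dHE hG hH hGH,
    mul_assoc (dHE hH), pullE_compE hG hJ hGJ]
  simp only [mul_assoc]

end Pullback

end Operators

/-! ### Commutators with an element of degree zero -/

section GradedAlgebra

variable {R : Type*} [Ring R] [Algebra ℂ R] {s : Finset ℤ} {π : ℤ → R}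

theorem HasDeg.smul {i : ℤ} {X : R} (hX : HasDeg π i X) (c : ℂ) : HasDeg π i (c • X) := fun k => by
  rw [mul_smul_comm, smul_mul_assoc, hX]

theorem HasDeg.commutator {j : ℤ} {X F : R} (hX : HasDeg π j X) (hF : HasDeg π 0 F) :
    HasDeg π j (X * F - F * X) := by
  have h1 := hX.mul hF
  have h2 := hF.mul hX
  rw [zero_add] at h1
  rw [add_zero] at h2
  rw [sub_eq_add_neg]
  exact h1.add h2.neg

/-- The part of degree `-1` of a commutator. -/
theorem IsGrading.commutator_eq (h : IsGrading s π) {P Q F a b : R} (hP : HasDeg π (-1) P)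
    (hQ : HasDeg π 1 Q) (hF : HasDeg π 0 F) (hA : HasDeg π (-1) (Complex.I • b - a))
    (hA' : HasDeg π 1 (Complex.I • b + a)) (hb : (P + Q) * F - F * (P + Q) = b) :
    Complex.I • b - a = (2 * Complex.I) • (P * F - F * P) := by
  -- Both `2√-1 [P, F] + 2√-1 [Q, F]` and `(√-1 b - a) + (√-1 b + a)` are decompositions of `2√-1 b`
  -- by degrees `-1` and `1`.
  have h1 := ((hP.commutator hF).smul (2 * Complex.I)).add hA.neg
  have h2 := ((hQ.commutator hF).smul (2 * Complex.I)).add hA'.neg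
  have h3 := h.eq_zero_of_add (i := -1) (j := 1) (by decide) h1 h2 (Z := 0)
    (by simp) (by
      rw [← hb, add_mul, mul_add]
      module)
  exact (add_neg_eq_zero.1 h3).symm

/-- When `P² = 0`, both `P [P, F]` and `-[P, F] P` are equal to `-P F P`. -/
theorem mul_commutator_of_sq_eq_zero {P F A : R} (hP : P * P = 0) {c : ℂ}
    (hA : A = c • (P * F - F * P)) : P * A = -(A * P) := by
  rw [hA, mul_smul_comm, smul_mul_assoc, ← smul_neg]
  congr 1
  rw [mul_sub, sub_mul, ← mul_assoc, hP, zero_mul, mul_assoc F, hP, mul_zero, mul_assoc]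
  abel

/-- `A` anticommutes with `P` and commutes with `F`, so it anticommutes with `[P, F]`, and therefore
with itself. -/
theorem sq_commutator_eq_zero {P F A : R} (hP : P * P = 0) {c : ℂ}
    (hA : A = c • (P * F - F * P)) (hAF : A * F = F * A) : A * A = 0 := by
  have h1 := mul_commutator_of_sq_eq_zero hP hA
  have h4 : (P * F - F * P) * A = -(A * (P * F - F * P)) := by
    rw [sub_mul, mul_sub, mul_assoc, ← hAF, ← mul_assoc, h1, mul_assoc F, h1, ← mul_assoc A F, hAF]
    noncomm_ring
  have h5 : A * A = -(A * A) := by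
    conv_lhs => rw [hA, smul_mul_assoc, ← hA, h4, smul_neg, ← mul_smul_comm, ← hA]
  have h6 : (2 : ℂ) • (A * A) = 0 := by
    rw [two_smul]
    nth_rewrite 1 [h5]
    exact neg_add_cancel _
  have h7 := congrArg (fun X => (2⁻¹ : ℂ) • X) h6
  simpa [smul_smul] using h7

/-- The anticommutator of `∂̄` and `𝒜`. -/
theorem anticommutator_eq {P Q D F A a b : R} (hD : D * D = 0) (hPQ : P + Q = D)
    (hb : D * F - F * D = b) (hA : A = Complex.I • b - a) (hPA : P * A = -(A * P)) :
    Q * A + A * Q = -(D * a + a * D) := by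
  -- As `P` anticommutes with `A`, `Q` may be replaced by `D`. The part `√-1 b` of `A` then drops
  -- out, because `b = [D, F]` anticommutes with `D`.
  have h1 : Q * A + A * Q = D * A + A * D := by
    rw [← hPQ, add_mul, mul_add, hPA]
    abel
  have h2 : D * b = -(b * D) := mul_commutator_of_sq_eq_zero (c := 1) hD (by rw [one_smul, hb])
  rw [h1, hA, mul_sub, sub_mul, mul_smul_comm, smul_mul_assoc, h2]
  module

end GradedAlgebra

/-! ### Hamiltonian sections and the operator `𝒜` -/

section Moment

variable {E : Type*} [NormedAddCommGroup E] [NormedSpace ℝ E] [FiniteDimensional ℝ E]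
  {M : Type*} [TopologicalSpace M] [ChartedSpace E M] [IsManifold 𝓘(ℝ, E) ∞ M]

/-- The differential of a function, as a section of `TM ⊕ T*M`. -/
def dSec (φ : M → ℝ) (x : M) : Gen E := (0, dFun φ x)

variable {φ : M → ℝ}

theorem genRep_dSec (hφ : ContMDiff 𝓘(ℝ, E) 𝓘(ℝ, ℝ) ∞ φ) {x₀ : M} {y : E}
    (hy : y ∈ (ch E x₀).target) :
    genRep (dSec (E := E) φ) x₀ y = (0, fderiv ℝ (fun y => φ ((ch E x₀).symm y)) y) := by
  refine Prod.ext (map_zero (fwd E x₀ ((ch E x₀).symm y))) ?_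
  change dFun φ ((ch E x₀).symm y) ∘L bwd E x₀ y = _
  rw [dFun, ← tmap_comp (hφ.contMDiffAt.mdifferentiableAt (by simp))
    ((contMDiffAt_ch_symm hy).mdifferentiableAt (by simp)), tmap_eq_fderiv]

theorem contDiffAt_genRep_dSec (hφ : ContMDiff 𝓘(ℝ, E) 𝓘(ℝ, ℝ) ∞ φ) (x : M) :
    ContDiffAt ℝ ∞ (genRep (dSec (E := E) φ) x) (ch E x x) :=
  (contDiffAt_const.prodMk ((contDiffAt_comp_ch_symm hφ x).fderiv_right
    (m := ∞) (by simp))).congr_of_eventuallyEq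
    ((eventually_target x).mono fun _ hy => genRep_dSec hφ hy)

theorem sum_wedge_coord (ξ : E →L[ℝ] ℝ) (ρ : Spinor E) :
    ∑ a, wedge (covec E a) (((ξ (vec E a) : ℝ) : ℂ) • ρ) = wedge ξ ρ := by
  have h1 : ξ = ∑ a, ξ (vec E a) • covec E a := by
    refine ContinuousLinearMap.ext fun w => ?_
    conv_lhs => rw [← sum_coord_smul_vec w, map_sum]
    rw [sum_apply]
    refine Finset.sum_congr rfl fun a _ => ?_
    rw [map_smul, smul_apply, smul_eq_mul, smul_eq_mul, mul_comm]
  have h2 : ∀ ζ : E →L[ℝ] ℝ, cliff (0, ζ) ρ = wedge ζ ρ := fun ζ => by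
    rw [cliff, LinearMap.add_apply]
    have : interior (0 : E) ρ = 0 := by
      funext k
      exact map_zero (ρ (k + 1)).curryLeft
    rw [this, zero_add]
  have h3 : ((0, ξ) : Gen E) = ∑ a, ξ (vec E a) • ((0, covec E a) : Gen E) := by
    refine Prod.ext ?_ ?_
    · rw [Prod.fst_sum]
      simp
    · rw [Prod.snd_sum]
      exact h1
  rw [← h2, h3, cliff_sum, LinearMap.sum_apply]
  refine Finset.sum_congr rfl fun a _ => ?_
  rw [cliff_smul, LinearMap.smul_apply, h2, map_smul]

/-- The commutator of `d_H` and of the multiplication by a function. -/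
theorem dHE_mul_mulE {H : M → Alt E ℝ 3} (hH : IsSmooth H)
    (hφ : ContMDiff 𝓘(ℝ, E) 𝓘(ℝ, ℝ) ∞ φ) :
    dHE hH * mulE hφ - mulE hφ * dHE hH = cliffE (contDiffAt_genRep_dSec (E := E) hφ) := by
  refine LinearMap.ext fun θ => Subtype.ext <| funext fun x => ?_
  change dH H (fun z => (φ z : ℂ) • θ.1 z) x - (φ x : ℂ) • dH H θ.1 x =
    cliff (dSec φ x) (θ.1 x)
  rw [dH_eq H (fun_smul_mem hφ θ.2), dH_eq H θ.2, rep_fun_smul, ← genRep_self (dSec φ) x,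
    genRep_dSec hφ (mem_ch_target x), ← rep_self θ.1 x]
  set ρ := rep θ.1 x
  set y := ch E x x with hy
  set c := fun y => φ ((ch E x).symm y) with hc
  have hcy : ContDiffAt ℝ ∞ c y := contDiffAt_comp_ch_symm hφ x
  have h1 : φ x = c y := by rw [hc, hy]; simp only [ch_symm_self]
  have h0 : (fun y => ((φ ((ch E x).symm y) : ℝ) : ℂ) • ρ y) = fun z => ((c z : ℝ) : ℂ) • ρ z := rfl
  have hd : HasFDerivAt (fun z => ((c z : ℝ) : ℂ)) (Complex.ofRealCLM ∘L fderiv ℝ c y) y :=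
    Complex.ofRealCLM.hasFDerivAt.comp y (hcy.differentiableAt (by simp)).hasFDerivAt
  have h2 : ∀ v, pd (fun z => ((c z : ℝ) : ℂ) • ρ z) y v =
      ((fderiv ℝ c y v : ℝ) : ℂ) • ρ y + ((c y : ℝ) : ℂ) • pd ρ y v := fun v => by
    rw [pd_smul (mem_Omega_iff.1 θ.2 x) hd.differentiableAt, hd.fderiv]
    rfl
  have h3 : cliff (0, fderiv ℝ c y) (ρ y) = wedge (fderiv ℝ c y) (ρ y) := by
    rw [cliff, LinearMap.add_apply]
    have : interior (0 : E) (ρ y) = 0 := by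
      funext k
      exact map_zero (ρ y (k + 1)).curryLeft
    rw [this, zero_add]
  rw [h0, h1, h3, ← sum_wedge_coord]
  clear_value c
  simp only [dHl, dl, h2, map_add, map_smul, Finset.sum_add_distrib, smul_sub, Finset.smul_sum]
  abel

variable {H : M → Alt E ℝ 3} {J : M → Gen E →L[ℝ] Gen E}

theorem compE_mul_mulE (hJ : IsGenComplex H J) (hφ : ContMDiff 𝓘(ℝ, E) 𝓘(ℝ, ℝ) ∞ φ) :
    HasDeg (compE hJ.smooth) 0 (mulE (E := E) hφ) := by
  intro k
  refine LinearMap.ext fun θ => Subtype.ext <| funext fun x => ?_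
  rw [add_zero]
  exact map_smul (proj (J x) k) (φ x : ℂ) (θ.1 x)

/-- This yields smoothness of `ξ_M + η^ξ` as `-J` of the smooth section `df^ξ`, without examining
the action. -/
theorem contDiffAt_genRep_of_J {u v : M → Gen E} (hJ : IsGenComplex H J)
    (hv : ∀ x, ContDiffAt ℝ ∞ (genRep v x) (ch E x x)) (hu : ∀ x, J x (v x) = -u x) (x : M) :
    ContDiffAt ℝ ∞ (genRep u x) (ch E x x) := by
  refine (((contDiffAt_repJ hJ.smooth (mem_ch_target x)).clm_apply
    (hv x)).neg).congr_of_eventuallyEq ((eventually_target x).mono fun y hy => ?_)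
  simp only [← genRep_end J v hy, hu]
  simp only [genRep, map_neg, neg_neg]

/-- The data of a Hamiltonian section: `J u = dφ` and `ι_X H = dη` for `u = X + η`. -/
structure IsHamiltonian (H : M → Alt E ℝ 3) (J : M → Gen E →L[ℝ] Gen E) (φ : M → ℝ)
    (u : M → Gen E) : Prop where
  smooth : ContMDiff 𝓘(ℝ, E) 𝓘(ℝ, ℝ) ∞ φ
  map_eq : ∀ x, J x (u x) = dSec φ x
  map_dSec : ∀ x, J x (dSec φ x) = -u x
  interior_eq : ∀ x, (H x).curryLeft (u x).1 = extD (fun z => oneForm (u z).2) x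

namespace IsHamiltonian

variable {u : M → Gen E}

theorem contDiffAt (h : IsHamiltonian H J φ u) (hJ : IsGenComplex H J) (x : M) :
    ContDiffAt ℝ ∞ (genRep u x) (ch E x x) :=
  contDiffAt_genRep_of_J hJ (contDiffAt_genRep_dSec h.smooth) h.map_dSec x

/-- The operator `𝒜 = -u + √-1 dφ`. -/
def opA (h : IsHamiltonian H J φ u) (hJ : IsGenComplex H J) : Module.End ℂ (OmegaS E M) :=
  Complex.I • cliffE (contDiffAt_genRep_dSec h.smooth) - cliffE (h.contDiffAt hJ)

theorem opA_apply (h : IsHamiltonian H J φ u) (hJ : IsGenComplex H J) (θ : OmegaS E M) (x : M) :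
    (h.opA hJ θ).1 x = cliffC ⟨-u x, dSec φ x⟩ (θ.1 x) := by
  rw [cliffC, cliff_neg, LinearMap.add_apply, LinearMap.neg_apply, neg_add_eq_sub]
  rfl

/-- `𝒜` is minus the Clifford action of `u - √-1 J u`, an element of `L`. -/
theorem hasDeg_opA (h : IsHamiltonian H J φ u) (hJ : IsGenComplex H J) :
    HasDeg (compE hJ.smooth) (-1) (h.opA hJ) := by
  intro k
  refine LinearMap.ext fun θ => Subtype.ext <| funext fun x => ?_
  have h1 := spin_mul_lower (hJ.isSkew x) (hJ.sq_eq x) (u x)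
  have h2 := proj_mul_of_degree (hJ.isSkew x) (hJ.sq_eq x) (D := lower (J x) (u x)) (j := -1)
    (by rw [h1]; simp) k (θ.1 x)
  have h3 : ∀ ρ, Complex.I • cliff (dSec φ x) ρ - cliff (u x) ρ = -lower (J x) (u x) ρ := by
    intro ρ
    rw [lower, h.map_eq, LinearMap.sub_apply, neg_sub]
    rfl
  change proj (J x) (k + -1) (Complex.I • cliff (dSec φ x) (θ.1 x) - cliff (u x) (θ.1 x)) =
    Complex.I • cliff (dSec φ x) (proj (J x) k (θ.1 x)) - cliff (u x) (proj (J x) k (θ.1 x))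
  rw [h3, h3, map_neg, h2]

/-- This is the action of `u + √-1 J u`, in the conjugate of `L`. It is needed to recognize the part
of degree `1` of the commutator of `d_H` with `φ`. -/
theorem hasDeg_conj (h : IsHamiltonian H J φ u) (hJ : IsGenComplex H J) :
    HasDeg (compE hJ.smooth) 1
      (Complex.I • cliffE (contDiffAt_genRep_dSec h.smooth) + cliffE (h.contDiffAt hJ)) := by
  intro k
  refine LinearMap.ext fun θ => Subtype.ext <| funext fun x => ?_
  have h1 := eq_add_of_sub_eq (spin_mul_cliff (hJ.isSkew x) (u x))
  have h2 := eq_add_of_sub_eq (spin_mul_cliff (hJ.isSkew x) (dSec φ x))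
  rw [h.map_eq] at h1
  rw [h.map_dSec, cliff_neg] at h2
  have h4 := proj_mul_of_degree (hJ.isSkew x) (hJ.sq_eq x)
    (D := Complex.I • cliff (dSec φ x) + cliff (u x)) (j := 1)
    (by
      rw [mul_add, add_mul, mul_smul_comm, smul_mul_assoc, h1, h2, smul_add, smul_add, smul_smul,
        Int.cast_one, neg_one_mul, neg_mul, Complex.I_mul_I, smul_neg]
      module) k (θ.1 x)
  exact h4

/-- The central identity: anticommutation of `𝒜` with `∂`, `𝒜² = 0`, stability of `U_G` under `𝒜`
and the second half of the deformation argument are all drawn from it. -/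
theorem two_I_smul_commutator [T2Space M] (h : IsHamiltonian H J φ u) (hH : IsSmooth H)
    (hJ : IsGenComplex H J) :
    h.opA hJ = (2 * Complex.I) • (delE hH hJ * mulE h.smooth - mulE h.smooth * delE hH hJ) :=
  (isGrading_compE hJ).commutator_eq (hasDeg_delE hH hJ) (hasDeg_delbarE hH hJ)
    (compE_mul_mulE hJ h.smooth) (h.hasDeg_opA hJ) (h.hasDeg_conj hJ)
    (by rw [delE_add_delbarE hH hJ]; exact dHE_mul_mulE hH h.smooth)

theorem opA_mul_mulE (h : IsHamiltonian H J φ u) (hJ : IsGenComplex H J) :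
    h.opA hJ * mulE h.smooth = mulE h.smooth * h.opA hJ := by
  refine LinearMap.ext fun θ => Subtype.ext <| funext fun x => ?_
  change Complex.I • cliff (dSec φ x) ((φ x : ℂ) • θ.1 x) - cliff (u x) ((φ x : ℂ) • θ.1 x) =
    (φ x : ℂ) • (Complex.I • cliff (dSec φ x) (θ.1 x) - cliff (u x) (θ.1 x))
  rw [map_smul, map_smul, smul_sub, smul_comm Complex.I]

theorem delE_mul_opA [T2Space M] (h : IsHamiltonian H J φ u) (hH : IsClosedThreeForm H)
    (hJ : IsGenComplex H J) :
    delE hH.1 hJ * h.opA hJ = -(h.opA hJ * delE hH.1 hJ) :=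
  mul_commutator_of_sq_eq_zero (R := Module.End ℂ (OmegaS E M)) (delE_sq hH hJ).1 (h.two_I_smul_commutator hH.1 hJ)

theorem opA_sq [T2Space M] (h : IsHamiltonian H J φ u) (hH : IsClosedThreeForm H)
    (hJ : IsGenComplex H J) : h.opA hJ * h.opA hJ = 0 :=
  sq_commutator_eq_zero (R := Module.End ℂ (OmegaS E M)) (delE_sq hH hJ).1 (h.two_I_smul_commutator hH.1 hJ) (h.opA_mul_mulE hJ)

theorem dHE_mul_cliffE {v : M → Gen E} (hH : IsSmooth H)
    (hv : ∀ x, ContDiffAt ℝ ∞ (genRep v x) (ch E x x))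
    (hd : ∀ x, (H x).curryLeft (v x).1 = extD (fun z => oneForm (v z).2) x)
    (θ : OmegaS E M) (x : M) :
    ((dHE hH * cliffE hv + cliffE hv * dHE hH) θ).1 x =
      lieD (fun y => (genRep v x y).1) (rep θ.1 x) (ch E x x) := by
  change dH H (fun z => cliff (v z) (θ.1 z)) x + cliff (v x) (dH H θ.1 x) = _
  have hc : chartRep (fun z => oneForm (v z).2) x = fun z => oneForm (genRep v x z).2 :=
    funext fun z => chartRep_oneForm _ x z
  rw [dH_eq H (cliff_mem hv θ.2), dH_eq H θ.2, dHl_congr ((eventually_target x).mono fun y hy =>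
    rep_cliff v θ.1 hy)]
  have h1 := dHl_cliff_add (H := chartRep H x) (mem_Omega_iff.1 θ.2 x) (hv x) (by
    rw [chartRep_self, genRep_self, hd, extD_eq, hc])
  rw [genRep_self] at h1
  exact h1

/-- `∂̄ 𝒜 + 𝒜 ∂̄ = -L_X`. -/
theorem delbarE_mul_opA [T2Space M] (h : IsHamiltonian H J φ u) (hH : IsClosedThreeForm H)
    (hJ : IsGenComplex H J) (θ : OmegaS E M) (x : M) :
    ((delbarE hH.1 hJ * h.opA hJ + h.opA hJ * delbarE hH.1 hJ) θ).1 x =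
      -lieD (fun y => (genRep u x y).1) (rep θ.1 x) (ch E x x) := by
  have h1 := anticommutator_eq (dHE_mul_dHE hH) (delE_add_delbarE hH.1 hJ)
    (dHE_mul_mulE hH.1 h.smooth) (A := h.opA hJ) rfl (h.delE_mul_opA hH hJ)
  refine (congrArg (fun D : Module.End ℂ (OmegaS E M) => (D θ).1 x) h1).trans ?_
  exact congrArg Neg.neg (dHE_mul_cliffE hH.1 (h.contDiffAt hJ) h.interior_eq θ x)

end IsHamiltonian

end Moment

section MomentMap

variable {E : Type*} [NormedAddCommGroup E] [NormedSpace ℝ E]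
  {M : Type*} [TopologicalSpace M] [ChartedSpace E M] [IsManifold 𝓘(ℝ, E) ∞ M]
  {EG : Type*} [NormedAddCommGroup EG] [NormedSpace ℝ EG]
  {G : Type*} [TopologicalSpace G] [ChartedSpace EG G] [Group G] [MulAction G M]
  {H : M → Alt E ℝ 3} {J : M → Gen E →L[ℝ] Gen E}
  {f : M → Module.Dual ℝ (Lie𝔤 EG G)} {η : M → Lie𝔤 EG G →ₗ[ℝ] (E →L[ℝ] ℝ)}

theorem IsMomentMap.isHamiltonian (h : IsMomentMap H J f η) (ξ : Lie𝔤 EG G) :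
    IsHamiltonian H J (fun x => f x ξ) (fun x => (fundField ξ x, η x ξ)) where
  smooth := h.smooth ξ
  map_eq x := by
    rw [(h.mem_L ξ x).1]
    simp [dSec]
  map_dSec x := by
    have h1 : dSec (E := E) (fun x => f x ξ) x = -(0, -dFun (fun z => f z ξ) x) := by
      simp [dSec]
    rw [h1, map_neg, (h.mem_L ξ x).2]
  interior_eq := h.interior_eq ξ

end MomentMap

/-! ### Families of maps depending smoothly on a group element -/

section Families

variable (EG : Type*) [NormedAddCommGroup EG] [NormedSpace ℝ EG]
  {G : Type*} [TopologicalSpace G] [ChartedSpace EG G]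
  {E : Type*} [NormedAddCommGroup E] [NormedSpace ℝ E]
  {V : Type*} [NormedAddCommGroup V] [NormedSpace ℝ V]

/-- The family of maps `F g` is smooth near `(g₀, y₀)`, jointly in the parameter `g` and the
variable. -/
def JSmoothAt (F : G → E → V) (g₀ : G) (y₀ : E) : Prop :=
  ContDiffAt ℝ ∞ (fun p : EG × E => F ((ch EG g₀).symm p.1) p.2) (ch EG g₀ g₀, y₀)

namespace JSmoothAt

variable {EG} {F : G → E → V} {g₀ : G} {y₀ : E}

theorem eventually_differentiableAt (h : JSmoothAt EG F g₀ y₀) :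
    ∀ᶠ p in nhds (ch EG g₀ g₀, y₀),
      DifferentiableAt ℝ (fun p : EG × E => F ((ch EG g₀).symm p.1) p.2) p := by
  have h1 : ContDiffAt ℝ 1 (fun p : EG × E => F ((ch EG g₀).symm p.1) p.2) (ch EG g₀ g₀, y₀) :=
    h.of_le (by exact mod_cast le_top)
  exact (h1.eventually (by simp)).mono fun z hz => hz.differentiableAt (by simp)

theorem hasFDerivAt_right {p : EG × E}
    (h : DifferentiableAt ℝ (fun p : EG × E => F ((ch EG g₀).symm p.1) p.2) p) :
    HasFDerivAt (F ((ch EG g₀).symm p.1))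
      (fderiv ℝ (fun p : EG × E => F ((ch EG g₀).symm p.1) p.2) p ∘L
        ContinuousLinearMap.inr ℝ EG E) p.2 :=
  HasFDerivAt.comp (f := fun y => (p.1, y)) p.2 h.hasFDerivAt (hasFDerivAt_prodMk_right p.1 p.2)

theorem fderiv_eventuallyEq (h : JSmoothAt EG F g₀ y₀) :
    (fun p : EG × E => fderiv ℝ (F ((ch EG g₀).symm p.1)) p.2) =ᶠ[nhds (ch EG g₀ g₀, y₀)]
      fun p => fderiv ℝ (fun p : EG × E => F ((ch EG g₀).symm p.1) p.2) p ∘L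
        ContinuousLinearMap.inr ℝ EG E :=
  h.eventually_differentiableAt.mono fun _ hp => (hasFDerivAt_right hp).fderiv

/-- Stability under differentiation in the second variable permits repeated differentiation under
the integral sign. -/
protected theorem fderiv (h : JSmoothAt EG F g₀ y₀) :
    JSmoothAt EG (fun g y => fderiv ℝ (F g) y) g₀ y₀ :=
  ((h.fderiv_right (m := ∞) (by simp)).clm_comp contDiffAt_const).congr_of_eventuallyEq
    h.fderiv_eventuallyEq

theorem contDiffAt (h : JSmoothAt EG F g₀ y₀) : ContDiffAt ℝ ∞ (F g₀) y₀ := by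
  have h1 : ContDiffAt ℝ ∞ (fun y : E => (ch EG g₀ g₀, y)) y₀ :=
    contDiffAt_const.prodMk contDiffAt_id
  have h2 := ContDiffAt.comp y₀ (show ContDiffAt ℝ ∞ _ (ch EG g₀ g₀, y₀) from h) h1
  refine h2.congr_of_eventuallyEq (Filter.Eventually.of_forall fun y => ?_)
  simp only [Function.comp_apply, ch_symm_self]

theorem continuousAt (h : JSmoothAt EG F g₀ y₀) :
    ContinuousAt (fun p : G × E => F p.1 p.2) (g₀, y₀) := by
  have h1 : ContinuousAt (fun p : G × E => (ch EG g₀ p.1, p.2)) (g₀, y₀) :=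
    (ContinuousAt.comp (g := ch EG g₀) (f := Prod.fst) (continuousAt_extChartAt g₀)
      continuousAt_fst).prodMk continuousAt_snd
  have h2 := ContinuousAt.comp (f := fun p : G × E => (ch EG g₀ p.1, p.2)) (x := (g₀, y₀))
    (ContDiffAt.continuousAt h) h1
  refine h2.congr ?_
  have h3 : ∀ᶠ p in nhds (g₀, y₀), p.1 ∈ (ch EG g₀).source :=
    (show ContinuousAt Prod.fst (g₀, y₀) from continuousAt_fst).eventually_mem
      ((isOpen_extChartAt_source g₀).mem_nhds (mem_ch_source (E := EG) g₀))
  filter_upwards [h3] with p hp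
  simp only [Function.comp_apply, (ch EG g₀).left_inv hp]

end JSmoothAt

variable {EG} in
theorem continuous_of_jSmoothAt {F : G → E → V} {y : E} (h : ∀ g, JSmoothAt EG F g y) :
    Continuous (fun g => F g y) := continuous_iff_continuousAt.2 fun g =>
  ContinuousAt.comp (g := fun p : G × E => F p.1 p.2) (f := fun g => (g, y)) (h g).continuousAt
    (continuousAt_id.prodMk continuousAt_const)

end Families

/-! ### Differentiation under integrals over a compact group -/

section ParametricIntegral

open MeasureTheory

variable {EG : Type*} [NormedAddCommGroup EG] [NormedSpace ℝ EG]
  {G : Type*} [TopologicalSpace G] [ChartedSpace EG G] [CompactSpace G]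
  [MeasurableSpace G] [BorelSpace G] {μ : Measure G} [IsFiniteMeasure μ]
  {E : Type*} [NormedAddCommGroup E] [NormedSpace ℝ E] [FiniteDimensional ℝ E]
  {V : Type*} [NormedAddCommGroup V] [NormedSpace ℝ V]

theorem integrable_of_continuous {a : G → V} (ha : Continuous a) : Integrable a μ :=
  ha.integrable_of_hasCompactSupport (HasCompactSupport.of_compactSpace a)

/-- The integrand's derivative is jointly continuous on `G` times a closed ball around `y`, which is
compact, so a constant dominates it. -/
theorem hasFDerivAt_integral {a : G → ℝ} (ha : Continuous a) {F : G → E → V} {U : Set E}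
    (hU : IsOpen U) (h : ∀ g, ∀ y ∈ U, JSmoothAt EG F g y) {y : E} (hy : y ∈ U) :
    HasFDerivAt (fun y => ∫ g, a g • F g y ∂μ) (∫ g, a g • fderiv ℝ (F g) y ∂μ) y := by
  have : ProperSpace E := FiniteDimensional.proper ℝ E
  obtain ⟨r, hr, hrU⟩ := Metric.nhds_basis_closedBall.mem_iff.1 (hU.mem_nhds hy)
  have hc : ContinuousOn (fun p : G × E => a p.1 • fderiv ℝ (F p.1) p.2)
      (Set.univ ×ˢ Metric.closedBall y r) := fun p hp =>
    ((ha.continuousAt.comp continuousAt_fst).smul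
      (h p.1 p.2 (hrU hp.2)).fderiv.continuousAt).continuousWithinAt
  obtain ⟨C, hC⟩ := (isCompact_univ.prod (isCompact_closedBall y r)).exists_bound_of_continuousOn hc
  refine hasFDerivAt_integral_of_dominated_of_fderiv_le (bound := fun _ => C)
    (F' := fun y g => a g • fderiv ℝ (F g) y)
    (Metric.closedBall_mem_nhds y hr) ?_ ?_ ?_ ?_ (integrable_const C) ?_
  · filter_upwards [hU.mem_nhds hy] with z hz
    exact (integrable_of_continuous
      (ha.smul (continuous_of_jSmoothAt fun g => h g z hz))).aestronglyMeasurable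
  · exact integrable_of_continuous (ha.smul (continuous_of_jSmoothAt fun g => h g y hy))
  · exact (integrable_of_continuous
      (ha.smul (continuous_of_jSmoothAt fun g => (h g y hy).fderiv))).aestronglyMeasurable
  · exact Filter.Eventually.of_forall fun g z hz => hC (g, z) ⟨Set.mem_univ _, hz⟩
  · exact Filter.Eventually.of_forall fun g z hz =>
      (((h g z (hrU hz)).contDiffAt.differentiableAt (by simp)).hasFDerivAt).const_smul (a g)


universe u

/-- The derivative is an integral of the same kind with values in `E →L[ℝ] V`. The induction
therefore runs over all `V`, which must share the universe of `E`. -/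
theorem contDiffOn_integral {E : Type u} [NormedAddCommGroup E] [NormedSpace ℝ E]
    [FiniteDimensional ℝ E] {V : Type u} [NormedAddCommGroup V] [NormedSpace ℝ V]
    {a : G → ℝ} (ha : Continuous a) {F : G → E → V} {U : Set E}
    (hU : IsOpen U) (h : ∀ g, ∀ y ∈ U, JSmoothAt EG F g y) :
    ContDiffOn ℝ ∞ (fun y => ∫ g, a g • F g y ∂μ) U := by
  refine contDiffOn_infty.2 fun n => ?_
  induction n generalizing V with
  | zero =>
    refine contDiffOn_zero.2 fun y hy => ?_
    exact (hasFDerivAt_integral ha hU h hy).continuousAt.continuousWithinAt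
  | succ n ih =>
    rw [Nat.cast_succ, contDiffOn_succ_iff_fderiv_of_isOpen hU]
    refine ⟨fun y hy => (hasFDerivAt_integral ha hU h hy).differentiableAt.differentiableWithinAt,
      by simp, (ih fun g y hy => (h g y hy).fderiv).congr fun y hy => ?_⟩
    exact (hasFDerivAt_integral ha hU h hy).fderiv

end ParametricIntegral

/-! ### Second derivatives in affine directions -/

section SecondDerivative

theorem two_le_infty : minSmoothness ℝ 2 ≤ ∞ := by
  rw [minSmoothness_of_isRCLikeNormedField]
  exact ENat.LEInfty.out

variable {W : Type*} [NormedAddCommGroup W] [NormedSpace ℝ W]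
  {V : Type*} [NormedAddCommGroup V] [NormedSpace ℝ V]

theorem hasDerivAt_line (p v : W) (t : ℝ) : HasDerivAt (fun t : ℝ => p + t • v) v t := by
  simpa using ((hasDerivAt_id t).smul_const v).const_add p

theorem hasDerivAt_comp_line {φ : W → V} {p : W} (h : DifferentiableAt ℝ φ p) (v : W) :
    HasDerivAt (fun t : ℝ => φ (p + t • v)) (fderiv ℝ φ p v) 0 := by
  have h1 : HasFDerivAt φ (fderiv ℝ φ p) (p + (0 : ℝ) • v) := by
    rw [zero_smul, add_zero]
    exact h.hasFDerivAt
  exact h1.comp_hasDerivAt 0 (hasDerivAt_line p v 0)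

theorem tendsto_line (p v : W) : Filter.Tendsto (fun t : ℝ => p + t • v) (nhds 0) (nhds p) := by
  have := (hasDerivAt_line p v 0).continuousAt
  rwa [ContinuousAt, zero_smul, add_zero] at this

/-- The second derivative vanishes in directions where the map is affine. -/
theorem fderiv_fderiv_eq_zero {φ : W → V} {p v : W} (h : ContDiffAt ℝ ∞ φ p) {q w : V}
    (ha : ∀ᶠ t in nhds (0 : ℝ), φ (p + t • v) = q + t • w) :
    fderiv ℝ (fderiv ℝ φ) p v v = 0 := by
  have hd : ∀ᶠ z in nhds p, DifferentiableAt ℝ φ z := by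
    have h1 : ContDiffAt ℝ 1 φ p := h.of_le (by exact mod_cast le_top)
    exact (h1.eventually (by simp)).mono fun z hz => hz.differentiableAt (by simp)
  have h1 : ∀ᶠ t in nhds (0 : ℝ), fderiv ℝ φ (p + t • v) v = w := by
    filter_upwards [(tendsto_line p v).eventually hd, ha.eventually_nhds] with t ht hat
    have h2 := ht.hasFDerivAt.comp_hasDerivAt t (hasDerivAt_line p v t)
    exact h2.unique ((hasDerivAt_line q w t).congr_of_eventuallyEq hat)
  have h3 : DifferentiableAt ℝ (fderiv ℝ φ) p :=
    (h.fderiv_right (m := ∞) (by simp)).differentiableAt (by simp)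
  have h4 := (hasDerivAt_comp_line h3 v).clm_apply (hasDerivAt_const (0 : ℝ) v)
  rw [map_zero, add_zero] at h4
  exact h4.unique ((hasDerivAt_const (0 : ℝ) w).congr_of_eventuallyEq h1)

end SecondDerivative

theorem contMDiff_act (E : Type*) [NormedAddCommGroup E] [NormedSpace ℝ E]
    {M : Type*} [TopologicalSpace M] [ChartedSpace E M]
    (EG : Type*) [NormedAddCommGroup EG] [NormedSpace ℝ EG]
    {G : Type*} [TopologicalSpace G] [ChartedSpace EG G] [Group G]
    [MulAction G M] [ContMDiffSMul 𝓘(ℝ, EG) 𝓘(ℝ, E) ∞ G M] (g : G) :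
    ContMDiff 𝓘(ℝ, E) 𝓘(ℝ, E) ∞ (fun z : M => g • z) :=
  (contMDiff_smul (I := 𝓘(ℝ, EG)) (I' := 𝓘(ℝ, E)) (n := ∞) (G := G) (M := M)).comp
    (contMDiff_const.prodMk contMDiff_id)

/-! ### The adjoint action and Lie derivatives along the group action -/

section Families

variable {EG : Type*} [NormedAddCommGroup EG] [NormedSpace ℝ EG]
  {G : Type*} [TopologicalSpace G] [ChartedSpace EG G] [Group G] [LieGroup 𝓘(ℝ, EG) ∞ G]
  {E : Type*} [NormedAddCommGroup E] [NormedSpace ℝ E]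
  {M : Type*} [TopologicalSpace M] [ChartedSpace E M] [IsManifold 𝓘(ℝ, E) ∞ M]
  [MulAction G M] [ContMDiffSMul 𝓘(ℝ, EG) 𝓘(ℝ, E) ∞ G M]

theorem contMDiffAt_symm_fst (g₀ : G) (y₀ : E) :
    ContMDiffAt 𝓘(ℝ, EG × E) 𝓘(ℝ, EG) ∞ (fun p : EG × E => (ch EG g₀).symm p.1)
      (ch EG g₀ g₀, y₀) :=
  ContMDiffAt.comp (g := (ch EG g₀).symm) (f := Prod.fst) (x := (ch EG g₀ g₀, y₀))
    (contMDiffAt_ch_symm (mem_ch_target g₀)) contDiffAt_fst.contMDiffAt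

theorem contMDiffAt_symm_snd {x₀ : M} {y₀ : E} (hy : y₀ ∈ (ch E x₀).target) (a : EG) :
    ContMDiffAt 𝓘(ℝ, EG × E) 𝓘(ℝ, E) ∞ (fun p : EG × E => (ch E x₀).symm p.2) (a, y₀) :=
  ContMDiffAt.comp (g := (ch E x₀).symm) (f := Prod.snd) (x := (a, y₀))
    (contMDiffAt_ch_symm hy) contDiffAt_snd.contMDiffAt

/-- The action is smooth, jointly in the group element and the point. -/
theorem jSmoothAt_act {x₀ x₁ : M} {g₀ : G} {y₀ : E} (hy : y₀ ∈ (ch E x₀).target)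
    (hs : g₀ • (ch E x₀).symm y₀ ∈ (ch E x₁).source) :
    JSmoothAt EG (fun (g : G) y => ch E x₁ (g • (ch E x₀).symm y)) g₀ y₀ := by
  rw [JSmoothAt, ← contMDiffAt_iff_contDiffAt]
  have h1 := ContMDiffAt.comp (ch EG g₀ g₀, y₀)
    (contMDiff_smul (I := 𝓘(ℝ, EG)) (I' := 𝓘(ℝ, E)) (n := ∞) (G := G) (M := M)).contMDiffAt
    ((contMDiffAt_symm_fst g₀ y₀).prodMk (contMDiffAt_symm_snd hy (ch EG g₀ g₀)))
  refine ContMDiffAt.comp (g := ch E x₁) (ch EG g₀ g₀, y₀) (contMDiffAt_ch ?_) h1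
  simpa only [Function.comp_apply, ch_symm_self] using hs

/-- Conjugation is smooth. -/
theorem jSmoothAt_conj (g₀ : G) :
    JSmoothAt EG (fun (g : G) y => ch EG (1 : G) (g * (ch EG (1 : G)).symm y * g⁻¹)) g₀
      (ch EG (1 : G) 1) := by
  rw [JSmoothAt, ← contMDiffAt_iff_contDiffAt]
  have h0 := contMDiffAt_symm_fst (EG := EG) (E := EG) g₀ (ch EG (1 : G) 1)
  have h1 := (ContMDiffAt.mul (I := 𝓘(ℝ, EG)) h0 (contMDiffAt_symm_snd (mem_ch_target (E := EG) (1 : G)) (ch EG g₀ g₀))).mul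
    (ContMDiffAt.inv h0)
  refine ContMDiffAt.comp (g := ch EG (1 : G)) (ch EG g₀ g₀, ch EG (1 : G) 1)
    (contMDiffAt_ch ?_) h1
  change (ch EG g₀).symm (ch EG g₀ g₀) * (ch EG (1 : G)).symm (ch EG (1 : G) 1) *
    ((ch EG g₀).symm (ch EG g₀ g₀))⁻¹ ∈ _
  rw [ch_symm_self, ch_symm_self, mul_one, mul_inv_cancel]
  exact mem_ch_source _

theorem contMDiff_conj (g : G) : ContMDiff 𝓘(ℝ, EG) 𝓘(ℝ, EG) ∞ (fun h : G => g * h * g⁻¹) :=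
  (contMDiff_const.mul contMDiff_id).mul contMDiff_const

theorem Ad_eq (g : G) (ξ : EG) : Ad (EG := EG) g ξ =
    fderiv ℝ (fun y => ch EG (1 : G) (g * (ch EG (1 : G)).symm y * g⁻¹)) (ch EG (1 : G) 1) ξ := by
  have h1 := fderiv_inCh (f := fun h : G => g * h * g⁻¹) (x₀ := 1) (x₁ := 1)
    (mem_ch_target (E := EG) (1 : G)) ((contMDiff_conj g).contMDiffAt.mdifferentiableAt (by simp))
    (by rw [ch_symm_self, mul_one, mul_inv_cancel]; exact mem_ch_source (1 : G))
  rw [ch_symm_self, bwd_self, mul_one, mul_inv_cancel, fwd_self] at h1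
  exact (congrArg (fun A : EG →L[ℝ] EG => A ξ) h1).symm

/-- The adjoint action is continuous. -/
theorem continuous_Ad (ξ : EG) : Continuous (fun g : G => (Ad (EG := EG) g ξ : EG)) := by
  refine Continuous.congr ?_ fun g => (Ad_eq g ξ).symm
  exact (continuous_of_jSmoothAt fun g => (jSmoothAt_conj (EG := EG) g).fderiv).clm_apply
    continuous_const

/-- Infinitesimally this is `[ξ, ξ] = 0`. In the chart at the identity, let `φ(a, b) = a b a⁻¹`.
Since `φ(a, 1) = 1`, `φ(1, b) = b` and `φ(a, a) = a`, the second derivative of `φ` vanishes on the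
diagonal pairs of `(ξ, 0)`, `(0, ξ)` and `(ξ, ξ)`, hence on the mixed pair by polarization. The
curve is a straight line in the chart, as only its velocity at the identity matters. -/
theorem hasDerivAt_Ad (ξ : EG) :
    HasDerivAt (fun t : ℝ => (Ad (EG := EG) ((ch EG (1 : G)).symm (ch EG (1 : G) 1 + t • ξ)) ξ : EG))
      0 0 := by
  set e := ch EG (1 : G) 1 with he
  set φ : EG × EG → EG := fun p => ch EG (1 : G) ((ch EG (1 : G)).symm p.1 *
    (ch EG (1 : G)).symm p.2 * ((ch EG (1 : G)).symm p.1)⁻¹) with hφ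
  have hs : ContDiffAt ℝ ∞ φ (e, e) := jSmoothAt_conj (EG := EG) (1 : G)
  have hinv : ∀ᶠ t in nhds (0 : ℝ), ch EG (1 : G) ((ch EG (1 : G)).symm (e + t • ξ)) = e + t • ξ :=
    ((tendsto_line e ξ).eventually (eventually_target (E := EG) (1 : G))).mono
      fun t ht => (ch EG (1 : G)).right_inv ht
  have h1 : fderiv ℝ (fderiv ℝ φ) (e, e) (ξ, 0) (ξ, 0) = 0 :=
    fderiv_fderiv_eq_zero hs (q := e) (w := 0) (Filter.Eventually.of_forall fun t => by
      simp [φ, e])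
  have h2 : fderiv ℝ (fderiv ℝ φ) (e, e) (0, ξ) (0, ξ) = 0 :=
    fderiv_fderiv_eq_zero hs (q := e) (w := ξ) (hinv.mono fun t ht => by
      rw [← ht]
      simp [φ, e])
  have h3 : fderiv ℝ (fderiv ℝ φ) (e, e) (ξ, ξ) (ξ, ξ) = 0 :=
    fderiv_fderiv_eq_zero hs (q := e) (w := ξ) (hinv.mono fun t ht => by
      rw [← ht]
      simp [φ])
  have h4 := hs.isSymmSndFDerivAt two_le_infty (ξ, 0) (0, ξ)
  have h5 : ((ξ, ξ) : EG × EG) = (ξ, 0) + (0, ξ) := by simp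
  rw [h5, map_add, map_add, add_apply, add_apply, h1, h2, ← h4, zero_add, add_zero,
    ← two_smul ℝ] at h3
  have h6 : fderiv ℝ (fderiv ℝ φ) (e, e) (ξ, 0) (0, ξ) = 0 :=
    (smul_eq_zero.1 h3).resolve_left two_ne_zero
  have h7 : DifferentiableAt ℝ (fderiv ℝ φ) (e, e) :=
    (hs.fderiv_right (m := ∞) (by simp)).differentiableAt (by simp)
  have h8 := (hasDerivAt_comp_line h7 (ξ, 0)).clm_apply
    (hasDerivAt_const (0 : ℝ) ((0, ξ) : EG × EG))
  rw [map_zero, add_zero, h6] at h8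
  refine h8.congr_of_eventuallyEq ?_
  have h9 := (jSmoothAt_conj (EG := EG) (1 : G)).fderiv_eventuallyEq
  have h10 : Filter.Tendsto (fun t : ℝ => ((e, e) : EG × EG) + t • (ξ, 0)) (nhds 0)
    (nhds (e, e)) := tendsto_line _ _
  filter_upwards [h10.eventually h9] with t ht
  rw [Ad_eq]
  have h11 := congrArg (fun A : EG →L[ℝ] EG => A ξ) ht
  have h12 : ((e, e) : EG × EG) + t • (ξ, 0) = (e + t • ξ, e) := by simp
  rw [h12] at h11 ⊢
  exact h11

theorem fwd_fundField (ξ : EG) {x₀ x : M} (hx : x ∈ (ch E x₀).source) :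
    fwd E x₀ x (fundField (EG := EG) (G := G) ξ x) =
      fderiv ℝ (fun a => ch E x₀ ((ch EG (1 : G)).symm a • x)) (ch EG (1 : G) 1) ξ := by
  have hc : ContMDiff 𝓘(ℝ, EG) 𝓘(ℝ, E) ∞ (fun g : G => g • x) :=
    (contMDiff_smul (I := 𝓘(ℝ, EG)) (I' := 𝓘(ℝ, E)) (n := ∞) (G := G) (M := M)).comp
      (contMDiff_id.prodMk contMDiff_const)
  have h1 := fderiv_inCh (f := fun g : G => g • x) (x₀ := 1) (x₁ := x₀)
    (mem_ch_target (E := EG) (1 : G)) (hc.contMDiffAt.mdifferentiableAt (by simp))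
    (by rwa [ch_symm_self, one_smul])
  rw [ch_symm_self, bwd_self, one_smul] at h1
  exact (congrArg (fun A : EG →L[ℝ] E => A ξ) h1).symm

variable [FiniteDimensional ℝ E]

/-- The Lie derivative is the derivative of the pullback along a curve. -/
theorem hasDerivAt_pullback (ξ : EG) {θ : Form E M} (hθ : θ ∈ Omega E M) (x : M) (k : ℕ) :
    HasDerivAt
      (fun t : ℝ => pullback ((ch EG (1 : G)).symm (ch EG (1 : G) 1 + t • ξ)) θ x k)
      (lieD (fun y => fwd E x ((ch E x).symm y) (fundField (EG := EG) (G := G) ξ ((ch E x).symm y)))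
        (rep θ x) (ch E x x) k) 0 := by
  set e := ch EG (1 : G) 1 with he
  set y₀ := ch E x x with hy₀
  set Ψ : EG × E → E := fun p => ch E x ((ch EG (1 : G)).symm p.1 • (ch E x).symm p.2) with hΨ
  have hmem : (1 : G) • (ch E x).symm y₀ ∈ (ch E x).source := by
    rw [ch_symm_self, one_smul]
    exact mem_ch_source x
  have hj := jSmoothAt_act (EG := EG) (G := G) (mem_ch_target (E := E) x) hmem
  have hs : ContDiffAt ℝ ∞ Ψ (e, y₀) := hj
  have hsd : DifferentiableAt ℝ (fderiv ℝ Ψ) (e, y₀) :=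
    (hs.fderiv_right (m := ∞) (by simp)).differentiableAt (by simp)
  -- In the chart, `ξ_M` is the partial derivative of the action map `Ψ` in the group direction `ξ`.
  have hX : (fun y => fwd E x ((ch E x).symm y)
      (fundField (EG := EG) (G := G) ξ ((ch E x).symm y))) =ᶠ[nhds y₀]
      fun y => fderiv ℝ Ψ (e, y) (ξ, 0) := by
    have h1 : Filter.Tendsto (fun y : E => (e, y)) (nhds y₀) (nhds (e, y₀)) :=
      (Continuous.prodMk_right e).tendsto y₀
    filter_upwards [h1.eventually hj.eventually_differentiableAt, eventually_target x] with y hd hy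
    rw [fwd_fundField ξ ((ch E x).map_target hy)]
    have h2 := HasFDerivAt.comp (f := fun a : EG => (a, y)) e hd.hasFDerivAt
      (hasFDerivAt_prodMk_left e y)
    exact congrArg (fun A : EG →L[ℝ] E => A ξ) h2.fderiv
  have hline : ∀ t : ℝ, ((e, y₀) : EG × E) + t • ((ξ, 0) : EG × E) = (e + t • ξ, y₀) := by simp
  have hten := tendsto_line ((e, y₀) : EG × E) (ξ, 0)
  have hc := hasDerivAt_comp_line (hs.differentiableAt (by simp)) (ξ, 0)
  have hA : HasDerivAt (fun t : ℝ => fderiv ℝ Ψ (e + t • ξ, y₀) ∘L ContinuousLinearMap.inr ℝ EG E)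
      (fderiv ℝ (fderiv ℝ Ψ) (e, y₀) (ξ, 0) ∘L ContinuousLinearMap.inr ℝ EG E) 0 := by
    have h1 := (hasDerivAt_comp_line hsd (ξ, 0)).clm_comp
      (hasDerivAt_const (0 : ℝ) (ContinuousLinearMap.inr ℝ EG E))
    rw [ContinuousLinearMap.comp_zero, add_zero] at h1
    exact h1.congr_of_eventuallyEq (Filter.Eventually.of_forall fun t =>
      congrArg (fun p => fderiv ℝ Ψ p ∘L ContinuousLinearMap.inr ℝ EG E) (hline t).symm)
  have hXd : fderiv ℝ (fun y => fwd E x ((ch E x).symm y)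
      (fundField (EG := EG) (G := G) ξ ((ch E x).symm y))) y₀ =
      fderiv ℝ (fderiv ℝ Ψ) (e, y₀) (ξ, 0) ∘L ContinuousLinearMap.inr ℝ EG E := by
    rw [hX.fderiv_eq]
    have h1 := (HasFDerivAt.comp (f := fun y : E => (e, y)) y₀ hsd.hasFDerivAt
      (hasFDerivAt_prodMk_right e y₀)).clm_apply (hasFDerivAt_const ((ξ, 0) : EG × E) y₀)
    refine h1.fderiv.trans (ContinuousLinearMap.ext fun w => ?_)
    -- Symmetry of second derivatives identifies the derivative of `ξ_M` in space with the
    -- derivative, along the curve, of the tangent maps of the action.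
    have h2 := hs.isSymmSndFDerivAt two_le_infty (0, w) (ξ, 0)
    simp only [ContinuousLinearMap.comp_zero, zero_add]
    exact h2
  have hX0 := hX.eq_of_nhds
  have hone : (ch EG (1 : G)).symm e = 1 := ch_symm_self (1 : G)
  have hA0 : fderiv ℝ Ψ (e + (0 : ℝ) • ξ, y₀) ∘L ContinuousLinearMap.inr ℝ EG E =
      ContinuousLinearMap.id ℝ E := by
    rw [zero_smul, add_zero, ← hj.fderiv_eventuallyEq.eq_of_nhds]
    have h1 := fderiv_inCh (f := fun z : M => (1 : G) • z) (x₀ := x) (x₁ := x)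
      (mem_ch_target (E := E) x)
      (((contMDiff_act E EG (1 : G)) _).mdifferentiableAt (by simp)) hmem
    have h2 : (fun y => ch E x ((ch EG (1 : G)).symm (ch EG (1 : G) 1) • (ch E x).symm y)) =
        inCh (fun z : M => (1 : G) • z) x x := by
      funext y
      rw [ch_symm_self]
      rfl
    refine (congrArg (fun Φ => fderiv ℝ Φ (ch E x x)) h2).trans (h1.trans ?_)
    rw [ch_symm_self, bwd_self, one_smul, fwd_self]
    exact actMap_one x
  have hmain := hasDerivAt_comp_pullback (mem_Omega_iff.1 hθ x) (c := fun t => Ψ (e + t • ξ, y₀))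
    (X := fun y => fwd E x ((ch E x).symm y) (fundField (EG := EG) (G := G) ξ ((ch E x).symm y)))
    (by
      have h1 := hc.congr_of_eventuallyEq (f₁ := fun t : ℝ => Ψ (e + t • ξ, y₀))
        (Filter.Eventually.of_forall fun t => congrArg Ψ (hline t).symm)
      rw [← hX0] at h1
      exact h1)
    (by
      change ch E x ((ch EG (1 : G)).symm (e + (0 : ℝ) • ξ) • (ch E x).symm y₀) = y₀
      rw [zero_smul, add_zero, hone, one_smul, ch_symm_self])
    (by
      rw [hXd]
      exact hA) hA0 k
  refine hmain.congr_of_eventuallyEq ?_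
  have h5 : ContinuousAt Ψ (e, y₀) := hs.continuousAt
  have h6 : ∀ᶠ t in nhds (0 : ℝ), (ch EG (1 : G)).symm (e + t • ξ) • x ∈ (ch E x).source := by
    have h7 : ContinuousAt (fun a : EG => (ch EG (1 : G)).symm a • x) e := by
      have hc : ContMDiff 𝓘(ℝ, EG) 𝓘(ℝ, E) ∞ (fun g : G => g • x) :=
        (contMDiff_smul (I := 𝓘(ℝ, EG)) (I' := 𝓘(ℝ, E)) (n := ∞) (G := G) (M := M)).comp
          (contMDiff_id.prodMk contMDiff_const)
      exact hc.continuous.continuousAt.comp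
        (contMDiffAt_ch_symm (mem_ch_target (E := EG) (1 : G))).continuousAt
    have h8 : (ch EG (1 : G)).symm e • x ∈ (ch E x).source := by
      rw [hone, one_smul]
      exact mem_ch_source x
    exact (tendsto_line e ξ).eventually
      (h7.eventually_mem ((isOpen_extChartAt_source x).mem_nhds h8))
  filter_upwards [hten.eventually hj.fderiv_eventuallyEq, h6] with t ht htm
  rw [hline] at ht
  set g := (ch EG (1 : G)).symm (e + t • ξ) with hg
  have h9 := chartRep_pullForm (E := E) (f := fun z : M => g • z) (fun z => θ z k)
    (mem_ch_target (E := E) x) (((contMDiff_act E EG g) _).mdifferentiableAt (by simp))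
    (x₁ := x) (by rwa [ch_symm_self])
  rw [chartRep_self] at h9
  refine Eq.trans h9 ?_
  refine congrArg (fun A : E →L[ℝ] E =>
    (rep θ x (Ψ (e + t • ξ, y₀)) k).compContinuousLinearMap A) ?_
  exact ht

/-- An equivariant family of forms that depends differentiably on `ξ` is invariant under the flow
of `ξ_M`. -/
theorem lieD_eq_zero {ι : Type*} [Fintype ι] {c : ι → EG → ℝ} {θ : ι → Form E M}
    (hθ : ∀ j, θ j ∈ Omega E M) {α : Lie𝔤 EG G → Form E M}
    (hα : ∀ ζ : EG, α ζ = ∑ j, ((c j ζ : ℝ) : ℂ) • θ j)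
    (heq : ∀ (g : G) ζ, pullback g (α (Ad g ζ)) = α ζ) {ξ : EG}
    (hc : ∀ j, DifferentiableAt ℝ (c j) ξ) (x : M) :
    lieD (fun y => fwd E x ((ch E x).symm y) (fundField (EG := EG) (G := G) ξ ((ch E x).symm y)))
      (rep (α ξ) x) (ch E x x) = 0 := by
  funext k
  have hmem : α ξ ∈ Omega E M := by
    rw [hα]
    exact (OmegaS E M).sum_mem fun j _ => (OmegaS E M).smul_mem _ (hθ j)
  set g : ℝ → G := fun t => (ch EG (1 : G)).symm (ch EG (1 : G) 1 + t • ξ) with hg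
  have h1 := hasDerivAt_pullback (G := G) ξ hmem x k
  have hg0 : g 0 = 1 := by simp [g]
  have hAd0 : (Ad (EG := EG) (g 0) ξ : EG) = ξ := by
    rw [hg0, Ad_eq]
    have : (fun y => ch EG (1 : G) (1 * (ch EG (1 : G)).symm y * 1⁻¹)) =ᶠ[nhds (ch EG (1 : G) 1)]
        fun y => y := by
      filter_upwards [eventually_target (E := EG) (1 : G)] with y hy
      rw [one_mul, inv_one, mul_one, (ch EG (1 : G)).right_inv hy]
    rw [this.fderiv_eq, fderiv_fun_id]
    rfl
  set A : ℝ → EG := fun t => Ad (EG := EG) (g t) ξ with hAdef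
  have hA : HasDerivAt A 0 0 := hasDerivAt_Ad (G := G) ξ
  have hA0 : A 0 = ξ := hAd0
  -- The coefficients are stationary because `Ad_{g(t)} ξ` is. To first order, `g(t)^* α(ξ)`
  -- therefore agrees with `g(t)^* α(Ad_{g(t)} ξ)`, which is constant by equivariance.
  have h2 : ∀ j, HasDerivAt (fun t => c j (A t) - c j ξ) 0 0 := by
    intro j
    have h3 : HasFDerivAt (c j) (fderiv ℝ (c j) ξ) (A 0) := by
      rw [hA0]
      exact (hc j).hasFDerivAt
    have h4 := (h3.comp_hasDerivAt 0 hA).sub_const (c j ξ)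
    rwa [map_zero] at h4
  have h5 : ∀ j, HasDerivAt (fun t => (c j (A t) - c j ξ) • pullback (g t) (θ j) x k) 0 0 := by
    intro j
    have h6 := (h2 j).fun_smul (hasDerivAt_pullback (G := G) ξ (hθ j) x k)
    rw [hA0, sub_self, zero_smul, zero_smul, zero_add] at h6
    exact h6
  have h7 := h1.fun_add (HasDerivAt.fun_sum fun j (_ : j ∈ Finset.univ) => h5 j)
  rw [Finset.sum_const_zero, add_zero] at h7
  have h8 : (fun t => pullback (g t) (α ξ) x k + ∑ j, (c j (A t) - c j ξ) •
      pullback (g t) (θ j) x k) = fun _ => α ξ x k := by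
    funext t
    have h9 := congrFun (congrFun (heq (g t) ξ) x) k
    rw [← h9]
    have h10 : ∀ ζ : EG, pullback (g t) (α ζ) x k =
        ∑ j, c j ζ • pullback (g t) (θ j) x k := by
      intro ζ
      rw [hα]
      change pb _ ((∑ j, ((c j ζ : ℝ) : ℂ) • θ j) (g t • x)) k = _
      rw [Finset.sum_apply, map_sum, Finset.sum_apply]
      refine Finset.sum_congr rfl fun j _ => ?_
      rw [Pi.smul_apply, map_smul]
      exact Complex.coe_smul _ _
    refine Eq.trans ?_ (h10 (A t)).symm
    rw [h10, ← Finset.sum_add_distrib]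
    refine Finset.sum_congr rfl fun j _ => ?_
    rw [sub_smul, add_sub_cancel]
  have h11 : HasDerivAt (fun _ : ℝ => α ξ x k) _ 0 := h8 ▸ h7
  exact h11.unique (hasDerivAt_const (0 : ℝ) (α ξ x k))

end Families

/-! ### Integrals of spinor-valued functions -/

section SpinorIntegral

open MeasureTheory

variable {G : Type*} [TopologicalSpace G] [CompactSpace G] [MeasurableSpace G] [BorelSpace G]
  {E : Type*} [NormedAddCommGroup E] [NormedSpace ℝ E]

/-- Continuity, in every degree, of a family of spinors. -/
def SpinorContinuous (ρ : G → Spinor E) : Prop := ∀ k, Continuous (fun g => ρ g k)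

/-- The integral, degree by degree, of a family of spinors. -/
def spinorIntegral (μ : Measure G) (ρ : G → Spinor E) : Spinor E := fun k => ∫ g, ρ g k ∂μ

/-- The operator `D` on spinors commutes with integrals. -/
def CommutesWithIntegral (μ : Measure G) (D : Module.End ℂ (Spinor E)) : Prop :=
  ∀ ρ : G → Spinor E, SpinorContinuous ρ → SpinorContinuous (fun g => D (ρ g)) ∧
    D (spinorIntegral μ ρ) = spinorIntegral μ (fun g => D (ρ g))

variable {μ : Measure G} [IsFiniteMeasure μ]

theorem spinorIntegral_add {ρ σ : G → Spinor E} (hρ : SpinorContinuous ρ)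
    (hσ : SpinorContinuous σ) : spinorIntegral μ (fun g => ρ g + σ g) =
      spinorIntegral μ ρ + spinorIntegral μ σ := funext fun k =>
  integral_add (integrable_of_continuous (hρ k)) (integrable_of_continuous (hσ k))

theorem spinorIntegral_smul (c : ℂ) (ρ : G → Spinor E) :
    spinorIntegral μ (fun g => c • ρ g) = c • spinorIntegral μ ρ := funext fun k =>
  integral_smul c fun g => ρ g k

theorem spinorIntegral_sum {ι : Type*} {s : Finset ι} {ρ : ι → G → Spinor E}
    (h : ∀ i ∈ s, SpinorContinuous (ρ i)) : spinorIntegral μ (fun g => ∑ i ∈ s, ρ i g) =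
      ∑ i ∈ s, spinorIntegral μ (ρ i) := funext fun k => by
  simp only [spinorIntegral, Finset.sum_apply]
  exact integral_finsetSum s fun i hi => integrable_of_continuous (h i hi k)

/-- An operator given by continuous linear maps between the components. -/
theorem commutesWithIntegral_of_clm {D : Module.End ℂ (Spinor E)} {m : ℕ → ℕ}
    (T : ∀ k, Alt E ℂ (m k) →L[ℝ] Alt E ℂ k) (hD : ∀ ρ k, D ρ k = T k (ρ (m k))) :
    CommutesWithIntegral μ D := fun ρ hρ => by
  refine ⟨fun k => ?_, funext fun k => ?_⟩
  · simp only [hD]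
    exact (T k).continuous.comp (hρ (m k))
  · simp only [hD, spinorIntegral]
    exact ((T k).integral_comp_comm (integrable_of_continuous (hρ (m k)))).symm

namespace CommutesWithIntegral

variable {D D' : Module.End ℂ (Spinor E)}

theorem add (h : CommutesWithIntegral μ D) (h' : CommutesWithIntegral μ D') :
    CommutesWithIntegral μ (D + D') := fun ρ hρ => by
  refine ⟨fun k => ((h ρ hρ).1 k).add ((h' ρ hρ).1 k), ?_⟩
  simp only [LinearMap.add_apply]
  rw [(h ρ hρ).2, (h' ρ hρ).2, ← spinorIntegral_add (h ρ hρ).1 (h' ρ hρ).1]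

theorem smul (h : CommutesWithIntegral μ D) (c : ℂ) : CommutesWithIntegral μ (c • D) :=
  fun ρ hρ => by
  refine ⟨fun k => ((h ρ hρ).1 k).const_smul c, ?_⟩
  simp only [LinearMap.smul_apply]
  rw [(h ρ hρ).2, spinorIntegral_smul]

theorem mul (h : CommutesWithIntegral μ D) (h' : CommutesWithIntegral μ D') :
    CommutesWithIntegral μ (D * D') := fun ρ hρ => by
  refine ⟨(h _ (h' ρ hρ).1).1, ?_⟩
  rw [Module.End.mul_apply, (h' ρ hρ).2, (h _ (h' ρ hρ).1).2]
  rfl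

theorem one : CommutesWithIntegral μ (1 : Module.End ℂ (Spinor E)) := fun _ hρ => ⟨hρ, rfl⟩

theorem zero : CommutesWithIntegral μ (0 : Module.End ℂ (Spinor E)) := fun ρ _ =>
  ⟨fun _ => continuous_const, funext fun k => by simp [spinorIntegral]⟩

theorem sum {ι : Type*} {s : Finset ι} {D : ι → Module.End ℂ (Spinor E)}
    (h : ∀ i ∈ s, CommutesWithIntegral μ (D i)) : CommutesWithIntegral μ (∑ i ∈ s, D i) := by
  classical
  induction s using Finset.induction_on with
  | empty => simpa using zero
  | insert i s hi ih =>
    rw [Finset.sum_insert hi]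
    exact (h i (Finset.mem_insert_self i s)).add (ih fun j hj => h j (Finset.mem_insert_of_mem hj))

theorem pow (h : CommutesWithIntegral μ D) (m : ℕ) : CommutesWithIntegral μ (D ^ m) := by
  induction m with
  | zero => simpa using one
  | succ m ih =>
    rw [pow_succ]
    exact ih.mul h

theorem aeval (h : CommutesWithIntegral μ D) (p : Polynomial ℂ) :
    CommutesWithIntegral μ (Polynomial.aeval D p) := by
  induction p using Polynomial.induction_on' with
  | add p q hp hq =>
    rw [map_add]
    exact hp.add hq
  | monomial m c =>
    rw [Polynomial.aeval_monomial, ← Algebra.smul_def]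
    exact (h.pow m).smul c

end CommutesWithIntegral

theorem commutesWithIntegral_pb (A : E →L[ℝ] E) : CommutesWithIntegral μ (pb A) :=
  commutesWithIntegral_of_clm (m := id)
    (fun _ => ContinuousAlternatingMap.compContinuousLinearMapCLM A) fun _ _ => rfl

theorem commutesWithIntegral_interior (X : E) : CommutesWithIntegral μ (interior X) :=
  commutesWithIntegral_of_clm (m := fun k => k + 1)
    (fun k => (curryLeftC E k).flip X) fun _ _ => rfl

theorem commutesWithIntegral_wedge (ξ : E →L[ℝ] ℝ) : CommutesWithIntegral μ (wedge ξ) := by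
  refine commutesWithIntegral_of_clm (m := fun k => k - 1)
    (fun k => match k with
      | 0 => 0
      | k + 1 => wedgeC E k ξ) fun ρ k => ?_
  cases k <;> rfl

theorem commutesWithIntegral_cliff (u : Gen E) : CommutesWithIntegral μ (cliff u) :=
  (commutesWithIntegral_interior u.1).add (commutesWithIntegral_wedge u.2)

variable [FiniteDimensional ℝ E]

theorem commutesWithIntegral_wedge3 (H : Alt E ℝ 3) : CommutesWithIntegral μ (wedge3 H) :=
  .smul (.sum fun _ _ => .sum fun _ _ => .sum fun _ _ => .smul
    ((commutesWithIntegral_wedge _).mul ((commutesWithIntegral_wedge _).mul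
      (commutesWithIntegral_wedge _))) _) _

theorem commutesWithIntegral_spin (J : Gen E →L[ℝ] Gen E) : CommutesWithIntegral μ (spin J) :=
  .smul (.sum fun _ _ => ((commutesWithIntegral_cliff _).mul (commutesWithIntegral_cliff _)).add
    ((commutesWithIntegral_cliff _).mul (commutesWithIntegral_cliff _))) _

theorem commutesWithIntegral_proj (J : Gen E →L[ℝ] Gen E) (k : ℤ) :
    CommutesWithIntegral μ (proj J k) := (commutesWithIntegral_spin J).aeval _

end SpinorIntegral

/-! ### Weighted averages of forms over the group -/

section Average

open MeasureTheory

universe u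

variable {EG : Type*} [NormedAddCommGroup EG] [NormedSpace ℝ EG]
  {G : Type*} [TopologicalSpace G] [ChartedSpace EG G] [Group G] [LieGroup 𝓘(ℝ, EG) ∞ G]
  [CompactSpace G] [MeasurableSpace G] [BorelSpace G]
  {E : Type u} [NormedAddCommGroup E] [NormedSpace ℝ E] [FiniteDimensional ℝ E]
  {M : Type*} [TopologicalSpace M] [ChartedSpace E M] [IsManifold 𝓘(ℝ, E) ∞ M]
  [MulAction G M] [ContMDiffSMul 𝓘(ℝ, EG) 𝓘(ℝ, E) ∞ G M]

/-- The weighted average `∫ a(g) g^* θ` of a form. -/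
def average (μ : Measure G) (a : G → ℝ) (θ : Form E M) : Form E M :=
  fun x => spinorIntegral μ (fun g => (a g : ℂ) • pullback g θ x)

theorem spinorContinuous_smul {a : G → ℝ} (ha : Continuous a) {ρ : G → Spinor E} (hρ : SpinorContinuous ρ) :
    SpinorContinuous (fun g => (a g : ℂ) • ρ g) := fun k =>
  (Complex.continuous_ofReal.comp ha).smul (hρ k)

variable (EG)

include EG

/-- The pullbacks of a form depend smoothly on the group element. -/
theorem jSmoothAt_pullback {θ : Form E M} (hθ : θ ∈ Omega E M) (k : ℕ) {x₀ : M} {y₀ : E}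
    (hy : y₀ ∈ (ch E x₀).target) (g₀ : G) :
    JSmoothAt EG (fun g y => rep (pullback g θ) x₀ y k) g₀ y₀ := by
  set x₁ := g₀ • (ch E x₀).symm y₀ with hx₁
  have hj := jSmoothAt_act (EG := EG) hy (mem_ch_source (E := E) x₁)
  have h1 : ContDiffAt ℝ ∞ (chartRep (fun z => θ z k) x₁) (ch E x₁ x₁) :=
    contDiffAt_chartRep_center (hθ k) x₁
  have h2 : ContDiffAt ℝ ∞ (fun p : EG × E => chartRep (fun z => θ z k) x₁
      (ch E x₁ ((ch EG g₀).symm p.1 • (ch E x₀).symm p.2))) (ch EG g₀ g₀, y₀) := by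
    refine ContDiffAt.comp (g := chartRep (fun z => θ z k) x₁) _ ?_ hj
    simpa only [ch_symm_self] using h1
  refine (ContDiffAt.compAlt h2 hj.fderiv).congr_of_eventuallyEq ?_
  have h3 : ContinuousAt (fun p : EG × E => (ch EG g₀).symm p.1 • (ch E x₀).symm p.2)
      (ch EG g₀ g₀, y₀) :=
    ((contMDiff_smul (I := 𝓘(ℝ, EG)) (I' := 𝓘(ℝ, E)) (n := ∞) (G := G)
      (M := M)).continuous.continuousAt).comp
      ((contMDiffAt_symm_fst g₀ y₀).continuousAt.prodMk
        (contMDiffAt_symm_snd hy (ch EG g₀ g₀)).continuousAt)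
  have h4 : ∀ᶠ p in nhds (ch EG g₀ g₀, y₀),
      (ch EG g₀).symm p.1 • (ch E x₀).symm p.2 ∈ (ch E x₁).source := by
    refine h3.eventually_mem ((isOpen_extChartAt_source x₁).mem_nhds ?_)
    rw [ch_symm_self]
    exact mem_ch_source (E := E) x₁
  have h5 : ∀ᶠ p in nhds (ch EG g₀ g₀, y₀), p.2 ∈ (ch E x₀).target :=
    (continuousAt_snd (p := (ch EG g₀ g₀, y₀))).eventually_mem (ch_target_mem hy)
  filter_upwards [h4, h5] with p hp hp'
  exact chartRep_pullForm (E := E) (f := fun z : M => (ch EG g₀).symm p.1 • z) (fun z => θ z k)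
    hp' (((contMDiff_act E EG _) _).mdifferentiableAt (by simp)) hp

theorem spinorContinuous_pullback {θ : Form E M} (hθ : θ ∈ Omega E M) (x : M) :
    SpinorContinuous (fun g : G => pullback g θ x) := fun k => by
  have h1 := continuous_of_jSmoothAt fun g : G =>
    jSmoothAt_pullback EG hθ k (mem_ch_target (E := E) x) g
  simpa only [rep_self] using h1

variable {μ : Measure G} [IsFiniteMeasure μ] {a : G → ℝ}

theorem rep_average (ha : Continuous a) {θ : Form E M} (hθ : θ ∈ Omega E M) (x₀ : M) (y : E) :
    rep (average μ a θ) x₀ y =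
      spinorIntegral μ (fun g => (a g : ℂ) • rep (pullback g θ) x₀ y) := by
  have h1 := (commutesWithIntegral_pb (μ := μ) (bwd E x₀ y) _ (spinorContinuous_smul ha
    (spinorContinuous_pullback EG hθ ((ch E x₀).symm y)))).2
  simp only [map_smul] at h1
  exact h1

theorem rep_average_apply (ha : Continuous a) {θ : Form E M} (hθ : θ ∈ Omega E M) (x₀ : M)
    (y : E) (k : ℕ) :
    rep (average μ a θ) x₀ y k = ∫ g, a g • rep (pullback g θ) x₀ y k ∂μ := by
  rw [rep_average EG ha hθ]
  exact integral_congr_ae (Filter.Eventually.of_forall fun g => Complex.coe_smul _ _)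

theorem average_mem (ha : Continuous a) {θ : Form E M} (hθ : θ ∈ Omega E M) :
    average μ a θ ∈ Omega E M := by
  intro k x₀
  refine (contDiffOn_integral (μ := μ) ha (isOpen_extChartAt_target x₀) fun g y hy =>
    jSmoothAt_pullback EG hθ k hy g).congr fun y hy => ?_
  exact rep_average_apply EG ha hθ x₀ y k

theorem pd_rep_average (ha : Continuous a) {θ : Form E M} (hθ : θ ∈ Omega E M) (x : M) (v : E) :
    pd (rep (average μ a θ) x) (ch E x x) v =
      spinorIntegral μ (fun g => (a g : ℂ) • pd (rep (pullback g θ) x) (ch E x x) v) ∧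
    SpinorContinuous (fun g : G => pd (rep (pullback g θ) x) (ch E x x) v) := by
  have hy := mem_ch_target (E := E) x
  have hj : ∀ k, ∀ g : G, ∀ y ∈ (ch E x).target,
      JSmoothAt EG (fun g y => rep (pullback g θ) x y k) g y := fun k g y hy =>
    jSmoothAt_pullback EG hθ k hy g
  have hc : ∀ k, Continuous (fun g : G =>
      fderiv ℝ (fun y => rep (pullback g θ) x y k) (ch E x x)) := fun k =>
    continuous_of_jSmoothAt fun g => (hj k g _ hy).fderiv
  refine ⟨funext fun k => ?_, fun k => (hc k).clm_apply continuous_const⟩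
  have h1 := hasFDerivAt_integral (μ := μ) ha (isOpen_extChartAt_target x) (hj k) hy
  have h2 : (fun z => rep (average μ a θ) x z k) =
      fun y => ∫ g, a g • rep (pullback g θ) x y k ∂μ :=
    funext fun y => rep_average_apply EG ha hθ x y k
  rw [pd, h2, h1.fderiv, ContinuousLinearMap.integral_apply
    (integrable_of_continuous (ha.smul (hc k)))]
  exact integral_congr_ae (Filter.Eventually.of_forall fun g => (Complex.coe_smul _ _).symm)

variable {H : M → Alt E ℝ 3} {J : M → Gen E →L[ℝ] Gen E}

/-- The derivatives pass under the integral, the algebraic operators commute with it, and each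
pullback commutes with `d_H` because `H` is invariant. -/
theorem dH_average (hH : IsSmooth H) (hGH : PreservesH G H) (ha : Continuous a) {θ : Form E M}
    (hθ : θ ∈ Omega E M) : dH H (average μ a θ) = average μ a (dH H θ) := by
  funext x
  have hG := contMDiff_act (M := M) (G := G) E EG
  have h1 : ∀ g : G, pullback g (dH H θ) x =
      dHl (chartRep H x) (rep (pullback g θ) x) (ch E x x) := by
    intro g
    rw [← dH_eq H (pullback_mem hG g hθ)]
    have := congrArg (fun D : Module.End ℂ (OmegaS E M) => (D ⟨θ, hθ⟩).1 x)
      (pullE_dHE hG hH hGH g)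
    exact this
  rw [dH_eq H (average_mem EG ha hθ), average]
  simp only [h1, dHl, dl, (pd_rep_average EG ha hθ x _).1, rep_self]
  have h2 : ∀ i, SpinorContinuous (fun g : G =>
      (a g : ℂ) • pd (rep (pullback g θ) x) (ch E x x) (vec E i)) := fun i =>
    spinorContinuous_smul ha (pd_rep_average (μ := μ) EG ha hθ x _).2
  have h3 : SpinorContinuous (fun g : G => (a g : ℂ) • pullback g θ x) :=
    spinorContinuous_smul ha (spinorContinuous_pullback EG hθ x)
  have h4 := fun i => commutesWithIntegral_wedge (μ := μ) (covec E i) _ (h2 i)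
  have h5 := commutesWithIntegral_wedge3 (μ := μ) (chartRep H x (ch E x x)) _ h3
  have h6 : ∀ ρ σ : G → Spinor E, SpinorContinuous ρ → SpinorContinuous σ →
      spinorIntegral μ ρ - spinorIntegral μ σ = spinorIntegral μ (fun g => ρ g - σ g) :=
    fun ρ σ hρ hσ => funext fun k => (integral_sub (integrable_of_continuous (hρ k))
      (integrable_of_continuous (hσ k))).symm
  simp only [(h4 _).2]
  rw [average, h5.2, ← spinorIntegral_sum fun i _ => (h4 i).1, h6 _ _ ?_ h5.1]
  · simp only [map_smul, smul_sub, Finset.smul_sum]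
  · intro k
    simp only [Finset.sum_apply]
    exact continuous_finsetSum _ fun i _ => (h4 i).1 k

theorem component_average (hJ : IsSmoothEnd J) (hGJ : PreservesJ G J) (ha : Continuous a)
    {θ : Form E M} (hθ : θ ∈ Omega E M) (k : ℤ) :
    component J k (average μ a θ) = average μ a (component J k θ) := by
  funext x
  have hG := contMDiff_act (M := M) (G := G) E EG
  have h1 : ∀ g : G, pullback g (component J k θ) x = proj (J x) k (pullback g θ x) := fun g =>
    congrArg (fun D : Module.End ℂ (OmegaS E M) => (D ⟨θ, hθ⟩).1 x) (pullE_compE hG hJ hGJ g k)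
  have h2 := (commutesWithIntegral_proj (μ := μ) (J x) k _ (spinorContinuous_smul ha
    (spinorContinuous_pullback EG hθ x))).2
  simp only [map_smul, ← h1] at h2
  exact h2

variable (μ) in
/-- The weighted average as an operator on `Ω(M)`. -/
def averageE (ha : Continuous a) : Module.End ℂ (OmegaS E M) where
  toFun θ := ⟨average μ a θ.1, average_mem EG ha θ.2⟩
  map_add' θ τ := Subtype.ext <| funext fun x => by
    have h1 := spinorIntegral_add (μ := μ)
      (spinorContinuous_smul ha (spinorContinuous_pullback EG θ.2 x))
      (spinorContinuous_smul ha (spinorContinuous_pullback EG τ.2 x))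
    simp only [← smul_add] at h1
    exact h1
  map_smul' c θ := Subtype.ext <| funext fun x => by
    have h1 := spinorIntegral_smul (μ := μ) c (fun g => (a g : ℂ) • pullback g θ.1 x)
    simp only [smul_comm c] at h1
    exact h1

theorem averageE_degPart (hH : IsSmooth H) (hJ : IsSmoothEnd J) (hGH : PreservesH G H)
    (hGJ : PreservesJ G J) (ha : Continuous a) (j : ℤ) :
    averageE EG μ ha * degPart (degs E) (compE hJ) j (dHE hH) =
      degPart (degs E) (compE hJ) j (dHE hH) * averageE (E := E) (M := M) EG μ ha := by
  have h1 : averageE (E := E) (M := M) EG μ ha * dHE hH = dHE hH * averageE EG μ ha :=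
    LinearMap.ext fun θ => Subtype.ext (dH_average EG hH hGH ha θ.2).symm
  have h2 : ∀ k, averageE (E := E) (M := M) EG μ ha * compE hJ k =
      compE hJ k * averageE EG μ ha := fun k =>
    LinearMap.ext fun θ => Subtype.ext (component_average EG hJ hGJ ha θ.2 k).symm
  rw [degPart, Finset.mul_sum, Finset.sum_mul]
  refine Finset.sum_congr rfl fun k _ => ?_
  rw [← mul_assoc, h2, mul_assoc, ← mul_assoc (averageE EG μ ha), h1, mul_assoc (dHE hH), h2]
  simp only [mul_assoc]

/-- Since `h^* g^* = (g h)^*`, a right translation of the integration variable moves `h` into the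
weight. -/
theorem pullback_average [μ.IsMulRightInvariant] (ha : Continuous a) {θ : Form E M}
    (hθ : θ ∈ Omega E M) (h : G) :
    pullback h (average μ a θ) = average μ (fun g => a (g * h⁻¹)) θ := by
  have : IsTopologicalGroup G := topologicalGroup_of_lieGroup 𝓘(ℝ, EG) ∞
  funext x
  have h1 := (commutesWithIntegral_pb (μ := μ) (actMap E h x) _ (spinorContinuous_smul ha
    (spinorContinuous_pullback EG hθ (h • x)))).2
  refine h1.trans (funext fun k => ?_)
  have h2 := integral_mul_right_eq_self (μ := μ)
    (fun g => ((a (g * h⁻¹) : ℂ) • pullback g θ x) k) h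
  refine Eq.trans (integral_congr_ae (Filter.Eventually.of_forall fun g => ?_)) h2
  simp only [mul_inv_cancel_right, map_smul]
  have h3 := congrFun (pullback_pullback (contMDiff_act (M := M) (G := G) E EG) h g θ) x
  rw [← h3]
  rfl

end Average

/-! ### Interpolation of polynomial functions -/

section Interpolation

/-- Points `p i` and functions `c i` such that `q = ∑ q(p i) c i` for `q` in `P`. -/
def Interpolates {X : Type*} {n : ℕ} (P : Submodule ℝ (X → ℝ)) (p : Fin n → X)
    (c : Fin n → X → ℝ) : Prop := ∀ q ∈ P, ∀ x, q x = ∑ i, q (p i) * c i x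

/-- A function killed by all evaluations is zero, so the evaluations span the dual of the
finite-dimensional `P`. A basis chosen among them gives the nodes, and biduality realizes the dual
basis by functions in `P`. -/
theorem exists_interpolates {X : Type*} (P : Submodule ℝ (X → ℝ)) [FiniteDimensional ℝ P] :
    ∃ (n : ℕ) (p : Fin n → X) (c : Fin n → X → ℝ), (∀ i, c i ∈ P) ∧ Interpolates P p c := by
  let ev : X → Module.Dual ℝ P := fun x => (LinearMap.proj x : (X → ℝ) →ₗ[ℝ] ℝ) ∘ₗ P.subtype
  have hev : ∀ φ : Module.Dual ℝ (Module.Dual ℝ P), ∃ q : P, ∀ x, φ (ev x) = q.1 x := by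
    intro φ
    obtain ⟨q, rfl⟩ := (Module.evalEquiv ℝ P).surjective φ
    exact ⟨q, fun x => rfl⟩
  have hspan : ⊤ ≤ Submodule.span ℝ (Set.range ev) := by
    by_contra hlt
    obtain ⟨φ, hφ, hle⟩ := Submodule.exists_le_ker_of_lt_top _ (lt_top_iff_ne_top.2 fun h =>
      hlt h.ge)
    obtain ⟨q, rfl⟩ := (Module.evalEquiv ℝ P).surjective φ
    refine hφ ?_
    have hq : q = 0 := Subtype.ext <| funext fun x =>
      LinearMap.mem_ker.1 (hle (Submodule.subset_span ⟨x, rfl⟩))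
    rw [hq, map_zero]
  let b := Module.Basis.ofSpan hspan
  have hb : ∀ i, ∃ x, ev x = b i := fun i => by
    have := Module.Basis.ofSpan_subset hspan (Set.mem_range_self i)
    exact this
  have : Fintype _ := FiniteDimensional.fintypeBasisIndex b
  choose p hp using hb
  choose q hq using fun i => hev (b.coord i)
  let e := Fintype.equivFin ((linearIndepOn_empty ℝ id).extend (Set.empty_subset (Set.range ev)))
  refine ⟨_, fun i => p (e.symm i), fun i => (q (e.symm i)).1, fun i => (q (e.symm i)).2,
    fun r hr x => ?_⟩
  have h1 : r x = ev x ⟨r, hr⟩ := rfl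
  rw [h1, ← b.sum_repr (ev x), LinearMap.sum_apply, ← e.symm.sum_comp]
  refine Finset.sum_congr rfl fun i _ => ?_
  rw [LinearMap.smul_apply, ← hp, smul_eq_mul, mul_comm]
  exact congrArg (r (p (e.symm i)) * ·) (hq (e.symm i) x)

end Interpolation

section PolyFun

variable {W : Type*} [AddCommGroup W] [Module ℝ W]

variable (W) in
/-- The polynomial functions of degree at most `m`. -/
def polyFun (m : ℕ) : Submodule ℝ (W → ℝ) :=
  Submodule.span ℝ {q | ∃ k ≤ m, ∃ l : Fin k → Module.Dual ℝ W, q = fun ξ => ∏ i, l i ξ}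

theorem polyFun_mono {m m' : ℕ} (h : m ≤ m') : polyFun W m ≤ polyFun W m' :=
  Submodule.span_mono fun _ ⟨k, hk, l, hq⟩ => ⟨k, hk.trans h, l, hq⟩

theorem prod_mem_polyFun {m : ℕ} (l : Fin m → Module.Dual ℝ W) :
    (fun ξ => ∏ i, l i ξ) ∈ polyFun W m := Submodule.subset_span ⟨m, le_rfl, l, rfl⟩

theorem mul_mem_polyFun {m : ℕ} (l : Module.Dual ℝ W) {q : W → ℝ} (hq : q ∈ polyFun W m) :
    (fun ξ => l ξ * q ξ) ∈ polyFun W (m + 1) := by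
  induction hq using Submodule.span_induction with
  | mem q hq =>
    obtain ⟨k, hk, l', rfl⟩ := hq
    refine Submodule.subset_span ⟨k + 1, by omega, Fin.cons l l', ?_⟩
    funext ξ
    rw [Fin.prod_univ_succ]
    rfl
  | zero =>
    simp only [Pi.zero_apply, mul_zero]
    exact zero_mem _
  | add q r _ _ h1 h2 =>
    simp only [Pi.add_apply, mul_add]
    exact add_mem h1 h2
  | smul a q _ h1 =>
    simp only [Pi.smul_apply, smul_eq_mul, mul_left_comm _ a]
    exact Submodule.smul_mem _ a h1

theorem comp_mem_polyFun {m : ℕ} (A : W →ₗ[ℝ] W) {q : W → ℝ} (hq : q ∈ polyFun W m) :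
    (fun ξ => q (A ξ)) ∈ polyFun W m := by
  induction hq using Submodule.span_induction with
  | mem q hq =>
    obtain ⟨k, hk, l, rfl⟩ := hq
    exact Submodule.subset_span ⟨k, hk, fun i => l i ∘ₗ A, rfl⟩
  | zero => exact zero_mem _
  | add q r _ _ h1 h2 => exact add_mem h1 h2
  | smul a q _ h1 => exact Submodule.smul_mem _ a h1

/-- The functions that are the sum of a constant and of a linear form. -/
def affineFun (W : Type*) [AddCommGroup W] [Module ℝ W] : Submodule ℝ (W → ℝ) :=
  1 ⊔ LinearMap.range (LinearMap.ltoFun ℝ W ℝ ℝ)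

/-- A product of at most `m` linear forms lies in the `m`-th power of the affine functions, which is
finitely generated. As constants are affine, products of fewer factors lie in that power too. -/
instance finiteDimensional_polyFun [FiniteDimensional ℝ W] (m : ℕ) :
    FiniteDimensional ℝ (polyFun W m) := by
  have h1 : (affineFun W).FG := by
    refine Submodule.FG.sup ?_ ?_
    · rw [Submodule.one_eq_span]
      exact Submodule.fg_span_singleton _
    · rw [← Submodule.map_top]
      exact Module.Finite.fg_top.map _
  have h2 : FiniteDimensional ℝ ((affineFun W) ^ m : Submodule ℝ (W → ℝ)) :=
    Module.Finite.iff_fg.2 (h1.pow m)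
  refine Submodule.finiteDimensional_of_le (S₂ := (affineFun W) ^ m) (Submodule.span_le.2 ?_)
  rintro q ⟨k, hk, l, rfl⟩
  have h3 : (1 : Submodule ℝ (W → ℝ)) ≤ affineFun W := le_sup_left
  refine (pow_le_pow_right₀ h3 hk) ?_
  have h4 : (fun ξ => ∏ i, l i ξ) = (List.ofFn fun i => (l i : W → ℝ)).prod := by
    rw [List.prod_ofFn]
    funext ξ
    rw [Finset.prod_apply]
  have h5 : ∀ i, (l i : W → ℝ) ∈ affineFun W := fun i =>
    (le_sup_right : _ ≤ affineFun W) ⟨l i, rfl⟩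
  have h6 : ∀ (k : ℕ) (l : Fin k → W → ℝ), (∀ i, l i ∈ affineFun W) →
      (List.ofFn l).prod ∈ affineFun W ^ k := by
    intro k
    induction k with
    | zero =>
      intro l _
      rw [List.ofFn_zero, List.prod_nil, pow_zero]
      exact Submodule.one_le.1 le_rfl
    | succ k ih =>
      intro l hl
      rw [List.ofFn_succ, List.prod_cons, pow_succ']
      exact Submodule.mul_mem_mul (hl 0) (ih _ fun i => hl i.succ)
  exact h4 ▸ h6 k _ h5

end PolyFun

section Differentiability

variable {W : Type*} [NormedAddCommGroup W] [NormedSpace ℝ W] [FiniteDimensional ℝ W]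

theorem differentiable_of_mem_polyFun {m : ℕ} {q : W → ℝ} (hq : q ∈ polyFun W m) :
    Differentiable ℝ q := by
  induction hq using Submodule.span_induction with
  | mem q hq =>
    obtain ⟨k, hk, l, rfl⟩ := hq
    have h1 : ∀ i, Differentiable ℝ (l i) := fun i =>
      (LinearMap.toContinuousLinearMap (l i)).differentiable
    fun_prop
  | zero => exact differentiable_const 0
  | add q r _ _ h1 h2 => exact h1.add h2
  | smul a q _ h1 => exact h1.const_smul a

end Differentiability

/-! ### The deformation from `Q` to `Q + A` -/

section Algebra

variable {V : Type*} [AddCommGroup V] [Module ℂ V] {h : ℤ}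
  {π : ℤ → Module.End ℂ V} {P Q A F : Module.End ℂ V} {c : ℂ}

/-- The deformation of `Q` to `Q + A`: first half of the lemma. -/
theorem exists_of_mem_range_of_mem_ker (hπ : IsGrading (Finset.Icc (-h) h) π)
    (hP : HasDeg π (-1) P) (hQ : HasDeg π 1 Q) (hA : HasDeg π (-1) A)
    (hQA : (Q + A) * (Q + A) = 0) (hPQA : P * (Q + A) = -((Q + A) * P))
    (hdd : ∀ α β, Q α = 0 → P β = α → ∃ γ, Q (P γ) = α) {α β : V} (hα : (Q + A) α = 0)
    (hβ : P β = α) : ∃ γ, (Q + A) (P γ) = α := by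
  -- Induction on a bound for the degrees present in `α`: only those below `n - h` occur, and none
  -- do when `n = 0`.
  have key : ∀ n : ℕ, ∀ α β : V, (Q + A) α = 0 → P β = α → (∀ j : ℤ, n - h ≤ j → π j α = 0) →
      ∃ γ, (Q + A) (P γ) = α := by
    intro n
    induction n with
    | zero =>
      intro α β _ _ hz
      refine ⟨0, ?_⟩
      have h1 := congrArg (fun X : Module.End ℂ V => X α) hπ.sum
      simp only [LinearMap.sum_apply, Module.End.one_apply] at h1
      rw [map_zero, map_zero, ← h1]
      exact (Finset.sum_eq_zero fun j hj => hz j (by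
        have := (Finset.mem_Icc.1 hj).1
        push_cast
        omega)).symm
    | succ n ih =>
      intro α β hα hβ hz
      set k : ℤ := n - h with hk
      have deg : ∀ {i : ℤ} {X : Module.End ℂ V}, HasDeg π i X → ∀ j v,
          π j (X v) = X (π (j - i) v) := by
        intro i X hX j v
        have := congrArg (fun Y : Module.End ℂ V => Y v) (hX (j - i))
        simpa using this
      have hmul : ∀ i j v, π i (π j v) = if i = j then π j v else 0 := by
        intro i j v
        have := congrArg (fun Y : Module.End ℂ V => Y v) (hπ.mul i j)
        rw [Module.End.mul_apply] at this
        rw [this]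
        split_ifs <;> rfl
      have hz' : ∀ j, k < j → π j α = 0 := fun j hj => hz j (by push_cast; omega)
      -- In degree `k + 1` the equation `(Q + A) α = 0` sees only the top component of `α`: a
      -- contribution of `A` would come from degree `k + 2`.
      have hQk : Q (π k α) = 0 := by
        have h1 := congrArg (π (k + 1)) hα
        rw [LinearMap.add_apply, map_add, map_zero, deg hQ, deg hA, hz' (k + 1 - -1) (by omega),
          map_zero, add_zero, add_sub_cancel_right] at h1
        exact h1
      have hPk : P (π (k + 1) β) = π k α := by
        rw [← hβ, deg hP, sub_neg_eq_add]
      obtain ⟨γ, hγ⟩ := hdd _ _ hQk hPk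
      -- `Q P` has degree zero, so `γ` may be replaced by its component of degree `k`. The error `A
      -- P γ` then has degree `k - 2`, which does not disturb the induction.
      have hγk : Q (P (π k γ)) = π k α := by
        have h1 := congrArg (π k) hγ
        rw [deg hQ, deg hP, hmul, if_pos rfl] at h1
        rwa [show k - 1 - -1 = k by ring] at h1
      have hsq : (Q + A) ((Q + A) (P (π k γ))) = 0 :=
        congrArg (fun X : Module.End ℂ V => X (P (π k γ))) hQA
      have hcomm : P ((Q + A) (π k γ)) = -(Q + A) (P (π k γ)) :=
        congrArg (fun X : Module.End ℂ V => X (π k γ)) hPQA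
      obtain ⟨δ, hδ⟩ := ih (α - (Q + A) (P (π k γ))) (β + (Q + A) (π k γ))
        (by rw [map_sub, hα, hsq, sub_zero])
        (by rw [map_add, hβ, hcomm, sub_eq_add_neg])
        (by
          intro j hj
          have h1 : π j (A (P (π k γ))) = 0 := by
            rw [deg hA, deg hP, hmul, if_neg (by omega), map_zero, map_zero]
          rw [map_sub, LinearMap.add_apply, hγk, map_add, h1, add_zero, hmul]
          rcases hj.eq_or_lt with rfl | hj
          · rw [if_pos rfl, sub_self]
          · rw [hz' j hj, if_neg (by omega), sub_zero])
      refine ⟨δ + π k γ, ?_⟩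
      rw [map_add, map_add, hδ, sub_add_cancel]
  -- For this `n` the condition concerns only degrees above `h`, which are absent from the grading.
  refine key (2 * h + 1).toNat α β hα hβ fun j hj => ?_
  have : j ∉ Finset.Icc (-h) h := by
    rw [Finset.mem_Icc]
    omega
  rw [hπ.zero j this, LinearMap.zero_apply]

/-- The deformation of `Q` to `Q + A`: second half of the lemma. -/
theorem exists_of_mem_ker_of_mem_range (hPQ : P * Q + Q * P = 0)
    (hQA : (Q + A) * (Q + A) = 0) (hPQA : P * (Q + A) = -((Q + A) * P))
    (hA : A = c • (P * F - F * P))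
    (hdd : ∀ α β, P α = 0 → Q β = α → ∃ γ, Q (P γ) = α)
    (hfirst : ∀ α β, (Q + A) α = 0 → P β = α → ∃ γ, (Q + A) (P γ) = α)
    {α β : V} (hα : P α = 0) (hβ : (Q + A) β = α) : ∃ γ, (Q + A) (P γ) = α := by
  have hsq : ∀ v, (Q + A) ((Q + A) v) = 0 := fun v =>
    congrArg (fun X : Module.End ℂ V => X v) hQA
  have hcomm : ∀ v, P ((Q + A) v) = -(Q + A) (P v) := fun v =>
    congrArg (fun X : Module.End ℂ V => X v) hPQA
  have hPQ' : ∀ v, P (Q v) = -Q (P v) := fun v =>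
    eq_neg_of_add_eq_zero_left (congrArg (fun X : Module.End ℂ V => X v) hPQ)
  -- `P β` is closed for `Q + A` and exact for `P`; the first half corrects `β` by a `(Q + A)`-exact
  -- term so that it becomes `P`-closed.
  obtain ⟨δ, hδ⟩ := hfirst (P β) β (by
    have := hcomm β
    rw [hβ, hα] at this
    exact (neg_eq_zero.1 this.symm)) rfl
  set β' := β + (Q + A) δ with hβ'
  have h1 : P β' = 0 := by rw [hβ', map_add, hcomm, hδ, add_neg_cancel]
  have h2 : (Q + A) β' = α := by rw [hβ', map_add, hsq, add_zero, hβ]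
  -- The undeformed lemma gives `Q β' = Q P ε = P (-Q ε)`, and `P β' = 0` gives `A β' = c P F β'`.
  -- Their sum `α` is thus `P`-exact, and the first half finishes.
  obtain ⟨ε, hε⟩ := hdd (Q β') β' (by rw [hPQ', h1, map_zero, neg_zero]) rfl
  have h3 : A β' = c • P (F β') := by
    have := congrArg (fun X : Module.End ℂ V => X β') hA
    rw [this, LinearMap.smul_apply, LinearMap.sub_apply, Module.End.mul_apply,
      Module.End.mul_apply, h1, map_zero, sub_zero]
  refine hfirst α (-Q ε + c • F β') (by rw [← hβ, hsq]) ?_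
  rw [map_add, map_neg, hPQ', neg_neg, hε, map_smul, ← h3, ← LinearMap.add_apply, h2]

end Algebra

/-! ### The adjoint action on the Lie algebra -/

section Adjoint

variable {EG : Type*} [NormedAddCommGroup EG] [NormedSpace ℝ EG]
  {G : Type*} [TopologicalSpace G] [ChartedSpace EG G] [Group G]

/-- The adjoint action as a linear map. -/
def AdL (g : G) : Lie𝔤 EG G →ₗ[ℝ] Lie𝔤 EG G where
  toFun := Ad g
  map_add' ξ ζ := (tmap (E := EG) (E' := EG) (fun h : G => g * h * g⁻¹) 1).map_add ξ ζ
  map_smul' c ξ := (tmap (E := EG) (E' := EG) (fun h : G => g * h * g⁻¹) 1).map_smul c ξ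

theorem Ad_mul [LieGroup 𝓘(ℝ, EG) ∞ G] (g h : G) (ξ : Lie𝔤 EG G) :
    Ad (g * h) ξ = Ad g (Ad h ξ) := by
  have h1 : ∀ (g x : G), MDifferentiableAt 𝓘(ℝ, EG) 𝓘(ℝ, EG) (fun k : G => g * k * g⁻¹) x :=
    fun g x => (contMDiff_conj g).contMDiffAt.mdifferentiableAt (by simp)
  have h2 : (fun k : G => g * h * k * (g * h)⁻¹) =
      (fun k : G => g * k * g⁻¹) ∘ (fun k : G => h * k * h⁻¹) := by
    funext k
    simp only [Function.comp_apply]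
    group
  have h3 := mfderiv_comp (I := 𝓘(ℝ, EG)) (I' := 𝓘(ℝ, EG)) (I'' := 𝓘(ℝ, EG)) (1 : G)
    (h1 g (h * 1 * h⁻¹)) (h1 h 1)
  rw [← h2] at h3
  have h4 : h * 1 * h⁻¹ = 1 := by group
  have h5 : tmap (E := EG) (E' := EG) (fun k : G => g * h * k * (g * h)⁻¹) 1 =
      (tmap (E := EG) (E' := EG) (fun k : G => g * k * g⁻¹) (h * 1 * h⁻¹)).comp
        (tmap (E := EG) (E' := EG) (fun k : G => h * k * h⁻¹) 1) := h3
  rw [h4] at h5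
  exact congrArg (fun A : EG →L[ℝ] EG => A ξ) h5

end Adjoint

/-! ### Polynomial maps from `𝔤` to forms -/

section PolyForms

variable {EG : Type*} [NormedAddCommGroup EG] [NormedSpace ℝ EG]
  {G : Type*} [TopologicalSpace G] [ChartedSpace EG G] [Group G]
  {E : Type*} [NormedAddCommGroup E] [NormedSpace ℝ E]
  {M : Type*} [TopologicalSpace M] [ChartedSpace E M]

theorem smul_mem_polyForms {m : ℕ} {q : Lie𝔤 EG G → ℝ} (hq : q ∈ polyFun (Lie𝔤 EG G) m)
    {θ : Form E M} (hθ : θ ∈ Omega E M) : (fun ξ => (q ξ : ℂ) • θ) ∈ polyForms E M EG G := by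
  induction hq using Submodule.span_induction with
  | mem q hq =>
    obtain ⟨k, hk, l, rfl⟩ := hq
    exact Submodule.subset_span ⟨k, l, θ, hθ, rfl⟩
  | zero =>
    simp only [Pi.zero_apply, Complex.ofReal_zero, zero_smul]
    exact zero_mem _
  | add q r _ _ h1 h2 =>
    simp only [Pi.add_apply, Complex.ofReal_add, add_smul]
    exact add_mem h1 h2
  | smul a q _ h1 =>
    simp only [Pi.smul_apply, smul_eq_mul, Complex.ofReal_mul, mul_smul]
    exact Submodule.smul_mem _ (a : ℂ) h1

variable [IsManifold 𝓘(ℝ, E) ∞ M]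

theorem mem_Omega_of_mem_polyForms {α : Lie𝔤 EG G → Form E M} (hα : α ∈ polyForms E M EG G)
    (ξ : Lie𝔤 EG G) : α ξ ∈ Omega E M := by
  induction hα using Submodule.span_induction with
  | mem α hα =>
    obtain ⟨k, l, θ, hθ, rfl⟩ := hα
    exact (OmegaS E M).smul_mem _ hθ
  | zero => exact (OmegaS E M).zero_mem
  | add α β _ _ h1 h2 => exact (OmegaS E M).add_mem h1 h2
  | smul a α _ h1 => exact (OmegaS E M).smul_mem a h1

/-- Once the interpolated degree is large enough, the map is recovered from its values at the nodes.
Quantifying over all large `m'` allows two summands to use the same nodes. -/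
theorem eq_sum_of_mem_polyForms {α : Lie𝔤 EG G → Form E M} (hα : α ∈ polyForms E M EG G) :
    ∃ m, ∀ m' ≥ m, ∀ (n : ℕ) (p : Fin n → Lie𝔤 EG G) (c : Fin n → Lie𝔤 EG G → ℝ),
      Interpolates (polyFun (Lie𝔤 EG G) m') p c → ∀ ξ, α ξ = ∑ i, (c i ξ : ℂ) • α (p i) := by
  induction hα using Submodule.span_induction with
  | mem α hα =>
    obtain ⟨m, l, θ, hθ, rfl⟩ := hα
    refine ⟨m, fun m' hm n p c hpc ξ => ?_⟩
    have h1 := hpc _ (polyFun_mono hm (prod_mem_polyFun l)) ξ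
    simp only at h1 ⊢
    rw [h1, Complex.ofReal_sum, Finset.sum_smul]
    refine Finset.sum_congr rfl fun i _ => ?_
    rw [smul_smul, Complex.ofReal_mul, mul_comm]
  | zero =>
    refine ⟨0, fun m' _ n p c _ ξ => ?_⟩
    simp
  | add α β _ _ h1 h2 =>
    obtain ⟨m₁, h1⟩ := h1
    obtain ⟨m₂, h2⟩ := h2
    refine ⟨max m₁ m₂, fun m' hm n p c hpc ξ => ?_⟩
    simp only [Pi.add_apply, smul_add, Finset.sum_add_distrib]
    rw [h1 m' (le_of_max_le_left hm) n p c hpc ξ, h2 m' (le_of_max_le_right hm) n p c hpc ξ]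
  | smul a α _ h1 =>
    obtain ⟨m, h1⟩ := h1
    refine ⟨m, fun m' hm n p c hpc ξ => ?_⟩
    simp only [Pi.smul_apply, smul_comm _ a]
    rw [← Finset.smul_sum, ← h1 m' hm n p c hpc ξ]

variable [FiniteDimensional ℝ EG]

instance : FiniteDimensional ℝ (Lie𝔤 EG G) := inferInstanceAs (FiniteDimensional ℝ EG)

theorem exists_eq_sum_of_mem_polyForms {α : Lie𝔤 EG G → Form E M}
    (hα : α ∈ polyForms E M EG G) :
    ∃ (m n : ℕ) (p : Fin n → Lie𝔤 EG G) (c : Fin n → Lie𝔤 EG G → ℝ),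
      (∀ i, c i ∈ polyFun (Lie𝔤 EG G) m) ∧ Interpolates (polyFun (Lie𝔤 EG G) m) p c ∧
        ∀ ξ, α ξ = ∑ i, (c i ξ : ℂ) • α (p i) := by
  obtain ⟨m, hm⟩ := eq_sum_of_mem_polyForms hα
  obtain ⟨n, p, c, hc, hpc⟩ := exists_interpolates (polyFun (Lie𝔤 EG G) m)
  exact ⟨m, n, p, c, hc, hpc, hm m le_rfl n p c hpc⟩

/-- By interpolation the map is a finite sum of polynomials times fixed forms, so any linear
operator applied value by value preserves polynomiality, with no continuity needed. -/
theorem map_mem_polyForms {α : Lie𝔤 EG G → OmegaS E M}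
    (hα : (fun ξ => (α ξ).1) ∈ polyForms E M EG G) (T : Module.End ℂ (OmegaS E M)) :
    (fun ξ => (T (α ξ)).1) ∈ polyForms E M EG G := by
  obtain ⟨m, n, p, c, hc, -, h⟩ := exists_eq_sum_of_mem_polyForms hα
  have h1 : (fun ξ => (T (α ξ)).1) = ∑ i, fun ξ => (c i ξ : ℂ) • (T (α (p i))).1 := by
    funext ξ
    have h2 : α ξ = ∑ i, (c i ξ : ℂ) • α (p i) := Subtype.ext <| by
      rw [h ξ, Submodule.coe_sum]
      rfl
    rw [h2, map_sum, Submodule.coe_sum, Finset.sum_apply]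
    refine Finset.sum_congr rfl fun i _ => ?_
    rw [map_smul]
    rfl
  rw [h1]
  exact Submodule.sum_mem _ fun i _ => smul_mem_polyForms (hc i) (T (α (p i))).2

/-- Since `f^ξ` is linear in `ξ`, expanding it in a basis of `𝔤*` exhibits the product as
polynomial, of degree higher by one. -/
theorem fun_smul_mem_polyForms [FiniteDimensional ℝ E] {α : Lie𝔤 EG G → Form E M} (hα : α ∈ polyForms E M EG G)
    {f : M → Module.Dual ℝ (Lie𝔤 EG G)}
    (hf : ∀ ξ, ContMDiff 𝓘(ℝ, E) 𝓘(ℝ, ℝ) ∞ (fun x => f x ξ)) :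
    (fun ξ x => (f x ξ : ℂ) • α ξ x) ∈ polyForms E M EG G := by
  obtain ⟨m, n, p, c, hc, -, h⟩ := exists_eq_sum_of_mem_polyForms hα
  let b := Module.finBasis ℝ (Lie𝔤 EG G)
  have h1 : (fun ξ x => (f x ξ : ℂ) • α ξ x) = ∑ a, ∑ i, fun ξ =>
      ((b.coord a ξ * c i ξ : ℝ) : ℂ) • fun x => (f x (b a) : ℂ) • α (p i) x := by
    funext ξ x
    have h2 : f x ξ = ∑ a, b.coord a ξ * f x (b a) := by
      conv_lhs => rw [← b.sum_repr ξ]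
      rw [map_sum]
      exact Finset.sum_congr rfl fun a _ => LinearMap.map_smul (f x) (b.coord a ξ) (b a)
    have h3 := congrFun (h ξ) x
    rw [Finset.sum_apply] at h3
    rw [h2, h3, Complex.ofReal_sum, Finset.sum_smul]
    simp only [Finset.sum_apply]
    refine Finset.sum_congr rfl fun a _ => ?_
    rw [Finset.smul_sum]
    refine Finset.sum_congr rfl fun i _ => ?_
    simp only [Pi.smul_apply, smul_smul, Complex.ofReal_mul]
    congr 1
    ring
  rw [h1]
  exact Submodule.sum_mem _ fun a _ => Submodule.sum_mem _ fun i _ =>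
    smul_mem_polyForms (mul_mem_polyFun (b.coord a) (hc i))
      (fun_smul_mem (hf _) (mem_Omega_of_mem_polyForms hα _))

end PolyForms

/-! ### Equivariant polynomial primitives -/

section Lift

open MeasureTheory

universe u

variable {EG : Type*} [NormedAddCommGroup EG] [NormedSpace ℝ EG] [FiniteDimensional ℝ EG]
  {G : Type*} [TopologicalSpace G] [ChartedSpace EG G] [Group G] [LieGroup 𝓘(ℝ, EG) ∞ G]
  [CompactSpace G]
  {E : Type u} [NormedAddCommGroup E] [NormedSpace ℝ E] [FiniteDimensional ℝ E]
  {M : Type*} [TopologicalSpace M] [ChartedSpace E M] [IsManifold 𝓘(ℝ, E) ∞ M]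
  [MulAction G M] [ContMDiffSMul 𝓘(ℝ, EG) 𝓘(ℝ, E) ∞ G M]

theorem continuous_comp_Ad {m : ℕ} {q : EG → ℝ} (hq : q ∈ polyFun EG m) (ξ : EG) :
    Continuous (fun g : G => q (Ad (EG := EG) g ξ)) :=
  (differentiable_of_mem_polyFun hq).continuous.comp (continuous_Ad ξ)

theorem average_sum [MeasurableSpace G] [BorelSpace G] {μ : Measure G} [IsFiniteMeasure μ]
    {ι : Type*} {s : Finset ι} {a : ι → G → ℝ} (ha : ∀ i, Continuous (a i)) (r : ι → ℝ)
    {θ : Form E M} (hθ : ∀ x, SpinorContinuous (fun g : G => pullback g θ x)) :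
    average μ (fun g => ∑ i ∈ s, a i g * r i) θ = ∑ i ∈ s, (r i : ℂ) • average μ (a i) θ := by
  funext x
  have h1 := spinorIntegral_sum (μ := μ) (s := s) (ρ := fun i g =>
    (r i : ℂ) • (a i g : ℂ) • pullback g θ x) fun i _ k =>
      (spinorContinuous_smul (ha i) (hθ x) k).const_smul _
  rw [Finset.sum_apply]
  simp only [spinorIntegral_smul] at h1
  refine Eq.trans (congrArg (spinorIntegral μ) (funext fun g => ?_)) h1
  rw [Complex.ofReal_sum, Finset.sum_smul]
  refine Finset.sum_congr rfl fun i _ => ?_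
  rw [smul_smul, Complex.ofReal_mul, mul_comm]

-- Inversion turns left-invariant Haar measure, normalized on the compact set `G`, into a
-- right-invariant one, as `pullback_average` requires.
variable (G) in
theorem exists_rightInvariant [IsTopologicalGroup G] [MeasurableSpace G] [BorelSpace G] :
    ∃ μ : Measure G, IsProbabilityMeasure μ ∧ μ.IsMulRightInvariant := by
  let K : TopologicalSpace.PositiveCompacts G := ⊤
  refine ⟨(Measure.haarMeasure K).inv, ⟨?_⟩, inferInstance⟩
  rw [Measure.inv_apply, Set.inv_univ]
  exact Measure.haarMeasure_self (K₀ := K)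

/-- If every value of an equivariant polynomial map is in the image of an operator that commutes
with averages, then the map is the image of an equivariant polynomial map. -/
theorem exists_lift (T : Module.End ℂ (OmegaS E M))
    (hT : ∀ [MeasurableSpace G] [BorelSpace G] (μ : Measure G) [IsFiniteMeasure μ] (a : G → ℝ)
      (ha : Continuous a), averageE EG μ ha * T = T * averageE EG μ ha)
    {α : Lie𝔤 EG G → OmegaS E M} (hα : (fun ξ => (α ξ).1) ∈ UG E M EG G)
    (h : ∀ ξ, ∃ θ, T θ = α ξ) :
    ∃ γ : Lie𝔤 EG G → OmegaS E M, (fun ξ => (γ ξ).1) ∈ UG E M EG G ∧ ∀ ξ, T (γ ξ) = α ξ := by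
  let _ : MeasurableSpace G := borel G
  have : BorelSpace G := ⟨rfl⟩
  have : IsTopologicalGroup G := topologicalGroup_of_lieGroup 𝓘(ℝ, EG) ∞
  obtain ⟨μ, hμ, hinv⟩ := exists_rightInvariant G
  obtain ⟨m, n, p, c, hc, hpc, hαs⟩ := exists_eq_sum_of_mem_polyForms hα.1
  -- Primitives are chosen at the nodes only. The candidate is `γ(ξ) = ∑ i, ∫ c_i(Ad_g ξ) g^* θ_i`,
  -- the average over `G` of the interpolated map `∑ c_i θ_i`, which need not be equivariant.
  choose θ hθ using fun i => h (p i)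
  have ha : ∀ i ξ, Continuous (fun g : G => c i (Ad g ξ)) := fun i ξ =>
    continuous_comp_Ad (EG := EG) (q := fun ζ : EG => c i ζ) (m := m) (hc i) ξ
  refine ⟨fun ξ => ∑ i, averageE EG μ (ha i ξ) (θ i), ⟨?_, ?_⟩, fun ξ => ?_⟩
  -- The function `c_i ∘ Ad_g` is again polynomial of bounded degree; interpolating it takes the
  -- dependence on `ξ` out of the integral.
  · have h1 : (fun ξ => (∑ i, averageE EG μ (ha i ξ) (θ i) : OmegaS E M).1) =
        ∑ i, ∑ j, fun ξ => (c j ξ : ℂ) • average μ (fun g => c i (Ad g (p j))) (θ i).1 := by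
      funext ξ
      rw [Submodule.coe_sum, Finset.sum_apply]
      refine Finset.sum_congr rfl fun i _ => ?_
      rw [Finset.sum_apply]
      have h2 := average_sum (μ := μ) (s := Finset.univ) (fun j => ha i (p j))
        (fun j => c j ξ) (spinorContinuous_pullback EG (θ i).2)
      refine Eq.trans (congrArg (fun b => average μ b (θ i).1) (funext fun g => ?_)) h2
      exact hpc _ (comp_mem_polyFun (AdL g) (hc i)) ξ
    rw [h1]
    exact Submodule.sum_mem _ fun i _ => Submodule.sum_mem _ fun j _ =>
      smul_mem_polyForms (hc j) (average_mem EG (ha i (p j)) (θ i).2)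
  · intro g ξ
    have h1 : ∀ ξ, (∑ i, averageE EG μ (ha i ξ) (θ i) : OmegaS E M).1 =
        ∑ i, average μ (fun g => c i (Ad g ξ)) (θ i).1 := fun ξ => Submodule.coe_sum _ _ _
    have h2 : ∀ τ : Fin n → Form E M, pullback g (∑ i, τ i) = ∑ i, pullback g (τ i) := fun τ => by
      funext x
      have h3 : pullback g (∑ i, τ i) x = pb (actMap E g x) ((∑ i, τ i) (g • x)) := rfl
      rw [h3, Finset.sum_apply, map_sum, Finset.sum_apply]
      rfl
    simp only [h1, h2]
    refine Finset.sum_congr rfl fun i _ => ?_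
    -- The translation of the weight caused by `g^*` cancels the passage from `ξ` to `Ad_g ξ`.
    rw [pullback_average EG (ha i _) (θ i).2]
    refine congrArg (fun b => average μ b (θ i).1) (funext fun k => ?_)
    rw [← Ad_mul, inv_mul_cancel_right]
  · have h1 : T (∑ i, averageE EG μ (ha i ξ) (θ i)) = ∑ i, averageE EG μ (ha i ξ) (α (p i)) := by
      rw [map_sum]
      refine Finset.sum_congr rfl fun i _ => ?_
      rw [← hθ]
      exact (congrArg (fun X : Module.End ℂ (OmegaS E M) => X (θ i)) (hT μ _ (ha i ξ))).symm
    rw [h1]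
    refine Subtype.ext <| funext fun x => ?_
    rw [Submodule.coe_sum, Finset.sum_apply]
    have h2 := spinorIntegral_sum (μ := μ) (s := Finset.univ) (ρ := fun i g =>
      (c i (Ad g ξ) : ℂ) • pullback g (α (p i)).1 x) fun i _ =>
        spinorContinuous_smul (ha i ξ) (spinorContinuous_pullback EG (α (p i)).2 x)
    refine h2.symm.trans ?_
    -- Interpolation and equivariance identify the integrand with `g^* α(Ad_g ξ) = α(ξ)`, constant
    -- in `g`; the measure has total mass one.
    have h3 : ∀ g : G, ∑ i, (c i (Ad g ξ) : ℂ) • pullback g (α (p i)).1 x = (α ξ).1 x := by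
      intro g
      refine Eq.trans ?_ (congrFun (hα.2 g ξ) x)
      have h4 : ∀ τ : Form E M, pullback g τ x = pb (actMap E g x) (τ (g • x)) := fun τ => rfl
      simp only [h4]
      rw [hαs (Ad g ξ), Finset.sum_apply, map_sum]
      exact Finset.sum_congr rfl fun i _ => (map_smul _ _ _).symm
    simp only [h3]
    funext k
    have h5 : spinorIntegral μ (fun _ => (α ξ).1 x) k = ∫ _, (α ξ).1 x k ∂μ := rfl
    rw [h5, integral_const, probReal_univ, one_smul]

end Lift

/-! ### The equivariant complex and the `∂̄_G ∂`-lemma -/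

section EquivariantComplex

universe u

variable {EG : Type*} [NormedAddCommGroup EG] [NormedSpace ℝ EG]
  {G : Type*} [TopologicalSpace G] [ChartedSpace EG G] [Group G] [LieGroup 𝓘(ℝ, EG) ∞ G]
  {E : Type u} [NormedAddCommGroup E] [NormedSpace ℝ E] [FiniteDimensional ℝ E]
  {M : Type*} [TopologicalSpace M] [ChartedSpace E M] [IsManifold 𝓘(ℝ, E) ∞ M]
  [MulAction G M] [ContMDiffSMul 𝓘(ℝ, EG) 𝓘(ℝ, E) ∞ G M]

variable (E M EG G) in
/-- The space `U_G`, as a space of maps from `𝔤` to `Ω(M)`. -/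
def EquivForms : Submodule ℂ (Lie𝔤 EG G → OmegaS E M) where
  carrier := {α | (fun ξ => (α ξ).1) ∈ UG E M EG G}
  zero_mem' := ⟨zero_mem _, fun _ _ => rfl⟩
  add_mem' h h' := ⟨add_mem h.1 h'.1, fun g ξ =>
    congrArg₂ (fun a b : Form E M => a + b) (h.2 g ξ) (h'.2 g ξ)⟩
  smul_mem' c _ h := ⟨Submodule.smul_mem _ c h.1, fun g ξ =>
    congrArg (fun a : Form E M => c • a) (h.2 g ξ)⟩

variable (E M EG G) in
/-- The type of the elements of `U_G`. -/
def EquivSpace : Type _ := ↥(EquivForms EG G E M)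

instance : AddCommGroup (EquivSpace EG G E M) := (EquivForms EG G E M).addCommGroup

instance : Module ℂ (EquivSpace EG G E M) := (EquivForms EG G E M).module

/-- A family of operators on `Ω(M)`, parametrized by `𝔤`, that preserves `U_G`. -/
def PreservesUG (T : Lie𝔤 EG G → Module.End ℂ (OmegaS E M)) : Prop :=
  ∀ α ∈ EquivForms EG G E M, (fun ξ => T ξ (α ξ)) ∈ EquivForms EG G E M

/-- The operator on `U_G` given by a family of operators on `Ω(M)`. -/
def PreservesUG.toEnd {T : Lie𝔤 EG G → Module.End ℂ (OmegaS E M)} (hT : PreservesUG T) :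
    Module.End ℂ (EquivSpace EG G E M) where
  toFun α := ⟨fun ξ => T ξ (α.1 ξ), hT α.1 α.2⟩
  map_add' α β := Subtype.ext <| funext fun ξ => (T ξ).map_add (α.1 ξ) (β.1 ξ)
  map_smul' c α := Subtype.ext <| funext fun ξ => (T ξ).map_smul c (α.1 ξ)

/-- Pullback on `Ω(M)` by the elements of `G`. -/
abbrev pullG (EG : Type*) [NormedAddCommGroup EG] [NormedSpace ℝ EG] {G : Type*}
    [TopologicalSpace G] [ChartedSpace EG G] [Group G] [MulAction G M]
    [ContMDiffSMul 𝓘(ℝ, EG) 𝓘(ℝ, E) ∞ G M] (g : G) : Module.End ℂ (OmegaS E M) :=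
  pullE (contMDiff_act (M := M) (G := G) E EG) g

theorem preservesUG_const [FiniteDimensional ℝ EG] {T : Module.End ℂ (OmegaS E M)}
    (hT : ∀ g : G, pullG EG g * T = T * pullG EG g) :
    PreservesUG (fun _ : Lie𝔤 EG G => T) := fun α hα => by
  refine ⟨map_mem_polyForms hα.1 T, fun g ξ => ?_⟩
  have h1 := congrArg (fun X : Module.End ℂ (OmegaS E M) => (X (α (Ad g ξ))).1) (hT g)
  refine Eq.trans h1 (congrArg (fun θ => (T θ).1) (?_ : pullG EG g (α (Ad g ξ)) = α ξ))
  exact Subtype.ext (hα.2 g ξ)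

variable {H : M → Alt E ℝ 3} {J : M → Gen E →L[ℝ] Gen E}
  {f : M → Module.Dual ℝ (Lie𝔤 EG G)} {η : M → Lie𝔤 EG G →ₗ[ℝ] (E →L[ℝ] ℝ)}

theorem preservesUG_mulE [FiniteDimensional ℝ EG] (hf : IsMomentMap H J f η) :
    PreservesUG (fun ξ => mulE (E := E) (hf.smooth ξ)) := fun α hα => by
  refine ⟨fun_smul_mem_polyForms hα.1 hf.smooth, fun g ξ => funext fun x => ?_⟩
  change pb (actMap E g x) ((f (g • x) (Ad g ξ) : ℂ) • (α (Ad g ξ)).1 (g • x)) =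
    (f x ξ : ℂ) • (α ξ).1 x
  rw [map_smul, hf.equivariant]
  exact congrArg (fun ρ : Spinor E => (f x ξ : ℂ) • ρ) (congrFun (hα.2 g ξ) x)

/-- Equivariance of `ξ_M` and `η` need not be checked: `𝒜` is a multiple of the commutator of `∂`
with the moment map, both of which preserve `U_G`. -/
theorem preservesUG_opA [T2Space M] [FiniteDimensional ℝ EG] (hH : IsSmooth H)
    (hJ : IsGenComplex H J) (hf : IsMomentMap H J f η)
    (hdel : PreservesUG (fun _ : Lie𝔤 EG G => delE hH hJ)) :
    PreservesUG (fun ξ => (hf.isHamiltonian ξ).opA hJ) := fun α hα => by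
  have hF := preservesUG_mulE hf
  have h1 := (EquivForms EG G E M).smul_mem (2 * Complex.I)
    ((EquivForms EG G E M).sub_mem (hdel _ (hF α hα)) (hF _ (hdel α hα)))
  convert h1 using 1
  funext ξ
  exact congrArg (fun X : Module.End ℂ (OmegaS E M) => X (α ξ))
    ((hf.isHamiltonian ξ).two_I_smul_commutator hH hJ)

/-- `∂̄ 𝒜 + 𝒜 ∂̄ = 0` on equivariant maps. -/
theorem delbarE_mul_opA_eq_zero [T2Space M] [FiniteDimensional ℝ EG] (hH : IsClosedThreeForm H)
    (hJ : IsGenComplex H J) (hf : IsMomentMap H J f η) {α : Lie𝔤 EG G → OmegaS E M}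
    (hα : α ∈ EquivForms EG G E M) (ξ : Lie𝔤 EG G) :
    (delbarE hH.1 hJ * (hf.isHamiltonian ξ).opA hJ +
      (hf.isHamiltonian ξ).opA hJ * delbarE hH.1 hJ) (α ξ) = 0 := by
  refine Subtype.ext <| funext fun x => ?_
  obtain ⟨m, n, p, c, hc, -, h⟩ := exists_eq_sum_of_mem_polyForms hα.1
  have h1 := lieD_eq_zero (EG := EG) (G := G) (ι := Fin n) (c := fun j => c j)
    (fun j => (α (p j)).2) h hα.2 (ξ := ξ) (fun j => (differentiable_of_mem_polyFun (W := EG)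
      (q := fun ζ : EG => c j ζ) (hc j)) ξ) x
  refine ((hf.isHamiltonian ξ).delbarE_mul_opA hH hJ (α ξ) x).trans ?_
  exact neg_eq_zero.2 h1

/-- The relations between `P` and `Q` place the image of `Q P` in both intersections, so only the
two existence statements have content. The injection `e` passes from a vector space with linear
operators to the set `K`, on which `p` and `q` are bare functions. -/
theorem ddLemma_of {V A : Type*} [AddCommGroup V] [Module ℂ V] [AddCommGroup A] {K : Set A}
    {p q : A → A} {P Q : Module.End ℂ V} (e : V → A) (he : Function.Injective e) (he0 : e 0 = 0)
    (hK : Set.range e = K) (hp : ∀ v, p (e v) = e (Q v)) (hq : ∀ v, q (e v) = e (P v))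
    (hPP : P * P = 0) (hQQ : Q * Q = 0) (hPQ : P * Q = -(Q * P))
    (h1 : ∀ {α β}, Q α = 0 → P β = α → ∃ γ, Q (P γ) = α)
    (h2 : ∀ {α β}, P α = 0 → Q β = α → ∃ γ, Q (P γ) = α) : DDLemma K p q := by
  subst hK
  have hQQ' : ∀ v, Q (Q v) = 0 := fun v => congrArg (fun X : Module.End ℂ V => X v) hQQ
  have hPP' : ∀ v, P (P v) = 0 := fun v => congrArg (fun X : Module.End ℂ V => X v) hPP
  have hPQ' : ∀ v, P (Q v) = -Q (P v) := fun v =>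
    congrArg (fun X : Module.End ℂ V => X v) hPQ
  have hz : ∀ v, e v = 0 → v = 0 := fun v hv => he (hv.trans he0.symm)
  have e1 : {a ∈ Set.range e | p a = 0} ∩ (q '' Set.range e) =
      (fun a => p (q a)) '' Set.range e := by
    ext a
    constructor
    · rintro ⟨⟨⟨α, rfl⟩, ha⟩, _, ⟨β, rfl⟩, hb⟩
      rw [hp] at ha
      rw [hq] at hb
      obtain ⟨γ, hγ⟩ := h1 (hz _ ha) (he hb)
      exact ⟨e γ, ⟨γ, rfl⟩, by simp only [hq, hp, hγ]⟩
    · rintro ⟨_, ⟨γ, rfl⟩, rfl⟩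
      simp only [hq, hp]
      refine ⟨⟨⟨_, rfl⟩, by rw [hp, hQQ', he0]⟩, e (-Q γ), ⟨_, rfl⟩, ?_⟩
      rw [hq, map_neg, hPQ', neg_neg]
  have e2 : (p '' Set.range e) ∩ {a ∈ Set.range e | q a = 0} =
      (fun a => p (q a)) '' Set.range e := by
    ext a
    constructor
    · rintro ⟨⟨_, ⟨β, rfl⟩, hb⟩, ⟨α, rfl⟩, ha⟩
      rw [hq] at ha
      rw [hp] at hb
      obtain ⟨γ, hγ⟩ := h2 (hz _ ha) (he hb)
      exact ⟨e γ, ⟨γ, rfl⟩, by simp only [hq, hp, hγ]⟩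
    · rintro ⟨_, ⟨γ, rfl⟩, rfl⟩
      simp only [hq, hp]
      refine ⟨⟨e (P γ), ⟨_, rfl⟩, hp _⟩, ⟨_, rfl⟩, ?_⟩
      rw [hq, hPQ', hPP', map_zero, neg_zero, he0]
  exact ⟨e2.trans e1.symm, e1⟩

theorem exists_delbarE_delE (hH : IsSmooth H) (hJ : IsGenComplex H J)
    (hdd : DDLemma (Omega E M) (delbar H J) (del H J)) {θ τ : OmegaS E M} :
    (delbarE hH hJ θ = 0 → delE hH hJ τ = θ → ∃ σ, (delbarE hH hJ * delE hH hJ) σ = θ) ∧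
    (delE hH hJ θ = 0 → delbarE hH hJ τ = θ → ∃ σ, (delbarE hH hJ * delE hH hJ) σ = θ) := by
  have key : θ.1 ∈ (fun a => delbar H J (del H J a)) '' Omega E M →
      ∃ σ, (delbarE hH hJ * delE hH hJ) σ = θ := by
    rintro ⟨σ, hσ, h⟩
    refine ⟨⟨σ, hσ⟩, Subtype.ext ?_⟩
    rw [Module.End.mul_apply, delbarE_apply, delE_apply]
    exact h
  refine ⟨fun h1 h2 => key ?_, fun h1 h2 => key ?_⟩
  · rw [← hdd.2]
    exact ⟨⟨θ.2, by rw [← delbarE_apply hH hJ, h1]; rfl⟩, τ.1, τ.2, by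
      rw [← delE_apply hH hJ, h2]⟩
  · rw [← hdd.2, ← hdd.1]
    exact ⟨⟨τ.1, τ.2, by rw [← delbarE_apply hH hJ, h2]⟩, θ.2, by
      rw [← delE_apply hH hJ, h1]; rfl⟩

/-- The `∂̄_G ∂`-lemma. -/
theorem ddLemma_equivariant [T2Space M] [FiniteDimensional ℝ EG] [CompactSpace G]
    (hH : IsClosedThreeForm H) (hJ : IsGenComplex H J) (hGH : PreservesH G H)
    (hGJ : PreservesJ G J) (hf : IsMomentMap H J f η)
    (hdd : DDLemma (Omega E M) (delbar H J) (del H J)) :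
    DDLemma (UG E M EG G) (delbarG H J f η) (delEq H J) := by
  have hG := contMDiff_act (M := M) (G := G) E EG
  have hdel : PreservesUG (fun _ : Lie𝔤 EG G => delE hH.1 hJ) := preservesUG_const fun g =>
    pullE_degPart hG hH.1 hJ.smooth hGH hGJ g _
  have hdelbar : PreservesUG (fun _ : Lie𝔤 EG G => delbarE hH.1 hJ) := preservesUG_const fun g =>
    pullE_degPart hG hH.1 hJ.smooth hGH hGJ g _
  have hcomp : ∀ k, PreservesUG (fun _ : Lie𝔤 EG G => compE hJ.smooth k) := fun k =>
    preservesUG_const fun g => pullE_compE hG hJ.smooth hGJ g k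
  have hF := preservesUG_mulE hf
  have hA := preservesUG_opA hH.1 hJ hf hdel
  have hgr := isGrading_compE hJ
  have happ : ∀ {X Y : Module.End ℂ (OmegaS E M)}, X = Y → ∀ θ, X θ = Y θ :=
    fun h θ => congrArg (fun X : Module.End ℂ (OmegaS E M) => X θ) h
  -- The operators act value by value in `ξ`, so the grading and the identities on `Ω(M)` pass to
  -- `U_G`. Only `∂̄𝒜 + 𝒜∂̄ = 0` requires equivariance of the argument.
  have hgrK : IsGrading (Finset.Icc (-halfDim E) (halfDim E)) fun k => (hcomp k).toEnd :=
    { mul := fun i j => LinearMap.ext fun α => Subtype.ext <| funext fun ξ => by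
        refine (happ (hgr.mul i j) (α.1 ξ)).trans ?_
        split_ifs <;> rfl
      zero := fun k hk => LinearMap.ext fun α => Subtype.ext <| funext fun ξ =>
        happ (hgr.zero k hk) (α.1 ξ)
      sum := LinearMap.ext fun α => Subtype.ext <| funext fun ξ => by
        have h1 := happ hgr.sum (α.1 ξ)
        rw [LinearMap.sum_apply] at h1
        let ev : EquivSpace EG G E M →+ OmegaS E M :=
          { toFun := fun α => α.1 ξ, map_zero' := rfl, map_add' := fun _ _ => rfl }
        rw [LinearMap.sum_apply]
        exact (map_sum ev _ _).trans h1 }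
  have hdegP : HasDeg (fun k => (hcomp k).toEnd) (-1) hdel.toEnd := fun k =>
    LinearMap.ext fun α => Subtype.ext <| funext fun ξ => happ (hasDeg_delE hH.1 hJ k) (α.1 ξ)
  have hdegQ : HasDeg (fun k => (hcomp k).toEnd) 1 hdelbar.toEnd := fun k =>
    LinearMap.ext fun α => Subtype.ext <| funext fun ξ => happ (hasDeg_delbarE hH.1 hJ k) (α.1 ξ)
  have hdegA : HasDeg (fun k => (hcomp k).toEnd) (-1) hA.toEnd := fun k =>
    LinearMap.ext fun α => Subtype.ext <| funext fun ξ =>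
      happ ((hf.isHamiltonian ξ).hasDeg_opA hJ k) (α.1 ξ)
  obtain ⟨hPP, hQQ, hPQ⟩ := delE_sq hH hJ
  have hPPK : hdel.toEnd * hdel.toEnd = 0 := LinearMap.ext fun α => Subtype.ext <|
    funext fun ξ => happ hPP (α.1 ξ)
  have hQQK : hdelbar.toEnd * hdelbar.toEnd = 0 := LinearMap.ext fun α => Subtype.ext <|
    funext fun ξ => happ hQQ (α.1 ξ)
  have hPQK : hdel.toEnd * hdelbar.toEnd + hdelbar.toEnd * hdel.toEnd = 0 :=
    LinearMap.ext fun α => Subtype.ext <| funext fun ξ => happ hPQ (α.1 ξ)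
  have hAAK : hA.toEnd * hA.toEnd = 0 := LinearMap.ext fun α => Subtype.ext <|
    funext fun ξ => happ ((hf.isHamiltonian ξ).opA_sq hH hJ) (α.1 ξ)
  have hPAK : hdel.toEnd * hA.toEnd + hA.toEnd * hdel.toEnd = 0 :=
    LinearMap.ext fun α => Subtype.ext <| funext fun ξ =>
      add_eq_zero_iff_eq_neg.2 (happ ((hf.isHamiltonian ξ).delE_mul_opA hH hJ) (α.1 ξ))
  have hQAK : hdelbar.toEnd * hA.toEnd + hA.toEnd * hdelbar.toEnd = 0 :=
    LinearMap.ext fun α => Subtype.ext <| funext fun ξ => delbarE_mul_opA_eq_zero hH hJ hf α.2 ξ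
  have hAK : hA.toEnd = (2 * Complex.I) • (hdel.toEnd * hF.toEnd - hF.toEnd * hdel.toEnd) :=
    LinearMap.ext fun α => Subtype.ext <| funext fun ξ =>
      happ ((hf.isHamiltonian ξ).two_I_smul_commutator hH.1 hJ) (α.1 ξ)
  have hGG : (hdelbar.toEnd + hA.toEnd) * (hdelbar.toEnd + hA.toEnd) = 0 := by
    rw [mul_add, add_mul, add_mul, hQQK, hAAK, zero_add, add_zero, add_comm, hQAK]
  have hPG : hdel.toEnd * (hdelbar.toEnd + hA.toEnd) =
      -((hdelbar.toEnd + hA.toEnd) * hdel.toEnd) := by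
    refine eq_neg_of_add_eq_zero_left ?_
    rw [mul_add, add_mul, add_add_add_comm, hPQK, hPAK, add_zero]
  -- The hypothesis on `Ω(M)` gives a primitive for each `ξ`, with no control of its dependence on
  -- `ξ`. Since `∂̄∂` commutes with averages, `exists_lift` replaces these by an equivariant
  -- polynomial primitive; this is the undeformed lemma on `U_G`.
  have hlift : ∀ α : EquivSpace EG G E M,
      (∀ ξ, ∃ σ, (delbarE hH.1 hJ * delE hH.1 hJ) σ = α.1 ξ) →
      ∃ γ, hdelbar.toEnd (hdel.toEnd γ) = α := by
    intro α h
    obtain ⟨γ, hγ, h'⟩ := exists_lift (EG := EG) (G := G) _ (fun μ _ a ha => by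
      rw [← mul_assoc]
      have h1 := averageE_degPart EG (μ := μ) hH.1 hJ.smooth hGH hGJ ha
      have h2 : averageE EG μ ha * delbarE hH.1 hJ = delbarE hH.1 hJ * averageE EG μ ha := h1 _
      have h3 : averageE EG μ ha * delE hH.1 hJ = delE hH.1 hJ * averageE EG μ ha := h1 _
      rw [h2, mul_assoc, h3, mul_assoc]) α.2 h
    exact ⟨⟨γ, hγ⟩, Subtype.ext (funext h')⟩
  have hev : ∀ {X Y : EquivSpace EG G E M}, X = Y → ∀ ξ, X.1 ξ = Y.1 ξ := fun h ξ => by rw [h]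
  have first : ∀ α β, (hdelbar.toEnd + hA.toEnd) α = 0 → hdel.toEnd β = α →
      ∃ γ, (hdelbar.toEnd + hA.toEnd) (hdel.toEnd γ) = α := fun α β =>
    exists_of_mem_range_of_mem_ker hgrK hdegP hdegQ hdegA hGG hPG fun α β h1 h2 =>
      hlift α fun ξ => (exists_delbarE_delE hH.1 hJ hdd).1 (hev h1 ξ) (hev h2 ξ)
  refine ddLemma_of (V := EquivSpace EG G E M) (P := hdel.toEnd)
    (Q := hdelbar.toEnd + hA.toEnd) (fun α ξ => (α.1 ξ).1) ?_ rfl ?_ ?_ ?_ hPPK hGG hPG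
    (fun {α β} => first α β) fun h1 h2 =>
      exists_of_mem_ker_of_mem_range hPQK hGG hPG hAK (fun α β h1 h2 => hlift α fun ξ =>
        (exists_delbarE_delE hH.1 hJ hdd).2 (hev h1 ξ) (hev h2 ξ)) first h1 h2
  · exact fun α β h => Subtype.ext <| funext fun ξ => Subtype.ext (congrFun h ξ)
  · refine Set.ext fun α => ⟨?_, fun h => ?_⟩
    · rintro ⟨α, rfl⟩
      exact α.2
    · exact ⟨⟨fun ξ => ⟨α ξ, mem_Omega_of_mem_polyForms h.1 ξ⟩, h⟩, rfl⟩
  · intro α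
    funext ξ
    refine congrArg₂ (fun a b : Form E M => a + b) (delbarE_apply hH.1 hJ (α.1 ξ)).symm
      (funext fun x => ?_)
    exact ((hf.isHamiltonian ξ).opA_apply hJ (α.1 ξ) x).symm
  · intro α
    funext ξ
    exact (delE_apply hH.1 hJ (α.1 ξ)).symm

end EquivariantComplex

end GenCx

end

theorem mainTheorem1
    -- the manifold
    {E : Type*} [NormedAddCommGroup E] [NormedSpace ℝ E] [FiniteDimensional ℝ E]
    {M : Type*} [TopologicalSpace M] [T2Space M] [SecondCountableTopology M]
    [ChartedSpace E M] [IsManifold 𝓘(ℝ, E) ∞ M]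
    -- the compact connected Lie group and its smooth action
    {EG : Type*} [NormedAddCommGroup EG] [NormedSpace ℝ EG] [FiniteDimensional ℝ EG]
    {G : Type*} [TopologicalSpace G] [T2Space G] [CompactSpace G] [ConnectedSpace G]
    [ChartedSpace EG G] [Group G] [LieGroup 𝓘(ℝ, EG) ∞ G]
    [MulAction G M] [ContMDiffSMul 𝓘(ℝ, EG) 𝓘(ℝ, E) ∞ G M]
    -- the twisted generalized complex structure
    (H : M → GenCx.Alt E ℝ 3) (hH : GenCx.IsClosedThreeForm H)
    (J : M → GenCx.Gen E →L[ℝ] GenCx.Gen E) (hJ : GenCx.IsGenComplex H J)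
    -- the action is Hamiltonian
    (hGH : GenCx.PreservesH G H) (hGJ : GenCx.PreservesJ G J)
    (f : M → Module.Dual ℝ (GenCx.Lie𝔤 EG G))
    (η : M → GenCx.Lie𝔤 EG G →ₗ[ℝ] (E →L[ℝ] ℝ))
    (hf : GenCx.IsMomentMap H J f η)
    -- the `∂̄∂`-lemma
    (hdd : GenCx.DDLemma (GenCx.Omega E M) (GenCx.delbar H J) (GenCx.del H J)) :
    GenCx.DDLemma (GenCx.UG E M EG G) (GenCx.delbarG H J f η) (GenCx.delEq H J) := by
  exact GenCx.ddLemma_equivariant hH hJ hGH hGJ hf hdd
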